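/- Let $F$ be a finite extension of $\mathbb{Q}_p$ with ring of integers $\mathfrak{o}$, maximal ideal $\mathfrak{p}=\varpi\mathfrak{o}$, residue field of odd order $q$, and absolute value normalized by $|\varpi|=q^{-1}$. Let $\psi:F\to\mathbb{C}^\times$ be a non-trivial continuous unitary additive character, let $c_\psi$ be the largest integer $c$ with $\psi(\mathfrak{p}^{-c})=1$, let $\boldsymbol\delta\in F^\times$ have order $c_\psi$, and put $\mathfrak{d}=\boldsymbol\delta\mathfrak{o}$. Let $\mathrm{Mp}_2(F)=\{[g,\zeta] : g\in \mathrm{SL}_2(F),\ \zeta\in\{\pm1\}\}$ with product $[g_1,\zeta_1][g_2,\zeta_2]=[g_1g_2,\zeta_1\zeta_2\,\boldsymbol c(g_1,g_2)]$, where $$\boldsymbol c(g_1,g_2)=\Bigl(\tfrac{\boldsymbol b(g_1)}{\boldsymbol b(g_1g_2)},\tfrac{\boldsymbol b(g_2)}{\boldsymbol b(g_1g_2)}\Bigr),\qquad \boldsymbol b\begin{pmatrix}a&b\\c&d\end{pmatrix}=\begin{cases}c&(c\ne0),\\ d&(c=0),\end{cases}$$ and $(\cdot,\cdot)$ is the quadratic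 Hilbert symbol of $F$. For $S\subset \mathrm{SL}_2(F)$ let $\widetilde S$ be its inverse image in $\mathrm{Mp}_2(F)$. Put $\mathbf u^\sharp(b)=\bigl[\begin{pmatrix}1&b\\0&1\end{pmatrix},1\bigr]$ for $b\in F$, and $\mathbf m(a)=\bigl[\begin{pmatrix}a&0\\0&a^{-1}\end{pmatrix},1\bigr]$, $\mathbf w_a=\bigl[\begin{pmatrix}0&-a^{-1}\\a&0\end{pmatrix},1\bigr]$ for $a\in F^\times$. Let $dy$ be the Haar measure on $F$ with $\mathrm{Vol}(\mathfrak o)=1$, and for a Schwartz function $\phi$ on $F$ let $\hat\phi(x)=|\boldsymbol\delta|^{1/2}\int_F\phi(y)\psi(xy)\,dy$. For $a\in F^\times$ the Weil constant $\alpha_\psi(a)$ is the complex number such that $\int_F\phi(y)\psi(ay^2)\,dy=\alpha_\psi(a)|2a|^{-1/2}\int_F\hat\phi(y)\psi(-y^2/(4a))\,dy$ for all Schwartz functions $\phi$. The Weil representation $\omega_\psi$ of $\mathrm{Mp}_2(F)$ on the space of Schwartz functions is given by $$\omega_\psi(\mathbf u^\sharp(b))\phi(x)=\psi(bx^2)\phi(x),\quad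 \omega_\psi(\mathbf m(a))\phi(x)=\tfrac{\alpha_\psi(1)}{\alpha_\psi(a)}|a|^{1/2}\phi(ax),\quad \omega_\psi(\mathbf w_a)\phi(x)=\overline{\alpha_\psi(a)}\,|2a^{-1}|^{1/2}\hat\phi(-2a^{-1}x),$$ with $[1,\zeta]$ acting by $\zeta$. For ideals $\mathfrak b,\mathfrak c$ let $\Gamma[\mathfrak b,\mathfrak c]$ be the set of $\begin{pmatrix}a&b\\c&d\end{pmatrix}\in \mathrm{SL}_2(F)$ with $a,d\in\mathfrak o$, $b\in\mathfrak b$, $c\in\mathfrak c$, and let $\varepsilon$ be the genuine character of $\widetilde{\Gamma[\mathfrak d^{-1},\mathfrak d]}$ with $\omega_\psi(\gamma)\mathbf 1_{\mathfrak o}=\varepsilon(\gamma)^{-1}\mathbf 1_{\mathfrak o}$. Let $\Gamma_2$ be either $\Gamma_0(\varpi)=\Gamma[\mathfrak d^{-1},\varpi\mathfrak d]$ or $\Gamma[\varpi\mathfrak d^{-1},\mathfrak d]$. Let $\widetilde{\mathcal H}=\widetilde{\mathcal H}(\widetilde\Gamma_2\backslash \mathrm{Mp}_2(F)/\widetilde\Gamma_2;\varepsilon)$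 be the space of compactly supported genuine functions $\varphi:\mathrm{Mp}_2(F)\to\mathbb{C}$ with $\varphi(\gamma_1g\gamma_2)=\varepsilon(\gamma_1\gamma_2)\varphi(g)$ for $\gamma_1,\gamma_2\in\widetilde\Gamma_2$, with the convolution product $(\varphi_1*\varphi_2)(g)=\int_{\mathrm{Mp}_2(F)}\varphi_1(h)\varphi_2(h^{-1}g)\,dh$ for the Haar measure with $\mathrm{Vol}(\widetilde\Gamma_2)=1$; its unit is the function equal to $\varepsilon$ on $\widetilde\Gamma_2$ and to $0$ elsewhere. For $m\in\mathbb Z$ put $a_m=\boldsymbol\delta\varpi^{m}$ if $\Gamma_2=\Gamma_0(\varpi)$ and $a_m=\boldsymbol\delta\varpi^{-m}$ if $\Gamma_2=\Gamma[\varpi\mathfrak d^{-1},\mathfrak d]$, and let $\widetilde{\mathcal U}_m$ be the function supported on $\widetilde\Gamma_2\mathbf w_{a_m}\widetilde\Gamma_2$ with $$\widetilde{\mathcal U}_m(\gamma_1\mathbf w_{a_m}\gamma_2)=q^{-|m|/2}\,\varepsilon(\gamma_1)\,\alpha_\psi(a_m)\,\varepsilon(\gamma_2)\qquad(\gamma_1,\gamma_2\in\widetilde\Gamma_2).$$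 Then $\widetilde{\mathcal H}$ is a unital associative $\mathbb C$-algebra, generated by $\widetilde{\mathcal U}_0$ and $\widetilde{\mathcal U}_1$ with the defining relations $$(\widetilde{\mathcal U}_0-q)(\widetilde{\mathcal U}_0+1)=0,\qquad \widetilde{\mathcal U}_1^2=1;$$ that is, $x_0\mapsto\widetilde{\mathcal U}_0$, $x_1\mapsto\widetilde{\mathcal U}_1$ induces an isomorphism of $\mathbb C\langle x_0,x_1\rangle/\bigl((x_0-q)(x_0+1),\,x_1^2-1\bigr)$ onto $\widetilde{\mathcal H}$. Moreover, let $I\subset \mathrm{PGL}_2(F)$ be the Iwahori subgroup, the image of the matrices $\begin{pmatrix}a&b\\ \varpi c&d\end{pmatrix}\in \mathrm{GL}_2(F)$ with $a,d\in\mathfrak o$, $b\in\mathfrak d^{-1}$, $c\in\mathfrak d$ and determinant in $\mathfrak o^\times$, and let $\mathcal H(I\backslash \mathrm{PGL}_2(F)/I)$ be the convolution algebra of compactly supported $I$-bi-invariant complex functions on $\mathrm{PGL}_2(F)$, for the Haar measure with $\mathrm{Vol}(I)=1$. Then $\widetilde{\mathcal H}$ and $\mathcal H(I\backslash \mathrm{PGL}_2(F)/I)$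 are isomorphic $\mathbb C$-algebras. -/

import Mathlib

open MeasureTheory Matrix
open scoped NormedField Valued ComplexConjugate MatrixGroups

noncomputable section

namespace Metaplectic

/-! ### The metaplectic double cover of `SL₂(F)` -/

open scoped Classical in
/-- The quadratic Hilbert symbol `(a, b)` of a field, for non-zero `a` and `b`: it is `1` if
`a x² + b y² = z²` has a non-trivial solution, and `-1` otherwise. -/
def hilbertSymbol {F : Type*} [Field F] (a b : F) : ℤˣ :=
  if ∃ x y z : F, (x ≠ 0 ∨ y ≠ 0 ∨ z ≠ 0) ∧ a * x ^ 2 + b * y ^ 2 = z ^ 2 then 1 else -1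

open scoped Classical in
/-- `𝐛(g)` is the lower left entry of `g` if that is non-zero, and the lower right one otherwise. -/
def lowerEntry {F : Type*} [Field F] (g : SpecialLinearGroup (Fin 2) F) : F :=
  if g.1 1 0 ≠ 0 then g.1 1 0 else g.1 1 1

/-- Kubota's 2-cocycle on `SL₂(F)`. -/
def cocycle {F : Type*} [Field F] (g₁ g₂ : SpecialLinearGroup (Fin 2) F) : ℤˣ :=
  hilbertSymbol (lowerEntry g₁ / lowerEntry (g₁ * g₂)) (lowerEntry g₂ / lowerEntry (g₁ * g₂))

/-- `Mp₂(F)`: the pairs `[g, ζ]` with `g ∈ SL₂(F)` and `ζ ∈ {±1}`. -/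
@[ext] structure Mp2 (F : Type*) [Field F] where
  mat : SpecialLinearGroup (Fin 2) F
  sgn : ℤˣ

section group

variable {F : Type*} [Field F]

instance : Mul (Mp2 F) :=
  ⟨fun x y => ⟨x.mat * y.mat, x.sgn * y.sgn * cocycle x.mat y.mat⟩⟩

instance : One (Mp2 F) := ⟨⟨1, 1⟩⟩

instance : Inv (Mp2 F) := ⟨fun x => ⟨x.mat⁻¹, x.sgn * cocycle x.mat x.mat⁻¹⟩⟩

theorem hilbertSymbol_one_left (b : F) : hilbertSymbol 1 b = 1 :=
  if_pos ⟨1, 0, 1, Or.inl one_ne_zero, by ring⟩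

theorem hilbertSymbol_one_right (a : F) : hilbertSymbol a 1 = 1 :=
  if_pos ⟨0, 1, 1, Or.inr (Or.inl one_ne_zero), by ring⟩

theorem hilbertSymbol_comm (a b : F) : hilbertSymbol a b = hilbertSymbol b a := by
  have : (∃ x y z : F, (x ≠ 0 ∨ y ≠ 0 ∨ z ≠ 0) ∧ a * x ^ 2 + b * y ^ 2 = z ^ 2) ↔
      ∃ x y z : F, (x ≠ 0 ∨ y ≠ 0 ∨ z ≠ 0) ∧ b * x ^ 2 + a * y ^ 2 = z ^ 2 := by
    constructor <;> rintro ⟨x, y, z, h, e⟩ <;> exact ⟨y, x, z, by tauto, by rw [← e]; ring⟩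
  unfold hilbertSymbol
  by_cases h : ∃ x y z : F, (x ≠ 0 ∨ y ≠ 0 ∨ z ≠ 0) ∧ a * x ^ 2 + b * y ^ 2 = z ^ 2
  · rw [if_pos h, if_pos (this.1 h)]
  · rw [if_neg h, if_neg (fun h' => h (this.2 h'))]

theorem lowerEntry_one : lowerEntry (1 : SpecialLinearGroup (Fin 2) F) = 1 := by
  simp [lowerEntry]

theorem lowerEntry_ne_zero (g : SpecialLinearGroup (Fin 2) F) : lowerEntry g ≠ 0 := by
  unfold lowerEntry
  split_ifs with h
  · exact h
  · intro h'
    have := g.2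
    rw [Matrix.det_fin_two, h', not_not.mp h] at this
    simp at this

theorem one_mul_mp2 (x : Mp2 F) : 1 * x = x := by
  ext1
  · exact one_mul x.mat
  · change 1 * x.sgn * cocycle 1 x.mat = x.sgn
    simp [cocycle, div_self (lowerEntry_ne_zero x.mat), hilbertSymbol_one_right]

theorem mul_inv_mp2 (x : Mp2 F) : x * x⁻¹ = 1 := by
  ext1
  · exact mul_inv_cancel x.mat
  · change x.sgn * (x.sgn * cocycle x.mat x.mat⁻¹) * cocycle x.mat x.mat⁻¹ = 1
    rw [← mul_assoc, Int.units_mul_self, one_mul, Int.units_mul_self]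

theorem inv_mul_mp2 (x : Mp2 F) : x⁻¹ * x = 1 := by
  ext1
  · exact inv_mul_cancel x.mat
  · change x.sgn * cocycle x.mat x.mat⁻¹ * x.sgn * cocycle x.mat⁻¹ x.mat = 1
    have : cocycle x.mat⁻¹ x.mat = cocycle x.mat x.mat⁻¹ := by
      simp only [cocycle, mul_inv_cancel, inv_mul_cancel]
      exact hilbertSymbol_comm _ _
    rw [this, mul_right_comm x.sgn, Int.units_mul_self, one_mul, Int.units_mul_self]

/-- `𝐮♯(b) = [(1, b; 0, 1)]`. -/
def uSharp (b : F) : Mp2 F := ⟨⟨!![1, b; 0, 1], by simp [Matrix.det_fin_two]⟩, 1⟩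

/-- `𝐦(a) = [(a, 0; 0, a⁻¹)]` for `a ≠ 0`. -/
def mDiag (a : Fˣ) : Mp2 F := ⟨⟨!![(a : F), 0; 0, (a : F)⁻¹], by simp [Matrix.det_fin_two]⟩, 1⟩

/-- `𝐰_a = [(0, -a⁻¹; a, 0)]` for `a ≠ 0`. -/
def wAnti (a : Fˣ) : Mp2 F := ⟨⟨!![0, -(a : F)⁻¹; (a : F), 0], by simp [Matrix.det_fin_two]⟩, 1⟩

/-- The inverse image in `Mp₂(F)` of a subset of `SL₂(F)`. -/
def lift (S : Set (SpecialLinearGroup (Fin 2) F)) : Set (Mp2 F) := {x | x.mat ∈ S}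

theorem eq_uSharp_mul_mDiag (g : SpecialLinearGroup (Fin 2) F) (a : Fˣ) (ha : g.1 0 0 = a)
    (hc : g.1 1 0 = 0) : (⟨g, 1⟩ : Mp2 F) = uSharp (g.1 0 0 * g.1 0 1) * mDiag a := by
  have hd : g.1 1 1 = (a : F)⁻¹ := by
    have := g.2
    rw [Matrix.det_fin_two, hc, ha] at this
    exact eq_inv_of_mul_eq_one_right (by linear_combination this)
  have hm : g = (uSharp (g.1 0 0 * g.1 0 1)).mat * (mDiag a).mat := by
    have h0 : (a : F) * g.1 0 1 * (a : F)⁻¹ = g.1 0 1 := by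
      field_simp [a.ne_zero]
    apply Subtype.ext
    change g.1 = !![1, g.1 0 0 * g.1 0 1; 0, 1] * !![(a : F), 0; 0, (a : F)⁻¹]
    rw [Matrix.mul_fin_two, Matrix.eta_fin_two g.1, ha, hc, hd]
    simp [h0]
  ext1
  · exact hm
  · change (1 : ℤˣ) = 1 * 1 * cocycle _ _
    rw [cocycle, ← hm]
    have h1 : lowerEntry (mDiag a).mat = lowerEntry g := by
      simp [lowerEntry, mDiag, hc, hd]
    rw [h1, div_self (lowerEntry_ne_zero g), hilbertSymbol_one_right]
    simp

theorem eq_uSharp_mul_wAnti_mul_uSharp (g : SpecialLinearGroup (Fin 2) F) (c : Fˣ)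
    (hc : g.1 1 0 = c) : (⟨g, 1⟩ : Mp2 F) =
      uSharp (g.1 0 0 / g.1 1 0) * (wAnti c * uSharp (g.1 1 1 / g.1 1 0)) := by
  have hne : g.1 1 0 ≠ 0 := by rw [hc]; exact c.ne_zero
  have hdet := g.2
  rw [Matrix.det_fin_two] at hdet
  have hm : g = (uSharp (g.1 0 0 / g.1 1 0)).mat *
      ((wAnti c).mat * (uSharp (g.1 1 1 / g.1 1 0)).mat) := by
    apply Subtype.ext
    change g.1 = !![1, g.1 0 0 / g.1 1 0; 0, 1] *
      (!![0, -(c : F)⁻¹; (c : F), 0] * !![1, g.1 1 1 / g.1 1 0; 0, 1])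
    rw [Matrix.mul_fin_two, Matrix.mul_fin_two, ← hc]
    conv_lhs => rw [Matrix.eta_fin_two g.1]
    ext i j
    fin_cases i <;> fin_cases j <;> simp
    · field_simp
    · field_simp
      linear_combination -hdet
    · field_simp
  have h1 : lowerEntry ((wAnti c).mat * (uSharp (g.1 1 1 / g.1 1 0)).mat) = g.1 1 0 := by
    have : ((wAnti c).mat * (uSharp (g.1 1 1 / g.1 1 0)).mat).1 1 0 = g.1 1 0 := by
      change (!![0, -(c : F)⁻¹; (c : F), 0] * !![1, g.1 1 1 / g.1 1 0; 0, 1]) 1 0 = g.1 1 0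
      rw [Matrix.mul_fin_two, hc]
      simp
    rw [lowerEntry, this, if_pos hne]
  have h2 : lowerEntry (wAnti c).mat = g.1 1 0 := by simp [lowerEntry, wAnti, hc]
  have h3 : lowerEntry g = g.1 1 0 := by simp [lowerEntry, hne]
  ext1
  · exact hm
  · change (1 : ℤˣ) = 1 * (1 * 1 * cocycle _ _) * cocycle _ _
    have e1 : cocycle (wAnti c).mat (uSharp (g.1 1 1 / g.1 1 0)).mat = 1 := by
      rw [cocycle, h1, h2, div_self hne, hilbertSymbol_one_left]
    have e2 : cocycle (uSharp (g.1 0 0 / g.1 1 0)).mat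
        (wAnti c * uSharp (g.1 1 1 / g.1 1 0)).mat = 1 := by
      change cocycle _ ((wAnti c).mat * (uSharp (g.1 1 1 / g.1 1 0)).mat) = 1
      rw [cocycle, ← hm, h1, h3, div_self hne, hilbertSymbol_one_right]
    rw [e1, e2]
    simp

end group

/-! ### Weil constants, the Weil representation and the genuine character `ε` -/

section weil

variable {F : Type*} [NontriviallyNormedField F] [ProperSpace F]

/-- The closed unit ball of `F`, that is, its ring of integers. -/
def unitBall (F : Type*) [NontriviallyNormedField F] [ProperSpace F] :
    TopologicalSpace.PositiveCompacts F where
  carrier := Metric.closedBall 0 1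
  isCompact' := isCompact_closedBall 0 1
  interior_nonempty' := ⟨0, Metric.ball_subset_interior_closedBall (by simp)⟩

/-- The Haar measure on `F` for which the ring of integers has volume `1`. -/
def haarF (F : Type*) [NontriviallyNormedField F] [ProperSpace F] : @Measure F (borel F) :=
  letI : MeasurableSpace F := borel F
  haveI : BorelSpace F := ⟨rfl⟩
  Measure.addHaarMeasure (unitBall F)

/-- The integral over `F` for `haarF`. -/
def integralF (f : F → ℂ) : ℂ := @integral F ℂ _ _ (borel F) (haarF F) f

/-- Schwartz functions on `F`: the locally constant functions with compact support. -/
def IsSchwartz (φ : F → ℂ) : Prop := IsLocallyConstant φ ∧ HasCompactSupport φ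

/-- The Fourier transform `φ̂(x) = |δ|^{1/2} ∫ φ(y) ψ(xy) dy`. -/
def fourierF (ψ : AddChar F Circle) (δ : F) (φ : F → ℂ) (x : F) : ℂ :=
  ((‖δ‖ ^ (1 / 2 : ℝ) : ℝ) : ℂ) * integralF (fun y => φ y * (ψ (x * y) : ℂ))

/-- The Weil constant `α_ψ(a)`, `a ≠ 0`: the constant such that, for all Schwartz functions `φ`,
`∫ φ(y) ψ(a y²) dy = α_ψ(a) |2a|^{-1/2} ∫ φ̂(y) ψ(-y² / (4a)) dy`. -/
def weilConst (ψ : AddChar F Circle) (δ a : F) : ℂ :=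
  Classical.epsilon fun α : ℂ => ∀ φ : F → ℂ, IsSchwartz φ →
    integralF (fun y => φ y * (ψ (a * y ^ 2) : ℂ)) =
      α * ((‖2 * a‖ ^ (-(1 / 2) : ℝ) : ℝ) : ℂ) *
        integralF (fun y => fourierF ψ δ φ y * (ψ (-(y ^ 2 / (4 * a))) : ℂ))

/-- The operator `ω_ψ(𝐮♯(b))`. -/
def opUSharp (ψ : AddChar F Circle) (b : F) (φ : F → ℂ) : F → ℂ :=
  fun x => (ψ (b * x ^ 2) : ℂ) * φ x

/-- The operator `ω_ψ(𝐦(a))`. -/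
def opM (ψ : AddChar F Circle) (δ a : F) (φ : F → ℂ) : F → ℂ :=
  fun x => weilConst ψ δ 1 / weilConst ψ δ a * ((‖a‖ ^ (1 / 2 : ℝ) : ℝ) : ℂ) * φ (a * x)

/-- The operator `ω_ψ(𝐰_a)`. -/
def opW (ψ : AddChar F Circle) (δ a : F) (φ : F → ℂ) : F → ℂ :=
  fun x => conj (weilConst ψ δ a) * ((‖2 * a⁻¹‖ ^ (1 / 2 : ℝ) : ℝ) : ℂ) *
    fourierF ψ δ φ (-2 * a⁻¹ * x)

open scoped Classical in
/-- The Weil representation `ω_ψ`, evaluated through `[g, ζ] = 𝐮♯(ab) 𝐦(a) [1, ζ]` if `c = 0` and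
`[g, ζ] = 𝐮♯(a/c) 𝐰_c 𝐮♯(d/c) [1, ζ]` if `c ≠ 0`, where `g = (a, b; c, d)`
(see `eq_uSharp_mul_mDiag` and `eq_uSharp_mul_wAnti_mul_uSharp`); `[1, ζ]` acts by `ζ`. -/
def weilRep (ψ : AddChar F Circle) (δ : F) (x : Mp2 F) (φ : F → ℂ) : F → ℂ :=
  ((x.sgn : ℤ) : ℂ) •
    if x.mat.1 1 0 = 0 then
      opUSharp ψ (x.mat.1 0 0 * x.mat.1 0 1) (opM ψ δ (x.mat.1 0 0) φ)
    else
      opUSharp ψ (x.mat.1 0 0 / x.mat.1 1 0) (opW ψ δ (x.mat.1 1 0)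
        (opUSharp ψ (x.mat.1 1 1 / x.mat.1 1 0) φ))

/-- The characteristic function of the ring of integers. -/
def phi0 (F : Type*) [NontriviallyNormedField F] : F → ℂ :=
  Set.indicator (Metric.closedBall 0 1) 1

/-- The genuine character `ε`, given by `ω_ψ(γ) φ₀ = ε(γ)⁻¹ φ₀` for `γ` in the inverse image of
`Γ₀(4)`. -/
def eps (ψ : AddChar F Circle) (δ : F) (γ : Mp2 F) : ℂ :=
  Classical.epsilon fun z : ℂ => weilRep ψ δ γ (phi0 F) = z⁻¹ • phi0 F

end weil

/-! ### Congruence subgroups and Hecke algebras -/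

section hecke

/-- `Γ[β𝔬, γ𝔬]`: the matrices `(a, b; c, d)` in `SL₂(F)` with `a, d ∈ 𝔬`, `b ∈ β𝔬`, `c ∈ γ𝔬`. -/
def congruenceSet {F : Type*} [NontriviallyNormedField F] (β γ : F) :
    Set (SpecialLinearGroup (Fin 2) F) :=
  {g | ‖g.1 0 0‖ ≤ 1 ∧ ‖g.1 1 1‖ ≤ 1 ∧ ‖g.1 0 1‖ ≤ ‖β‖ ∧ ‖g.1 1 0‖ ≤ ‖γ‖}

/-- The two choices for `Γ₂`. -/
inductive Level
  /-- `Γ₂ = Γ₀(ϖ) = Γ[𝔡⁻¹, ϖ𝔡]` -/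
  | lower
  /-- `Γ₂ = Γ[ϖ𝔡⁻¹, 𝔡]` -/
  | upper

/-- The group `Γ₂`, where `𝔡 = δ𝔬`. -/
def Gamma2 {F : Type*} [NontriviallyNormedField F] (δ ϖ : F) :
    Level → Set (SpecialLinearGroup (Fin 2) F)
  | .lower => congruenceSet δ⁻¹ (ϖ * δ)
  | .upper => congruenceSet (ϖ * δ⁻¹) δ

instance {F : Type*} [NontriviallyNormedField F] :
    MeasurableSpace (SpecialLinearGroup (Fin 2) F) := borel _

instance {F : Type*} [NontriviallyNormedField F] :
    BorelSpace (SpecialLinearGroup (Fin 2) F) := ⟨rfl⟩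

instance {F : Type*} [NontriviallyNormedField F] : MeasurableSpace (Mp2 F) :=
  MeasurableSpace.comap Mp2.mat inferInstance ⊔ MeasurableSpace.comap Mp2.sgn ⊤

/-- The Haar measure on the two-sheeted cover `Mp₂(F)` of `SL₂(F)` which is attached to a Haar
measure `μ` on `SL₂(F)`: `μ` on each of the sheets `ζ = 1` and `ζ = -1`. -/
def haarMp2 {F : Type*} [NontriviallyNormedField F]
    (μ : Measure (SpecialLinearGroup (Fin 2) F)) : Measure (Mp2 F) :=
  μ.map (fun g => ⟨g, 1⟩) + μ.map (fun g => ⟨g, -1⟩)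

/-- The convolution product `(φ₁ ∗ φ₂)(g) = ∫ φ₁(h) φ₂(h⁻¹ g) dh`. -/
def conv {G : Type*} [Mul G] [Inv G] [MeasurableSpace G] (μ : Measure G) (φ₁ φ₂ : G → ℂ) : G → ℂ :=
  fun g => ∫ h, φ₁ h * φ₂ (h⁻¹ * g) ∂μ

/-- A subset of a topological space is relatively compact if its closure is compact. The union of
two relatively compact sets, hence the support of a sum, is again relatively compact. -/
theorem isCompact_closure_image_support_add {X Y : Type*} [TopologicalSpace Y] (p : X → Y)
    {φ₁ φ₂ : X → ℂ} (h₁ : IsCompact (closure (p '' Function.support φ₁)))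
    (h₂ : IsCompact (closure (p '' Function.support φ₂))) :
    IsCompact (closure (p '' Function.support (φ₁ + φ₂))) := by
  refine (h₁.union h₂).of_isClosed_subset isClosed_closure ?_
  rw [← closure_union, ← Set.image_union]
  exact closure_mono (Set.image_mono (Function.support_add φ₁ φ₂))

theorem isCompact_closure_image_support_smul {X Y : Type*} [TopologicalSpace Y] (p : X → Y)
    (c : ℂ) {φ : X → ℂ} (h : IsCompact (closure (p '' Function.support φ))) :
    IsCompact (closure (p '' Function.support (c • φ))) :=
  h.of_isClosed_subset isClosed_closure
    (closure_mono (Set.image_mono (Function.support_const_smul_subset c φ)))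

/-- The underlying space of the genuine Hecke algebra `ℋ̃(Γ̃ \ Mp₂(F) / Γ̃; ε)`: compactly supported
genuine functions `φ` on `Mp₂(F)` with `φ(γ₁ g γ₂) = ε(γ₁ γ₂) φ(g)` for `γ₁, γ₂ ∈ Γ̃`. The support
of `φ` is compact if and only if its image in `SL₂(F)` is relatively compact, because `Mp₂(F)` is a
finite cover and such a `φ` is locally constant. -/
def genuineHecke {F : Type*} [NontriviallyNormedField F] [ProperSpace F]
    (ψ : AddChar F Circle) (δ : F) (Γ : Set (SpecialLinearGroup (Fin 2) F)) :
    Submodule ℂ (Mp2 F → ℂ) where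
  carrier := {φ | IsCompact (closure (Mp2.mat '' Function.support φ)) ∧
    (∀ (g : SpecialLinearGroup (Fin 2) F) (ζ : ℤˣ), φ ⟨g, ζ⟩ = ((ζ : ℤ) : ℂ) * φ ⟨g, 1⟩) ∧
    ∀ γ₁ ∈ lift Γ, ∀ γ₂ ∈ lift Γ, ∀ g, φ (γ₁ * g * γ₂) = eps ψ δ (γ₁ * γ₂) * φ g}
  zero_mem' := ⟨by simp, by simp, by simp⟩
  add_mem' := fun {a b} ha hb =>
    ⟨isCompact_closure_image_support_add _ ha.1 hb.1,
     fun g ζ => by simp only [Pi.add_apply]; rw [ha.2.1, hb.2.1, mul_add],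
     fun γ₁ h₁ γ₂ h₂ g => by
       simp only [Pi.add_apply]; rw [ha.2.2 γ₁ h₁ γ₂ h₂, hb.2.2 γ₁ h₁ γ₂ h₂, mul_add]⟩
  smul_mem' := fun c a ha =>
    ⟨isCompact_closure_image_support_smul _ c ha.1,
     fun g ζ => by simp only [Pi.smul_apply, smul_eq_mul]; rw [ha.2.1]; ring,
     fun γ₁ h₁ γ₂ h₂ g => by
       simp only [Pi.smul_apply, smul_eq_mul]; rw [ha.2.2 γ₁ h₁ γ₂ h₂]; ring⟩

/-- The unit of the genuine Hecke algebra: `ε` on `Γ̃`, and zero elsewhere. -/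
def heckeOne {F : Type*} [NontriviallyNormedField F] [ProperSpace F]
    (ψ : AddChar F Circle) (δ : F) (Γ : Set (SpecialLinearGroup (Fin 2) F)) : Mp2 F → ℂ :=
  Set.indicator (lift Γ) (eps ψ δ)

open scoped Classical in
/-- The function `X_g`, supported on the double coset `Γ̃ g Γ̃`, with
`X_g(γ₁ g γ₂) = ε(γ₁) ε(g) ε(γ₂)`; the argument `v` is the value `ε(g)`. -/
def doubleCosetFun {F : Type*} [NontriviallyNormedField F] [ProperSpace F]
    (ψ : AddChar F Circle) (δ : F) (Γ : Set (SpecialLinearGroup (Fin 2) F)) (g : Mp2 F) (v : ℂ) :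
    Mp2 F → ℂ :=
  fun x => if h : ∃ p : Mp2 F × Mp2 F, p.1 ∈ lift Γ ∧ p.2 ∈ lift Γ ∧ x = p.1 * g * p.2 then
    eps ψ δ h.choose.1 * v * eps ψ δ h.choose.2 else 0

/-- The exponent of `ϖ` in the representative of the double coset that carries `Ũ_m`. -/
def Level.exponent : Level → ℤ → ℤ
  | .lower, m => m
  | .upper, m => -m

/-- The Hecke operator `Ũ_m = q^{-|m|/2} X_g` with `g = 𝐰_{δϖ^m}` if `Γ₂ = Γ₀(ϖ)` and
`g = 𝐰_{δϖ^{-m}}` if `Γ₂ = Γ[ϖ𝔡⁻¹, 𝔡]`, where `ε(𝐰_{δa}) = α_ψ(δa)`. -/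
def heckeU {F : Type*} [NontriviallyNormedField F] [ProperSpace F]
    (ψ : AddChar F Circle) (δ ϖ : Fˣ) (q : ℕ) (t : Level) (m : ℤ) : Mp2 F → ℂ :=
  (((q : ℝ) ^ (-(|m| : ℝ) / 2) : ℝ) : ℂ) •
    doubleCosetFun ψ (δ : F) (Gamma2 (δ : F) (ϖ : F) t) (wAnti (δ * ϖ ^ t.exponent m))
      (weilConst ψ (δ : F) ((δ * ϖ ^ t.exponent m : Fˣ) : F))

/-! The Iwahori–Hecke algebra of `PGL₂(F)`. -/

instance {F : Type*} [NontriviallyNormedField F] : TopologicalSpace PGL(Fin 2, F) :=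
  inferInstanceAs (TopologicalSpace (GL (Fin 2) F ⧸ Subgroup.center (GL (Fin 2) F)))

instance {F : Type*} [NontriviallyNormedField F] : MeasurableSpace PGL(Fin 2, F) := borel _

instance {F : Type*} [NontriviallyNormedField F] : BorelSpace PGL(Fin 2, F) := ⟨rfl⟩

/-- The Iwahori subgroup of `PGL₂(F)`: the image of the matrices `(a, b; ϖc, d)` with `a, d ∈ 𝔬`,
`b ∈ 𝔡⁻¹`, `c ∈ 𝔡` and determinant in `𝔬ˣ`, where `𝔡 = δ𝔬`. -/
def iwahori {F : Type*} [NontriviallyNormedField F] (δ ϖ : F) : Set PGL(Fin 2, F) :=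
  ProjGenLinGroup.mk '' {g : GL (Fin 2) F | ‖g.1 0 0‖ ≤ 1 ∧ ‖g.1 1 1‖ ≤ 1 ∧ ‖g.1 0 1‖ ≤ ‖δ⁻¹‖ ∧
    ‖g.1 1 0‖ ≤ ‖ϖ * δ‖ ∧ ‖g.1.det‖ = 1}

/-- The underlying space of `ℋ(I \ PGL₂(F) / I)`: compactly supported functions `φ` with
`φ(k₁ g k₂) = φ(g)` for `k₁, k₂ ∈ I`. -/
def pglHecke {F : Type*} [NontriviallyNormedField F] (I : Set PGL(Fin 2, F)) :
    Submodule ℂ (PGL(Fin 2, F) → ℂ) where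
  carrier := {φ | HasCompactSupport φ ∧ ∀ k₁ ∈ I, ∀ k₂ ∈ I, ∀ g, φ (k₁ * g * k₂) = φ g}
  zero_mem' := ⟨HasCompactSupport.zero, by simp⟩
  add_mem' := fun {a b} ha hb => ⟨ha.1.add hb.1, fun k₁ h₁ k₂ h₂ g => by
    simp only [Pi.add_apply]; rw [ha.2 k₁ h₁ k₂ h₂, hb.2 k₁ h₁ k₂ h₂]⟩
  smul_mem' := fun c a ha => ⟨ha.1.smul_left (f := fun _ => c), fun k₁ h₁ k₂ h₂ g => by
    simp only [Pi.smul_apply]; rw [ha.2 k₁ h₁ k₂ h₂]⟩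

/-- The relations `(x₀ - q)(x₀ + 1) = 0` and `x₁² = 1`. -/
inductive IwahoriRel (q : ℕ) : FreeAlgebra ℂ (Fin 2) → FreeAlgebra ℂ (Fin 2) → Prop
  | quadratic : IwahoriRel q
      ((FreeAlgebra.ι ℂ 0 - algebraMap ℂ _ (q : ℂ)) * (FreeAlgebra.ι ℂ 0 + 1)) 0
  | involution : IwahoriRel q (FreeAlgebra.ι ℂ 1 ^ 2) 1

/-- The unital associative `ℂ`-algebra with generators `x₀`, `x₁` and the defining relations
`(x₀ - q)(x₀ + 1) = 0` and `x₁² = 1`. -/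
abbrev PresentedAlgebra (q : ℕ) : Type := RingQuot (IwahoriRel q)

/-- The generators `x₀` and `x₁`. -/
def gen (q : ℕ) (i : Fin 2) : PresentedAlgebra q :=
  RingQuot.mkAlgHom ℂ (IwahoriRel q) (FreeAlgebra.ι ℂ i)

end hecke

end Metaplectic

end

/-! Write Γ̃ for the inverse image of Γ₂, and put s = 𝐰_δ and t = 𝐰_b with b = a_1. Modulo Γ₂ these
project to the two simple reflections of the affine Weyl group of SL₂(F). Hence Mp₂(F) is the
disjoint union of the double cosets of the alternating words in s and t, and on each of them a Hecke
function is determined by its value at the word. Let T₀ and T₁ be the functions Ũ₀ and Ũ₁ on Γ̃sΓ̃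
and Γ̃tΓ̃. The support of an alternating product of T₀ and T₁ lies in the double coset of the
corresponding word, because lengths add. If T₀ and T₁ satisfy the two relations they are invertible,
so the product is non-zero and does not vanish at the word. Thus the alternating products form a
basis of the Hecke algebra. The relations alone show that alternating words span the presented
algebra, and so the map from it is bijective. This is `HeckeAlg.liftPresented_bijective`; it needs
no structure constants beyond the two squares.

The squares are computed uniformly. For a simple reflection 𝐰_a let T be the function on its cell
with value v at 𝐰_a. The cell consists of q left cosets, represented by unipotent elements on which
ε is 1, and T * T is supported on Γ̃ and the cell. Let χ be the quadratic character of the unit part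
(`unitChar`). The value at the identity is q v² χ(-1)^{ord(aδ)}. The coefficient of T is v times the
sum of χ^{ord(aδ)} over the non-zero residue classes, since the product of a unit t with a gives
T(𝐰_{at}) = v χ(t)^{ord(aδ)} (`cell_mul_self_of_conj`). For a = δ the exponent is even: the sum is q
- 1, the Weil constant is 1, and T₀² = (q - 1)T₀ + q. For a = b the exponent is odd: the character
sum vanishes, and v² = q⁻¹ α_ψ(b)² = q⁻¹ χ(-1) gives T₁² = 1. So although Γ̃tΓ̃ has q cosets, T₁
behaves like an element of length zero. That is the source of the comparison with PGL₂.

The arithmetic enters through three facts. The Hilbert symbol is given by the tame formula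
(`OddUniformizer.hilbertSymbol_eq`), hence is bilinear, and this makes Mp₂(F) associative
(`midAssoc`). The Weil constants are Gauss integrals: they are 1 if ord(aδ) is even, and √q divided
by a residue Gauss sum otherwise. Finally, ω_ψ acts on the characteristic function of the integers
by an explicit sign (`weilRep_phi0`), which is multiplicative on the congruence group and compatible
with conjugation by 𝐰_a (`splitSign_mul`, `splitSign_eq_of_mul_wAnti`).

For PGL₂(F) the same theorem applies with the trivial character. There the second reflection
normalizes the Iwahori subgroup, its cell is a single coset, and its square is 1 at once. Both Hecke
algebras are thus isomorphic to the same presented algebra. -/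

set_option linter.unusedSectionVars false

noncomputable section

namespace Metaplectic

/-! ### Hecke algebras of equivariant functions on an abstract group -/

section abstractHecke

variable {G : Type*} [Group G]

/-- The sum of a right `Γ`-invariant function over the left cosets of `Γ`. -/
def cosetSum (Γ : Subgroup G) (f : G → ℂ) : ℂ := ∑ᶠ x : G ⧸ Γ, f x.out

/-- The convolution product as a sum over left cosets. -/
def cosetConv (Γ : Subgroup G) (φ₁ φ₂ : G → ℂ) : G → ℂ :=
  fun g => cosetSum Γ fun h => φ₁ h * φ₂ (h⁻¹ * g)

/-- Functions with `φ(γ₁ g γ₂) = ε(γ₁) ε(γ₂) φ(g)`, supported on finitely many left cosets. -/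
def HeckeAlg (Γ : Subgroup G) (ε : Γ →* ℂ) : Submodule ℂ (G → ℂ) where
  carrier := {φ | (∀ γ₁ γ₂ : Γ, ∀ g, φ (γ₁ * g * γ₂) = ε γ₁ * ε γ₂ * φ g) ∧
    ((QuotientGroup.mk : G → G ⧸ Γ) '' Function.support φ).Finite}
  zero_mem' := ⟨by simp, by simp⟩
  add_mem' := fun {a b} ha hb =>
    ⟨fun γ₁ γ₂ g => by simp only [Pi.add_apply]; rw [ha.1, hb.1, mul_add],
     (ha.2.union hb.2).subset (by
      rw [← Set.image_union]; exact Set.image_mono (Function.support_add a b))⟩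
  smul_mem' := fun c a ha =>
    ⟨fun γ₁ γ₂ g => by simp only [Pi.smul_apply, smul_eq_mul]; rw [ha.1]; ring,
     ha.2.subset (Set.image_mono (Function.support_const_smul_subset c a))⟩

/-- `y` lies in the double coset `Γ x Γ`. -/
def InDC (Γ : Subgroup G) (x y : G) : Prop := ∃ γ₁ γ₂ : Γ, y = γ₁ * x * γ₂

/-- The alternating product `a b a b ⋯` with `n` factors. -/
def altProd {M : Type*} [Monoid M] : M → M → ℕ → M
  | _, _, 0 => 1
  | a, b, n + 1 => a * altProd b a n

theorem map_altProd {M N F : Type*} [Monoid M] [Monoid N] [FunLike F M N] [MonoidHomClass F M N]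
    (f : F) (a b : M) (n : ℕ) : f (altProd a b n) = altProd (f a) (f b) n := by
  induction n generalizing a b with
  | zero => simp [altProd]
  | succ n ih => simp [altProd, ih]

variable {Γ : Subgroup G} {ε : Γ →* ℂ}

theorem apply_mk_out {f : G → ℂ} (hf : ∀ g (γ : Γ), f (g * γ) = f g) (g : G) :
    f (g : G ⧸ Γ).out = f g := by
  obtain ⟨γ, hγ⟩ := QuotientGroup.mk_out_eq_mul Γ g
  rw [hγ, hf]

theorem apply_eq_of_mk_eq {f : G → ℂ} (hf : ∀ g (γ : Γ), f (g * γ) = f g) {g h : G}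
    (e : (g : G ⧸ Γ) = h) : f g = f h := by
  rw [← apply_mk_out hf g, e, apply_mk_out hf h]

/-- Left translation permutes the left cosets, and by right invariance the chosen representatives do
not matter. -/
theorem cosetSum_mul_left {f : G → ℂ} (hf : ∀ g (γ : Γ), f (g * γ) = f g) (a : G) :
    cosetSum Γ (fun h => f (a * h)) = cosetSum Γ f := by
  unfold cosetSum
  rw [← finsum_comp_equiv (MulAction.toPerm a : Equiv.Perm (G ⧸ Γ)) (f := fun x => f x.out)]
  refine finsum_congr fun x => ?_
  beta_reduce
  have : (MulAction.toPerm a x : G ⧸ Γ) = ((a * x.out : G) : G ⧸ Γ) := by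
    conv_lhs => rw [← QuotientGroup.out_eq' x]
    rfl
  rw [this, apply_mk_out hf]

/-- Lets explicit representatives replace the chosen ones. The family may contain cosets on which
`f` vanishes, but it has to cover the support and must not repeat a coset. -/
theorem cosetSum_eq_sum {X : Type*} [Fintype X] {f : G → ℂ} (hf : ∀ g (γ : Γ), f (g * γ) = f g)
    (c : X → G) (hinj : Function.Injective fun x => (c x : G ⧸ Γ))
    (hcov : ∀ g, f g ≠ 0 → ∃ x, (g : G ⧸ Γ) = c x) : cosetSum Γ f = ∑ x, f (c x) := by
  classical
  unfold cosetSum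
  rw [finsum_eq_sum_of_support_subset (s := Finset.univ.image fun x => (c x : G ⧸ Γ)),
    Finset.sum_image fun x _ y _ h => hinj h]
  · exact Finset.sum_congr rfl fun x _ => apply_mk_out hf _
  · intro y hy
    obtain ⟨x, hx⟩ := hcov _ hy
    rw [QuotientGroup.out_eq'] at hx
    simpa using ⟨x, hx.symm⟩

namespace HeckeAlg

theorem eps_mul_eps_inv (γ : Γ) : ε γ * ε γ⁻¹ = 1 := by rw [← map_mul, mul_inv_cancel, map_one]

theorem apply_mul_right (φ : HeckeAlg Γ ε) (g : G) (γ : Γ) : φ.1 (g * γ) = ε γ * φ.1 g := by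
  simpa using φ.2.1 1 γ g

theorem apply_mul_left (φ : HeckeAlg Γ ε) (γ : Γ) (g : G) : φ.1 (γ * g) = ε γ * φ.1 g := by
  simpa using φ.2.1 γ 1 g

/-- The two factors change by ε(γ) and ε(γ⁻¹), which cancel. This is why the convolution descends to
a sum over cosets. -/
theorem conv_integrand_invariant (φ₁ φ₂ : HeckeAlg Γ ε) (g h : G) (γ : Γ) :
    φ₁.1 (h * γ) * φ₂.1 ((h * γ)⁻¹ * g) = φ₁.1 h * φ₂.1 (h⁻¹ * g) := by
  have : (h * γ)⁻¹ * g = (γ⁻¹ : Γ) * (h⁻¹ * g) := by simp [mul_assoc]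
  rw [this, apply_mul_right, apply_mul_left]
  linear_combination φ₁.1 h * φ₂.1 (h⁻¹ * g) * eps_mul_eps_inv (ε := ε) γ

theorem exists_of_cosetConv_ne_zero {φ₁ φ₂ : G → ℂ} {g : G} (h : cosetConv Γ φ₁ φ₂ g ≠ 0) :
    ∃ x : G, φ₁ x ≠ 0 ∧ φ₂ (x⁻¹ * g) ≠ 0 := by
  by_contra! H
  refine h ?_
  unfold cosetConv cosetSum
  refine finsum_eq_zero_of_forall_eq_zero fun x => ?_
  by_cases h1 : φ₁ x.out = 0
  · simp [h1]
  · simp [H _ h1]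

theorem cosetConv_mem (φ₁ φ₂ : HeckeAlg Γ ε) : cosetConv Γ φ₁.1 φ₂.1 ∈ HeckeAlg Γ ε := by
  constructor
  · intro γ₁ γ₂ g
    unfold cosetConv
    rw [← cosetSum_mul_left (fun h γ => conv_integrand_invariant φ₁ φ₂ _ h γ) (γ₁ : G)]
    unfold cosetSum
    rw [mul_finsum]
    refine finsum_congr fun x => ?_
    beta_reduce
    have : ((γ₁ : G) * x.out)⁻¹ * (γ₁ * g * γ₂) = x.out⁻¹ * g * γ₂ := by group
    rw [this, apply_mul_left, apply_mul_right]
    ring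
  -- If g is in the support, then g = x(x⁻¹g) with x in the support of φ₁ and x⁻¹g in that of φ₂. So
  -- the cosets of the support lie in finitely many translates of the finite set belonging to φ₂.
  · refine (φ₁.2.2.biUnion fun x _ => φ₂.2.2.image fun y => x.out • y).subset ?_
    rintro _ ⟨g, hg, rfl⟩
    obtain ⟨x, h1, h2⟩ := exists_of_cosetConv_ne_zero hg
    obtain ⟨γ, hγ⟩ := QuotientGroup.mk_out_eq_mul Γ x
    simp only [Set.mem_iUnion]
    refine ⟨(x : G ⧸ Γ), ⟨x, h1, rfl⟩, ((γ⁻¹ : Γ) * (x⁻¹ * g) : G), ⟨_, ?_, rfl⟩, ?_⟩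
    · rw [Function.mem_support, apply_mul_left]
      exact mul_ne_zero (left_ne_zero_of_mul_eq_one (eps_mul_eps_inv _)) h2
    · change (((x : G ⧸ Γ).out * ((γ⁻¹ : Γ) * (x⁻¹ * g)) : G) : G ⧸ Γ) = g
      rw [hγ]
      congr 1
      simp [mul_assoc]

instance : Mul (HeckeAlg Γ ε) := ⟨fun φ₁ φ₂ => ⟨cosetConv Γ φ₁.1 φ₂.1, cosetConv_mem φ₁ φ₂⟩⟩

open scoped Classical in
instance : One (HeckeAlg Γ ε) := ⟨⟨fun g => if h : g ∈ Γ then ε ⟨g, h⟩ else 0, by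
  constructor
  · intro γ₁ γ₂ g
    beta_reduce
    by_cases h : g ∈ Γ
    · have h' : (γ₁ : G) * g * γ₂ ∈ Γ := Γ.mul_mem (Γ.mul_mem γ₁.2 h) γ₂.2
      rw [dif_pos h, dif_pos h']
      have : (⟨γ₁ * g * γ₂, h'⟩ : Γ) = γ₁ * ⟨g, h⟩ * γ₂ := rfl
      rw [this, map_mul, map_mul]
      ring
    · have h' : (γ₁ : G) * g * γ₂ ∉ Γ := by
        rwa [Subgroup.mul_mem_cancel_right _ γ₂.2, Subgroup.mul_mem_cancel_left _ γ₁.2]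
      rw [dif_neg h, dif_neg h', mul_zero]
  · refine (Set.finite_singleton ((1 : G) : G ⧸ Γ)).subset ?_
    rintro _ ⟨g, hg, rfl⟩
    have : g ∈ Γ := by
      by_contra h
      simp [h] at hg
    simpa [QuotientGroup.eq] using this⟩⟩

theorem mul_apply (φ₁ φ₂ : HeckeAlg Γ ε) (g : G) :
    (φ₁ * φ₂).1 g = cosetSum Γ fun h => φ₁.1 h * φ₂.1 (h⁻¹ * g) := rfl

theorem one_apply_mem {g : G} (h : g ∈ Γ) : (1 : HeckeAlg Γ ε).1 g = ε ⟨g, h⟩ := dif_pos h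

theorem one_apply_notMem {g : G} (h : g ∉ Γ) : (1 : HeckeAlg Γ ε).1 g = 0 := dif_neg h

protected theorem one_mul (φ : HeckeAlg Γ ε) : 1 * φ = φ := by
  ext g
  rw [mul_apply, cosetSum_eq_sum (X := Unit) (fun h γ => conv_integrand_invariant _ _ _ h γ)
    (fun _ => 1) (fun _ _ _ => rfl)]
  · simp [one_apply_mem Γ.one_mem, show (⟨1, Γ.one_mem⟩ : Γ) = 1 from rfl]
  · intro h hh
    refine ⟨(), ?_⟩
    by_contra h'
    refine hh ?_
    rw [one_apply_notMem, zero_mul]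
    intro h''
    exact h' (by simpa [QuotientGroup.eq] using h'')

protected theorem mul_one (φ : HeckeAlg Γ ε) : φ * 1 = φ := by
  ext g
  rw [mul_apply, cosetSum_eq_sum (X := Unit) (fun h γ => conv_integrand_invariant _ _ _ h γ)
    (fun _ => g) (fun _ _ _ => rfl)]
  · simp [one_apply_mem Γ.one_mem, show (⟨1, Γ.one_mem⟩ : Γ) = 1 from rfl]
  · intro h hh
    refine ⟨(), ?_⟩
    by_contra h'
    refine hh ?_
    rw [one_apply_notMem, mul_zero]
    intro h''
    exact h' (by simpa [QuotientGroup.eq] using h'')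

/-- Both sides are the sum of φ₁(x) φ₂(x⁻¹y) φ₃(y⁻¹g) over pairs of cosets. On the right the inner
variable is first translated by x; then the two sums are exchanged, which is legitimate because only
finitely many pairs contribute. -/
protected theorem mul_assoc (φ₁ φ₂ φ₃ : HeckeAlg Γ ε) : φ₁ * φ₂ * φ₃ = φ₁ * (φ₂ * φ₃) := by
  ext g
  have hR : (φ₁ * (φ₂ * φ₃)).1 g = ∑ᶠ x : G ⧸ Γ, ∑ᶠ y : G ⧸ Γ,
      φ₁.1 x.out * (φ₂.1 (x.out⁻¹ * y.out) * φ₃.1 (y.out⁻¹ * g)) := by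
    rw [mul_apply]
    refine finsum_congr fun x => ?_
    beta_reduce
    rw [mul_apply, ← mul_finsum]
    congr 1
    have hinv : ∀ h (γ : Γ), φ₂.1 (x.out⁻¹ * (h * γ)) * φ₃.1 ((h * γ)⁻¹ * g) =
        φ₂.1 (x.out⁻¹ * h) * φ₃.1 (h⁻¹ * g) := by
      intro h γ
      have : (h * γ)⁻¹ * g = (γ⁻¹ : Γ) * (h⁻¹ * g) := by simp [mul_assoc]
      rw [this, ← mul_assoc, apply_mul_right, apply_mul_left]
      linear_combination φ₂.1 (x.out⁻¹ * h) * φ₃.1 (h⁻¹ * g) * eps_mul_eps_inv (ε := ε) γ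
    refine Eq.trans ?_ (cosetSum_mul_left
      (f := fun h => φ₂.1 (x.out⁻¹ * h) * φ₃.1 (h⁻¹ * g)) hinv x.out)
    refine finsum_congr fun z => ?_
    simp [mul_assoc]
  have hL : (φ₁ * φ₂ * φ₃).1 g = ∑ᶠ y : G ⧸ Γ, ∑ᶠ x : G ⧸ Γ,
      φ₁.1 x.out * (φ₂.1 (x.out⁻¹ * y.out) * φ₃.1 (y.out⁻¹ * g)) := by
    rw [mul_apply]
    refine finsum_congr fun y => ?_
    beta_reduce
    rw [mul_apply]
    unfold cosetSum
    rw [finsum_mul]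
    exact finsum_congr fun x => by ring
  have hfin : (Function.support fun p : (G ⧸ Γ) × (G ⧸ Γ) =>
      φ₁.1 p.1.out * (φ₂.1 (p.1.out⁻¹ * p.2.out) * φ₃.1 (p.2.out⁻¹ * g))).Finite := by
    refine (φ₁.2.2.biUnion fun x _ => φ₂.2.2.image fun y => (x, x.out • y)).subset ?_
    rintro ⟨x, y⟩ h
    rw [Function.mem_support] at h
    have h1 := left_ne_zero_of_mul h
    have h2 := left_ne_zero_of_mul (right_ne_zero_of_mul h)
    simp only [Set.mem_iUnion]
    refine ⟨x, ⟨x.out, h1, QuotientGroup.out_eq' x⟩, _, ⟨_, h2, rfl⟩, ?_⟩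
    refine Prod.ext rfl ?_
    change ((x.out * (x.out⁻¹ * y.out) : G) : G ⧸ Γ) = y
    rw [mul_inv_cancel_left, QuotientGroup.out_eq']
  rw [hL, hR, ← finsum_curry (fun p : (G ⧸ Γ) × (G ⧸ Γ) =>
    φ₁.1 p.1.out * (φ₂.1 (p.1.out⁻¹ * p.2.out) * φ₃.1 (p.2.out⁻¹ * g))) hfin]
  rw [← finsum_comp_equiv (Equiv.prodComm (G ⧸ Γ) (G ⧸ Γ)), finsum_curry]
  · rfl
  · exact (hfin.preimage (Equiv.prodComm (G ⧸ Γ) (G ⧸ Γ)).injective.injOn)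

theorem support_finite (φ : HeckeAlg Γ ε) (f : G → ℂ) :
    (Function.support fun x : G ⧸ Γ => φ.1 x.out * f x.out).Finite := by
  refine φ.2.2.subset fun x hx => ⟨x.out, left_ne_zero_of_mul hx, QuotientGroup.out_eq' x⟩

instance : Ring (HeckeAlg Γ ε) where
  mul_assoc := HeckeAlg.mul_assoc
  one_mul := HeckeAlg.one_mul
  mul_one := HeckeAlg.mul_one
  zero_mul φ := by
    ext g
    rw [mul_apply]
    exact finsum_eq_zero_of_forall_eq_zero fun x => zero_mul _
  mul_zero φ := by
    ext g
    rw [mul_apply]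
    exact finsum_eq_zero_of_forall_eq_zero fun x => mul_zero _
  left_distrib φ₁ φ₂ φ₃ := by
    ext g
    change (φ₁ * (φ₂ + φ₃)).1 g = (φ₁ * φ₂).1 g + (φ₁ * φ₃).1 g
    simp only [mul_apply, cosetSum]
    rw [← finsum_add_distrib (support_finite φ₁ fun h => φ₂.1 (h⁻¹ * g))
      (support_finite φ₁ fun h => φ₃.1 (h⁻¹ * g))]
    exact finsum_congr fun x => mul_add _ _ _
  right_distrib φ₁ φ₂ φ₃ := by
    ext g
    change ((φ₁ + φ₂) * φ₃).1 g = (φ₁ * φ₃).1 g + (φ₂ * φ₃).1 g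
    simp only [mul_apply, cosetSum]
    rw [← finsum_add_distrib (support_finite φ₁ fun h => φ₃.1 (h⁻¹ * g))
      (support_finite φ₂ fun h => φ₃.1 (h⁻¹ * g))]
    exact finsum_congr fun x => add_mul _ _ _
  neg_add_cancel := neg_add_cancel
  zsmul := fun n x => n • x
  zsmul_zero' := SubNegMonoid.zsmul_zero'
  zsmul_succ' := SubNegMonoid.zsmul_succ'
  zsmul_neg' := SubNegMonoid.zsmul_neg'
  nsmul := fun n x => n • x
  nsmul_zero := AddMonoid.nsmul_zero
  nsmul_succ := AddMonoid.nsmul_succ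

instance : Algebra ℂ (HeckeAlg Γ ε) := Algebra.ofModule
  (fun c φ₁ φ₂ => by
    ext g
    change (c • φ₁ * φ₂).1 g = c * (φ₁ * φ₂).1 g
    simp only [mul_apply, cosetSum]
    rw [mul_finsum]
    exact finsum_congr fun x => mul_assoc c _ _)
  (fun c φ₁ φ₂ => by
    ext g
    change (φ₁ * c • φ₂).1 g = c * (φ₁ * φ₂).1 g
    simp only [mul_apply, cosetSum]
    rw [mul_finsum]
    exact finsum_congr fun x => mul_left_comm _ c _)

end HeckeAlg

end abstractHecke

/-! ### The presented algebra -/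

section presented

/-- The alternating words in two letters: `a b a ⋯` of length `n`, and `b a b ⋯` of length `n + 1`. -/
def altWord {M : Type*} [Monoid M] (a b : M) : ℕ ⊕ ℕ → M
  | Sum.inl n => altProd a b n
  | Sum.inr n => altProd b a (n + 1)

theorem map_altWord {M N F : Type*} [Monoid M] [Monoid N] [FunLike F M N] [MonoidHomClass F M N]
    (f : F) (a b : M) (i : ℕ ⊕ ℕ) : f (altWord a b i) = altWord (f a) (f b) i := by
  cases i <;> exact map_altProd f _ _ _

theorem exists_altWord_eq_left {M : Type*} [Monoid M] (a b : M) (n : ℕ) :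
    ∃ i, altWord a b i = altProd a b n := ⟨Sum.inl n, rfl⟩

theorem exists_altWord_eq_right {M : Type*} [Monoid M] (a b : M) (n : ℕ) :
    ∃ i, altWord a b i = altProd b a n := by
  cases n with
  | zero => exact ⟨Sum.inl 0, rfl⟩
  | succ n => exact ⟨Sum.inr n, rfl⟩

variable {q : ℕ}

theorem quadratic_relation_iff {A : Type*} [Ring A] [Algebra ℂ A] (z : ℂ) (T : A) :
    (T - algebraMap ℂ A z) * (T + 1) = 0 ↔ T * T = (z - 1) • T + z • (1 : A) := by
  rw [Algebra.algebraMap_eq_smul_one, sub_mul, mul_add, mul_one, smul_mul_assoc, one_mul,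
    sub_smul, one_smul, smul_add, sub_eq_zero]
  constructor <;> intro h
  · rw [eq_sub_of_add_eq h]
    abel
  · rw [h]
    abel

theorem gen_zero_mul_gen_zero :
    gen q 0 * gen q 0 = ((q : ℂ) - 1) • gen q 0 + (q : ℂ) • (1 : PresentedAlgebra q) := by
  have h := RingQuot.mkAlgHom_rel ℂ (IwahoriRel.quadratic (q := q))
  rw [map_mul, map_sub, map_add, map_one, map_zero, AlgHom.commutes] at h
  exact (quadratic_relation_iff _ _).1 h

theorem gen_one_mul_gen_one : gen q 1 * gen q 1 = (1 : PresentedAlgebra q) := by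
  have h := RingQuot.mkAlgHom_rel ℂ (IwahoriRel.involution (q := q))
  rwa [map_pow, map_one, pow_two] at h

/-- The span contains 1 and is stable under left multiplication by both generators: a generator
either lengthens a word or meets its own first letter, and then the relation for its square rewrites
the product by words that are no longer. -/
theorem span_altWord : Submodule.span ℂ (Set.range (altWord (gen q 0) (gen q 1))) = ⊤ := by
  set S := Submodule.span ℂ (Set.range (altWord (gen q 0) (gen q 1))) with hS
  have hl : ∀ n, altProd (gen q 0) (gen q 1) n ∈ S := fun n => by
    obtain ⟨i, hi⟩ := exists_altWord_eq_left (gen q 0) (gen q 1) n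
    exact hi ▸ Submodule.subset_span ⟨i, rfl⟩
  have hr : ∀ n, altProd (gen q 1) (gen q 0) n ∈ S := fun n => by
    obtain ⟨i, hi⟩ := exists_altWord_eq_right (gen q 0) (gen q 1) n
    exact hi ▸ Submodule.subset_span ⟨i, rfl⟩
  have hgen : ∀ i, ∀ s ∈ S, gen q i * s ∈ S := by
    intro i s hs
    induction hs using Submodule.span_induction with
    | zero => simp
    | add x y _ _ hx hy => rw [mul_add]; exact S.add_mem hx hy
    | smul c x _ hx => rw [mul_smul_comm]; exact S.smul_mem c hx
    | mem x hx =>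
      have h0l : ∀ n, gen q 0 * altProd (gen q 0) (gen q 1) n ∈ S := by
        rintro (_ | n)
        · exact hl 1
        · change gen q 0 * (gen q 0 * altProd (gen q 1) (gen q 0) n) ∈ S
          rw [← mul_assoc, gen_zero_mul_gen_zero, add_mul, smul_mul_assoc, smul_mul_assoc, one_mul]
          exact S.add_mem (S.smul_mem _ (hl (n + 1))) (S.smul_mem _ (hr n))
      have h1r : ∀ n, gen q 1 * altProd (gen q 1) (gen q 0) n ∈ S := by
        rintro (_ | n)
        · exact hr 1
        · change gen q 1 * (gen q 1 * altProd (gen q 0) (gen q 1) n) ∈ S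
          rw [← mul_assoc, gen_one_mul_gen_one, one_mul]
          exact hl n
      obtain ⟨j, rfl⟩ := hx
      fin_cases i <;> rcases j with n | n
      · exact h0l n
      · exact hl (n + 2)
      · exact hr (n + 1)
      · exact h1r (n + 1)
  have hmul : ∀ x : FreeAlgebra ℂ (Fin 2), ∀ s ∈ S, RingQuot.mkAlgHom ℂ (IwahoriRel q) x * s ∈ S := by
    intro x
    induction x using FreeAlgebra.induction with
    | grade0 r =>
      intro s hs
      rw [AlgHom.commutes, ← Algebra.smul_def]
      exact S.smul_mem r hs
    | grade1 i => exact hgen i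
    | mul a b ha hb =>
      intro s hs
      rw [map_mul, mul_assoc]
      exact ha _ (hb s hs)
    | add a b ha hb =>
      intro s hs
      rw [map_add, add_mul]
      exact S.add_mem (ha s hs) (hb s hs)
  rw [eq_top_iff]
  intro y _
  obtain ⟨x, rfl⟩ := RingQuot.mkAlgHom_surjective ℂ (IwahoriRel q) y
  simpa using hmul x 1 (hl 0)

variable {A : Type*} [Ring A] [Algebra ℂ A]

/-- The algebra homomorphism out of the presented algebra given by two elements that satisfy the
relations. -/
def liftPresented (T₀ T₁ : A) (h₀ : T₀ * T₀ = ((q : ℂ) - 1) • T₀ + (q : ℂ) • (1 : A))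
    (h₁ : T₁ * T₁ = 1) : PresentedAlgebra q →ₐ[ℂ] A :=
  RingQuot.liftAlgHom ℂ ⟨FreeAlgebra.lift ℂ ![T₀, T₁], fun {x y} h => by
    cases h with
    | quadratic =>
      rw [map_mul, map_sub, map_add, map_one, map_zero, AlgHom.commutes, FreeAlgebra.lift_ι_apply]
      change (T₀ - algebraMap ℂ _ (q : ℂ)) * (T₀ + 1) = 0
      exact (quadratic_relation_iff _ _).2 h₀
    | involution =>
      rw [map_pow, map_one, FreeAlgebra.lift_ι_apply, pow_two]
      exact h₁⟩

theorem liftPresented_gen_zero (T₀ T₁ : A)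
    (h₀ : T₀ * T₀ = ((q : ℂ) - 1) • T₀ + (q : ℂ) • (1 : A)) (h₁ : T₁ * T₁ = 1) :
    liftPresented T₀ T₁ h₀ h₁ (gen q 0) = T₀ := by
  rw [liftPresented, gen, RingQuot.liftAlgHom_mkAlgHom_apply, FreeAlgebra.lift_ι_apply]
  rfl

theorem liftPresented_gen_one (T₀ T₁ : A)
    (h₀ : T₀ * T₀ = ((q : ℂ) - 1) • T₀ + (q : ℂ) • (1 : A)) (h₁ : T₁ * T₁ = 1) :
    liftPresented T₀ T₁ h₀ h₁ (gen q 1) = T₁ := by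
  rw [liftPresented, gen, RingQuot.liftAlgHom_mkAlgHom_apply, FreeAlgebra.lift_ι_apply]
  rfl

theorem isUnit_altProd {M : Type*} [Monoid M] {a b : M} (ha : IsUnit a) (hb : IsUnit b) (n : ℕ) :
    IsUnit (altProd a b n) := by
  induction n generalizing a b with
  | zero => exact isUnit_one
  | succ n ih => exact ha.mul (ih hb ha)

/-- The constant term of the quadratic relation is the non-zero number q, so the inverse is a
polynomial in T₀. -/
theorem isUnit_of_quadratic {T₀ : A} (hq : q ≠ 0)
    (h₀ : T₀ * T₀ = ((q : ℂ) - 1) • T₀ + (q : ℂ) • (1 : A)) : IsUnit T₀ := by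
  have hq' : (q : ℂ) ≠ 0 := Nat.cast_ne_zero.2 hq
  refine ⟨⟨T₀, (q : ℂ)⁻¹ • (T₀ - ((q : ℂ) - 1) • (1 : A)), ?_, ?_⟩, rfl⟩
  · rw [mul_smul_comm, mul_sub, mul_smul_comm, mul_one, h₀, add_sub_cancel_left, smul_smul,
      inv_mul_cancel₀ hq', one_smul]
  · rw [smul_mul_assoc, sub_mul, smul_mul_assoc, one_mul, h₀, add_sub_cancel_left, smul_smul,
      inv_mul_cancel₀ hq', one_smul]

end presented

/-! ### Hecke algebras whose double cosets are indexed by alternating words -/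

section structureTheorem

variable {G : Type*} [Group G] {Γ : Subgroup G} {ε : Γ →* ℂ}

/-- The combinatorics of the double cosets of the alternating words in `s₀`, `s₁`. -/
structure IwahoriSystem (Γ : Subgroup G) (s₀ s₁ : G) : Prop where
  mul_left : ∀ n (γ : Γ), InDC Γ (s₀ * altProd s₁ s₀ n) (s₀ * γ * altProd s₁ s₀ n)
  mul_right : ∀ n (γ : Γ), InDC Γ (s₁ * altProd s₀ s₁ n) (s₁ * γ * altProd s₀ s₁ n)
  cover : ∀ g, ∃ i, InDC Γ (altWord s₀ s₁ i) g
  disjoint : ∀ i j, InDC Γ (altWord s₀ s₁ i) (altWord s₀ s₁ j) → i = j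

/-- The empty word is listed only on the left, so exchanging the letters matches `Sum.inl (n + 1)`
with `Sum.inr n` and fixes `Sum.inl 0`. -/
theorem IwahoriSystem.symm {s₀ s₁ : G} (h : IwahoriSystem Γ s₀ s₁) : IwahoriSystem Γ s₁ s₀ where
  mul_left := h.mul_right
  mul_right := h.mul_left
  cover g := by
    obtain ⟨i, hi⟩ := h.cover g
    rcases i with n | n
    · obtain ⟨j, hj⟩ := exists_altWord_eq_right s₁ s₀ n
      exact ⟨j, hj ▸ hi⟩
    · exact ⟨Sum.inl (n + 1), hi⟩
  disjoint := by
    rintro (m | m) (n | n) hmn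
    · rcases m with _ | m <;> rcases n with _ | n
      · rfl
      · exact absurd (h.disjoint (Sum.inl 0) (Sum.inr n) hmn) (by simp)
      · exact absurd (h.disjoint (Sum.inr m) (Sum.inl 0) hmn) (by simp)
      · have := h.disjoint (Sum.inr m) (Sum.inr n) hmn
        simp_all
    · rcases m with _ | m
      · exact absurd (h.disjoint (Sum.inl 0) (Sum.inl (n + 1)) hmn) (by simp)
      · exact absurd (h.disjoint (Sum.inr m) (Sum.inl (n + 1)) hmn) (by simp)
    · rcases n with _ | n
      · exact absurd (h.disjoint (Sum.inl (m + 1)) (Sum.inl 0) hmn) (by simp)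
      · exact absurd (h.disjoint (Sum.inl (m + 1)) (Sum.inr n) hmn) (by simp)
    · have := h.disjoint (Sum.inl (m + 1)) (Sum.inl (n + 1)) hmn
      simp_all

namespace InDC

protected theorem refl (x : G) : InDC Γ x x := ⟨1, 1, by simp⟩

theorem symm {x y : G} (h : InDC Γ x y) : InDC Γ y x := by
  obtain ⟨γ₁, γ₂, rfl⟩ := h
  exact ⟨γ₁⁻¹, γ₂⁻¹, by simp [mul_assoc]⟩

theorem trans {x y z : G} (h : InDC Γ x y) (h' : InDC Γ y z) : InDC Γ x z := by
  obtain ⟨γ₁, γ₂, rfl⟩ := h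
  obtain ⟨γ₃, γ₄, rfl⟩ := h'
  exact ⟨γ₃ * γ₁, γ₂ * γ₄, by simp [mul_assoc]⟩

theorem mul_left {x y : G} (h : InDC Γ x y) (γ : Γ) : InDC Γ x (γ * y) :=
  h.trans ⟨γ, 1, by simp⟩

theorem mul_right {x y : G} (h : InDC Γ x y) (γ : Γ) : InDC Γ x (y * γ) :=
  h.trans ⟨1, γ, by simp⟩

end InDC

namespace HeckeAlg

theorem apply_ne_zero_of_inDC (φ : HeckeAlg Γ ε) {x y : G} (h : InDC Γ x y) (hy : φ.1 y ≠ 0) :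
    φ.1 x ≠ 0 := by
  obtain ⟨γ₁, γ₂, rfl⟩ := h
  rw [φ.2.1] at hy
  exact right_ne_zero_of_mul hy

/-- A product is supported on ΓaΓbΓ; the last hypothesis says that this is one double coset. -/
theorem mul_support {φ₁ φ₂ : HeckeAlg Γ ε} {a b c : G} (h₁ : ∀ g, φ₁.1 g ≠ 0 → InDC Γ a g)
    (h₂ : ∀ g, φ₂.1 g ≠ 0 → InDC Γ b g) (h : ∀ γ : Γ, InDC Γ c (a * γ * b)) :
    ∀ g, (φ₁ * φ₂).1 g ≠ 0 → InDC Γ c g := by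
  intro g hg
  obtain ⟨x, hx₁, hx₂⟩ := exists_of_cosetConv_ne_zero hg
  obtain ⟨γ₁, γ₂, e₁⟩ := h₁ _ hx₁
  obtain ⟨γ₃, γ₄, e₂⟩ := h₂ _ hx₂
  have : g = γ₁ * (a * (γ₂ * γ₃ : Γ) * b) * γ₄ := by
    rw [inv_mul_eq_iff_eq_mul] at e₂
    rw [e₂, e₁]
    simp [mul_assoc]
  rw [this]
  exact ((h _).mul_left γ₁).mul_right γ₄

theorem one_ne_zero' : (1 : HeckeAlg Γ ε) ≠ 0 := by
  intro h
  have : (1 : HeckeAlg Γ ε).1 1 = (0 : HeckeAlg Γ ε).1 1 := by rw [h]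
  rw [one_apply_mem Γ.one_mem] at this
  change ε 1 = 0 at this
  simp at this

instance : Nontrivial (HeckeAlg Γ ε) := ⟨1, 0, one_ne_zero'⟩

/-- Induction on the length, exchanging the two letters at every step. The first axiom of the system
is the additivity of lengths that keeps the product inside a single double coset. -/
theorem altProd_support {s₀ s₁ : G} (hs : IwahoriSystem Γ s₀ s₁) {T₀ T₁ : HeckeAlg Γ ε}
    (h₀ : ∀ g, T₀.1 g ≠ 0 → InDC Γ s₀ g) (h₁ : ∀ g, T₁.1 g ≠ 0 → InDC Γ s₁ g) (n : ℕ) :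
    ∀ g, (altProd T₀ T₁ n).1 g ≠ 0 → InDC Γ (altProd s₀ s₁ n) g := by
  induction n generalizing s₀ s₁ T₀ T₁ with
  | zero =>
    intro g hg
    by_cases h : g ∈ Γ
    · exact ⟨⟨g, h⟩, 1, by simp [altProd]⟩
    · exact absurd (one_apply_notMem h) hg
  | succ n ih => exact mul_support h₀ (ih hs.symm h₁ h₀) (hs.mul_left n)

variable {q : ℕ} {s₀ s₁ : G}

/-- The products τ are units, hence non-zero, and each lives on its own double coset; so evaluating
at the words w gives a diagonal matrix with non-zero entries. This yields linear independence.
Surjectivity holds because a function in the Hecke algebra is determined by its values at the words.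
-/
theorem liftPresented_bijective (hq : q ≠ 0) (hs : IwahoriSystem Γ s₀ s₁) {T₀ T₁ : HeckeAlg Γ ε}
    (h₀ : ∀ g, T₀.1 g ≠ 0 → InDC Γ s₀ g) (h₁ : ∀ g, T₁.1 g ≠ 0 → InDC Γ s₁ g)
    (hT₀ : T₀ * T₀ = ((q : ℂ) - 1) • T₀ + (q : ℂ) • (1 : HeckeAlg Γ ε)) (hT₁ : T₁ * T₁ = 1) :
    Function.Bijective (liftPresented (q := q) T₀ T₁ hT₀ hT₁) := by
  have hu₀ : IsUnit T₀ := isUnit_of_quadratic hq hT₀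
  have hu₁ : IsUnit T₁ := ⟨⟨T₁, T₁, hT₁, hT₁⟩, rfl⟩
  set τ : ℕ ⊕ ℕ → HeckeAlg Γ ε := altWord T₀ T₁ with hτ
  set w : ℕ ⊕ ℕ → G := altWord s₀ s₁ with hw
  have hsupp : ∀ i g, (τ i).1 g ≠ 0 → InDC Γ (w i) g := by
    rintro (n | n)
    · exact altProd_support hs h₀ h₁ n
    · exact altProd_support hs.symm h₁ h₀ (n + 1)
  have hne : ∀ i, (τ i).1 (w i) ≠ 0 := by
    intro i
    have hi : τ i ≠ 0 := by
      rcases i with n | n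
      · exact (isUnit_altProd hu₀ hu₁ n).ne_zero
      · exact (isUnit_altProd hu₁ hu₀ (n + 1)).ne_zero
    obtain ⟨g, hg⟩ : ∃ g, (τ i).1 g ≠ 0 := by
      by_contra! H
      exact hi (Subtype.ext (funext H))
    exact apply_ne_zero_of_inDC _ (hsupp i g hg) hg
  have hoff : ∀ i j, i ≠ j → (τ i).1 (w j) = 0 := by
    intro i j hij
    by_contra h
    exact hij (hs.disjoint i j (hsupp i _ h))
  have heval : ∀ (c : (ℕ ⊕ ℕ) →₀ ℂ) j,
      (Finsupp.linearCombination ℂ τ c).1 (w j) = c j * (τ j).1 (w j) := by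
    intro c j
    have : (Finsupp.linearCombination ℂ τ c).1 (w j) = c.sum fun i a => a * (τ i).1 (w j) := by
      rw [Finsupp.linearCombination_apply, Finsupp.sum, Finsupp.sum, AddSubmonoidClass.coe_finsetSum,
        Finset.sum_apply]
      rfl
    rw [this, Finsupp.sum, Finset.sum_eq_single j]
    · intro i _ hij
      rw [hoff i j hij, mul_zero]
    · intro hj
      rw [Finsupp.notMem_support_iff.1 hj, zero_mul]
  have hcomp : ∀ c : (ℕ ⊕ ℕ) →₀ ℂ, liftPresented (q := q) T₀ T₁ hT₀ hT₁
      (Finsupp.linearCombination ℂ (altWord (gen q 0) (gen q 1)) c) =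
      Finsupp.linearCombination ℂ τ c := by
    intro c
    rw [← AlgHom.toLinearMap_apply, Finsupp.apply_linearCombination]
    congr 2
    funext i
    simp only [Function.comp, AlgHom.toLinearMap_apply]
    rw [map_altWord, liftPresented_gen_zero, liftPresented_gen_one]
  constructor
  · rw [injective_iff_map_eq_zero]
    intro x hx
    obtain ⟨c, rfl⟩ : ∃ c, Finsupp.linearCombination ℂ (altWord (gen q 0) (gen q 1)) c = x := by
      have : x ∈ Submodule.span ℂ (Set.range (altWord (gen q 0) (gen q 1))) := by
        rw [span_altWord]; trivial
      rwa [Finsupp.mem_span_range_iff_exists_finsupp] at this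
    rw [hcomp] at hx
    have hc : c = 0 := by
      ext j
      have := heval c j
      rw [hx] at this
      change 0 = _ at this
      simpa [hne j] using this.symm
    rw [hc, map_zero]
  · intro φ
    -- Different words lie in different double cosets, a fortiori in different left cosets, so a
    -- function supported on finitely many left cosets sees only finitely many words.
    have hfin : (Function.support fun i => φ.1 (w i) / (τ i).1 (w i)).Finite := by
      refine Set.Finite.of_finite_image (f := fun i => (w i : G ⧸ Γ)) (φ.2.2.subset ?_) ?_
      · rintro _ ⟨i, hi, rfl⟩
        exact ⟨w i, fun h => hi (by simp [h]), rfl⟩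
      · intro i _ j _ hij
        refine hs.disjoint i j ⟨1, ⟨(w i)⁻¹ * w j, QuotientGroup.eq.1 hij⟩, by simp [hw]⟩
    refine ⟨Finsupp.linearCombination ℂ (altWord (gen q 0) (gen q 1))
      (Finsupp.ofSupportFinite _ hfin), ?_⟩
    rw [hcomp]
    ext g
    obtain ⟨j, γ₁, γ₂, rfl⟩ := hs.cover g
    rw [(Finsupp.linearCombination ℂ τ _).2.1, φ.2.1]
    change _ * (Finsupp.linearCombination ℂ τ _).1 (w j) = _ * φ.1 (w j)
    rw [heval, Finsupp.ofSupportFinite_coe, div_mul_cancel₀ _ (hne j)]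

/-- Two elements supported on `Γ ∪ Γ s Γ` agree if they do at `1` and `s`. -/
theorem ext_of_support {φ₁ φ₂ : HeckeAlg Γ ε} {s : G}
    (h₁ : ∀ g, φ₁.1 g ≠ 0 → g ∈ Γ ∨ InDC Γ s g) (h₂ : ∀ g, φ₂.1 g ≠ 0 → g ∈ Γ ∨ InDC Γ s g)
    (h_one : φ₁.1 1 = φ₂.1 1) (h_s : φ₁.1 s = φ₂.1 s) : φ₁ = φ₂ := by
  ext g
  by_cases hg : g ∈ Γ ∨ InDC Γ s g
  · rcases hg with hg | ⟨γ₁, γ₂, rfl⟩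
    · have e := apply_mul_left φ₁ ⟨g, hg⟩ 1
      have e' := apply_mul_left φ₂ ⟨g, hg⟩ 1
      rw [mul_one] at e e'
      rw [e, e', h_one]
    · rw [φ₁.2.1, φ₂.2.1, h_s]
  · rw [not_not.1 (mt (h₁ g) hg), not_not.1 (mt (h₂ g) hg)]

/-- The product of an element supported on `Γ s Γ = ⋃ u(x) s Γ`, with `ε(u(x)) = 1`, and another
element. -/
theorem mul_apply_eq_sum {X : Type*} [Fintype X] {φ₁ : HeckeAlg Γ ε} (φ₂ : HeckeAlg Γ ε) {s : G}
    (h₁ : ∀ g, φ₁.1 g ≠ 0 → InDC Γ s g) (u : X → Γ) (hu : ∀ x, ε (u x) = 1)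
    (hinj : Function.Injective fun x => ((u x * s : G) : G ⧸ Γ))
    (hcov : ∀ γ : Γ, ∃ x, ((γ * s : G) : G ⧸ Γ) = (u x * s : G)) (g : G) :
    (φ₁ * φ₂).1 g = φ₁.1 s * ∑ x, φ₂.1 (s⁻¹ * (u x : G)⁻¹ * g) := by
  rw [mul_apply, cosetSum_eq_sum (fun h γ => conv_integrand_invariant _ _ _ h γ)
    (fun x => (u x * s : G)) hinj, Finset.mul_sum]
  · refine Finset.sum_congr rfl fun x _ => ?_
    rw [apply_mul_left, hu, one_mul, _root_.mul_inv_rev]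
  · intro h hh
    obtain ⟨γ₁, γ₂, rfl⟩ := h₁ _ (left_ne_zero_of_mul hh)
    obtain ⟨x, hx⟩ := hcov γ₁
    exact ⟨x, by rw [← hx, QuotientGroup.eq]; simp [mul_assoc]⟩

end HeckeAlg

end structureTheorem

/-! ### Integrals and compactness in terms of cosets -/

section cosetIntegral

variable {G : Type*} [Group G] {Γ : Subgroup G}

/-- Such a function is a finite linear combination of indicators of left cosets, all of which have
volume 1. -/
theorem integral_eq_cosetSum [MeasurableSpace G] {μ : Measure G}
    (hmeas : ∀ h : G, MeasurableSet {x | h⁻¹ * x ∈ Γ}) (hvol : ∀ h : G, μ {x | h⁻¹ * x ∈ Γ} = 1)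
    {f : G → ℂ} (hf : ∀ g (γ : Γ), f (g * γ) = f g)
    (hfin : (QuotientGroup.mk '' Function.support f : Set (G ⧸ Γ)).Finite) :
    ∫ g, f g ∂μ = cosetSum Γ f := by
  classical
  have hsum : f = fun g => ∑ x ∈ hfin.toFinset,
      Set.indicator {y | (x.out : G)⁻¹ * y ∈ Γ} (fun _ => f x.out) g := by
    funext g
    by_cases hg : f g = 0
    · rw [Finset.sum_eq_zero, hg]
      intro x _
      by_cases h : (x.out : G)⁻¹ * g ∈ Γ
      · rw [Set.indicator_of_mem (by exact h), ← hg]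
        exact apply_eq_of_mk_eq hf (QuotientGroup.eq.2 h)
      · exact Set.indicator_of_notMem (by exact h) _
    · rw [Finset.sum_eq_single ((g : G) : G ⧸ Γ)]
      · rw [Set.indicator_of_mem, apply_mk_out hf]
        exact QuotientGroup.eq.1 (QuotientGroup.out_eq' _)
      · intro x _ hx
        refine Set.indicator_of_notMem (fun h => hx ?_) _
        rw [← QuotientGroup.eq.2 h, QuotientGroup.out_eq']
      · intro h
        exact absurd (hfin.mem_toFinset.2 ⟨g, hg, rfl⟩) h
  have hint : ∫ g, f g ∂μ = ∑ x ∈ hfin.toFinset, f x.out := by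
    conv_lhs => rw [hsum]
    rw [integral_finsetSum]
    · refine Finset.sum_congr rfl fun x _ => ?_
      rw [integral_indicator (hmeas _), setIntegral_const, measureReal_def, hvol]
      simp
    · intro x _
      exact (integrable_indicator_iff (hmeas _)).2 (integrableOn_const (by simp [hvol]))
  rw [hint, cosetSum, finsum_eq_sum_of_support_subset]
  intro x hx
  exact hfin.mem_toFinset.2 ⟨x.out, hx, QuotientGroup.out_eq' x⟩

theorem conv_eq_cosetConv [MeasurableSpace G] {μ : Measure G}
    (hmeas : ∀ h : G, MeasurableSet {x | h⁻¹ * x ∈ Γ}) (hvol : ∀ h : G, μ {x | h⁻¹ * x ∈ Γ} = 1)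
    {ε : Γ →* ℂ} (φ₁ φ₂ : HeckeAlg Γ ε) : conv μ φ₁.1 φ₂.1 = (φ₁ * φ₂).1 := by
  funext g
  refine integral_eq_cosetSum hmeas hvol
    (fun h γ => HeckeAlg.conv_integrand_invariant φ₁ φ₂ g h γ) ?_
  exact φ₁.2.2.subset (Set.image_mono fun x hx => left_ne_zero_of_mul hx)

/-- The quotient by an open subgroup is discrete, so compact sets have finite image; conversely,
finitely many translates of the compact subgroup have compact union. -/
theorem isCompact_closure_iff_finite_cosets [TopologicalSpace G] [IsTopologicalGroup G]
    (ho : IsOpen (Γ : Set G)) (hc : IsCompact (Γ : Set G)) (A : Set G) :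
    IsCompact (closure A) ↔ (QuotientGroup.mk '' A : Set (G ⧸ Γ)).Finite := by
  have : DiscreteTopology (G ⧸ Γ) := QuotientGroup.discreteTopology ho
  constructor
  · intro h
    have h' := h.image (QuotientGroup.continuous_mk (N := Γ))
    exact (isCompact_iff_finite.1 h').subset (Set.image_mono subset_closure)
  · intro h
    have hK : IsCompact (⋃ x ∈ (QuotientGroup.mk '' A : Set (G ⧸ Γ)),
        (fun y => x.out * y) '' (Γ : Set G)) :=
      h.isCompact_biUnion fun x _ => hc.image (continuous_const_mul _)
    refine hK.closure_of_subset fun a ha => ?_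
    simp only [Set.mem_iUnion]
    refine ⟨a, ⟨a, ha, rfl⟩, (a : G ⧸ Γ).out⁻¹ * a, ?_, by simp⟩
    exact QuotientGroup.eq.1 (QuotientGroup.out_eq' _)

end cosetIntegral

/-! ### The local field -/

section localField

variable {F : Type*} [NontriviallyNormedField F] [IsUltrametricDist F]

/-- `ϖ` is a uniformizer, with `|ϖ| = q⁻¹`, of a field whose residue field has odd order `q`. -/
structure OddUniformizer (q : ℕ) (ϖ : F) : Prop where
  odd : Odd q
  card : q = Nat.card 𝓀[F]
  irreducible : ∃ ϖ₀ : 𝒪[F], (ϖ₀ : F) = ϖ ∧ Irreducible ϖ₀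
  norm : ‖ϖ‖ = (q : ℝ)⁻¹

open scoped Classical in
/-- The residue class of an integral element, and `0` for the other elements. -/
def residueClass (x : F) : 𝓀[F] :=
  if h : ‖x‖ ≤ 1 then IsLocalRing.residue 𝒪[F] ⟨x, Valued.integer.mem_iff.2 h⟩ else 0

theorem residueClass_of_le {x : F} (h : ‖x‖ ≤ 1) :
    residueClass x = IsLocalRing.residue 𝒪[F] ⟨x, Valued.integer.mem_iff.2 h⟩ := dif_pos h

theorem norm_add_le_of_le {x y : F} {r : ℝ} (hx : ‖x‖ ≤ r) (hy : ‖y‖ ≤ r) : ‖x + y‖ ≤ r :=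
  (IsUltrametricDist.norm_add_le_max x y).trans (max_le hx hy)

theorem norm_sub_le_of_le {x y : F} {r : ℝ} (hx : ‖x‖ ≤ r) (hy : ‖y‖ ≤ r) : ‖x - y‖ ≤ r := by
  rw [sub_eq_add_neg]
  exact norm_add_le_of_le hx (by rwa [norm_neg])

theorem norm_add_eq_of_lt {x y : F} (h : ‖y‖ < ‖x‖) : ‖x + y‖ = ‖x‖ := by
  rw [IsUltrametricDist.norm_add_eq_max_of_norm_ne_norm h.ne', max_eq_left h.le]

theorem residueClass_add {x y : F} (hx : ‖x‖ ≤ 1) (hy : ‖y‖ ≤ 1) :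
    residueClass (x + y) = residueClass x + residueClass y := by
  rw [residueClass_of_le hx, residueClass_of_le hy, residueClass_of_le (norm_add_le_of_le hx hy),
    ← map_add]
  rfl

theorem residueClass_neg {x : F} (hx : ‖x‖ ≤ 1) : residueClass (-x) = -residueClass x := by
  rw [residueClass_of_le hx, residueClass_of_le (x := -x) (by rwa [norm_neg]), ← map_neg]
  rfl

theorem residueClass_mul {x y : F} (hx : ‖x‖ ≤ 1) (hy : ‖y‖ ≤ 1) :
    residueClass (x * y) = residueClass x * residueClass y := by
  have : ‖x * y‖ ≤ 1 := by
    rw [norm_mul]; exact mul_le_one₀ hx (norm_nonneg _) hy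
  rw [residueClass_of_le hx, residueClass_of_le hy, residueClass_of_le this, ← map_mul]
  rfl

theorem residueClass_one : residueClass (1 : F) = 1 := by
  rw [residueClass_of_le (by simp), ← map_one (IsLocalRing.residue 𝒪[F])]
  rfl

theorem residueClass_eq_zero_iff {x : F} (hx : ‖x‖ ≤ 1) : residueClass x = 0 ↔ ‖x‖ < 1 := by
  rw [residueClass_of_le hx, IsLocalRing.residue_eq_zero_iff, IsLocalRing.mem_maximalIdeal,
    mem_nonunits_iff, Valued.integer.isUnit_iff_norm_eq_one]
  change ¬ ‖x‖ = 1 ↔ _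
  exact ⟨fun h => lt_of_le_of_ne hx h, fun h => h.ne⟩

theorem residueClass_surjective (k : 𝓀[F]) : ∃ x : F, ‖x‖ ≤ 1 ∧ residueClass x = k := by
  obtain ⟨x, rfl⟩ := IsLocalRing.residue_surjective k
  exact ⟨x, Valued.integer.norm_le_one x, residueClass_of_le (Valued.integer.norm_le_one x)⟩

theorem residueClass_eq_iff {x y : F} (hx : ‖x‖ ≤ 1) (hy : ‖y‖ ≤ 1) :
    residueClass x = residueClass y ↔ ‖x - y‖ < 1 := by
  rw [← residueClass_eq_zero_iff (norm_sub_le_of_le hx hy), sub_eq_add_neg,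
    residueClass_add hx (by rwa [norm_neg]), residueClass_neg hy, ← sub_eq_add_neg, sub_eq_zero]

namespace OddUniformizer

variable {q : ℕ} {ϖ : F}

theorem finite_residueField (hϖ : OddUniformizer q ϖ) : Finite 𝓀[F] :=
  Nat.finite_of_card_ne_zero (by rw [← hϖ.card]; exact hϖ.odd.pos.ne')

theorem one_lt (hϖ : OddUniformizer q ϖ) : 1 < q := by
  have := hϖ.finite_residueField
  rw [hϖ.card]
  exact Finite.one_lt_card

theorem one_lt_cast (hϖ : OddUniformizer q ϖ) : (1 : ℝ) < q := Nat.one_lt_cast.2 hϖ.one_lt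

theorem norm_pos (hϖ : OddUniformizer q ϖ) : 0 < ‖ϖ‖ := by
  rw [hϖ.norm]
  exact inv_pos.2 (zero_lt_one.trans hϖ.one_lt_cast)

theorem norm_lt_one (hϖ : OddUniformizer q ϖ) : ‖ϖ‖ < 1 := by
  rw [hϖ.norm]
  exact inv_lt_one_of_one_lt₀ hϖ.one_lt_cast

theorem ne_zero (hϖ : OddUniformizer q ϖ) : ϖ ≠ 0 := norm_pos_iff.1 hϖ.norm_pos

/-- An element x with |ϖ| < |x| < 1 would give the factorization ϖ = x · (ϖ/x) into two non-units.
-/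
theorem norm_le_of_lt_one (hϖ : OddUniformizer q ϖ) {x : F} (hx : ‖x‖ < 1) : ‖x‖ ≤ ‖ϖ‖ := by
  by_contra! h
  obtain ⟨ϖ₀, h₀, hirr⟩ := hϖ.irreducible
  have hx0 : x ≠ 0 := by
    rintro rfl
    rw [norm_zero] at h
    exact absurd h (not_lt.2 (norm_nonneg _))
  have hdiv : ‖ϖ / x‖ < 1 := by
    rw [norm_div, div_lt_one (norm_pos_iff.2 hx0)]
    exact h
  have hprod : ϖ₀ = ⟨x, Valued.integer.mem_iff.2 hx.le⟩ *
      ⟨ϖ / x, Valued.integer.mem_iff.2 hdiv.le⟩ := by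
    apply Subtype.ext
    change (ϖ₀ : F) = x * (ϖ / x)
    rw [h₀, mul_div_cancel₀ _ hx0]
  rcases hirr.isUnit_or_isUnit hprod with h1 | h1 <;>
    rw [Valued.integer.isUnit_iff_norm_eq_one] at h1
  · exact hx.ne h1
  · exact hdiv.ne h1

theorem norm_zpow (hϖ : OddUniformizer q ϖ) (n : ℤ) : ‖ϖ ^ n‖ = (q : ℝ) ^ (-n) := by
  rw [_root_.norm_zpow, hϖ.norm, _root_.inv_zpow, _root_.zpow_neg]

/-- Choose n with qⁿ < |x| ≤ qⁿ⁺¹. Then xϖⁿ⁺¹ has norm in the interval from |ϖ| (excluded) to 1, and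
by the gap below 1 it is a unit. -/
theorem exists_norm_eq (hϖ : OddUniformizer q ϖ) {x : F} (hx : x ≠ 0) :
    ∃ n : ℤ, ‖x‖ = ‖ϖ‖ ^ n := by
  obtain ⟨n, hn₁, hn₂⟩ := exists_mem_Ioc_zpow (norm_pos_iff.2 hx) hϖ.one_lt_cast
  have hpos : (0 : ℝ) < q := zero_lt_one.trans hϖ.one_lt_cast
  have h1 : ‖x * ϖ ^ (n + 1)‖ ≤ 1 := by
    rw [norm_mul, hϖ.norm_zpow, _root_.zpow_neg]
    exact mul_inv_le_one_of_le₀ hn₂ (zpow_pos hpos _).le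
  have h2 : ‖ϖ‖ < ‖x * ϖ ^ (n + 1)‖ := by
    rw [norm_mul, hϖ.norm_zpow, hϖ.norm, neg_add, zpow_add₀ hpos.ne', _root_.zpow_neg, _root_.zpow_neg_one,
      ← mul_assoc]
    refine lt_mul_of_one_lt_left (inv_pos.2 hpos) ?_
    rwa [← div_eq_mul_inv, one_lt_div (zpow_pos hpos _)]
  have h3 : ‖x * ϖ ^ (n + 1)‖ = 1 := by
    by_contra h
    exact absurd (hϖ.norm_le_of_lt_one (lt_of_le_of_ne h1 h)) (not_le.2 h2)
  refine ⟨-(n + 1), ?_⟩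
  rw [norm_mul, _root_.norm_zpow] at h3
  rw [_root_.zpow_neg]
  exact eq_inv_of_mul_eq_one_left h3

/-- Otherwise 2 = 0 in the residue field, which would then have even order. -/
theorem norm_two (hϖ : OddUniformizer q ϖ) : ‖(2 : F)‖ = 1 := by
  have h1 : ‖(2 : F)‖ ≤ 1 := by exact_mod_cast IsUltrametricDist.norm_natCast_le_one F 2
  by_contra h
  have h2 : ‖(2 : F)‖ < 1 := lt_of_le_of_ne h1 h
  have hfin := hϖ.finite_residueField
  have h3 := (residueClass_eq_zero_iff h1).2 h2
  have h4 : (2 : 𝓀[F]) = 0 := by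
    rw [← one_add_one_eq_two, residueClass_add (by simp) (by simp), residueClass_one] at h3
    rwa [← one_add_one_eq_two]
  have hchar : CharP 𝓀[F] 2 := by
    refine CharTwo.of_one_ne_zero_of_two_eq_zero one_ne_zero h4
  have := Fintype.ofFinite 𝓀[F]
  have hev := FiniteField.even_card_of_char_two (F := 𝓀[F]) (ringChar.eq 𝓀[F] 2 ▸ rfl)
  have hc := hϖ.card
  rw [Nat.card_eq_fintype_card] at hc
  have := hϖ.odd
  rw [hc, Nat.odd_iff] at this
  omega

theorem two_ne_zero (hϖ : OddUniformizer q ϖ) : (2 : F) ≠ 0 := by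
  rw [← norm_ne_zero_iff, hϖ.norm_two]
  exact one_ne_zero

end OddUniformizer

/-- The valuation of a non-zero element of a field whose value group is generated by `q`. -/
def ord (q : ℕ) (x : F) : ℤ := -Int.log q ‖x‖

namespace OddUniformizer

variable {q : ℕ} {ϖ : F}

theorem ord_eq_of_norm (hϖ : OddUniformizer q ϖ) {x : F} {n : ℤ} (hx : ‖x‖ = ‖ϖ‖ ^ n) :
    ord q x = n := by
  rw [ord, hx, hϖ.norm, _root_.inv_zpow, ← _root_.zpow_neg, Int.log_zpow hϖ.one_lt, neg_neg]

theorem norm_eq_zpow_ord (hϖ : OddUniformizer q ϖ) {x : F} (hx : x ≠ 0) :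
    ‖x‖ = ‖ϖ‖ ^ ord q x := by
  obtain ⟨n, hn⟩ := hϖ.exists_norm_eq hx
  rw [hn, hϖ.ord_eq_of_norm hn]

theorem ord_eq_iff (hϖ : OddUniformizer q ϖ) {x y : F} (hx : x ≠ 0) (hy : y ≠ 0) :
    ord q x = ord q y ↔ ‖x‖ = ‖y‖ := by
  rw [hϖ.norm_eq_zpow_ord hx, hϖ.norm_eq_zpow_ord hy]
  exact (zpow_right_injective₀ hϖ.norm_pos hϖ.norm_lt_one.ne).eq_iff.symm

theorem ord_mul (hϖ : OddUniformizer q ϖ) {x y : F} (hx : x ≠ 0) (hy : y ≠ 0) :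
    ord q (x * y) = ord q x + ord q y := by
  apply hϖ.ord_eq_of_norm
  rw [norm_mul, hϖ.norm_eq_zpow_ord hx, hϖ.norm_eq_zpow_ord hy, zpow_add₀ hϖ.norm_pos.ne']

theorem ord_zpow (hϖ : OddUniformizer q ϖ) (n : ℤ) : ord q (ϖ ^ n) = n :=
  hϖ.ord_eq_of_norm (by rw [_root_.norm_zpow])

theorem ord_of_norm_one (hϖ : OddUniformizer q ϖ) {x : F} (hx : ‖x‖ = 1) : ord q x = 0 :=
  hϖ.ord_eq_of_norm (by rw [hx, zpow_zero])

theorem ord_inv (hϖ : OddUniformizer q ϖ) {x : F} (hx : x ≠ 0) : ord q x⁻¹ = -ord q x := by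
  apply hϖ.ord_eq_of_norm
  rw [norm_inv, hϖ.norm_eq_zpow_ord hx, _root_.zpow_neg]

theorem norm_unitPart (hϖ : OddUniformizer q ϖ) {x : F} (hx : x ≠ 0) :
    ‖x * ϖ ^ (-ord q x)‖ = 1 := by
  rw [norm_mul, _root_.norm_zpow, hϖ.norm_eq_zpow_ord hx, ← zpow_add₀ hϖ.norm_pos.ne',
    add_neg_cancel, zpow_zero]

end OddUniformizer

open scoped Classical in
/-- The quadratic character of the unit part of a non-zero element. -/
def unitChar (q : ℕ) (ϖ x : F) : ℤˣ :=
  if IsSquare (residueClass (x * ϖ ^ (-ord q x))) then 1 else -1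

namespace OddUniformizer

variable {q : ℕ} {ϖ : F}

theorem ringChar_ne_two (hϖ : OddUniformizer q ϖ) : ringChar 𝓀[F] ≠ 2 := by
  intro h
  have := hϖ.finite_residueField
  have := Fintype.ofFinite 𝓀[F]
  have hev := FiniteField.even_card_of_char_two (F := 𝓀[F]) h
  have hc := hϖ.card
  rw [Nat.card_eq_fintype_card] at hc
  have := hϖ.odd
  rw [hc, Nat.odd_iff] at this
  omega

open scoped Classical in
theorem isSquare_mul_ite (hϖ : OddUniformizer q ϖ) {a b : 𝓀[F]} (ha : a ≠ 0) (hb : b ≠ 0) :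
    (if IsSquare (a * b) then 1 else -1 : ℤˣ) =
      (if IsSquare a then 1 else -1) * if IsSquare b then 1 else -1 := by
  have := hϖ.finite_residueField
  have := Fintype.ofFinite 𝓀[F]
  have key : ∀ c : 𝓀[F], c ≠ 0 → ∀ d : Decidable (IsSquare c),
      ((@ite ℤˣ (IsSquare c) d 1 (-1) : ℤˣ) : ℤ) = quadraticChar 𝓀[F] c := by
    intro c hc d
    split_ifs with h
    · rw [(quadraticChar_one_iff_isSquare hc).2 h]; rfl
    · rw [quadraticChar_neg_one_iff_not_isSquare.2 h]; rfl
  apply Units.ext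
  rw [Units.val_mul, key _ ha, key _ hb, key _ (mul_ne_zero ha hb), map_mul]

theorem unitChar_of_norm_one (hϖ : OddUniformizer q ϖ) {x : F} (hx : ‖x‖ = 1)
    [Decidable (IsSquare (residueClass x))] :
    unitChar q ϖ x = if IsSquare (residueClass x) then 1 else -1 := by
  rw [unitChar, hϖ.ord_of_norm_one hx, neg_zero, zpow_zero, mul_one]
  congr

theorem residueClass_ne_zero {x : F} (hx : ‖x‖ = 1) : residueClass x ≠ 0 := by
  rw [Ne, residueClass_eq_zero_iff hx.le, hx]
  exact lt_irrefl _

theorem unitChar_mul (hϖ : OddUniformizer q ϖ) {x y : F} (hx : x ≠ 0) (hy : y ≠ 0) :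
    unitChar q ϖ (x * y) = unitChar q ϖ x * unitChar q ϖ y := by
  have h : x * y * ϖ ^ (-ord q (x * y)) = (x * ϖ ^ (-ord q x)) * (y * ϖ ^ (-ord q y)) := by
    rw [hϖ.ord_mul hx hy, neg_add, zpow_add₀ hϖ.ne_zero]
    ring
  have h1 := hϖ.norm_unitPart hx
  have h2 := hϖ.norm_unitPart hy
  rw [unitChar, h, residueClass_mul h1.le h2.le,
    hϖ.isSquare_mul_ite (residueClass_ne_zero h1) (residueClass_ne_zero h2)]
  rfl

theorem unitChar_zpow (hϖ : OddUniformizer q ϖ) (n : ℤ) : unitChar q ϖ (ϖ ^ n) = 1 := by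
  rw [unitChar, hϖ.ord_zpow, ← zpow_add₀ hϖ.ne_zero, add_neg_cancel, zpow_zero, residueClass_one,
    if_pos IsSquare.one]

theorem unitChar_one (hϖ : OddUniformizer q ϖ) : unitChar q ϖ (1 : F) = 1 := by
  simpa using hϖ.unitChar_zpow 0

theorem unitChar_inv (hϖ : OddUniformizer q ϖ) {x : F} (hx : x ≠ 0) :
    unitChar q ϖ x⁻¹ = unitChar q ϖ x := by
  have h := hϖ.unitChar_mul hx (inv_ne_zero hx)
  rw [mul_inv_cancel₀ hx, hϖ.unitChar_one] at h
  rw [← Int.units_inv_eq_self (unitChar q ϖ x)]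
  exact eq_inv_of_mul_eq_one_right h.symm

theorem unitChar_eq_of_close (hϖ : OddUniformizer q ϖ) {x y : F} (hx : ‖x‖ = 1) (hy : ‖y‖ ≤ 1)
    (h : ‖x - y‖ < 1) : unitChar q ϖ x = unitChar q ϖ y := by
  classical
  have hy' : ‖y‖ = 1 := by
    have : y = x + (y - x) := by ring
    rw [this, norm_add_eq_of_lt (by rwa [norm_sub_rev, hx]), hx]
  rw [hϖ.unitChar_of_norm_one hx, hϖ.unitChar_of_norm_one hy',
    (residueClass_eq_iff hx.le hy).2 h]

end OddUniformizer

variable [ProperSpace F]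

namespace OddUniformizer

variable {q : ℕ} {ϖ : F}

/-- Hensel's lemma by the Newton iteration with frozen derivative: the fixed points of y ↦ y - (y² -
u)/2 are the square roots of u, and since |2| = 1 this map contracts the ball of radius |u - 1|
around 1 by the factor |u - 1|. -/
theorem isSquare_of_norm_sub_one_lt (hϖ : OddUniformizer q ϖ) {u : F} (hu : ‖u - 1‖ < 1) :
    IsSquare u := by
  have h2 := hϖ.two_ne_zero
  set ρ : NNReal := ‖u - 1‖₊ with hρ
  have hρ1 : ρ < 1 := hu
  let f : F → F := fun y => y - (y ^ 2 - u) / 2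
  set s : Set F := Metric.closedBall 1 ρ with hs
  have hmem : ∀ y, y ∈ s ↔ ‖y - 1‖ ≤ ‖u - 1‖ := fun y => by
    rw [hs, mem_closedBall_iff_norm]; rfl
  have hmaps : Set.MapsTo f s s := by
    intro y hy
    rw [hmem] at hy ⊢
    have : f y - 1 = ((u - 1) - (y - 1) * (y - 1)) / 2 := by
      simp only [f]
      field_simp
      ring
    rw [this, norm_div, hϖ.norm_two, div_one]
    refine norm_sub_le_of_le le_rfl ?_
    rw [norm_mul]
    exact (mul_le_of_le_one_right (norm_nonneg _) (hy.trans hu.le)).trans hy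
  have hcontr : ContractingWith ρ (hmaps.restrict f s s) := by
    refine ⟨hρ1, LipschitzWith.of_dist_le_mul fun y z => ?_⟩
    rw [Subtype.dist_eq, Subtype.dist_eq, dist_eq_norm, dist_eq_norm]
    change ‖f y - f z‖ ≤ _
    have : f y - f z = (-((y - 1 : F) + (z - 1))) / 2 * (y - z) := by
      simp only [f]
      field_simp
      ring
    rw [this, norm_mul, norm_div, hϖ.norm_two, div_one, norm_neg]
    exact mul_le_mul_of_nonneg_right
      (norm_add_le_of_le ((hmem _).1 y.2) ((hmem _).1 z.2)) (norm_nonneg _)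
  obtain ⟨y, -, hy, -⟩ := ContractingWith.exists_fixedPoint' Metric.isClosed_closedBall.isComplete
    hmaps hcontr (x := 1) (Metric.mem_closedBall_self ρ.2) (edist_ne_top _ _)
  have hy' : y - (y ^ 2 - u) / 2 = y := hy
  refine ⟨y, ?_⟩
  field_simp at hy'
  linear_combination hy'

theorem isSquare_of_residueClass (hϖ : OddUniformizer q ϖ) {u : F} (hu : ‖u‖ = 1)
    (h : IsSquare (residueClass u)) : IsSquare u := by
  obtain ⟨k, hk⟩ := h
  obtain ⟨t, ht, rfl⟩ := residueClass_surjective k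
  have htu : ‖t‖ = 1 := by
    by_contra h'
    have := (residueClass_eq_zero_iff ht).2 (lt_of_le_of_ne ht h')
    rw [this, mul_zero] at hk
    exact residueClass_ne_zero hu hk
  have ht0 : t ≠ 0 := norm_pos_iff.1 (by rw [htu]; exact one_pos)
  rw [← residueClass_mul ht ht, residueClass_eq_iff hu.le (by rw [norm_mul, htu, one_mul])] at hk
  obtain ⟨r, hr⟩ := hϖ.isSquare_of_norm_sub_one_lt (u := u / (t * t)) (by
    rw [div_sub_one (mul_ne_zero ht0 ht0), norm_div, norm_mul, htu]
    simpa using hk)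
  refine ⟨r * t, ?_⟩
  field_simp at hr
  linear_combination hr

theorem isSquare_of_unitChar (hϖ : OddUniformizer q ϖ) {u : F} (hu : ‖u‖ = 1)
    (h : unitChar q ϖ u = 1) : IsSquare u := by
  classical
  rw [hϖ.unitChar_of_norm_one hu] at h
  refine hϖ.isSquare_of_residueClass hu ?_
  by_contra h'
  rw [if_neg h'] at h
  exact absurd h (by decide)

end OddUniformizer

end localField

/-! ### The Hilbert symbol -/

section hilbertSymbol

section field

variable {F : Type*} [Field F]

theorem hilbertSymbol_eq_one_iff (a b : F) : hilbertSymbol a b = 1 ↔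
    ∃ x y z : F, (x ≠ 0 ∨ y ≠ 0 ∨ z ≠ 0) ∧ a * x ^ 2 + b * y ^ 2 = z ^ 2 := by
  unfold hilbertSymbol
  split_ifs with h
  · simp [h]
  · simp only [h, iff_false]
    decide

theorem hilbertSymbol_congr {a b a' b' : F}
    (h : hilbertSymbol a b = 1 ↔ hilbertSymbol a' b' = 1) :
    hilbertSymbol a b = hilbertSymbol a' b' := by
  rcases Int.units_eq_one_or (hilbertSymbol a b) with h1 | h1 <;>
    rcases Int.units_eq_one_or (hilbertSymbol a' b') with h2 | h2 <;> simp_all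

theorem hilbertSymbol_mul_sq_left (a b : F) {t : F} (ht : t ≠ 0) :
    hilbertSymbol (a * (t * t)) b = hilbertSymbol a b := by
  apply hilbertSymbol_congr
  rw [hilbertSymbol_eq_one_iff, hilbertSymbol_eq_one_iff]
  constructor
  · rintro ⟨x, y, z, h, e⟩
    refine ⟨t * x, y, z, ?_, by rw [← e]; ring⟩
    rcases h with h | h
    · exact Or.inl (mul_ne_zero ht h)
    · exact Or.inr h
  · rintro ⟨x, y, z, h, e⟩
    refine ⟨x / t, y, z, ?_, by rw [← e]; field_simp⟩
    rcases h with h | h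
    · exact Or.inl (div_ne_zero h ht)
    · exact Or.inr h

theorem hilbertSymbol_mul_sq_right (a b : F) {t : F} (ht : t ≠ 0) :
    hilbertSymbol a (b * (t * t)) = hilbertSymbol a b := by
  rw [hilbertSymbol_comm, hilbertSymbol_mul_sq_left _ _ ht, hilbertSymbol_comm]

theorem hilbertSymbol_inv_left (a b : F) : hilbertSymbol a⁻¹ b = hilbertSymbol a b := by
  by_cases ha : a = 0
  · simp [ha]
  · rw [← hilbertSymbol_mul_sq_left a⁻¹ b ha]
    congr 1
    field_simp

theorem hilbertSymbol_inv_right (a b : F) : hilbertSymbol a b⁻¹ = hilbertSymbol a b := by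
  rw [hilbertSymbol_comm, hilbertSymbol_inv_left, hilbertSymbol_comm]

theorem hilbertSymbol_neg_self (a : F) : hilbertSymbol a (-a) = 1 :=
  (hilbertSymbol_eq_one_iff _ _).2 ⟨1, 1, 0, Or.inl one_ne_zero, by ring⟩

theorem hilbertSymbol_of_add_eq_one {a b : F} (h : a + b = 1) : hilbertSymbol a b = 1 :=
  (hilbertSymbol_eq_one_iff _ _).2 ⟨1, 1, 1, Or.inl one_ne_zero, by linear_combination h⟩

/-- The equations a x² - a b y² = z² and a x² + b y² = z² are carried into each other by exchanging
x and z up to the factor a. This holds before bilinearity is available and is what reduces the case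
of two odd orders to a mixed one. -/
theorem hilbertSymbol_neg_mul {a b : F} (ha : a ≠ 0) :
    hilbertSymbol a (-(a * b)) = hilbertSymbol a b := by
  apply hilbertSymbol_congr
  rw [hilbertSymbol_eq_one_iff, hilbertSymbol_eq_one_iff]
  constructor
  · rintro ⟨x, y, z, h, e⟩
    refine ⟨z / a, y, x, ?_, ?_⟩
    · by_contra! h'
      rcases h with h | h | h
      · exact h h'.2.2
      · exact h h'.2.1
      · exact h (by simpa [ha] using h'.1)
    · field_simp
      linear_combination -e
  · rintro ⟨x, y, z, h, e⟩
    refine ⟨z, y, a * x, ?_, by linear_combination -a * e⟩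
    by_contra! h'
    rcases h with h | h | h
    · exact h (by simpa [ha] using h'.2.2)
    · exact h h'.2.1
    · exact h h'.1

theorem hilbertSymbol_mul_self (a b : F) : hilbertSymbol a b * hilbertSymbol a b = 1 :=
  Int.units_mul_self _

end field

variable {F : Type*} [NontriviallyNormedField F] [IsUltrametricDist F]

namespace OddUniformizer

variable {q : ℕ} {ϖ : F}

/-- If u is not a square modulo the maximal ideal, no cancellation occurs in z² - u x²: its norm is
the square of the larger of |x| and |z|. So its order is even, while b y² has odd order. -/
theorem hilbertSymbol_unit_odd [ProperSpace F] (hϖ : OddUniformizer q ϖ) {u b : F} (hu : ‖u‖ = 1)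
    (hb : b ≠ 0) (hodd : Odd (ord q b)) : hilbertSymbol u b = unitChar q ϖ u := by
  classical
  by_cases hc : unitChar q ϖ u = 1
  · rw [hc, hilbertSymbol_eq_one_iff]
    obtain ⟨r, rfl⟩ := hϖ.isSquare_of_unitChar hu hc
    exact ⟨1, 0, r, Or.inl one_ne_zero, by ring⟩
  · rw [(Int.units_eq_one_or _).resolve_left hc]
    refine (Int.units_eq_one_or _).resolve_left ?_
    rw [hilbertSymbol_eq_one_iff]
    rintro ⟨x, y, z, h, e⟩
    have hev : ∀ w : F, w ≠ 0 → ‖z ^ 2 - u * x ^ 2‖ = ‖w‖ ^ 2 → False := by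
      intro w hw hn
      have e' : z ^ 2 - u * x ^ 2 = b * (y * y) := by linear_combination -e
      have hy : y ≠ 0 := by
        rintro rfl
        rw [e', mul_zero, mul_zero, norm_zero] at hn
        exact pow_ne_zero 2 (norm_ne_zero_iff.2 hw) hn.symm
      rw [e', pow_two, ← norm_mul, ← hϖ.ord_eq_iff (mul_ne_zero hb (mul_ne_zero hy hy))
        (mul_ne_zero hw hw), hϖ.ord_mul hb (mul_ne_zero hy hy), hϖ.ord_mul hy hy,
        hϖ.ord_mul hw hw] at hn
      obtain ⟨k, hk⟩ := hodd
      omega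
    have hux : ‖u * x ^ 2‖ = ‖x‖ ^ 2 := by rw [norm_mul, hu, one_mul, norm_pow]
    rcases lt_trichotomy ‖x‖ ‖z‖ with hlt | heq | hgt
    · refine hev z (norm_pos_iff.1 ((norm_nonneg _).trans_lt hlt)) ?_
      rw [sub_eq_add_neg, norm_add_eq_of_lt, norm_pow]
      rw [norm_neg, hux, norm_pow]
      exact pow_lt_pow_left₀ hlt (norm_nonneg _) _root_.two_ne_zero
    · by_cases hx : x = 0
      · have hz : z = 0 := by rw [← norm_eq_zero, ← heq, hx, norm_zero]
        rw [hx, hz] at e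
        have hy : y = 0 := by simpa [hb] using e
        rcases h with h | h | h <;> contradiction
      · refine hev x hx ?_
        have hzx : ‖z / x‖ = 1 := by rw [norm_div, heq, div_self]; rwa [← heq, norm_ne_zero_iff]
        have e2 : z ^ 2 - u * x ^ 2 = (z / x * (z / x) - u) * x ^ 2 := by field_simp
        rw [e2, norm_mul, norm_pow]
        refine mul_left_eq_self₀.2 (Or.inl ?_)
        have hle : ‖z / x * (z / x)‖ ≤ 1 := by rw [norm_mul, hzx, one_mul]
        by_contra hne
        have hlt := lt_of_le_of_ne (norm_sub_le_of_le hle hu.le) hne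
        rw [← residueClass_eq_iff hle hu.le, residueClass_mul hzx.le hzx.le] at hlt
        refine hc ?_
        rw [hϖ.unitChar_of_norm_one hu, if_pos ⟨_, hlt.symm⟩]
    · refine hev x (norm_pos_iff.1 ((norm_nonneg _).trans_lt hgt)) ?_
      rw [norm_sub_rev, sub_eq_add_neg, norm_add_eq_of_lt, hux]
      rw [norm_neg, hux, norm_pow]
      exact pow_lt_pow_left₀ hgt (norm_nonneg _) _root_.two_ne_zero

/-- Over the finite residue field the conic u x² + v y² = 1 has a point. Lifting it makes the left
side congruent to 1, hence a square. -/
theorem hilbertSymbol_unit_unit [ProperSpace F] (hϖ : OddUniformizer q ϖ) {u v : F} (hu : ‖u‖ = 1)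
    (hv : ‖v‖ = 1) : hilbertSymbol u v = 1 := by
  have := hϖ.finite_residueField
  have := Fintype.ofFinite 𝓀[F]
  have hodd : Fintype.card 𝓀[F] % 2 = 1 := by
    have := hϖ.odd
    rwa [hϖ.card, Nat.card_eq_fintype_card, Nat.odd_iff] at this
  obtain ⟨a, b, hab⟩ := FiniteField.exists_root_sum_quadratic
    (f := Polynomial.C (residueClass u) * Polynomial.X ^ 2)
    (g := Polynomial.C (residueClass v) * Polynomial.X ^ 2 + Polynomial.C (-1))
    (Polynomial.degree_C_mul_X_pow 2 (residueClass_ne_zero hu))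
    (by
      rw [Polynomial.degree_add_C, Polynomial.degree_C_mul_X_pow 2 (residueClass_ne_zero hv)]
      · rfl
      · rw [Polynomial.degree_C_mul_X_pow 2 (residueClass_ne_zero hv)]
        decide) hodd
  obtain ⟨x, hx, rfl⟩ := residueClass_surjective a
  obtain ⟨y, hy, rfl⟩ := residueClass_surjective b
  simp only [Polynomial.eval_mul, Polynomial.eval_add, Polynomial.eval_C, Polynomial.eval_pow,
    Polynomial.eval_X] at hab
  have hx2 : ‖x * x‖ ≤ 1 := by rw [norm_mul]; exact mul_le_one₀ hx (norm_nonneg _) hx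
  have hy2 : ‖y * y‖ ≤ 1 := by rw [norm_mul]; exact mul_le_one₀ hy (norm_nonneg _) hy
  have hux : ‖u * (x * x)‖ ≤ 1 := by rwa [norm_mul, hu, one_mul]
  have hvy : ‖v * (y * y)‖ ≤ 1 := by rwa [norm_mul, hv, one_mul]
  have hres : residueClass (u * (x * x) + v * (y * y)) = residueClass (1 : F) := by
    rw [residueClass_add hux hvy, residueClass_mul hu.le hx2, residueClass_mul hv.le hy2,
      residueClass_mul hx hx, residueClass_mul hy hy, residueClass_one]
    linear_combination hab
  rw [residueClass_eq_iff (norm_add_le_of_le hux hvy) (by simp)] at hres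
  obtain ⟨z, hz⟩ := hϖ.isSquare_of_norm_sub_one_lt hres
  refine (hilbertSymbol_eq_one_iff _ _).2 ⟨x, y, z, ?_, by linear_combination hz⟩
  refine Or.inr (Or.inr ?_)
  rintro rfl
  rw [hz] at hres
  simp at hres

theorem units_zpow_even (u : ℤˣ) {n : ℤ} (h : Even n) : u ^ n = 1 := by
  obtain ⟨k, rfl⟩ := h
  rw [_root_.zpow_add, Int.units_mul_self]

theorem units_zpow_odd (u : ℤˣ) {n : ℤ} (h : Odd n) : u ^ n = u := by
  obtain ⟨k, rfl⟩ := h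
  rw [_root_.zpow_add, zpow_one, units_zpow_even u (even_two_mul k), one_mul]

theorem exists_eq_unit_mul_sq (hϖ : OddUniformizer q ϖ) {a : F} (ha : a ≠ 0)
    (hev : Even (ord q a)) : ∃ u t : F, ‖u‖ = 1 ∧ t ≠ 0 ∧ a = u * (t * t) ∧
      unitChar q ϖ u = unitChar q ϖ a := by
  obtain ⟨k, hk⟩ := hev
  have ht : ϖ ^ k ≠ 0 := zpow_ne_zero _ hϖ.ne_zero
  have e : a = a * ϖ ^ (-ord q a) * (ϖ ^ k * ϖ ^ k) := by
    rw [mul_assoc, ← zpow_add₀ hϖ.ne_zero, ← zpow_add₀ hϖ.ne_zero, hk, neg_add_cancel, zpow_zero,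
      mul_one]
  refine ⟨a * ϖ ^ (-ord q a), ϖ ^ k, hϖ.norm_unitPart ha, ht, e, ?_⟩
  rw [hϖ.unitChar_mul ha (zpow_ne_zero _ hϖ.ne_zero), hϖ.unitChar_zpow, mul_one]

theorem hilbertSymbol_even_odd [ProperSpace F] (hϖ : OddUniformizer q ϖ) {a b : F} (ha : a ≠ 0)
    (hb : b ≠ 0) (hev : Even (ord q a)) (hodd : Odd (ord q b)) :
    hilbertSymbol a b = unitChar q ϖ a := by
  obtain ⟨u, t, hu, ht, rfl, hc⟩ := hϖ.exists_eq_unit_mul_sq ha hev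
  rw [hilbertSymbol_mul_sq_left _ _ ht, hϖ.hilbertSymbol_unit_odd hu hb hodd, hc]

/-- The tame formula for the Hilbert symbol. -/
theorem hilbertSymbol_eq [ProperSpace F] (hϖ : OddUniformizer q ϖ) {a b : F} (ha : a ≠ 0)
    (hb : b ≠ 0) : hilbertSymbol a b =
      unitChar q ϖ a ^ ord q b * unitChar q ϖ b ^ ord q a *
        unitChar q ϖ (-1 : F) ^ (ord q a * ord q b) := by
  rcases Int.even_or_odd (ord q a) with hea | hoa <;> rcases Int.even_or_odd (ord q b) with heb | hob
  · obtain ⟨u, t, hu, ht, ea, -⟩ := hϖ.exists_eq_unit_mul_sq ha hea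
    obtain ⟨v, s, hv, hs, eb, -⟩ := hϖ.exists_eq_unit_mul_sq hb heb
    rw [units_zpow_even _ hea, units_zpow_even _ heb, units_zpow_even _ (hea.mul_right _), ea, eb,
      hilbertSymbol_mul_sq_left _ _ ht, hilbertSymbol_mul_sq_right _ _ hs,
      hϖ.hilbertSymbol_unit_unit hu hv]
    rfl
  · rw [units_zpow_even _ hea, units_zpow_odd _ hob, units_zpow_even _ (hea.mul_right _),
      hϖ.hilbertSymbol_even_odd ha hb hea hob, mul_one, mul_one]
  · rw [units_zpow_even _ heb, units_zpow_odd _ hoa, units_zpow_even _ (heb.mul_left _),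
      hilbertSymbol_comm, hϖ.hilbertSymbol_even_odd hb ha heb hoa, one_mul, mul_one]
  -- When both orders are odd, (a, b) = (a, -ab), and -ab has even order.
  · have hn : ‖(-1 : F)‖ = 1 := by simp
    have h1 : (-1 : F) ≠ 0 := neg_ne_zero.2 one_ne_zero
    have e : -(a * b) = -1 * (a * b) := by ring
    rw [units_zpow_odd _ hoa, units_zpow_odd _ hob, units_zpow_odd _ (hoa.mul hob),
      ← hilbertSymbol_neg_mul ha, hilbertSymbol_comm, hϖ.hilbertSymbol_even_odd
      (neg_ne_zero.2 (mul_ne_zero ha hb)) ha ?_ hoa, e, hϖ.unitChar_mul h1 (mul_ne_zero ha hb),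
      hϖ.unitChar_mul ha hb, mul_comm]
    rw [e, hϖ.ord_mul h1 (mul_ne_zero ha hb), hϖ.ord_mul ha hb, hϖ.ord_of_norm_one hn, zero_add]
    exact hoa.add_odd hob

theorem hilbertSymbol_unit_left [ProperSpace F] (hϖ : OddUniformizer q ϖ) {u b : F} (hu : ‖u‖ = 1)
    (hb : b ≠ 0) : hilbertSymbol u b = unitChar q ϖ u ^ ord q b := by
  rw [hϖ.hilbertSymbol_eq (norm_pos_iff.1 (hu ▸ one_pos)) hb, hϖ.ord_of_norm_one hu]
  simp

theorem hilbertSymbol_mul_left [ProperSpace F] (hϖ : OddUniformizer q ϖ) {a b c : F} (ha : a ≠ 0)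
    (hb : b ≠ 0) (hc : c ≠ 0) :
    hilbertSymbol (a * b) c = hilbertSymbol a c * hilbertSymbol b c := by
  rw [hϖ.hilbertSymbol_eq (mul_ne_zero ha hb) hc, hϖ.hilbertSymbol_eq ha hc,
    hϖ.hilbertSymbol_eq hb hc, hϖ.unitChar_mul ha hb, hϖ.ord_mul ha hb, add_mul, _root_.zpow_add, _root_.zpow_add,
    _root_.mul_zpow]
  simp only [mul_assoc, mul_left_comm]

end OddUniformizer

end hilbertSymbol

/-! ### `Mp₂(F)` is a group -/

section metaplecticGroup

variable {F : Type*} [Field F]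

theorem sl_mul_apply (g h : SpecialLinearGroup (Fin 2) F) (i j : Fin 2) :
    (g * h).1 i j = g.1 i 0 * h.1 0 j + g.1 i 1 * h.1 1 j := by
  change (g.1 * h.1) i j = _
  rw [Matrix.mul_apply, Fin.sum_univ_two]

theorem sl_det (g : SpecialLinearGroup (Fin 2) F) :
    g.1 0 0 * g.1 1 1 - g.1 0 1 * g.1 1 0 = 1 := by
  rw [← Matrix.det_fin_two]; exact g.2

theorem lowerEntry_of_ne {g : SpecialLinearGroup (Fin 2) F} (h : g.1 1 0 ≠ 0) :
    lowerEntry g = g.1 1 0 := if_pos h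

theorem lowerEntry_of_eq {g : SpecialLinearGroup (Fin 2) F} (h : g.1 1 0 = 0) :
    lowerEntry g = g.1 1 1 := if_neg (not_not.2 h)

/-- Bilinearity of the Hilbert symbol. -/
def SymbolBilinear (F : Type*) [Field F] : Prop := ∀ a b c : F, a ≠ 0 → b ≠ 0 → c ≠ 0 →
  hilbertSymbol (a * b) c = hilbertSymbol a c * hilbertSymbol b c

theorem hilbertSymbol_div_left (a c : F) {b : F} (hb : b ≠ 0) :
    hilbertSymbol (a / b) c = hilbertSymbol (a * b) c := by
  rw [← hilbertSymbol_mul_sq_left (a / b) c hb]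
  congr 1
  field_simp

theorem hilbertSymbol_div_right (a c : F) {b : F} (hb : b ≠ 0) :
    hilbertSymbol c (a / b) = hilbertSymbol c (a * b) := by
  rw [hilbertSymbol_comm, hilbertSymbol_div_left a c hb, hilbertSymbol_comm]

theorem cocycle_eq (g h : SpecialLinearGroup (Fin 2) F) : cocycle g h =
    hilbertSymbol (lowerEntry g * lowerEntry (g * h)) (lowerEntry h * lowerEntry (g * h)) := by
  rw [cocycle, hilbertSymbol_div_left _ _ (lowerEntry_ne_zero _),
    hilbertSymbol_div_right _ _ (lowerEntry_ne_zero _)]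

namespace SymbolBilinear

theorem mul_left (hF : SymbolBilinear F) {a b c : F} (ha : a ≠ 0) (hb : b ≠ 0) (hc : c ≠ 0) :
    hilbertSymbol (a * b) c = hilbertSymbol a c * hilbertSymbol b c := hF a b c ha hb hc

theorem mul_right (hF : SymbolBilinear F) {a b c : F} (ha : a ≠ 0) (hb : b ≠ 0) (hc : c ≠ 0) :
    hilbertSymbol c (a * b) = hilbertSymbol c a * hilbertSymbol c b := by
  rw [hilbertSymbol_comm, hF a b c ha hb hc, hilbertSymbol_comm a, hilbertSymbol_comm b]

end SymbolBilinear

theorem units_mul_cancel (x y : ℤˣ) : x * (x * y) = y := by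
  rw [← mul_assoc, Int.units_mul_self, one_mul]

theorem hilbertSymbol_self (hF : SymbolBilinear F) {a : F} (ha : a ≠ 0) :
    hilbertSymbol a a = hilbertSymbol (-1) a := by
  have h := hilbertSymbol_neg_self a
  rw [neg_eq_neg_one_mul, hF.mul_right (neg_ne_zero.2 one_ne_zero) ha ha] at h
  rw [hilbertSymbol_comm (-1)]
  exact (eq_inv_of_mul_eq_one_right h).trans (Int.units_inv_eq_self _)

section identities

variable {m : F}

/-- The hypothesis `rel` is the relation (x, 1 - x) = 1 in disguise. Multiplying it in, both sides
expand by bilinearity and (a, a) = (m, a) into the same product of symbols modulo squares. The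
letter m stands for -1; kept opaque, it is treated as one more generator in the expansion. -/
theorem cocycle_identity_generic (hF : SymbolBilinear F) {c₁ d₁ c₃ a₃ y : F} (h₁ : c₁ ≠ 0)
    (h₂ : d₁ ≠ 0) (h₃ : c₃ ≠ 0) (h₄ : a₃ ≠ 0) (h₅ : y ≠ 0) (hm : m ≠ 0)
    (rel : hilbertSymbol (d₁ * a₃ * y) (m * (c₁ * c₃ * y)) = 1)
    (hs : ∀ a : F, a ≠ 0 → hilbertSymbol a a = hilbertSymbol m a) :
    hilbertSymbol (c₁ * d₁) d₁ * hilbertSymbol (d₁ * y) (c₃ * y) =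
      hilbertSymbol (c₁ * y) (a₃ * y) * hilbertSymbol a₃ (c₃ * a₃) := by
  rw [← mul_one (hilbertSymbol _ _ * _), ← rel]
  simp only [hF.mul_left, hF.mul_right, ne_eq, mul_eq_zero, h₁, h₂, h₃, h₄, h₅, hm, or_self,
    not_false_eq_true, hs]
  simp only [mul_assoc, mul_comm, mul_left_comm, units_mul_cancel, hilbertSymbol_comm]

theorem cocycle_identity_left (hF : SymbolBilinear F) {c₁ c₃ x : F} (h₁ : c₁ ≠ 0) (h₃ : c₃ ≠ 0)
    (h₄ : x ≠ 0) (hm : m ≠ 0) (hs : ∀ a : F, a ≠ 0 → hilbertSymbol a a = hilbertSymbol m a) :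
    hilbertSymbol (c₁ * (m * c₁)) (m * c₁) *
        hilbertSymbol (m * c₁ * (m * (c₁ * c₃))) (c₃ * (m * (c₁ * c₃))) =
      hilbertSymbol (c₁ * (m * (c₁ * c₃))) (x * (m * (c₁ * c₃))) *
        hilbertSymbol x (c₃ * x) := by
  simp only [hF.mul_left, hF.mul_right, ne_eq, mul_eq_zero, h₁, h₃, h₄, hm, or_self,
    not_false_eq_true, hs]
  simp only [mul_assoc, mul_comm, mul_left_comm, units_mul_cancel, Int.units_mul_self,
    hilbertSymbol_comm, mul_one]

theorem cocycle_identity_right (hF : SymbolBilinear F) {c₁ c₃ d₁ : F} (h₁ : c₁ ≠ 0) (h₃ : c₃ ≠ 0)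
    (h₄ : d₁ ≠ 0) (hm : m ≠ 0) (hs : ∀ a : F, a ≠ 0 → hilbertSymbol a a = hilbertSymbol m a) :
    hilbertSymbol (c₁ * d₁) d₁ *
        hilbertSymbol (d₁ * (m * (c₁ * c₃))) (c₃ * (m * (c₁ * c₃))) =
      hilbertSymbol (c₁ * (m * (c₁ * c₃))) (m / c₃ * (m * (c₁ * c₃))) *
        hilbertSymbol (m / c₃) (c₃ * (m / c₃)) := by
  simp only [div_eq_mul_inv]
  have h₃' := inv_ne_zero h₃
  simp only [hF.mul_left, hF.mul_right, ne_eq, mul_eq_zero, h₁, h₃, h₄, hm, or_self,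
    not_false_eq_true, hs, hilbertSymbol_inv_left, hilbertSymbol_inv_right, h₃']
  simp only [mul_assoc, mul_comm, mul_left_comm, units_mul_cancel, Int.units_mul_self,
    hilbertSymbol_comm, mul_one]

theorem cocycle_identity_degenerate (hF : SymbolBilinear F) {c₁ c₃ d₁ : F} (h₁ : c₁ ≠ 0)
    (h₃ : c₃ ≠ 0) (h₄ : d₁ ≠ 0) (hm : m ≠ 0)
    (hs : ∀ a : F, a ≠ 0 → hilbertSymbol a a = hilbertSymbol m a) :
    hilbertSymbol (c₁ * d₁) d₁ *
        hilbertSymbol (d₁ * (m * (d₁ / c₃))) (c₃ * (m * (d₁ / c₃))) =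
      hilbertSymbol (c₁ * (m * (d₁ / c₃))) (c₁ * c₃ / d₁ * (m * (d₁ / c₃))) *
        hilbertSymbol (c₁ * c₃ / d₁) (c₃ * (c₁ * c₃ / d₁)) := by
  simp only [div_eq_mul_inv]
  have h₃' := inv_ne_zero h₃
  have h₄' := inv_ne_zero h₄
  simp only [hF.mul_left, hF.mul_right, ne_eq, mul_eq_zero, h₁, h₃, h₄, hm, or_self,
    not_false_eq_true, hs, hilbertSymbol_inv_left, hilbertSymbol_inv_right, h₃', h₄']
  simp only [mul_assoc, mul_comm, mul_left_comm, units_mul_cancel, Int.units_mul_self,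
    hilbertSymbol_comm, mul_one]

theorem cocycle_identity_torus (hF : SymbolBilinear F) {x₁ x₃ t y : F} (h₁ : x₁ ≠ 0) (h₃ : x₃ ≠ 0)
    (ht : t ≠ 0) (hy : y ≠ 0) :
    hilbertSymbol (x₁ * (x₁ * t)) (t * (x₁ * t)) * hilbertSymbol (x₁ * t * y) (x₃ * y) =
      hilbertSymbol (x₁ * y) (x₃ * t * y) * hilbertSymbol (t * (x₃ * t)) (x₃ * (x₃ * t)) := by
  simp only [hF.mul_left, hF.mul_right, ne_eq, mul_eq_zero, h₁, h₃, ht, hy, or_self,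
    not_false_eq_true]
  simp only [mul_assoc, mul_comm, mul_left_comm, units_mul_cancel, Int.units_mul_self,
    hilbertSymbol_comm, mul_one]

end identities

/-- The elements `y` with `(x y) z = x (y z)` for all `x` and `z`. -/
def MidAssoc (y : Mp2 F) : Prop := ∀ x z : Mp2 F, x * y * z = x * (y * z)

/-- Four re-bracketings show that this property is multiplicative, so associativity need only be
tested for generators in the middle position. -/
theorem MidAssoc.mul {y y' : Mp2 F} (h : MidAssoc y) (h' : MidAssoc y') : MidAssoc (y * y') := by
  intro x z
  rw [← h x y', h' (x * y) z, h x, h' y z]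

theorem midAssoc_of_cocycle {y : Mp2 F} (h : ∀ g k : SpecialLinearGroup (Fin 2) F,
    cocycle g y.mat * cocycle (g * y.mat) k = cocycle g (y.mat * k) * cocycle y.mat k) :
    MidAssoc y := by
  intro x z
  have h' := h x.mat z.mat
  ext1
  · exact mul_assoc x.mat y.mat z.mat
  · change x.sgn * y.sgn * cocycle x.mat y.mat * z.sgn * cocycle (x.mat * y.mat) z.mat =
      x.sgn * (y.sgn * z.sgn * cocycle y.mat z.mat) * cocycle x.mat (y.mat * z.mat)
    calc _ = x.sgn * y.sgn * z.sgn *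
          (cocycle x.mat y.mat * cocycle (x.mat * y.mat) z.mat) := by
          simp only [mul_assoc, mul_left_comm, mul_comm]
      _ = _ := by rw [h']; simp only [mul_assoc, mul_left_comm, mul_comm]

theorem cocycle_one_left (g : SpecialLinearGroup (Fin 2) F) : cocycle 1 g = 1 := by
  rw [cocycle, one_mul, div_self (lowerEntry_ne_zero g), hilbertSymbol_one_right]

theorem cocycle_one_right (g : SpecialLinearGroup (Fin 2) F) : cocycle g 1 = 1 := by
  rw [cocycle, mul_one, div_self (lowerEntry_ne_zero g), hilbertSymbol_one_left]

theorem midAssoc_sign (ζ : ℤˣ) : MidAssoc (⟨1, ζ⟩ : Mp2 F) :=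
  midAssoc_of_cocycle fun g k => by
    change cocycle g 1 * cocycle (g * 1) k = cocycle g (1 * k) * cocycle 1 k
    rw [cocycle_one_left, cocycle_one_right, mul_one, mul_one, one_mul, one_mul]

theorem mp2_eq_sign_mul (x : Mp2 F) : x = ⟨1, x.sgn⟩ * ⟨x.mat, 1⟩ := by
  ext1
  · exact (one_mul x.mat).symm
  · change x.sgn = x.sgn * 1 * cocycle 1 x.mat
    rw [cocycle_one_left, mul_one, mul_one]

theorem lowerEntry_mul_uSharp (g : SpecialLinearGroup (Fin 2) F) (b : F) :
    lowerEntry (g * (uSharp b).mat) = lowerEntry g := by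
  have h1 : (g * (uSharp b).mat).1 1 0 = g.1 1 0 := by
    rw [sl_mul_apply]; simp [uSharp]
  have h2 : (g * (uSharp b).mat).1 1 1 = g.1 1 0 * b + g.1 1 1 := by
    rw [sl_mul_apply]; simp [uSharp]
  by_cases h : g.1 1 0 = 0
  · rw [lowerEntry_of_eq h, lowerEntry_of_eq (h1.trans h), h2, h, zero_mul, zero_add]
  · rw [lowerEntry_of_ne h, lowerEntry_of_ne (h1 ▸ h), h1]

theorem lowerEntry_uSharp_mul (g : SpecialLinearGroup (Fin 2) F) (b : F) :
    lowerEntry ((uSharp b).mat * g) = lowerEntry g := by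
  have h1 : ∀ j, ((uSharp b).mat * g).1 1 j = g.1 1 j := by
    intro j; rw [sl_mul_apply]; simp [uSharp]
  by_cases h : g.1 1 0 = 0
  · rw [lowerEntry_of_eq h, lowerEntry_of_eq ((h1 0).trans h), h1]
  · rw [lowerEntry_of_ne h, lowerEntry_of_ne ((h1 0).symm ▸ h), h1]

theorem cocycle_uSharp_left (b : F) (g : SpecialLinearGroup (Fin 2) F) :
    cocycle (uSharp b).mat g = 1 := by
  rw [cocycle, lowerEntry_uSharp_mul, div_self (lowerEntry_ne_zero g), hilbertSymbol_one_right]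

theorem cocycle_uSharp_right (b : F) (g : SpecialLinearGroup (Fin 2) F) :
    cocycle g (uSharp b).mat = 1 := by
  rw [cocycle, lowerEntry_mul_uSharp, div_self (lowerEntry_ne_zero g), hilbertSymbol_one_left]

theorem midAssoc_uSharp (b : F) : MidAssoc (uSharp b) :=
  midAssoc_of_cocycle fun g k => by
    rw [cocycle_uSharp_left, cocycle_uSharp_right, one_mul, mul_one, cocycle, cocycle,
      lowerEntry_mul_uSharp, lowerEntry_uSharp_mul, mul_assoc]

theorem lowerEntry_mDiag (a : Fˣ) : lowerEntry (mDiag a).mat = (a : F)⁻¹ := by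
  simp [lowerEntry, mDiag]

theorem lowerEntry_mDiag_mul (a : Fˣ) (g : SpecialLinearGroup (Fin 2) F) :
    lowerEntry ((mDiag a).mat * g) = lowerEntry g * (a : F)⁻¹ := by
  have h1 : ∀ j, ((mDiag a).mat * g).1 1 j = (a : F)⁻¹ * g.1 1 j := by
    intro j; rw [sl_mul_apply]; simp [mDiag]
  by_cases h : g.1 1 0 = 0
  · rw [lowerEntry_of_eq h, lowerEntry_of_eq (by rw [h1, h, mul_zero]), h1, mul_comm]
  · rw [lowerEntry_of_ne h, lowerEntry_of_ne (by
      rw [h1]; exact mul_ne_zero (inv_ne_zero a.ne_zero) h), h1, mul_comm]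

/-- The alternatives differ by the square a², which symbols do not see; the common shape with a
factor s² lets one computation serve both. -/
theorem lowerEntry_mul_mDiag (a : Fˣ) (g : SpecialLinearGroup (Fin 2) F) :
    lowerEntry (g * (mDiag a).mat) = lowerEntry g * (a : F)⁻¹ * (1 * 1) ∨
    lowerEntry (g * (mDiag a).mat) = lowerEntry g * (a : F)⁻¹ * (a * a) := by
  have h1 : (g * (mDiag a).mat).1 1 0 = g.1 1 0 * a := by
    rw [sl_mul_apply]; simp [mDiag]
  have h2 : (g * (mDiag a).mat).1 1 1 = g.1 1 1 * (a : F)⁻¹ := by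
    rw [sl_mul_apply]; simp [mDiag]
  by_cases h : g.1 1 0 = 0
  · left
    rw [lowerEntry_of_eq h, lowerEntry_of_eq (by rw [h1, h, zero_mul]), h2, mul_one, mul_one]
  · right
    rw [lowerEntry_of_ne h, lowerEntry_of_ne (by rw [h1]; exact mul_ne_zero h a.ne_zero), h1]
    field_simp

theorem midAssoc_mDiag (hF : SymbolBilinear F) (a : Fˣ) : MidAssoc (mDiag a) :=
  midAssoc_of_cocycle fun g k => by
    have ha : (a : F)⁻¹ ≠ 0 := inv_ne_zero a.ne_zero
    have key : ∀ s : F, s ≠ 0 → lowerEntry (g * (mDiag a).mat) = lowerEntry g * (a : F)⁻¹ * (s * s) →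
        cocycle g (mDiag a).mat * cocycle (g * (mDiag a).mat) k =
          cocycle g ((mDiag a).mat * k) * cocycle (mDiag a).mat k := by
      intro s hs e
      simp only [cocycle_eq]
      rw [e, lowerEntry_mDiag, lowerEntry_mDiag_mul, ← mul_assoc g]
      rw [← cocycle_identity_torus hF (lowerEntry_ne_zero g) (lowerEntry_ne_zero k) ha
        (lowerEntry_ne_zero (g * (mDiag a).mat * k)), ← mul_assoc (lowerEntry g) _ (s * s),
        hilbertSymbol_mul_sq_left _ _ hs, ← mul_assoc (a : F)⁻¹ _ (s * s),
        hilbertSymbol_mul_sq_right _ _ hs, mul_right_comm (lowerEntry g * (a : F)⁻¹) (s * s),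
        hilbertSymbol_mul_sq_left _ _ hs]
    rcases lowerEntry_mul_mDiag a g with h | h
    · exact key 1 one_ne_zero h
    · exact key a a.ne_zero h

/-- The lower left entry of g w k is d₁a₃ - c₁c₃. If all of c₁, d₁, a₃, c₃ and this entry are
non-zero, dividing by the entry gives two numbers with sum 1, whose symbol is trivial. In every
degenerate case the entry collapses to a monomial, and bilinearity with (a, a) = (-1, a) suffices.
-/
theorem midAssoc_wAnti_one (hF : SymbolBilinear F) : MidAssoc (wAnti (1 : Fˣ) : Mp2 F) :=
  midAssoc_of_cocycle fun g k => by
    set w : SpecialLinearGroup (Fin 2) F := (wAnti (1 : Fˣ)).mat with hw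
    set c₁ := g.1 1 0 with hc₁
    set d₁ := g.1 1 1 with hd₁
    set a₃ := k.1 0 0 with ha₃
    set b₃ := k.1 0 1 with hb₃
    set c₃ := k.1 1 0 with hc₃
    set d₃ := k.1 1 1 with hd₃
    have hdet : a₃ * d₃ - b₃ * c₃ = 1 := sl_det k
    have hm : (-1 : F) ≠ 0 := neg_ne_zero.2 one_ne_zero
    have hs : ∀ a : F, a ≠ 0 → hilbertSymbol a a = hilbertSymbol (-1) a :=
      fun a ha => hilbertSymbol_self hF ha
    have gw0 : (g * w).1 1 0 = d₁ := by rw [sl_mul_apply]; simp [hw, wAnti, hd₁]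
    have gw1 : (g * w).1 1 1 = -1 * c₁ := by rw [sl_mul_apply]; simp [hw, wAnti, hc₁]
    have wk0 : (w * k).1 1 0 = a₃ := by rw [sl_mul_apply]; simp [hw, wAnti, ha₃]
    have wk1 : (w * k).1 1 1 = b₃ := by rw [sl_mul_apply]; simp [hw, wAnti, hb₃]
    have y0 : (g * w * k).1 1 0 = d₁ * a₃ + -1 * (c₁ * c₃) := by
      rw [sl_mul_apply, gw0, gw1, mul_assoc]
    have y1 : (g * w * k).1 1 1 = d₁ * b₃ + -1 * (c₁ * d₃) := by
      rw [sl_mul_apply, gw0, gw1, mul_assoc]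
    have Lg0 : c₁ = 0 → lowerEntry g = d₁ := fun h => lowerEntry_of_eq h
    have Lg1 : c₁ ≠ 0 → lowerEntry g = c₁ := fun h => lowerEntry_of_ne h
    have Lk0 : c₃ = 0 → lowerEntry k = d₃ := fun h => lowerEntry_of_eq h
    have Lk1 : c₃ ≠ 0 → lowerEntry k = c₃ := fun h => lowerEntry_of_ne h
    have Lgw0 : d₁ = 0 → lowerEntry (g * w) = -1 * c₁ := fun h => by
      rw [lowerEntry_of_eq (gw0.trans h), gw1]
    have Lgw1 : d₁ ≠ 0 → lowerEntry (g * w) = d₁ := fun h => by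
      rw [lowerEntry_of_ne (by rwa [gw0]), gw0]
    have Lwk0 : a₃ = 0 → lowerEntry (w * k) = b₃ := fun h => by
      rw [lowerEntry_of_eq (wk0.trans h), wk1]
    have Lwk1 : a₃ ≠ 0 → lowerEntry (w * k) = a₃ := fun h => by
      rw [lowerEntry_of_ne (by rwa [wk0]), wk0]
    have Ly0 : d₁ * a₃ + -1 * (c₁ * c₃) = 0 →
        lowerEntry (g * w * k) = d₁ * b₃ + -1 * (c₁ * d₃) := fun h => by
      rw [lowerEntry_of_eq (y0.trans h), y1]
    have Ly1 : d₁ * a₃ + -1 * (c₁ * c₃) ≠ 0 →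
        lowerEntry (g * w * k) = d₁ * a₃ + -1 * (c₁ * c₃) := fun h => by
      rw [lowerEntry_of_ne (by rwa [y0]), y0]
    have hLw : lowerEntry w = 1 := by simp [lowerEntry, hw, wAnti]
    simp only [cocycle_eq]
    rw [← mul_assoc g, hLw, one_mul, one_mul]
    have hy := lowerEntry_ne_zero (g * w * k)
    by_cases h₁ : c₁ = 0
    · have hd : d₁ ≠ 0 := by
        have := lowerEntry_ne_zero g
        rwa [Lg0 h₁] at this
      have e : lowerEntry (g * w * k) = d₁ * lowerEntry (w * k) := by
        by_cases h₃ : a₃ = 0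
        · rw [Ly0 (by rw [h₃, h₁]; ring), Lwk0 h₃, h₁]
          ring
        · rw [Ly1 (by rw [h₁]; simp [hd, h₃]), Lwk1 h₃, h₁]
          ring
      rw [e, Lg0 h₁, Lgw1 hd]
      have hx := lowerEntry_ne_zero (w * k)
      have hk := lowerEntry_ne_zero k
      simp only [hF.mul_left, hF.mul_right, ne_eq, mul_eq_zero, hd, hx, hk, or_self,
        not_false_eq_true]
      simp only [mul_assoc, mul_comm, mul_left_comm, units_mul_cancel, Int.units_mul_self,
        hilbertSymbol_comm, one_mul]
    by_cases h₃ : c₃ = 0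
    · have hd : d₃ ≠ 0 := by
        have := lowerEntry_ne_zero k
        rwa [Lk0 h₃] at this
      have ha : a₃ = d₃⁻¹ := by
        rw [h₃, mul_zero, sub_zero] at hdet
        exact eq_inv_of_mul_eq_one_left hdet
      have ha0 : a₃ ≠ 0 := ha ▸ inv_ne_zero hd
      have e : lowerEntry (g * w * k) = lowerEntry (g * w) * d₃ ∨
          lowerEntry (g * w * k) = lowerEntry (g * w) * d₃ * (a₃ * a₃) := by
        by_cases hd₁ : d₁ = 0
        · left
          rw [Ly0 (by rw [h₃, hd₁]; ring), Lgw0 hd₁, hd₁]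
          ring
        · right
          rw [Ly1 (by rw [h₃]; simp [hd₁, ha0]), Lgw1 hd₁, h₃, ha]
          field_simp
          ring
      have hx := lowerEntry_ne_zero (g * w)
      have hg := lowerEntry_ne_zero g
      have hda := inv_ne_zero hd
      rw [Lk0 h₃, Lwk1 ha0]
      rcases e with e | e <;> rw [e, ha] <;>
      simp only [hF.mul_left, hF.mul_right, ne_eq, mul_eq_zero, hd, hda, hx, hg, or_self,
        not_false_eq_true, hilbertSymbol_inv_left, hilbertSymbol_inv_right] <;>
      simp only [mul_assoc, mul_comm, mul_left_comm, units_mul_cancel, Int.units_mul_self,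
        hilbertSymbol_comm, mul_one, one_mul]
    rw [Lg1 h₁, Lk1 h₃]
    by_cases h₂ : d₁ = 0
    · have e : lowerEntry (g * w * k) = -1 * (c₁ * c₃) := by
        rw [Ly1 (by rw [h₂]; simp [h₁, h₃]), h₂]
        ring
      rw [e, Lgw0 h₂]
      exact cocycle_identity_left hF h₁ h₃ (lowerEntry_ne_zero _) hm hs
    rw [Lgw1 h₂]
    by_cases h₄ : a₃ = 0
    · have e : lowerEntry (g * w * k) = -1 * (c₁ * c₃) := by
        rw [Ly1 (by rw [h₄]; simp [h₁, h₃]), h₄]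
        ring
      have e' : lowerEntry (w * k) = -1 / c₃ := by
        rw [Lwk0 h₄, eq_div_iff h₃]
        rw [h₄] at hdet
        linear_combination -hdet
      rw [e, e']
      exact cocycle_identity_right hF h₁ h₃ h₂ hm hs
    rw [Lwk1 h₄]
    by_cases h₅ : d₁ * a₃ + -1 * (c₁ * c₃) = 0
    · have e : lowerEntry (g * w * k) = -1 * (d₁ / c₃) := by
        rw [Ly0 h₅]
        field_simp
        linear_combination d₃ * h₅ - d₁ * hdet
      have e' : a₃ = c₁ * c₃ / d₁ := by
        field_simp
        linear_combination h₅
      rw [e, e']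
      exact cocycle_identity_degenerate hF h₁ h₃ h₂ hm hs
    · rw [Ly1 h₅]
      refine cocycle_identity_generic hF h₁ h₂ h₃ h₄ h₅ hm ?_ hs
      rw [← hilbertSymbol_div_left _ _ h₅, ← mul_assoc (-1) (c₁ * c₃), ← hilbertSymbol_div_right _ _ h₅]
      apply hilbertSymbol_of_add_eq_one
      rw [← add_div, div_self h₅]

/-- By the Bruhat decomposition every element is a product of signs, 𝐮♯, 𝐦 and 𝐰₁. Brackets are kept
in these products, as multiplication is not yet known to be associative. -/
theorem midAssoc (hF : SymbolBilinear F) (y : Mp2 F) : MidAssoc y := by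
  have hone : ∀ c : Fˣ, MidAssoc (wAnti c : Mp2 F) := by
    intro c
    have e : wAnti c = ⟨1, cocycle (mDiag c⁻¹).mat (wAnti (1 : Fˣ)).mat⟩ *
        (mDiag c⁻¹ * wAnti (1 : Fˣ)) := by
      have hm : (wAnti c).mat = (mDiag c⁻¹).mat * (wAnti (1 : Fˣ)).mat := by
        apply Subtype.ext
        change !![0, -(c : F)⁻¹; (c : F), 0] =
          !![((c⁻¹ : Fˣ) : F), 0; 0, ((c⁻¹ : Fˣ) : F)⁻¹] *
            !![0, -((1 : Fˣ) : F)⁻¹; ((1 : Fˣ) : F), 0]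
        rw [Matrix.mul_fin_two]
        simp
      ext1
      · change (wAnti c).mat = 1 * ((mDiag c⁻¹).mat * (wAnti (1 : Fˣ)).mat)
        rw [one_mul, hm]
      · change (1 : ℤˣ) = cocycle _ _ * (1 * 1 * cocycle _ _) * cocycle 1 _
        rw [cocycle_one_left, one_mul, one_mul, mul_one, Int.units_mul_self]
    rw [e]
    exact (midAssoc_sign _).mul ((midAssoc_mDiag hF _).mul (midAssoc_wAnti_one hF))
  rw [mp2_eq_sign_mul y]
  refine (midAssoc_sign _).mul ?_
  by_cases h : y.mat.1 1 0 = 0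
  · have h0 : y.mat.1 0 0 ≠ 0 := by
      intro h0
      have := sl_det y.mat
      rw [h, h0] at this
      simp at this
    rw [eq_uSharp_mul_mDiag y.mat (Units.mk0 _ h0) rfl h]
    exact (midAssoc_uSharp _).mul (midAssoc_mDiag hF _)
  · rw [eq_uSharp_mul_wAnti_mul_uSharp y.mat (Units.mk0 _ h) rfl]
    exact (midAssoc_uSharp _).mul ((hone _).mul (midAssoc_uSharp _))

/-- The group structure of `Mp₂(F)`. -/
@[reducible] def mp2Group (hF : SymbolBilinear F) : Group (Mp2 F) where
  mul_assoc x y z := midAssoc hF y x z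
  one_mul := one_mul_mp2
  mul_one x := by
    ext1
    · exact mul_one x.mat
    · change x.sgn * 1 * cocycle x.mat 1 = x.sgn
      rw [cocycle_one_right, mul_one, mul_one]
  inv_mul_cancel := inv_mul_mp2

end metaplecticGroup

/-! ### Integrals over balls -/

section ballIntegrals

variable {F : Type*} [NontriviallyNormedField F] [ProperSpace F] [MeasurableSpace F] [BorelSpace F]

variable (F) in
/-- The Haar measure with volume `1` on the ring of integers, for any Borel structure. -/
abbrev volF : Measure F := Measure.addHaarMeasure (unitBall F)

theorem integralF_eq (f : F → ℂ) : integralF f = ∫ x, f x ∂(volF F) := by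
  have h : ‹MeasurableSpace F› = borel F := BorelSpace.measurable_eq
  subst h
  rfl

/-- The ball of radius `‖r‖` around `0`. -/
abbrev ballF (r : F) : Set F := Metric.closedBall 0 ‖r‖

omit [ProperSpace F] [MeasurableSpace F] [BorelSpace F] in
theorem mem_ballF {r x : F} : x ∈ ballF r ↔ ‖x‖ ≤ ‖r‖ := by simp

theorem measurableSet_ballF (r : F) : MeasurableSet (ballF r) := measurableSet_closedBall

theorem volF_ballF_lt_top (r : F) : volF F (ballF r) < ⊤ :=
  (isCompact_closedBall 0 ‖r‖).measure_lt_top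

theorem volF_ballF_one : volF F (ballF 1) = 1 := by
  have : (ballF (1 : F)) = unitBall F := by
    simp only [ballF, norm_one]
    rfl
  rw [this]
  exact Measure.addHaarMeasure_self

theorem setIntegral_add_right {S : Set F} (hS : MeasurableSet S) {h : F}
    (hinv : ∀ y, y + h ∈ S ↔ y ∈ S) (f : F → ℂ) :
    ∫ y in S, f (y + h) ∂(volF F) = ∫ y in S, f y ∂(volF F) := by
  rw [← integral_indicator hS, ← integral_indicator hS,
    ← integral_add_right_eq_self (Set.indicator S f) h]
  congr 1
  funext y
  by_cases hy : y ∈ S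
  · rw [Set.indicator_of_mem hy, Set.indicator_of_mem ((hinv y).2 hy)]
  · rw [Set.indicator_of_notMem hy, Set.indicator_of_notMem (mt (hinv y).1 hy)]

theorem integrableOn_of_norm_le_one {S : Set F} (hS : volF F S < ⊤) {f : F → ℂ}
    (hf : Continuous f) (hb : ∀ y, ‖f y‖ ≤ 1) : IntegrableOn f S (volF F) := by
  have : IsFiniteMeasure ((volF F).restrict S) := ⟨by simpa using hS⟩
  exact Integrable.of_bound hf.aestronglyMeasurable 1 (Filter.Eventually.of_forall hb)

variable [IsUltrametricDist F]

omit [ProperSpace F] [MeasurableSpace F] [BorelSpace F] in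
theorem add_mem_ballF_iff {r h : F} (hh : ‖h‖ ≤ ‖r‖) (y : F) : y + h ∈ ballF r ↔ y ∈ ballF r := by
  rw [mem_ballF, mem_ballF]
  constructor <;> intro hy
  · simpa using norm_sub_le_of_le hy hh
  · exact norm_add_le_of_le hy hh

/-- A function whose integrals over all translates of a ball inside `S` vanish has integral `0`
over `S`. -/
theorem setIntegral_eq_zero_of_average {S : Set F} (hS : MeasurableSet S) (hfin : volF F S < ⊤)
    {r : F} (hr : r ≠ 0) (hinv : ∀ h, ‖h‖ ≤ ‖r‖ → ∀ y, y ∈ S → y + h ∈ S) {f : F → ℂ}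
    (hf : Continuous f) (hb : ∀ y, ‖f y‖ ≤ 1)
    (h0 : ∀ y ∈ S, ∫ h in ballF r, f (y + h) ∂(volF F) = 0) : ∫ y in S, f y ∂(volF F) = 0 := by
  have h1 : IsFiniteMeasure ((volF F).restrict S) := ⟨by simpa using hfin⟩
  have h2 : IsFiniteMeasure ((volF F).restrict (ballF r)) :=
    ⟨by simpa using volF_ballF_lt_top r⟩
  have hswap : ∫ h in ballF r, ∫ y in S, f (y + h) ∂(volF F) ∂(volF F) =
      ∫ y in S, ∫ h in ballF r, f (y + h) ∂(volF F) ∂(volF F) := by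
    refine integral_integral_swap ?_
    refine Integrable.of_bound (Continuous.aestronglyMeasurable ?_) 1
      (Filter.Eventually.of_forall fun p => hb _)
    exact hf.comp (continuous_snd.add continuous_fst)
  rw [setIntegral_congr_fun hS fun y hy => h0 y hy] at hswap
  have hl : ∀ h ∈ ballF r, ∫ y in S, f (y + h) ∂(volF F) = ∫ y in S, f y ∂(volF F) := by
    intro h hh
    refine setIntegral_add_right hS (fun y => ⟨fun hy => ?_, hinv h (mem_ballF.1 hh) y⟩) f
    simpa using hinv (-h) (by rw [norm_neg]; exact mem_ballF.1 hh) _ hy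
  rw [setIntegral_congr_fun (measurableSet_ballF r) hl] at hswap
  rw [setIntegral_const, integral_zero, smul_eq_zero] at hswap
  refine hswap.resolve_left ?_
  rw [measureReal_def, ENNReal.toReal_eq_zero_iff, not_or]
  exact ⟨(Metric.measure_closedBall_pos _ _ (norm_pos_iff.2 hr)).ne', (volF_ballF_lt_top r).ne⟩

end ballIntegrals

/-! ### Additive characters and quadratic Gauss integrals -/

/-- `δ` generates the different of `ψ`: the character `ψ` is trivial on `δ⁻¹𝔬`, but not on
`ϖ⁻¹δ⁻¹𝔬`. -/
structure HasDifferent {F : Type*} [NontriviallyNormedField F] (ψ : AddChar F Circle)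
    (δ ϖ : F) : Prop where
  continuous : Continuous ψ
  ne_zero : δ ≠ 0
  trivial : ∀ x, ‖x * δ‖ ≤ 1 → ψ x = 1
  nontrivial : ∃ x, ‖x * δ * ϖ‖ ≤ 1 ∧ ψ x ≠ 1

section gaussIntegrals

variable {F : Type*} [NontriviallyNormedField F] [ProperSpace F] [IsUltrametricDist F]
  {q : ℕ} {ϖ : F}

/-- A section of the reduction map. -/
def residueLift (k : 𝓀[F]) : F := (residueClass_surjective k).choose

theorem norm_residueLift_le (k : 𝓀[F]) : ‖residueLift k‖ ≤ 1 :=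
  (residueClass_surjective k).choose_spec.1

theorem residueClass_residueLift (k : 𝓀[F]) : residueClass (residueLift k) = k :=
  (residueClass_surjective k).choose_spec.2

variable [MeasurableSpace F] [BorelSpace F]

/-- The ball t𝔬 is the disjoint union of the translates of tϖ𝔬 by t times the lifted residue
classes, and `f` is constant on each of them. -/
theorem OddUniformizer.setIntegral_ballF_eq_sum (hϖ : OddUniformizer q ϖ) [Fintype 𝓀[F]] {t : F}
    (ht : t ≠ 0) {f : F → ℂ}
    (hf : ∀ l h : F, ‖l‖ ≤ 1 → ‖h‖ ≤ ‖ϖ‖ → f (t * (l + h)) = f (t * l)) :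
    ∫ y in ballF t, f y ∂(volF F) =
      ((volF F).real (ballF (t * ϖ)) : ℂ) * ∑ k : 𝓀[F], f (t * residueLift k) := by
  have ht' : 0 < ‖t‖ := norm_pos_iff.2 ht
  have hmem : ∀ k y, y ∈ Metric.closedBall (t * residueLift k) ‖t * ϖ‖ ↔
      ‖y‖ ≤ ‖t‖ ∧ residueClass (y / t) = k := by
    intro k y
    have e : y - t * residueLift k = t * (y / t - residueLift k) := by field_simp
    rw [mem_closedBall_iff_norm, e, norm_mul, norm_mul, mul_le_mul_iff_right₀ ht']
    have hle : ‖y‖ ≤ ‖t‖ ↔ ‖y / t‖ ≤ 1 := by rw [norm_div, div_le_one ht']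
    rw [hle]
    constructor
    · intro h
      have h1 : ‖y / t‖ ≤ 1 := by
        simpa using norm_add_le_of_le (h.trans hϖ.norm_lt_one.le) (norm_residueLift_le k)
      refine ⟨h1, ?_⟩
      rw [← residueClass_residueLift k, residueClass_eq_iff h1 (norm_residueLift_le k)]
      exact h.trans_lt hϖ.norm_lt_one
    · rintro ⟨h1, h2⟩
      rw [← residueClass_residueLift k, residueClass_eq_iff h1 (norm_residueLift_le k)] at h2
      exact hϖ.norm_le_of_lt_one h2
  have hU : ballF t = ⋃ k : 𝓀[F], Metric.closedBall (t * residueLift k) ‖t * ϖ‖ := by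
    ext y
    rw [Set.mem_iUnion, mem_ballF]
    simp only [hmem]
    exact ⟨fun h => ⟨_, h, rfl⟩, fun ⟨_, h, _⟩ => h⟩
  have hconst : ∀ k, ∀ y ∈ Metric.closedBall (t * residueLift k) ‖t * ϖ‖,
      f y = f (t * residueLift k) := by
    intro k y hy
    have e : y = t * (residueLift k + (y / t - residueLift k)) := by field_simp; ring
    have e' : y - t * residueLift k = t * (y / t - residueLift k) := by field_simp
    rw [mem_closedBall_iff_norm, e', norm_mul, norm_mul, mul_le_mul_iff_right₀ ht'] at hy
    rw [e, hf _ _ (norm_residueLift_le k) hy]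
  have hvol : ∀ c : F, (volF F).real (Metric.closedBall c ‖t * ϖ‖) =
      (volF F).real (ballF (t * ϖ)) := by
    intro c
    have : Metric.closedBall c ‖t * ϖ‖ = (fun x => x + (-c)) ⁻¹' ballF (t * ϖ) := by
      ext x
      simp [mem_closedBall_iff_norm, sub_eq_add_neg]
    rw [this, measureReal_def, measure_preimage_add_right, measureReal_def]
  rw [hU, integral_iUnion_fintype (fun k => measurableSet_closedBall)]
  · rw [Finset.mul_sum]
    refine Finset.sum_congr rfl fun k _ => ?_
    rw [setIntegral_congr_fun measurableSet_closedBall (hconst k), setIntegral_const, hvol,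
      Complex.real_smul]
  · intro k k' hk
    refine Set.disjoint_left.2 fun y hy hy' => hk ?_
    rw [hmem] at hy hy'
    exact hy.2.symm.trans hy'.2
  · intro k
    refine IntegrableOn.congr_fun (f := fun _ => f (t * residueLift k)) ?_
      (fun y hy => (hconst k y hy).symm) measurableSet_closedBall
    exact integrableOn_const (isCompact_closedBall _ _).measure_lt_top.ne

/-- Splitting a ball into q residue balls shows that volume and norm scale alike under ϖ; the
normalization at the ring of integers propagates in both directions. -/
theorem OddUniformizer.volF_real_ballF (hϖ : OddUniformizer q ϖ) (b : F) (hb : b ≠ 0) :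
    (volF F).real (ballF b) = ‖b‖ := by
  have := hϖ.finite_residueField
  let _ := Fintype.ofFinite 𝓀[F]
  have hcard : (Fintype.card 𝓀[F] : ℝ) = q := by rw [← Nat.card_eq_fintype_card, hϖ.card]
  have hstep : ∀ t : F, t ≠ 0 →
      (volF F).real (ballF t) = q * (volF F).real (ballF (t * ϖ)) := by
    intro t ht
    have h := hϖ.setIntegral_ballF_eq_sum ht (f := fun _ => (1 : ℂ)) (fun _ _ _ _ => rfl)
    rw [setIntegral_const, Finset.sum_const, Finset.card_univ, Complex.real_smul, nsmul_eq_mul,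
      mul_one, mul_one] at h
    rw [← hcard, mul_comm]
    exact_mod_cast h
  have hz : ∀ n : ℤ, (volF F).real (ballF (ϖ ^ n)) = ‖ϖ ^ n‖ := by
    have hq0 : (q : ℝ) ≠ 0 := by have := hϖ.one_lt_cast; linarith
    have hs : ∀ n : ℤ, (volF F).real (ballF (ϖ ^ n)) = q * (volF F).real (ballF (ϖ ^ (n + 1))) := by
      intro n
      rw [_root_.zpow_add₀ hϖ.ne_zero, zpow_one]
      exact hstep _ (zpow_ne_zero _ hϖ.ne_zero)
    have hs' : ∀ n : ℤ, ‖ϖ ^ n‖ = q * ‖ϖ ^ (n + 1)‖ := by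
      intro n
      rw [_root_.zpow_add₀ hϖ.ne_zero, zpow_one, norm_mul, hϖ.norm]
      field_simp
    intro n
    induction n using Int.induction_on with
    | zero => rw [zpow_zero, measureReal_def, volF_ballF_one]; simp
    | succ n ih =>
      have := hs n
      rw [ih, hs'] at this
      exact (mul_left_cancel₀ hq0 this).symm
    | pred n ih =>
      rw [hs, hs', sub_add_cancel, ih]
  obtain ⟨n, hn⟩ := hϖ.exists_norm_eq hb
  have : ballF b = ballF (ϖ ^ n) := by
    simp only [ballF]
    rw [_root_.norm_zpow, hn]
  rw [this, hz, _root_.norm_zpow, hn]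

namespace HasDifferent

variable {ψ : AddChar F Circle} {δ : F}

theorem continuous_coe (hψ : HasDifferent ψ δ ϖ) {f : F → F} (hf : Continuous f) :
    Continuous fun y => (ψ (f y) : ℂ) :=
  continuous_subtype_val.comp (hψ.continuous.comp hf)

theorem integral_eq_vol (hψ : HasDifferent ψ δ ϖ) (hϖ : OddUniformizer q ϖ) {x b : F} (hb : b ≠ 0)
    (hx : ‖x * b * δ‖ ≤ 1) : ∫ y in ballF b, (ψ (x * y) : ℂ) ∂(volF F) = (‖b‖ : ℂ) := by
  have : ∀ y ∈ ballF b, (ψ (x * y) : ℂ) = 1 := by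
    intro y hy
    rw [hψ.trivial _ ?_, Circle.coe_one]
    refine le_trans ?_ hx
    simp only [norm_mul]
    gcongr
    exact mem_ballF.1 hy
  rw [setIntegral_congr_fun (measurableSet_ballF b) this, setIntegral_const,
    hϖ.volF_real_ballF b hb]
  simp

/-- Orthogonality: the translation by y₀/x preserves the ball and multiplies the integral by ψ(y₀) ≠
1. -/
theorem integral_eq_zero (hψ : HasDifferent ψ δ ϖ) (hϖ : OddUniformizer q ϖ) {x b : F}
    (hx : 1 < ‖x * b * δ‖) : ∫ y in ballF b, (ψ (x * y) : ℂ) ∂(volF F) = 0 := by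
  obtain ⟨y₀, hy₀, hne⟩ := hψ.nontrivial
  have hprod : x * b * δ ≠ 0 := norm_pos_iff.1 (one_pos.trans hx)
  obtain ⟨⟨hx0, hb0⟩, hδ0⟩ : (x ≠ 0 ∧ b ≠ 0) ∧ δ ≠ 0 := by
    simpa only [mul_ne_zero_iff] using hprod
  have h1 : ‖(x * b * δ)⁻¹‖ ≤ ‖ϖ‖ := hϖ.norm_le_of_lt_one (by
    rw [norm_inv]; exact inv_lt_one_of_one_lt₀ hx)
  have h2 : ‖y₀ / x‖ ≤ ‖b‖ := by
    have e : y₀ / x = b * ((y₀ * δ * ϖ) * ((x * b * δ)⁻¹ * ϖ⁻¹)) := by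
      have := hϖ.ne_zero
      field_simp
    rw [e, norm_mul]
    refine mul_le_of_le_one_right (norm_nonneg _) ?_
    rw [norm_mul]
    refine mul_le_one₀ hy₀ (norm_nonneg _) ?_
    rw [norm_mul, norm_inv ϖ]
    calc _ ≤ ‖ϖ‖ * ‖ϖ‖⁻¹ := by gcongr
      _ = 1 := mul_inv_cancel₀ hϖ.norm_pos.ne'
  have h3 := setIntegral_add_right (measurableSet_ballF b) (add_mem_ballF_iff h2)
    (fun y => (ψ (x * y) : ℂ))
  have h4 : ∀ y, (ψ (x * (y + y₀ / x)) : ℂ) = (ψ y₀ : ℂ) * ψ (x * y) := by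
    intro y
    rw [mul_add, mul_div_cancel₀ _ hx0, AddChar.map_add_eq_mul, Circle.coe_mul, mul_comm]
  simp only [h4] at h3
  rw [integral_const_mul] at h3
  by_contra h
  refine hne (Circle.ext ?_)
  rw [Circle.coe_one]
  exact mul_right_cancel₀ h (h3.trans (one_mul _).symm)

/-- Gauss integrals `∫ ψ(a (y + z)²)` over a ball vanish if `z` is outside of the ball, unless the
ball is small. -/
theorem integral_quadratic_eq_zero (hψ : HasDifferent ψ δ ϖ) (hϖ : OddUniformizer q ϖ)
    {a R : F} {S : Set F} (hS : MeasurableSet S) (hfin : volF F S < ⊤)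
    (hinv : ∀ h, ‖h‖ ≤ ‖R‖ → ∀ y, y ∈ S → y + h ∈ S)
    (hR : 1 ≤ ‖a * δ * R ^ 2‖) (z : F) (hz : ∀ y ∈ S, ‖R‖ < ‖y + z‖) :
    ∫ y in S, (ψ (a * (y + z) ^ 2) : ℂ) ∂(volF F) = 0 := by
  have hne : a * δ * R ^ 2 ≠ 0 := norm_pos_iff.1 (one_pos.trans_le hR)
  obtain ⟨⟨ha, hδ⟩, hR0⟩ : (a ≠ 0 ∧ δ ≠ 0) ∧ R ≠ 0 := by
    simpa only [mul_ne_zero_iff, ne_eq, OfNat.ofNat_ne_zero, not_false_eq_true, pow_eq_zero_iff]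
      using hne
  -- On the ball of radius |r| the term ψ(a h²) is trivial, while the linear term ψ(2a(y + z)h) is a
  -- non-trivial character as soon as |y + z| > |R|.
  set r : F := (a * δ * R)⁻¹ with hr
  have hr0 : r ≠ 0 := inv_ne_zero (mul_ne_zero (mul_ne_zero ha hδ) hR0)
  have hrR : ‖r‖ ≤ ‖R‖ := by
    have e : r = R * (a * δ * R ^ 2)⁻¹ := by rw [hr]; field_simp
    rw [e, norm_mul, norm_inv]
    exact mul_le_of_le_one_right (norm_nonneg _) (inv_le_one_of_one_le₀ hR)
  have h2r : ‖a * r ^ 2 * δ‖ ≤ 1 := by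
    have e : a * r ^ 2 * δ = (a * δ * R ^ 2)⁻¹ := by rw [hr]; field_simp
    rw [e, norm_inv]
    exact inv_le_one_of_one_le₀ hR
  refine setIntegral_eq_zero_of_average hS hfin hr0 (fun h hh => hinv h (hh.trans hrR))
    (hψ.continuous_coe (by fun_prop)) (fun y => (Circle.norm_coe _).le) fun y hy => ?_
  have hexp : ∀ h ∈ ballF r, (ψ (a * (y + h + z) ^ 2) : ℂ) =
      (ψ (a * (y + z) ^ 2) : ℂ) * ψ (2 * a * (y + z) * h) := by
    intro h hh
    have e : a * (y + h + z) ^ 2 = a * (y + z) ^ 2 + 2 * a * (y + z) * h + a * h ^ 2 := by ring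
    rw [e, AddChar.map_add_eq_mul, AddChar.map_add_eq_mul, hψ.trivial (a * h ^ 2), mul_one,
      Circle.coe_mul]
    refine le_trans ?_ h2r
    simp only [norm_mul, norm_pow]
    gcongr
    exact mem_ballF.1 hh
  rw [setIntegral_congr_fun (measurableSet_ballF r) hexp, integral_const_mul,
    hψ.integral_eq_zero hϖ, mul_zero]
  have e : 2 * a * (y + z) * r * δ = 2 * ((y + z) / R) := by rw [hr]; field_simp
  rw [e, norm_mul, hϖ.norm_two, one_mul, norm_div, one_lt_div (norm_pos_iff.2 hR0)]
  exact hz y hy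

/-- The shell between the two balls contributes nothing. So Gauss integrals over growing balls
stabilize, and no conditionally convergent integral over F is needed. -/
theorem integral_quadratic_ballF_eq (hψ : HasDifferent ψ δ ϖ) (hϖ : OddUniformizer q ϖ) {a R R' : F}
    (hR : 1 ≤ ‖a * δ * R ^ 2‖) (hRR' : ‖R‖ ≤ ‖R'‖) :
    ∫ y in ballF R', (ψ (a * y ^ 2) : ℂ) ∂(volF F) =
      ∫ y in ballF R, (ψ (a * y ^ 2) : ℂ) ∂(volF F) := by
  have hsub : ballF R ⊆ ballF R' := Metric.closedBall_subset_closedBall hRR'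
  have hint : IntegrableOn (fun y => (ψ (a * y ^ 2) : ℂ)) (ballF R') (volF F) :=
    integrableOn_of_norm_le_one (volF_ballF_lt_top R') (hψ.continuous_coe (by fun_prop))
      (fun y => (Circle.norm_coe _).le)
  have h := setIntegral_sdiff (measurableSet_ballF R) hint hsub
  have h0 := hψ.integral_quadratic_eq_zero hϖ (S := ballF R' \ ballF R)
    ((measurableSet_ballF R').diff (measurableSet_ballF R))
    ((measure_mono Set.sdiff_subset).trans_lt (volF_ballF_lt_top R'))
    (fun h hh y hy => ⟨(add_mem_ballF_iff (hh.trans hRR') y).2 hy.1,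
      fun hm => hy.2 ((add_mem_ballF_iff hh y).1 hm)⟩) hR 0
    (fun y hy => by rw [add_zero]; exact not_le.1 fun hle => hy.2 (mem_ballF.2 hle))
  simp only [add_zero] at h0
  rw [h0] at h
  exact (sub_eq_zero.1 h.symm)

end HasDifferent

end gaussIntegrals

/-! ### Quadratic Gauss sums over the residue field and the values of Gauss integrals -/

section gaussSums

variable {F : Type*} [NontriviallyNormedField F] [ProperSpace F] [IsUltrametricDist F]
  {q : ℕ} {ϖ δ : F} {ψ : AddChar F Circle}

/-- The quadratic Gauss sum over the residue field that is attached to `ψ` and an element `e` of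
order `-1` with respect to `ψ`. -/
def residueGauss (ψ : AddChar F Circle) (e : F) : ℂ :=
  ∑ᶠ k : 𝓀[F], (ψ (e * residueLift k ^ 2) : ℂ)

namespace HasDifferent

theorem map_mul_eq_of_residueClass (hψ : HasDifferent ψ δ ϖ) (hϖ : OddUniformizer q ϖ) {e x y : F}
    (he : ‖e * δ * ϖ‖ = 1) (hx : ‖x‖ ≤ 1) (hy : ‖y‖ ≤ 1) (h : residueClass x = residueClass y) :
    ψ (e * x) = ψ (e * y) := by
  have h1 := hϖ.norm_le_of_lt_one ((residueClass_eq_iff hx hy).1 h)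
  have h2 : e * x = e * y + e * (x - y) := by ring
  rw [h2, AddChar.map_add_eq_mul, hψ.trivial (e * (x - y)), mul_one]
  calc ‖e * (x - y) * δ‖ = ‖e‖ * ‖δ‖ * ‖x - y‖ := by simp only [norm_mul]; ring
    _ ≤ ‖e‖ * ‖δ‖ * ‖ϖ‖ := by gcongr
    _ = 1 := by rw [← he, norm_mul, norm_mul]

/-- The additive character of the residue field induced by `x ↦ ψ(e x)`. -/
def residueChar (hψ : HasDifferent ψ δ ϖ) (hϖ : OddUniformizer q ϖ) {e : F}
    (he : ‖e * δ * ϖ‖ = 1) : AddChar 𝓀[F] ℂ where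
  toFun k := (ψ (e * residueLift k) : ℂ)
  map_zero_eq_one' := by
    rw [hψ.map_mul_eq_of_residueClass hϖ he (norm_residueLift_le 0) (y := 0) (by simp), mul_zero,
      AddChar.map_zero_eq_one, Circle.coe_one]
    rw [residueClass_residueLift, (residueClass_eq_zero_iff (by simp)).2 (by simp)]
  map_add_eq_mul' k k' := by
    rw [← Circle.coe_mul, ← AddChar.map_add_eq_mul, ← mul_add]
    have h := norm_add_le_of_le (norm_residueLift_le k) (norm_residueLift_le k')
    rw [hψ.map_mul_eq_of_residueClass hϖ he (norm_residueLift_le _) h]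
    rw [residueClass_residueLift, residueClass_add (norm_residueLift_le k) (norm_residueLift_le k'),
      residueClass_residueLift, residueClass_residueLift]

theorem residueChar_residueClass (hψ : HasDifferent ψ δ ϖ) (hϖ : OddUniformizer q ϖ) {e : F}
    (he : ‖e * δ * ϖ‖ = 1) {x : F} (hx : ‖x‖ ≤ 1) :
    hψ.residueChar hϖ he (residueClass x) = (ψ (e * x) : ℂ) :=
  congrArg (fun z : Circle => (z : ℂ)) (hψ.map_mul_eq_of_residueClass hϖ he (norm_residueLift_le _) hx
    (residueClass_residueLift _))

theorem residueChar_isPrimitive (hψ : HasDifferent ψ δ ϖ) (hϖ : OddUniformizer q ϖ) {e : F}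
    (he : ‖e * δ * ϖ‖ = 1) : (hψ.residueChar hϖ he).IsPrimitive := by
  refine AddChar.IsPrimitive.of_ne_one fun h => ?_
  obtain ⟨y, hy, hne⟩ := hψ.nontrivial
  have he0 : e ≠ 0 := by
    rintro rfl
    simp at he
  have hye : ‖y / e‖ ≤ 1 := by
    have h1 : y / e = y * δ * ϖ * (e * δ * ϖ)⁻¹ := by
      have := hψ.ne_zero
      have := hϖ.ne_zero
      field_simp
    rw [h1, norm_mul, norm_inv, he, inv_one, mul_one]
    exact hy
  have h2 := hψ.residueChar_residueClass hϖ he hye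
  rw [h, AddChar.one_apply, mul_div_cancel₀ _ he0] at h2
  exact hne (Circle.ext (h2.symm.trans Circle.coe_one.symm))

-- An element a of the residue field has 1 + χ(a) square roots; the summand 1 contributes the sum of
-- a non-trivial additive character, which is 0.
open scoped Classical in
theorem residueGauss_eq (hψ : HasDifferent ψ δ ϖ) (hϖ : OddUniformizer q ϖ) [Fintype 𝓀[F]] {e : F}
    (he : ‖e * δ * ϖ‖ = 1) : residueGauss ψ e =
      gaussSum ((quadraticChar 𝓀[F]).ringHomComp (Int.castRingHom ℂ)) (hψ.residueChar hϖ he) := by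
  have hprim := hψ.residueChar_isPrimitive hϖ he
  set Ψ := hψ.residueChar hϖ he with hΨ
  have h1 : ∀ k : 𝓀[F], (ψ (e * residueLift k ^ 2) : ℂ) = Ψ (k ^ 2) := by
    intro k
    have hle : ‖residueLift k ^ 2‖ ≤ 1 := by
      rw [norm_pow]
      exact pow_le_one₀ (norm_nonneg _) (norm_residueLift_le k)
    rw [hΨ, ← hψ.residueChar_residueClass hϖ he hle, pow_two, pow_two,
      residueClass_mul (norm_residueLift_le k) (norm_residueLift_le k), residueClass_residueLift]
  have h2 : ∑ k : 𝓀[F], Ψ (k ^ 2) =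
      ∑ a : 𝓀[F], ((Finset.univ.filter fun k : 𝓀[F] => k ^ 2 = a).card : ℂ) * Ψ a := by
    rw [← Finset.sum_fiberwise (s := Finset.univ) (g := fun k : 𝓀[F] => k ^ 2)]
    refine Finset.sum_congr rfl fun a _ => ?_
    rw [Finset.sum_congr rfl (g := fun _ => Ψ a) fun k hk => by rw [(Finset.mem_filter.1 hk).2],
      Finset.sum_const, nsmul_eq_mul]
  have h3 : ∀ a : 𝓀[F], ((Finset.univ.filter fun k : 𝓀[F] => k ^ 2 = a).card : ℂ) =
      (quadraticChar 𝓀[F] a : ℂ) + 1 := by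
    intro a
    have := quadraticChar_card_sqrts hϖ.ringChar_ne_two a
    have h4 : ({x : 𝓀[F] | x ^ 2 = a} : Set 𝓀[F]).toFinset =
        Finset.univ.filter fun k : 𝓀[F] => k ^ 2 = a := by
      ext x; simp
    rw [h4] at this
    exact_mod_cast this
  have hne : Ψ ≠ 1 := by
    intro h
    rw [h] at hprim
    exact hprim one_ne_zero (by simp)
  rw [residueGauss, finsum_eq_sum_of_fintype, Finset.sum_congr rfl fun k _ => h1 k, h2, gaussSum]
  simp only [h3, add_mul, one_mul, Finset.sum_add_distrib]
  rw [AddChar.sum_eq_zero_of_ne_one hne, add_zero]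
  rfl

theorem quadraticChar_residueClass (hϖ : OddUniformizer q ϖ) [Fintype 𝓀[F]] [DecidableEq 𝓀[F]]
    {u : F} (hu : ‖u‖ = 1) : quadraticChar 𝓀[F] (residueClass u) = (unitChar q ϖ u : ℤ) := by
  classical
  rw [hϖ.unitChar_of_norm_one hu]
  split_ifs with h
  · rw [(quadraticChar_one_iff_isSquare (OddUniformizer.residueClass_ne_zero hu)).2 h]; rfl
  · rw [quadraticChar_neg_one_iff_not_isSquare.2 h]; rfl

theorem residueGauss_sq (hψ : HasDifferent ψ δ ϖ) (hϖ : OddUniformizer q ϖ) {e : F}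
    (he : ‖e * δ * ϖ‖ = 1) : residueGauss ψ e ^ 2 = ((unitChar q ϖ (-1 : F) : ℤ) : ℂ) * q := by
  classical
  have := hϖ.finite_residueField
  have := Fintype.ofFinite 𝓀[F]
  rw [hψ.residueGauss_eq hϖ he, gaussSum_sq
    ((MulChar.ringHomComp_ne_one_iff (RingHom.injective_int _)).2
      (quadraticChar_ne_one hϖ.ringChar_ne_two))
    ((quadraticChar_isQuadratic _).comp _) (hψ.residueChar_isPrimitive hϖ he),
    ← quadraticChar_residueClass hϖ (by simp), residueClass_neg (by simp), residueClass_one, hϖ.card,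
    Nat.card_eq_fintype_card]
  rfl

/-- The factor u shifts the additive character by a residue class, and a shifted Gauss sum changes
by χ(u), which is its own inverse. -/
theorem residueGauss_mul (hψ : HasDifferent ψ δ ϖ) (hϖ : OddUniformizer q ϖ) {e u : F}
    (he : ‖e * δ * ϖ‖ = 1) (hu : ‖u‖ = 1) :
    residueGauss ψ (u * e) = ((unitChar q ϖ u : ℤ) : ℂ) * residueGauss ψ e := by
  classical
  have := hϖ.finite_residueField
  have := Fintype.ofFinite 𝓀[F]
  have hue : ‖u * e * δ * ϖ‖ = 1 := by
    rw [mul_assoc, mul_assoc, norm_mul, hu, one_mul, ← mul_assoc, he]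
  have hk := OddUniformizer.residueClass_ne_zero hu
  have hshift : hψ.residueChar hϖ hue = (hψ.residueChar hϖ he).mulShift (residueClass u) := by
    ext k
    obtain ⟨x, hx, rfl⟩ := residueClass_surjective k
    rw [AddChar.mulShift_apply, ← residueClass_mul hu.le hx, hψ.residueChar_residueClass hϖ hue hx,
      hψ.residueChar_residueClass hϖ he (by rw [norm_mul, hu, one_mul]; exact hx)]
    congr 2
    ring
  have h := gaussSum_mulShift ((quadraticChar 𝓀[F]).ringHomComp (Int.castRingHom ℂ))
    (hψ.residueChar hϖ he) (Units.mk0 _ hk)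
  rw [Units.val_mk0, ← hshift, ← hψ.residueGauss_eq hϖ hue, ← hψ.residueGauss_eq hϖ he,
    MulChar.ringHomComp_apply, quadraticChar_residueClass hϖ hu] at h
  rw [← h, ← mul_assoc]
  have : (((unitChar q ϖ u : ℤˣ) : ℤ) : ℂ) * ((unitChar q ϖ u : ℤˣ) : ℤ) = 1 := by
    rw [← Int.cast_mul, ← Units.val_mul, Int.units_mul_self, Units.val_one, Int.cast_one]
  change _ = (((unitChar q ϖ u : ℤˣ) : ℤ) : ℂ) * ((unitChar q ϖ u : ℤˣ) : ℤ) * _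
  rw [this, one_mul]

theorem residueGauss_ne_zero (hψ : HasDifferent ψ δ ϖ) (hϖ : OddUniformizer q ϖ) {e : F}
    (he : ‖e * δ * ϖ‖ = 1) : residueGauss ψ e ≠ 0 := by
  intro h
  have h1 := hψ.residueGauss_sq hϖ he
  rw [h, zero_pow two_ne_zero] at h1
  have h2 : (q : ℂ) ≠ 0 := by exact_mod_cast (zero_lt_one.trans hϖ.one_lt).ne'
  have h3 : (((unitChar q ϖ (-1 : F) : ℤˣ) : ℤ) : ℂ) ≠ 0 := by
    exact_mod_cast (unitChar q ϖ (-1 : F)).ne_zero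
  exact mul_ne_zero h3 h2 h1.symm

variable [MeasurableSpace F] [BorelSpace F]

/-- The ball of radius |t| is already in the stable range, and the integrand is still identically 1
on it. -/
theorem integral_quadratic_of_even (hψ : HasDifferent ψ δ ϖ) (hϖ : OddUniformizer q ϖ) {a t R : F}
    (ht : ‖a * δ * t ^ 2‖ = 1) (hR : ‖t‖ ≤ ‖R‖) :
    ∫ y in ballF R, (ψ (a * y ^ 2) : ℂ) ∂(volF F) = (‖t‖ : ℂ) := by
  have ht0 : t ≠ 0 := by
    rintro rfl
    simp at ht
  rw [hψ.integral_quadratic_ballF_eq hϖ ht.ge hR]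
  have : ∀ y ∈ ballF t, (ψ (a * y ^ 2) : ℂ) = 1 := by
    intro y hy
    rw [hψ.trivial _ ?_, Circle.coe_one]
    refine le_trans ?_ ht.le
    have e : ∀ z : F, ‖a * z ^ 2 * δ‖ = ‖a‖ * ‖δ‖ * ‖z‖ ^ 2 := fun z => by
      simp only [norm_mul, norm_pow]; ring
    rw [mul_right_comm a δ, e, e]
    gcongr
    exact mem_ballF.1 hy
  rw [setIntegral_congr_fun (measurableSet_ballF t) this, setIntegral_const,
    hϖ.volF_real_ballF t ht0]
  simp

/-- The ball of radius |t| is in the stable range, and there the integrand depends only on y/t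
modulo ϖ; so the integral is a finite sum over the residue field. -/
theorem integral_quadratic_of_odd (hψ : HasDifferent ψ δ ϖ) (hϖ : OddUniformizer q ϖ) {a t R : F}
    (ht : ‖a * t ^ 2 * δ * ϖ‖ = 1) (hR : ‖t‖ ≤ ‖R‖) :
    ∫ y in ballF R, (ψ (a * y ^ 2) : ℂ) ∂(volF F) =
      (‖t * ϖ‖ : ℂ) * residueGauss ψ (a * t ^ 2) := by
  have := hϖ.finite_residueField
  have := Fintype.ofFinite 𝓀[F]
  have ht0 : t ≠ 0 := by
    rintro rfl
    simp at ht
  rw [hψ.integral_quadratic_ballF_eq hϖ (R := t) ?_ hR, hϖ.setIntegral_ballF_eq_sum ht0,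
    hϖ.volF_real_ballF _ (mul_ne_zero ht0 hϖ.ne_zero), residueGauss, finsum_eq_sum_of_fintype]
  · simp only [mul_pow, mul_assoc]
  · intro l h hl hh
    have e : a * (t * (l + h)) ^ 2 = a * t ^ 2 * (l + h) ^ 2 := by ring
    have e' : a * (t * l) ^ 2 = a * t ^ 2 * l ^ 2 := by ring
    have hlh : ‖l + h‖ ≤ 1 := norm_add_le_of_le hl (hh.trans hϖ.norm_lt_one.le)
    have hpow : ∀ {x : F}, ‖x‖ ≤ 1 → ‖x ^ 2‖ ≤ 1 := fun hx => by
      rw [norm_pow]; exact pow_le_one₀ (norm_nonneg _) hx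
    rw [e, e', hψ.map_mul_eq_of_residueClass hϖ ht (hpow hlh) (hpow hl)]
    rw [pow_two, pow_two, residueClass_mul hlh hlh, residueClass_mul hl hl,
      (residueClass_eq_iff hlh hl).2]
    rw [add_sub_cancel_left]
    exact hh.trans_lt hϖ.norm_lt_one
  · have e : a * t ^ 2 * δ * ϖ = (a * δ * t ^ 2) * ϖ := by ring
    rw [e, norm_mul] at ht
    by_contra hlt
    have := mul_lt_mul'' (not_le.1 hlt) hϖ.norm_lt_one (norm_nonneg _) (norm_nonneg _)
    rw [ht] at this
    linarith

end HasDifferent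

end gaussSums

/-! ### The Weil constants -/

section schwartz

variable {F : Type*} [NontriviallyNormedField F]

theorem IsSchwartz.exists_support_subset {φ : F → ℂ} (hφ : IsSchwartz φ) :
    ∃ M : F, M ≠ 0 ∧ ∀ y, φ y ≠ 0 → ‖y‖ ≤ ‖M‖ := by
  obtain ⟨C, hC⟩ := hφ.2.isCompact.isBounded.exists_norm_le
  obtain ⟨M, hM⟩ := NormedField.exists_lt_norm F (max C 0)
  refine ⟨M, norm_pos_iff.1 ((le_max_right _ _).trans_lt hM), fun y hy => ?_⟩
  exact (hC y (subset_tsupport φ hy)).trans ((le_max_left _ _).trans hM.le)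

/-- A Lebesgue number for the covering of the compact support by the fibres gives a uniform radius.
A point outside of the support whose translate lies inside is treated by translating back. -/
theorem IsSchwartz.exists_add_eq {φ : F → ℂ} (hφ : IsSchwartz φ) :
    ∃ r : F, r ≠ 0 ∧ ∀ h, ‖h‖ ≤ ‖r‖ → ∀ y, φ (y + h) = φ y := by
  obtain ⟨ε, hε, hb⟩ := lebesgue_number_lemma_of_metric (s := tsupport φ) (c := fun z => φ ⁻¹' {z})
    hφ.2 (fun z => IsLocallyConstant.iff_isOpen_fiber.1 hφ.1 z)
    (fun x _ => Set.mem_iUnion.2 ⟨φ x, rfl⟩)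
  obtain ⟨r, hr0, hr⟩ := NormedField.exists_norm_lt F hε
  have key : ∀ y ∈ tsupport φ, ∀ h, ‖h‖ ≤ ‖r‖ → φ (y + h) = φ y := by
    intro y hy h hh
    obtain ⟨z, hz⟩ := hb y hy
    have h1 : φ y = z := hz (Metric.mem_ball_self hε)
    have h2 : φ (y + h) = z := hz (by
      rw [mem_ball_iff_norm, add_sub_cancel_left]
      exact hh.trans_lt hr)
    rw [h1, h2]
  refine ⟨r, norm_pos_iff.1 hr0, fun h hh y => ?_⟩
  by_cases hy : y ∈ tsupport φ
  · exact key y hy h hh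
  · by_cases hy' : y + h ∈ tsupport φ
    · have := key _ hy' (-h) (by rwa [norm_neg])
      rw [add_neg_cancel_right] at this
      exact this.symm
    · rw [image_eq_zero_of_notMem_tsupport hy, image_eq_zero_of_notMem_tsupport hy']

theorem IsSchwartz.exists_norm_le {φ : F → ℂ} (hφ : IsSchwartz φ) : ∃ C : ℝ, ∀ y, ‖φ y‖ ≤ C :=
  hφ.2.exists_bound_of_continuous hφ.1.continuous

theorem isSchwartz_indicator_closedBall [ProperSpace F] [IsUltrametricDist F] {r : ℝ}
    (hr : r ≠ 0) : IsSchwartz (Set.indicator (Metric.closedBall (0 : F) r) (1 : F → ℂ)) := by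
  constructor
  · rw [IsLocallyConstant.iff_eventually_eq]
    intro x
    by_cases hx : x ∈ Metric.closedBall (0 : F) r
    · filter_upwards [(IsUltrametricDist.isOpen_closedBall (0 : F) hr).mem_nhds hx] with y hy
      rw [Set.indicator_of_mem hx, Set.indicator_of_mem hy]
      rfl
    · filter_upwards [Metric.isClosed_closedBall.isOpen_compl.mem_nhds hx] with y hy
      rw [Set.indicator_of_notMem hx, Set.indicator_of_notMem hy]
  · exact HasCompactSupport.intro (isCompact_closedBall 0 r)
      fun x hx => Set.indicator_of_notMem hx _

end schwartz

/-! ### The Weil constant as the inverse of a Gauss integral -/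

section weilConstants

variable {F : Type*} [NontriviallyNormedField F] [ProperSpace F] [IsUltrametricDist F]
  {q : ℕ} {ϖ δ : F} {ψ : AddChar F Circle}

namespace HasDifferent

section

variable [MeasurableSpace F] [BorelSpace F]

theorem exists_map_mul_ne_one (hψ : HasDifferent ψ δ ϖ) (hϖ : OddUniformizer q ϖ) {x b : F}
    (hx : 1 < ‖x * b * δ‖) : ∃ h, ‖h‖ ≤ ‖b‖ ∧ ψ (x * h) ≠ 1 := by
  by_contra! hcon
  have hb : b ≠ 0 := by
    rintro rfl
    simp at hx
    linarith
  have h := hψ.integral_eq_zero hϖ hx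
  have h1 : ∀ y ∈ ballF b, (ψ (x * y) : ℂ) = 1 := fun y hy => by
    rw [hcon y (mem_ballF.1 hy), Circle.coe_one]
  rw [setIntegral_congr_fun (measurableSet_ballF b) h1, setIntegral_const,
    hϖ.volF_real_ballF b hb] at h
  simp [hb] at h

theorem fourierF_eq_zero (hψ : HasDifferent ψ δ ϖ) (hϖ : OddUniformizer q ϖ) {φ : F → ℂ} {r x : F}
    (hr : ∀ h, ‖h‖ ≤ ‖r‖ → ∀ y, φ (y + h) = φ y) (hx : 1 < ‖x * r * δ‖) :
    fourierF ψ δ φ x = 0 := by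
  obtain ⟨h, hh, hne⟩ := hψ.exists_map_mul_ne_one hϖ hx
  have h1 := integral_add_right_eq_self (μ := volF F) (fun y => φ y * (ψ (x * y) : ℂ)) h
  have h2 : ∀ y, φ (y + h) * (ψ (x * (y + h)) : ℂ) = (ψ (x * h) : ℂ) * (φ y * ψ (x * y)) := by
    intro y
    rw [hr h hh, mul_add, AddChar.map_add_eq_mul, Circle.coe_mul]
    ring
  simp only [h2] at h1
  rw [integral_const_mul] at h1
  rw [fourierF, integralF_eq]
  refine mul_eq_zero_of_right _ ?_
  by_contra h0
  refine hne (Circle.ext ?_)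
  rw [Circle.coe_one]
  exact mul_right_cancel₀ h0 (h1.trans (one_mul _).symm)

/-- Fubini, then completion of the square: xy - x²/(4a) = a y² - (x - 2ay)²/(4a). The radius has to
exceed the support of the Fourier transform as well as |2aM|; then the shift by 2ay preserves the
ball, and the inner Gauss integral no longer depends on y. -/
theorem integral_fourierF (hψ : HasDifferent ψ δ ϖ) (hϖ : OddUniformizer q ϖ) {φ : F → ℂ}
    (hφ : IsSchwartz φ) {a : F} (ha : a ≠ 0) : ∃ R₀ : ℝ, ∀ R : F, R₀ ≤ ‖R‖ →
      integralF (fun y => fourierF ψ δ φ y * (ψ (-(y ^ 2 / (4 * a))) : ℂ)) =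
        ((‖δ‖ ^ (1 / 2 : ℝ) : ℝ) : ℂ) *
          (∫ y in ballF R, (ψ (-(1 / (4 * a)) * y ^ 2) : ℂ) ∂(volF F)) *
          integralF (fun y => φ y * (ψ (a * y ^ 2) : ℂ)) := by
  obtain ⟨M, hM0, hM⟩ := hφ.exists_support_subset
  obtain ⟨r, hr0, hr⟩ := hφ.exists_add_eq
  obtain ⟨C, hC⟩ := hφ.exists_norm_le
  have h2 : (2 : F) ≠ 0 := hϖ.two_ne_zero
  refine ⟨max ‖r * δ‖⁻¹ ‖2 * a * M‖, fun R hR => ?_⟩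
  have hR1 := (le_max_left _ _).trans hR
  have hR2 := (le_max_right _ _).trans hR
  have hrδ : 0 < ‖r * δ‖ := norm_pos_iff.2 (mul_ne_zero hr0 hψ.ne_zero)
  have hvanish : ∀ x, x ∉ ballF R →
      fourierF ψ δ φ x * (ψ (-(x ^ 2 / (4 * a))) : ℂ) = 0 := by
    intro x hx
    rw [mem_ballF, not_le] at hx
    rw [hψ.fourierF_eq_zero hϖ hr, zero_mul]
    rw [mul_assoc, norm_mul]
    have := hR1.trans_lt hx
    rwa [inv_lt_iff_one_lt_mul₀ hrδ] at this
  have hsupp : ∀ f : F → ℂ, ∫ y, φ y * f y ∂(volF F) = ∫ y in ballF M, φ y * f y ∂(volF F) := by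
    intro f
    refine (setIntegral_eq_integral_of_forall_compl_eq_zero fun y hy => ?_).symm
    rw [mem_ballF] at hy
    by_cases h : φ y = 0
    · rw [h, zero_mul]
    · exact absurd (hM y h) hy
  have e1 : IsFiniteMeasure ((volF F).restrict (ballF R)) :=
    ⟨by simpa using volF_ballF_lt_top R⟩
  have e2 : IsFiniteMeasure ((volF F).restrict (ballF M)) :=
    ⟨by simpa using volF_ballF_lt_top M⟩
  have hcφ : Continuous φ := hφ.1.continuous
  have hcψ : Continuous fun y => (ψ y : ℂ) := hψ.continuous_coe continuous_id
  have hswap : ∫ x in ballF R, ∫ y in ballF M,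
        φ y * (ψ (x * y) : ℂ) * (ψ (-(x ^ 2 / (4 * a))) : ℂ) ∂(volF F) ∂(volF F) =
      ∫ y in ballF M, ∫ x in ballF R,
        φ y * (ψ (x * y) : ℂ) * (ψ (-(x ^ 2 / (4 * a))) : ℂ) ∂(volF F) ∂(volF F) := by
    refine integral_integral_swap (Integrable.of_bound (Continuous.aestronglyMeasurable ?_) C
      (Filter.Eventually.of_forall fun p => ?_))
    · exact ((hcφ.comp continuous_snd).mul (hcψ.comp (continuous_fst.mul continuous_snd))).mul
        (hcψ.comp ((continuous_fst.pow 2).div_const _).neg)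
    · simp only [Function.uncurry, norm_mul, Circle.norm_coe, mul_one]
      exact hC _
  have hinner : ∀ y ∈ ballF M, ∫ x in ballF R,
        φ y * (ψ (x * y) : ℂ) * (ψ (-(x ^ 2 / (4 * a))) : ℂ) ∂(volF F) =
      (∫ x in ballF R, (ψ (-(1 / (4 * a)) * x ^ 2) : ℂ) ∂(volF F)) *
        (φ y * (ψ (a * y ^ 2) : ℂ)) := by
    intro y hy
    have hle : ‖-(2 * a * y)‖ ≤ ‖R‖ := by
      refine le_trans ?_ hR2
      rw [norm_neg, norm_mul, norm_mul _ M]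
      gcongr
      exact mem_ballF.1 hy
    have hsq : ∀ x, φ y * (ψ (x * y) : ℂ) * (ψ (-(x ^ 2 / (4 * a))) : ℂ) =
        (ψ (-(1 / (4 * a)) * (x + -(2 * a * y)) ^ 2) : ℂ) * (φ y * (ψ (a * y ^ 2) : ℂ)) := by
      intro x
      have h4 : (4 : F) ≠ 0 := by
        have : (4 : F) = 2 * 2 := by norm_num
        rw [this]
        exact mul_ne_zero h2 h2
      have e : x * y + -(x ^ 2 / (4 * a)) =
          -(1 / (4 * a)) * (x + -(2 * a * y)) ^ 2 + a * y ^ 2 := by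
        field_simp
        ring
      rw [mul_assoc, ← Circle.coe_mul, ← AddChar.map_add_eq_mul, e, AddChar.map_add_eq_mul,
        Circle.coe_mul]
      ring
    simp only [hsq]
    rw [integral_mul_const]
    congr 1
    exact setIntegral_add_right (measurableSet_ballF R) (add_mem_ballF_iff hle)
      (fun x => (ψ (-(1 / (4 * a)) * x ^ 2) : ℂ))
  rw [integralF_eq, integralF_eq, hsupp,
    ← setIntegral_eq_integral_of_forall_compl_eq_zero hvanish]
  have hfour : ∀ x, fourierF ψ δ φ x * (ψ (-(x ^ 2 / (4 * a))) : ℂ) =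
      ((‖δ‖ ^ (1 / 2 : ℝ) : ℝ) : ℂ) * ∫ y in ballF M,
        φ y * (ψ (x * y) : ℂ) * (ψ (-(x ^ 2 / (4 * a))) : ℂ) ∂(volF F) := by
    intro x
    rw [fourierF, integralF_eq, hsupp, integral_mul_const, mul_assoc]
  simp only [hfour]
  rw [integral_const_mul, hswap, setIntegral_congr_fun (measurableSet_ballF M) hinner,
    integral_const_mul, mul_assoc]

theorem integralF_indicator_small (hψ : HasDifferent ψ δ ϖ) (hϖ : OddUniformizer q ϖ) {a r : F}
    (hr : r ≠ 0) (h : ‖a * r ^ 2 * δ‖ ≤ 1) :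
    integralF (fun y => Set.indicator (ballF r) (1 : F → ℂ) y * (ψ (a * y ^ 2) : ℂ)) = ‖r‖ := by
  rw [integralF_eq]
  have h1 : ∀ y, Set.indicator (ballF r) (1 : F → ℂ) y * (ψ (a * y ^ 2) : ℂ) =
      Set.indicator (ballF r) (fun _ => (1 : ℂ)) y := by
    intro y
    by_cases hy : y ∈ ballF r
    · rw [Set.indicator_of_mem hy, Set.indicator_of_mem hy, Pi.one_apply, one_mul,
        hψ.trivial _ ?_, Circle.coe_one]
      refine le_trans ?_ h
      simp only [norm_mul, norm_pow]
      gcongr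
      exact mem_ballF.1 hy
    · rw [Set.indicator_of_notMem hy, Set.indicator_of_notMem hy, zero_mul]
  simp only [h1]
  rw [integral_indicator (measurableSet_ballF r), setIntegral_const, hϖ.volF_real_ballF r hr]
  simp

end

/-- The defining property of the Weil constant `α_ψ(a)`, and its value in terms of a Gauss
integral. -/
theorem weilConst_spec_and_eq (hψ : HasDifferent ψ δ ϖ) (hϖ : OddUniformizer q ϖ)
    [MeasurableSpace F] [BorelSpace F] {a : F} (ha : a ≠ 0) {J : ℂ} (hJ0 : J ≠ 0) {R₁ : ℝ}
    (hJ : ∀ R : F, R₁ ≤ ‖R‖ →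
      ∫ y in ballF R, (ψ (-(1 / (4 * a)) * y ^ 2) : ℂ) ∂(volF F) = J) :
    (∀ φ : F → ℂ, IsSchwartz φ →
      integralF (fun y => φ y * (ψ (a * y ^ 2) : ℂ)) =
        weilConst ψ δ a * ((‖2 * a‖ ^ (-(1 / 2) : ℝ) : ℝ) : ℂ) *
          integralF (fun y => fourierF ψ δ φ y * (ψ (-(y ^ 2 / (4 * a))) : ℂ))) ∧
    weilConst ψ δ a * (((‖2 * a‖ ^ (-(1 / 2) : ℝ) : ℝ) : ℂ) *
      (((‖δ‖ ^ (1 / 2 : ℝ) : ℝ) : ℂ) * J)) = 1 := by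
  have hI : ∀ φ : F → ℂ, IsSchwartz φ →
      integralF (fun y => fourierF ψ δ φ y * (ψ (-(y ^ 2 / (4 * a))) : ℂ)) =
        ((‖δ‖ ^ (1 / 2 : ℝ) : ℝ) : ℂ) * J * integralF (fun y => φ y * (ψ (a * y ^ 2) : ℂ)) := by
    intro φ hφ
    obtain ⟨R₀, hR₀⟩ := hψ.integral_fourierF hϖ hφ ha
    obtain ⟨R, hR⟩ := NormedField.exists_lt_norm F (max R₀ R₁)
    rw [hR₀ R ((le_max_left _ _).trans hR.le), hJ R ((le_max_right _ _).trans hR.le)]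
  set A : ℂ := ((‖2 * a‖ ^ (-(1 / 2) : ℝ) : ℝ) : ℂ) with hA
  set D : ℂ := ((‖δ‖ ^ (1 / 2 : ℝ) : ℝ) : ℂ) with hD
  have hA0 : A ≠ 0 := by
    rw [hA, Complex.ofReal_ne_zero]
    exact (Real.rpow_pos_of_pos (norm_pos_iff.2 (mul_ne_zero hϖ.two_ne_zero ha)) _).ne'
  have hD0 : D ≠ 0 := by
    rw [hD, Complex.ofReal_ne_zero]
    exact (Real.rpow_pos_of_pos (norm_pos_iff.2 hψ.ne_zero) _).ne'
  -- Every test function is multiplied by the same factor, so the inverse of that factor is a valid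
  -- constant and the choice made in the definition satisfies the defining property.
  have hspec := Classical.epsilon_spec (p := fun α : ℂ => ∀ φ : F → ℂ, IsSchwartz φ →
    integralF (fun y => φ y * (ψ (a * y ^ 2) : ℂ)) = α * A *
      integralF (fun y => fourierF ψ δ φ y * (ψ (-(y ^ 2 / (4 * a))) : ℂ)))
    ⟨(A * (D * J))⁻¹, fun φ hφ => by
      rw [hI φ hφ]
      field_simp⟩
  refine ⟨hspec, ?_⟩
  -- On a sufficiently small ball ψ(a y²) = 1, so its indicator is a test function with non-zero
  -- integral. This pins the constant down.
  obtain ⟨r, hr0, hr⟩ : ∃ r : F, r ≠ 0 ∧ ‖a * r ^ 2 * δ‖ ≤ 1 := by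
    have hc : Filter.Tendsto (fun r : F => ‖a * r ^ 2 * δ‖) (nhdsWithin 0 {0}ᶜ) (nhds 0) := by
      have : Continuous fun r : F => ‖a * r ^ 2 * δ‖ := by fun_prop
      simpa using (this.tendsto 0).mono_left nhdsWithin_le_nhds
    obtain ⟨r, hr⟩ := ((hc.eventually (ge_mem_nhds one_pos)).and
      self_mem_nhdsWithin).exists
    exact ⟨r, hr.2, hr.1⟩
  have hsm := hψ.integralF_indicator_small hϖ hr0 hr
  have hS := isSchwartz_indicator_closedBall (F := F) (norm_pos_iff.2 hr0).ne'
  have h1 := hspec _ hS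
  rw [hI _ hS, hsm] at h1
  have hr' : ((‖r‖ : ℝ) : ℂ) ≠ 0 := Complex.ofReal_ne_zero.2 (norm_pos_iff.2 hr0).ne'
  refine mul_right_cancel₀ hr' ?_
  rw [one_mul]
  refine Eq.trans ?_ h1.symm
  change weilConst ψ δ a * _ * _ = weilConst ψ δ a * _ * _
  ring

end HasDifferent

end weilConstants

/-! ### Values of the Weil constants -/

section weilValues

variable {F : Type*} [NontriviallyNormedField F] [ProperSpace F] [IsUltrametricDist F]
  {q : ℕ} {ϖ δ : F} {ψ : AddChar F Circle}

namespace HasDifferent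

theorem sqrt_factor (hϖ : OddUniformizer q ϖ) (a : F) {s t : ℝ} (ht : 0 ≤ t)
    (h : ‖a‖⁻¹ * ‖δ‖ * t ^ 2 = s) :
    ‖2 * a‖ ^ (-(1 / 2) : ℝ) * (‖δ‖ ^ (1 / 2 : ℝ) * t) = √s := by
  rw [Real.rpow_neg (norm_nonneg _), ← Real.sqrt_eq_rpow, ← Real.sqrt_eq_rpow, norm_mul,
    hϖ.norm_two, one_mul, ← h, Real.sqrt_mul (by positivity), Real.sqrt_mul (by positivity),
    Real.sqrt_inv, Real.sqrt_sq ht, mul_assoc]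

theorem weilConst_of_sq (hψ : HasDifferent ψ δ ϖ) (hϖ : OddUniformizer q ϖ) {a t : F}
    (ht : ‖a * δ * t ^ 2‖ = 1) :
    (∀ φ : F → ℂ, IsSchwartz φ →
      integralF (fun y => φ y * (ψ (a * y ^ 2) : ℂ)) =
        weilConst ψ δ a * ((‖2 * a‖ ^ (-(1 / 2) : ℝ) : ℝ) : ℂ) *
          integralF (fun y => fourierF ψ δ φ y * (ψ (-(y ^ 2 / (4 * a))) : ℂ))) ∧
    weilConst ψ δ a = 1 := by
  borelize F
  have hne : a * δ * t ^ 2 ≠ 0 := norm_pos_iff.1 (ht ▸ one_pos)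
  obtain ⟨⟨ha, hδ⟩, ht0⟩ : (a ≠ 0 ∧ δ ≠ 0) ∧ t ≠ 0 := by
    simpa only [mul_ne_zero_iff, ne_eq, OfNat.ofNat_ne_zero, not_false_eq_true, pow_eq_zero_iff]
      using hne
  have h2 := hϖ.two_ne_zero
  -- The Gauss integral that enters belongs to -1/(4a) rather than to a; |(δt)⁻¹| is the radius at
  -- which its integrand is still trivial.
  set s : F := (δ * t)⁻¹ with hs
  have hs0 : s ≠ 0 := inv_ne_zero (mul_ne_zero hδ ht0)
  have hn4 : ‖(4 : F)‖ = 1 := by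
    have : (4 : F) = 2 * 2 := by norm_num
    rw [this, norm_mul, hϖ.norm_two, one_mul]
  have h1 : ‖-(1 / (4 * a)) * δ * s ^ 2‖ = 1 := by
    have e : -(1 / (4 * a)) * δ * s ^ 2 = -((1 / 4) * (a * δ * t ^ 2)⁻¹) := by
      have h4 : (4 : F) ≠ 0 := norm_pos_iff.1 (hn4 ▸ one_pos)
      rw [hs]
      field_simp
    rw [e, norm_neg, norm_mul, norm_inv, ht, norm_div, norm_one, hn4]
    norm_num
  have h := hψ.weilConst_spec_and_eq hϖ ha (J := ((‖s‖ : ℝ) : ℂ)) (R₁ := ‖s‖)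
    (Complex.ofReal_ne_zero.2 (norm_pos_iff.2 hs0).ne')
    (fun R hR => hψ.integral_quadratic_of_even hϖ h1 hR)
  refine ⟨h.1, ?_⟩
  have h3 := h.2
  rw [← Complex.ofReal_mul, ← Complex.ofReal_mul,
    sqrt_factor hϖ a (norm_nonneg s) (s := 1) ?_, Real.sqrt_one, Complex.ofReal_one,
    mul_one] at h3
  · exact h3
  · rw [← ht, hs]
    simp only [norm_mul, norm_inv, norm_pow] at ht ⊢
    have := norm_ne_zero_iff.2 ha
    have := norm_ne_zero_iff.2 hδ
    have := norm_ne_zero_iff.2 ht0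
    field_simp
    nlinarith

/-- Here ord(aδ) is odd, and the Gauss integral of -1/(4a) is |tϖ| times a residue Gauss sum. The
powers of norms combine to q^{-1/2}. -/
theorem weilConst_of_uniformizer_mul_sq (hψ : HasDifferent ψ δ ϖ) (hϖ : OddUniformizer q ϖ)
    {a t : F} (ha : a ≠ 0) (ht : ‖t ^ 2 * δ * ϖ‖ = ‖a‖) :
    (∀ φ : F → ℂ, IsSchwartz φ →
      integralF (fun y => φ y * (ψ (a * y ^ 2) : ℂ)) =
        weilConst ψ δ a * ((‖2 * a‖ ^ (-(1 / 2) : ℝ) : ℝ) : ℂ) *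
          integralF (fun y => fourierF ψ δ φ y * (ψ (-(y ^ 2 / (4 * a))) : ℂ))) ∧
    ‖-(1 / (4 * a)) * t ^ 2 * δ * ϖ‖ = 1 ∧
    weilConst ψ δ a * residueGauss ψ (-(1 / (4 * a)) * t ^ 2) = ((√q : ℝ) : ℂ) := by
  borelize F
  have hn4 : ‖(4 : F)‖ = 1 := by
    have : (4 : F) = 2 * 2 := by norm_num
    rw [this, norm_mul, hϖ.norm_two, one_mul]
  have ha' := norm_ne_zero_iff.2 ha
  have ht0 : t ≠ 0 := by
    rintro rfl
    rw [zero_pow two_ne_zero, zero_mul, zero_mul, norm_zero] at ht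
    exact ha' ht.symm
  have h1 : ‖-(1 / (4 * a)) * t ^ 2 * δ * ϖ‖ = 1 := by
    have e : -(1 / (4 * a)) * t ^ 2 * δ * ϖ = -((1 / (4 * a)) * (t ^ 2 * δ * ϖ)) := by ring
    rw [e, norm_neg, norm_mul, ht, norm_div, norm_mul, hn4, norm_one]
    field_simp
  have htϖ : t * ϖ ≠ 0 := mul_ne_zero ht0 hϖ.ne_zero
  have hG := hψ.residueGauss_ne_zero hϖ h1
  have h := hψ.weilConst_spec_and_eq hϖ ha (R₁ := ‖t‖)
    (mul_ne_zero (Complex.ofReal_ne_zero.2 (norm_pos_iff.2 htϖ).ne') hG)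
    (fun R hR => hψ.integral_quadratic_of_odd hϖ h1 hR)
  refine ⟨h.1, h1, ?_⟩
  have h3 := h.2
  have h4 : ‖2 * a‖ ^ (-(1 / 2) : ℝ) * (‖δ‖ ^ (1 / 2 : ℝ) * ‖t * ϖ‖) = √((q : ℝ)⁻¹) := by
    refine sqrt_factor hϖ a (norm_nonneg _) ?_
    rw [← ht, ← hϖ.norm]
    have := norm_ne_zero_iff.2 ht0
    have := norm_ne_zero_iff.2 hψ.ne_zero
    have := hϖ.norm_pos.ne'
    simp only [norm_mul, norm_pow]
    field_simp
  have hq : (√(q : ℝ)) ≠ 0 := Real.sqrt_ne_zero'.2 (zero_lt_one.trans hϖ.one_lt_cast)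
  have h5 : ((‖2 * a‖ ^ (-(1 / 2) : ℝ) : ℝ) : ℂ) * (((‖δ‖ ^ (1 / 2 : ℝ) : ℝ) : ℂ) *
      ((‖t * ϖ‖ : ℂ) * residueGauss ψ (-(1 / (4 * a)) * t ^ 2))) =
      ((√q : ℝ) : ℂ)⁻¹ * residueGauss ψ (-(1 / (4 * a)) * t ^ 2) := by
    rw [← Complex.ofReal_inv, ← Real.sqrt_inv, ← h4]
    push_cast
    ring
  rw [h5] at h3
  have hq' : ((√q : ℝ) : ℂ) ≠ 0 := Complex.ofReal_ne_zero.2 hq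
  set G := residueGauss ψ (-(1 / (4 * a)) * t ^ 2)
  calc _ = ((√q : ℝ) : ℂ) * (weilConst ψ δ a * (((√q : ℝ) : ℂ)⁻¹ * G)) := by field_simp
    _ = _ := by rw [h3, mul_one]

theorem exists_sq_of_even (hψ : HasDifferent ψ δ ϖ) (hϖ : OddUniformizer q ϖ) {a : F} (ha : a ≠ 0)
    (h : Even (ord q (a * δ))) : ∃ t : F, ‖a * δ * t ^ 2‖ = 1 := by
  obtain ⟨k, hk⟩ := h
  refine ⟨ϖ ^ (-k), ?_⟩
  rw [norm_mul, hϖ.norm_eq_zpow_ord (mul_ne_zero ha hψ.ne_zero), hk, norm_pow, _root_.norm_zpow,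
    ← zpow_natCast, ← _root_.zpow_mul, ← _root_.zpow_add₀ hϖ.norm_pos.ne']
  convert zpow_zero _ using 2
  push_cast
  ring

theorem exists_sq_of_odd (hψ : HasDifferent ψ δ ϖ) (hϖ : OddUniformizer q ϖ) {a : F} (ha : a ≠ 0)
    (h : Odd (ord q (a * δ))) : ∃ t : F, ‖t ^ 2 * δ * ϖ‖ = ‖a‖ := by
  obtain ⟨k, hk⟩ := h
  have hn := hϖ.norm_eq_zpow_ord (mul_ne_zero ha hψ.ne_zero)
  rw [hk, norm_mul, _root_.zpow_add₀ hϖ.norm_pos.ne', zpow_one, _root_.zpow_mul,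
    zpow_ofNat] at hn
  have hδ := norm_ne_zero_iff.2 hψ.ne_zero
  refine ⟨ϖ ^ k * δ⁻¹, ?_⟩
  simp only [norm_mul, norm_pow, norm_inv, _root_.norm_zpow]
  rw [← mul_left_inj' hδ, hn]
  field_simp
  rw [← zpow_natCast, ← zpow_natCast, ← _root_.zpow_mul, ← _root_.zpow_mul, mul_comm k]
  exact mul_comm _ _

/-- The Weil constant satisfies its defining property. -/
theorem weilConst_spec (hψ : HasDifferent ψ δ ϖ) (hϖ : OddUniformizer q ϖ) {a : F} (ha : a ≠ 0)
    {φ : F → ℂ} (hφ : IsSchwartz φ) :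
    integralF (fun y => φ y * (ψ (a * y ^ 2) : ℂ)) =
      weilConst ψ δ a * ((‖2 * a‖ ^ (-(1 / 2) : ℝ) : ℝ) : ℂ) *
        integralF (fun y => fourierF ψ δ φ y * (ψ (-(y ^ 2 / (4 * a))) : ℂ)) := by
  rcases Int.even_or_odd (ord q (a * δ)) with h | h
  · obtain ⟨t, ht⟩ := hψ.exists_sq_of_even hϖ ha h
    exact (hψ.weilConst_of_sq hϖ ht).1 φ hφ
  · obtain ⟨t, ht⟩ := hψ.exists_sq_of_odd hϖ ha h
    exact (hψ.weilConst_of_uniformizer_mul_sq hϖ ha ht).1 φ hφ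

theorem weilConst_of_even (hψ : HasDifferent ψ δ ϖ) (hϖ : OddUniformizer q ϖ) {a : F} (ha : a ≠ 0)
    (h : Even (ord q (a * δ))) : weilConst ψ δ a = 1 := by
  obtain ⟨t, ht⟩ := hψ.exists_sq_of_even hϖ ha h
  exact (hψ.weilConst_of_sq hϖ ht).2

/-- Square the relation between the Weil constant and the residue Gauss sum, whose own square is
χ(-1)q. This sign is what later turns the square of Ũ₁ into exactly 1. -/
theorem weilConst_sq_of_odd (hψ : HasDifferent ψ δ ϖ) (hϖ : OddUniformizer q ϖ) {a : F} (ha : a ≠ 0)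
    (h : Odd (ord q (a * δ))) :
    weilConst ψ δ a ^ 2 = ((unitChar q ϖ (-1 : F) : ℤ) : ℂ) := by
  obtain ⟨t, ht⟩ := hψ.exists_sq_of_odd hϖ ha h
  obtain ⟨-, h1, h2⟩ := hψ.weilConst_of_uniformizer_mul_sq hϖ ha ht
  have h3 := congrArg (· ^ 2) h2
  simp only [mul_pow] at h3
  rw [hψ.residueGauss_sq hϖ h1, ← Complex.ofReal_pow, Real.sq_sqrt (Nat.cast_nonneg q),
    Complex.ofReal_natCast] at h3
  have hq : (q : ℂ) ≠ 0 := by exact_mod_cast (zero_lt_one.trans hϖ.one_lt).ne'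
  have h4 : weilConst ψ δ a ^ 2 * ((unitChar q ϖ (-1 : F) : ℤ) : ℂ) = 1 := by
    refine mul_right_cancel₀ hq ?_
    rw [one_mul, mul_assoc, h3]
  have h5 : ((unitChar q ϖ (-1 : F) : ℤ) : ℂ) * ((unitChar q ϖ (-1 : F) : ℤ) : ℂ) = 1 := by
    rw [← Int.cast_mul, ← Units.val_mul, Int.units_mul_self, Units.val_one, Int.cast_one]
  calc _ = weilConst ψ δ a ^ 2 * (((unitChar q ϖ (-1 : F) : ℤ) : ℂ) *
        ((unitChar q ϖ (-1 : F) : ℤ) : ℂ)) := by rw [h5, mul_one]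
    _ = _ := by rw [← mul_assoc, h4, one_mul]

theorem norm_weilConst (hψ : HasDifferent ψ δ ϖ) (hϖ : OddUniformizer q ϖ) {a : F} (ha : a ≠ 0) :
    ‖weilConst ψ δ a‖ = 1 := by
  rcases Int.even_or_odd (ord q (a * δ)) with h | h
  · rw [hψ.weilConst_of_even hϖ ha h, norm_one]
  · have h1 := congrArg norm (hψ.weilConst_sq_of_odd hϖ ha h)
    rw [norm_pow] at h1
    rcases Int.units_eq_one_or (unitChar q ϖ (-1 : F)) with h2 | h2 <;> rw [h2] at h1 <;>
      exact (pow_eq_one_iff_of_nonneg (norm_nonneg _) two_ne_zero).1 (by simpa using h1)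

theorem weilConst_ne_zero (hψ : HasDifferent ψ δ ϖ) (hϖ : OddUniformizer q ϖ) {a : F} (ha : a ≠ 0) :
    weilConst ψ δ a ≠ 0 :=
  norm_ne_zero_iff.1 (by rw [hψ.norm_weilConst hϖ ha]; exact one_ne_zero)

theorem conj_weilConst_mul (hψ : HasDifferent ψ δ ϖ) (hϖ : OddUniformizer q ϖ) {a : F}
    (ha : a ≠ 0) : conj (weilConst ψ δ a) * weilConst ψ δ a = 1 := by
  rw [mul_comm, Complex.mul_conj, Complex.normSq_eq_norm_sq, hψ.norm_weilConst hϖ ha]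
  simp

/-- For even order both constants are 1. For odd order the unit enters the residue Gauss sum through
its inverse and changes it by χ(u). -/
theorem weilConst_unit_mul (hψ : HasDifferent ψ δ ϖ) (hϖ : OddUniformizer q ϖ) {a u : F}
    (ha : a ≠ 0) (hu : ‖u‖ = 1) : weilConst ψ δ (u * a) =
      (((unitChar q ϖ u ^ ord q (a * δ) : ℤˣ) : ℤ) : ℂ) * weilConst ψ δ a := by
  have hu0 : u ≠ 0 := norm_pos_iff.1 (hu ▸ one_pos)
  have hord : ord q (u * a * δ) = ord q (a * δ) := by
    rw [mul_assoc, hϖ.ord_mul hu0 (mul_ne_zero ha hψ.ne_zero), hϖ.ord_of_norm_one hu, zero_add]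
  have hua := mul_ne_zero hu0 ha
  rcases Int.even_or_odd (ord q (a * δ)) with h | h
  · rw [hψ.weilConst_of_even hϖ ha h, hψ.weilConst_of_even hϖ hua (by rwa [hord]),
      OddUniformizer.units_zpow_even _ h]
    simp
  · rw [OddUniformizer.units_zpow_odd _ h]
    obtain ⟨t, ht⟩ := hψ.exists_sq_of_odd hϖ ha h
    obtain ⟨-, h1, h2⟩ := hψ.weilConst_of_uniformizer_mul_sq hϖ ha ht
    obtain ⟨-, -, h3⟩ := hψ.weilConst_of_uniformizer_mul_sq hϖ hua
      (ht.trans (by rw [norm_mul, hu, one_mul]))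
    have e : -(1 / (4 * (u * a))) * t ^ 2 = u⁻¹ * (-(1 / (4 * a)) * t ^ 2) := by
      simp only [one_div, _root_.mul_inv_rev]
      ring
    rw [e, hψ.residueGauss_mul hϖ h1 (by rw [norm_inv, hu, inv_one]), hϖ.unitChar_inv hu0,
      ← h2] at h3
    have h4 := mul_right_cancel₀ (hψ.residueGauss_ne_zero hϖ h1) ((mul_assoc _ _ _).trans h3)
    have h5 : ((unitChar q ϖ u : ℤ) : ℂ) * ((unitChar q ϖ u : ℤ) : ℂ) = 1 := by
      rw [← Int.cast_mul, ← Units.val_mul, Int.units_mul_self, Units.val_one, Int.cast_one]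
    rw [← h4, mul_comm _ ((unitChar q ϖ u : ℤ) : ℂ), ← mul_assoc, h5, one_mul]

theorem weilConst_mul_sq (hψ : HasDifferent ψ δ ϖ) (hϖ : OddUniformizer q ϖ) {a s : F}
    (ha : a ≠ 0) (hs : s ≠ 0) : weilConst ψ δ (a * s ^ 2) = weilConst ψ δ a := by
  have has := mul_ne_zero ha (pow_ne_zero 2 hs)
  rcases Int.even_or_odd (ord q (a * δ)) with h | h
  · obtain ⟨t, ht⟩ := hψ.exists_sq_of_even hϖ ha h
    rw [(hψ.weilConst_of_sq hϖ ht).2, (hψ.weilConst_of_sq hϖ (t := t / s) ?_).2]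
    rw [← ht]
    congr 1
    field_simp
  · obtain ⟨t, ht⟩ := hψ.exists_sq_of_odd hϖ ha h
    obtain ⟨-, h1, h2⟩ := hψ.weilConst_of_uniformizer_mul_sq hϖ ha ht
    have e1 : (t * s) ^ 2 * δ * ϖ = t ^ 2 * δ * ϖ * s ^ 2 := by ring
    obtain ⟨-, -, h3⟩ := hψ.weilConst_of_uniformizer_mul_sq hϖ has (t := t * s)
      (by rw [e1, norm_mul, ht, norm_mul])
    have e : -(1 / (4 * (a * s ^ 2))) * (t * s) ^ 2 = -(1 / (4 * a)) * t ^ 2 := by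
      simp only [one_div, _root_.mul_inv_rev]
      field_simp
    rw [e, ← h2] at h3
    exact mul_right_cancel₀ (hψ.residueGauss_ne_zero hϖ h1) h3

theorem weilConst_inv (hψ : HasDifferent ψ δ ϖ) (hϖ : OddUniformizer q ϖ) {a : F} (ha : a ≠ 0) :
    weilConst ψ δ a⁻¹ = weilConst ψ δ a := by
  rw [← hψ.weilConst_mul_sq hϖ ha (inv_ne_zero ha)]
  congr 1
  field_simp

theorem fourierF_phi0 (hψ : HasDifferent ψ δ ϖ) (hϖ : OddUniformizer q ϖ) (x : F) :
    fourierF ψ δ (phi0 F) x =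
      ((‖δ‖ ^ (1 / 2 : ℝ) : ℝ) : ℂ) * Set.indicator (ballF δ⁻¹) 1 x := by
  borelize F
  have h1 : integralF (fun y => phi0 F y * (ψ (x * y) : ℂ)) =
      ∫ y in ballF 1, (ψ (x * y) : ℂ) ∂(volF F) := by
    rw [integralF_eq, ← integral_indicator (measurableSet_ballF 1)]
    congr 1
    funext y
    have hb : (ballF (1 : F)) = Metric.closedBall 0 1 := by simp [ballF]
    rw [hb, phi0]
    by_cases hy : y ∈ Metric.closedBall (0 : F) 1
    · rw [Set.indicator_of_mem hy, Set.indicator_of_mem hy, Pi.one_apply, one_mul]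
    · rw [Set.indicator_of_notMem hy, Set.indicator_of_notMem hy, zero_mul]
  rw [fourierF, h1]
  congr 1
  have hδ := norm_pos_iff.2 hψ.ne_zero
  have hiff : x ∈ ballF δ⁻¹ ↔ ‖x * 1 * δ‖ ≤ 1 := by
    rw [mem_ballF, mul_one, norm_mul, norm_inv, ← one_div, le_div_iff₀ hδ]
  by_cases hx : x ∈ ballF δ⁻¹
  · rw [Set.indicator_of_mem hx, hψ.integral_eq_vol hϖ one_ne_zero (hiff.1 hx)]
    simp
  · rw [Set.indicator_of_notMem hx, hψ.integral_eq_zero hϖ (not_le.1 (mt hiff.2 hx))]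

/-- Apply the defining property of the Weil constant to the characteristic function of the integers:
its Fourier transform is supported on δ⁻¹𝔬, where ψ(-y²/(4a)) = 1. -/
theorem integral_quadratic_unitBall (hψ : HasDifferent ψ δ ϖ) (hϖ : OddUniformizer q ϖ)
    [MeasurableSpace F] [BorelSpace F] {a : F} (ha : 1 ≤ ‖a * δ‖) :
    ∫ y in ballF 1, (ψ (a * y ^ 2) : ℂ) ∂(volF F) =
      weilConst ψ δ a * ((‖a‖ ^ (-(1 / 2) : ℝ) * ‖δ‖ ^ (-(1 / 2) : ℝ) : ℝ) : ℂ) := by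
  have ha0 : a ≠ 0 := by
    rintro rfl
    simp at ha
    linarith
  have hδ := norm_pos_iff.2 hψ.ne_zero
  have hb : (ballF (1 : F)) = Metric.closedBall 0 1 := by simp [ballF]
  have hsp := hψ.weilConst_spec hϖ ha0 (φ := phi0 F) (isSchwartz_indicator_closedBall one_ne_zero)
  have h1 : integralF (fun y => phi0 F y * (ψ (a * y ^ 2) : ℂ)) =
      ∫ y in ballF 1, (ψ (a * y ^ 2) : ℂ) ∂(volF F) := by
    rw [integralF_eq, ← integral_indicator (measurableSet_ballF 1)]
    congr 1
    funext y
    rw [hb, phi0]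
    by_cases hy : y ∈ Metric.closedBall (0 : F) 1
    · rw [Set.indicator_of_mem hy, Set.indicator_of_mem hy, Pi.one_apply, one_mul]
    · rw [Set.indicator_of_notMem hy, Set.indicator_of_notMem hy, zero_mul]
  have h4 : ‖(4 : F)‖ = 1 := by
    have : (4 : F) = 2 * 2 := by norm_num
    rw [this, norm_mul, hϖ.norm_two, one_mul]
  have h2 : integralF (fun y => fourierF ψ δ (phi0 F) y * (ψ (-(y ^ 2 / (4 * a))) : ℂ)) =
      ((‖δ‖ ^ (1 / 2 : ℝ) : ℝ) : ℂ) * (‖δ⁻¹‖ : ℝ) := by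
    rw [← hψ.integralF_indicator_small hϖ (a := -(1 / (4 * a))) (inv_ne_zero hψ.ne_zero) ?_,
      integralF_eq, integralF_eq, ← integral_const_mul]
    · congr 1
      funext y
      rw [hψ.fourierF_phi0 hϖ, mul_assoc]
      congr 5
      ring
    · have e : -(1 / (4 * a)) * δ⁻¹ ^ 2 * δ = -((1 / 4) * (a * δ)⁻¹) := by
        have := hψ.ne_zero
        have h4' : (4 : F) ≠ 0 := norm_pos_iff.1 (h4 ▸ one_pos)
        field_simp
      rw [e, norm_neg, norm_mul, norm_div, h4, norm_one, div_one, one_mul, norm_inv]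
      exact inv_le_one_of_one_le₀ ha
  rw [← h1, hsp, h2, mul_assoc]
  congr 1
  have h3 : ‖2 * a‖ = ‖a‖ := by rw [norm_mul, hϖ.norm_two, one_mul]
  rw [h3, ← Complex.ofReal_mul, ← Complex.ofReal_mul]
  congr 2
  rw [norm_inv, ← Real.rpow_neg_one, ← Real.rpow_add hδ]
  norm_num

end HasDifferent

end weilValues

/-! ### The genuine character `ε` -/

section genuineCharacter

variable {F : Type*} [NontriviallyNormedField F] [ProperSpace F] [IsUltrametricDist F]
  {q : ℕ} {ϖ δ : F} {ψ : AddChar F Circle}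

namespace HasDifferent

theorem phi0_mul_unit {u : F} (hu : ‖u‖ = 1) (x : F) : phi0 F (u * x) = phi0 F x := by
  have h : u * x ∈ Metric.closedBall (0 : F) 1 ↔ x ∈ Metric.closedBall (0 : F) 1 := by
    rw [mem_closedBall_zero_iff, mem_closedBall_zero_iff, norm_mul, hu, one_mul]
  unfold phi0
  by_cases hx : x ∈ Metric.closedBall (0 : F) 1
  · rw [Set.indicator_of_mem hx, Set.indicator_of_mem (h.2 hx)]
    rfl
  · rw [Set.indicator_of_notMem hx, Set.indicator_of_notMem (mt h.1 hx)]

theorem psi_mul_phi0 (hψ : HasDifferent ψ δ ϖ) {b : F} (hb : ‖b * δ‖ ≤ 1) (x : F) :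
    (ψ (b * x ^ 2) : ℂ) * phi0 F x = phi0 F x := by
  by_cases hx : x ∈ Metric.closedBall (0 : F) 1
  · rw [hψ.trivial, Circle.coe_one, one_mul]
    rw [mem_closedBall_zero_iff] at hx
    rw [mul_right_comm, norm_mul, norm_pow]
    exact mul_le_one₀ hb (by positivity) (pow_le_one₀ (norm_nonneg _) hx)
  · rw [phi0, Set.indicator_of_notMem hx, mul_zero]

/-- Completing the square turns the transform into a Gauss integral over the integers with shift
x/d. If |x| ≤ 1 the shift is absorbed and the Weil constant of d/c appears; if |x| > 1 the shifted
arguments stay away from the integers and the integral vanishes. -/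
theorem fourierF_psi_mul_phi0 (hψ : HasDifferent ψ δ ϖ) (hϖ : OddUniformizer q ϖ) {c d : F}
    (hc : c ≠ 0) (hcδ : ‖c‖ ≤ ‖δ‖) (hd : ‖d‖ = 1) (x : F) :
    fourierF ψ δ (opUSharp ψ (d / c) (phi0 F)) (-2 * c⁻¹ * x) =
      weilConst ψ δ (d / c) * ((‖c‖ ^ (1 / 2 : ℝ) : ℝ) : ℂ) *
        ((ψ (-(x ^ 2 / (c * d))) : ℂ) * phi0 F x) := by
  borelize F
  have hd0 : d ≠ 0 := norm_pos_iff.1 (hd ▸ one_pos)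
  have hδ := norm_pos_iff.2 hψ.ne_zero
  have hc' := norm_pos_iff.2 hc
  have ha : 1 ≤ ‖d / c * δ‖ := by
    rw [norm_mul, norm_div, hd, one_div, ← div_eq_inv_mul, one_le_div hc']
    exact hcδ
  have hb : (ballF (1 : F)) = Metric.closedBall 0 1 := by simp [ballF]
  have hS : MeasurableSet (ballF (1 : F)) := measurableSet_ballF 1
  have h1 : integralF (fun y => opUSharp ψ (d / c) (phi0 F) y * (ψ (-2 * c⁻¹ * x * y) : ℂ)) =
      (ψ (-(x ^ 2 / (c * d))) : ℂ) *
        ∫ y in ballF 1, (ψ (d / c * (y + -(x / d)) ^ 2) : ℂ) ∂(volF F) := by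
    rw [integralF_eq, ← integral_const_mul, ← integral_indicator hS]
    congr 1
    funext y
    rw [opUSharp, hb, phi0]
    by_cases hy : y ∈ Metric.closedBall (0 : F) 1
    · rw [Set.indicator_of_mem hy, Set.indicator_of_mem hy, Pi.one_apply, mul_one,
        ← Circle.coe_mul, ← Circle.coe_mul, ← AddChar.map_add_eq_mul, ← AddChar.map_add_eq_mul]
      congr 2
      field_simp
      ring
    · rw [Set.indicator_of_notMem hy, Set.indicator_of_notMem hy, mul_zero, zero_mul]
  have h2 : ∫ y in ballF 1, (ψ (d / c * (y + -(x / d)) ^ 2) : ℂ) ∂(volF F) =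
      weilConst ψ δ (d / c) * ((‖c‖ ^ (1 / 2 : ℝ) * ‖δ‖ ^ (-(1 / 2) : ℝ) : ℝ) : ℂ) * phi0 F x := by
    by_cases hx : x ∈ Metric.closedBall (0 : F) 1
    · have hx' : ‖-(x / d)‖ ≤ ‖(1 : F)‖ := by
        rw [norm_neg, norm_div, hd, div_one, norm_one]
        exact mem_closedBall_zero_iff.1 hx
      rw [setIntegral_add_right hS (add_mem_ballF_iff hx') (fun y => (ψ (d / c * y ^ 2) : ℂ)),
        hψ.integral_quadratic_unitBall hϖ ha, phi0, Set.indicator_of_mem hx, Pi.one_apply, mul_one,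
        norm_div, hd, one_div, Real.inv_rpow hc'.le, ← Real.rpow_neg hc'.le, neg_neg]
    · rw [phi0, Set.indicator_of_notMem hx, mul_zero]
      rw [mem_closedBall_zero_iff, not_le] at hx
      refine hψ.integral_quadratic_eq_zero hϖ (R := 1) hS (volF_ballF_lt_top 1)
        (fun h hh y hy => (add_mem_ballF_iff hh y).2 hy) (by simpa using ha) _ fun y hy => ?_
      have hxd : ‖-(x / d)‖ = ‖x‖ := by rw [norm_neg, norm_div, hd, div_one]
      rw [mem_ballF, norm_one] at hy
      rw [add_comm, norm_add_eq_of_lt (by rw [hxd]; exact hy.trans_lt hx), hxd, norm_one]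
      exact hx
  rw [fourierF, h1, h2]
  have h3 : ((‖δ‖ ^ (1 / 2 : ℝ) : ℝ) : ℂ) *
      ((‖c‖ ^ (1 / 2 : ℝ) * ‖δ‖ ^ (-(1 / 2) : ℝ) : ℝ) : ℂ) = ((‖c‖ ^ (1 / 2 : ℝ) : ℝ) : ℂ) := by
    rw [← Complex.ofReal_mul]
    congr 1
    rw [Real.rpow_neg hδ.le]
    have := (Real.rpow_pos_of_pos hδ (1 / 2)).ne'
    field_simp
  rw [← h3]
  ring

/-- The value of the genuine character. -/
theorem weilRep_phi0 (hψ : HasDifferent ψ δ ϖ) (hϖ : OddUniformizer q ϖ) {γ : Mp2 F}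
    (hd : ‖γ.mat.1 1 1‖ = 1) (hb : ‖γ.mat.1 0 1‖ ≤ ‖δ⁻¹‖) (hc : ‖γ.mat.1 1 0‖ ≤ ‖δ‖) :
    weilRep ψ δ γ (phi0 F) = (((γ.sgn * unitChar q ϖ (γ.mat.1 1 1) ^
      ord q (δ * lowerEntry γ.mat) : ℤˣ) : ℤ) : ℂ) • phi0 F := by
  have hd0 : γ.mat.1 1 1 ≠ 0 := norm_pos_iff.1 (hd ▸ one_pos)
  have hδ := norm_pos_iff.2 hψ.ne_zero
  have hbδ : ‖γ.mat.1 0 1 * δ‖ ≤ 1 := by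
    rw [norm_mul]
    rw [norm_inv] at hb
    calc _ ≤ ‖δ‖⁻¹ * ‖δ‖ := by gcongr
      _ = 1 := inv_mul_cancel₀ hδ.ne'
  have hdet := sl_det γ.mat
  rw [weilRep, Units.val_mul, Int.cast_mul, mul_smul]
  congr 1
  funext x
  rw [Pi.smul_apply, smul_eq_mul]
  by_cases hc0 : γ.mat.1 1 0 = 0
  · rw [if_pos hc0]
    rw [hc0, mul_zero, sub_zero] at hdet
    have ha : ‖γ.mat.1 0 0‖ = 1 := by
      have := congrArg norm hdet
      rwa [norm_mul, hd, mul_one, norm_one] at this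
    have ha0 : γ.mat.1 0 0 ≠ 0 := left_ne_zero_of_mul (hdet ▸ one_ne_zero)
    have hα : weilConst ψ δ (γ.mat.1 0 0) = (((unitChar q ϖ (γ.mat.1 0 0) ^ ord q δ : ℤˣ) : ℤ) : ℂ) *
        weilConst ψ δ 1 := by
      have := hψ.weilConst_unit_mul hϖ one_ne_zero ha
      rwa [mul_one, one_mul] at this
    have hα1 := hψ.weilConst_ne_zero hϖ one_ne_zero
    have hda : γ.mat.1 1 1 = (γ.mat.1 0 0)⁻¹ := eq_inv_of_mul_eq_one_right hdet
    have hord : ord q (δ * lowerEntry γ.mat) = ord q δ := by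
      rw [lowerEntry_of_eq hc0, hϖ.ord_mul hψ.ne_zero hd0, hϖ.ord_of_norm_one hd, add_zero]
    rw [opUSharp, opM, phi0_mul_unit ha, ha, Real.one_rpow, Complex.ofReal_one, mul_one, hord, hda,
      hϖ.unitChar_inv ha0, hα]
    set s : ℤˣ := unitChar q ϖ (γ.mat.1 0 0) ^ ord q δ
    have hs : ((s : ℤ) : ℂ) * ((s : ℤ) : ℂ) = 1 := by
      rw [← Int.cast_mul, ← Units.val_mul, Int.units_mul_self, Units.val_one, Int.cast_one]
    have hs0 : ((s : ℤ) : ℂ) ≠ 0 := left_ne_zero_of_mul (hs ▸ one_ne_zero)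
    have hquot : weilConst ψ δ 1 / (((s : ℤ) : ℂ) * weilConst ψ δ 1) = ((s : ℤ) : ℂ) := by
      rw [div_eq_iff (mul_ne_zero hs0 hα1), ← mul_assoc, hs, one_mul]
    rw [hquot, mul_left_comm, hψ.psi_mul_phi0]
    rw [mul_assoc, norm_mul, ha, one_mul]
    exact hbδ
  · rw [if_neg hc0, opUSharp, opW, hψ.fourierF_psi_mul_phi0 hϖ hc0 hc hd, lowerEntry_of_ne hc0]
    set c := γ.mat.1 1 0
    set d := γ.mat.1 1 1
    have hα : weilConst ψ δ (d / c) =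
        (((unitChar q ϖ d ^ ord q (δ * c) : ℤˣ) : ℤ) : ℂ) * weilConst ψ δ c := by
      have h1 : unitChar q ϖ d ^ ord q (δ * c) =
          unitChar q ϖ d ^ ord q (c⁻¹ * δ) * unitChar q ϖ d ^ (2 * ord q c) := by
        rw [← _root_.zpow_add, hϖ.ord_mul hψ.ne_zero hc0, hϖ.ord_mul (inv_ne_zero hc0) hψ.ne_zero,
          hϖ.ord_inv hc0]
        congr 1
        ring
      rw [div_eq_mul_inv, hψ.weilConst_unit_mul hϖ (inv_ne_zero hc0) hd, hψ.weilConst_inv hϖ hc0, h1,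
        OddUniformizer.units_zpow_even _ (even_two_mul _), mul_one]
    have hn : ‖2 * c⁻¹‖ = ‖c‖⁻¹ := by rw [norm_mul, hϖ.norm_two, one_mul, norm_inv]
    have hc' := norm_pos_iff.2 hc0
    have hpow : ((‖c‖⁻¹ ^ (1 / 2 : ℝ) : ℝ) : ℂ) * ((‖c‖ ^ (1 / 2 : ℝ) : ℝ) : ℂ) = 1 := by
      rw [← Complex.ofReal_mul, Real.inv_rpow hc'.le, inv_mul_cancel₀
        (Real.rpow_pos_of_pos hc' _).ne', Complex.ofReal_one]
    -- By the determinant condition a/c - 1/(cd) = b/d, and b/d lies in 𝔡⁻¹. So the characters left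
    -- over combine to one that is trivial on the integers.
    have hpsi : (ψ (γ.mat.1 0 0 / c * x ^ 2) : ℂ) * (ψ (-(x ^ 2 / (c * d))) : ℂ) =
        (ψ (γ.mat.1 0 1 / d * x ^ 2) : ℂ) := by
      rw [← Circle.coe_mul, ← AddChar.map_add_eq_mul]
      congr 2
      field_simp
      linear_combination x ^ 2 * hdet
    have hbd : ‖γ.mat.1 0 1 / d * δ‖ ≤ 1 := by
      rw [div_mul_eq_mul_div, norm_div, hd, div_one]
      exact hbδ
    have hcc := hψ.conj_weilConst_mul hϖ hc0
    rw [hα, hn, ← hψ.psi_mul_phi0 hbd x, ← hpsi]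
    set s := (((unitChar q ϖ d ^ ord q (δ * c) : ℤˣ) : ℤ) : ℂ)
    set p₁ := (ψ (γ.mat.1 0 0 / c * x ^ 2) : ℂ)
    set p₂ := (ψ (-(x ^ 2 / (c * d))) : ℂ)
    have hp : p₁ * p₂ * phi0 F x = phi0 F x := by rw [hpsi, hψ.psi_mul_phi0 hbd]
    have hp2 : p₂ * (p₁ * p₂ * phi0 F x) = p₂ * phi0 F x := by rw [hp]
    rw [hp]
    calc _ = (conj (weilConst ψ δ c) * weilConst ψ δ c) *
          (((‖c‖⁻¹ ^ (1 / 2 : ℝ) : ℝ) : ℂ) * ((‖c‖ ^ (1 / 2 : ℝ) : ℝ) : ℂ)) * s *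
            (p₁ * p₂ * phi0 F x) := by ring
      _ = _ := by rw [hcc, hpow, hp, one_mul, one_mul]

/-- The characteristic function is 1 at 0, so the scalar chosen in the definition is determined; a
sign is its own inverse. -/
theorem eps_eq (hψ : HasDifferent ψ δ ϖ) (hϖ : OddUniformizer q ϖ) {γ : Mp2 F}
    (hd : ‖γ.mat.1 1 1‖ = 1) (hb : ‖γ.mat.1 0 1‖ ≤ ‖δ⁻¹‖) (hc : ‖γ.mat.1 1 0‖ ≤ ‖δ‖) :
    eps ψ δ γ = (((γ.sgn * unitChar q ϖ (γ.mat.1 1 1) ^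
      ord q (δ * lowerEntry γ.mat) : ℤˣ) : ℤ) : ℂ) := by
  have h := hψ.weilRep_phi0 hϖ hd hb hc
  set s : ℤˣ := γ.sgn * unitChar q ϖ (γ.mat.1 1 1) ^ ord q (δ * lowerEntry γ.mat)
  have hs : (((s : ℤ) : ℂ))⁻¹ = ((s : ℤ) : ℂ) := by
    refine inv_eq_of_mul_eq_one_right ?_
    rw [← Int.cast_mul, ← Units.val_mul, Int.units_mul_self, Units.val_one, Int.cast_one]
  have hsp := Classical.epsilon_spec (p := fun z : ℂ => weilRep ψ δ γ (phi0 F) = z⁻¹ • phi0 F)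
    ⟨((s : ℤ) : ℂ), by rw [h, hs]⟩
  have h0 : phi0 F 0 = 1 := Set.indicator_of_mem (by simp) _
  have h1 := congrFun (h.symm.trans hsp) 0
  rw [Pi.smul_apply, Pi.smul_apply, h0, smul_eq_mul, smul_eq_mul, mul_one, mul_one] at h1
  rw [eps, ← inv_inv (Classical.epsilon _), ← h1, hs]

end HasDifferent

end genuineCharacter

/-! ### The splitting of the metaplectic cover over the congruence subgroups -/

section congruence

variable {F : Type*} [NontriviallyNormedField F] [IsUltrametricDist F] {β γ : F}

theorem norm_mul_lt_of_congruence (hβγ : ‖β * γ‖ < 1) {b c : F} (hb : ‖b‖ ≤ ‖β‖) (hc : ‖c‖ ≤ ‖γ‖) :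
    ‖b * c‖ < 1 := by
  rw [norm_mul] at hβγ ⊢
  exact (mul_le_mul hb hc (norm_nonneg _) (norm_nonneg _)).trans_lt hβγ

theorem norm_mul_diag_sub_one_lt (hβγ : ‖β * γ‖ < 1) {g : SpecialLinearGroup (Fin 2) F}
    (hg : g ∈ congruenceSet β γ) : ‖g.1 0 0 * g.1 1 1 - 1‖ < 1 := by
  have h : g.1 0 0 * g.1 1 1 - 1 = g.1 0 1 * g.1 1 0 := by linear_combination sl_det g
  rw [h]
  exact norm_mul_lt_of_congruence hβγ hg.2.2.1 hg.2.2.2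

theorem norm_diag_eq_one (hβγ : ‖β * γ‖ < 1) {g : SpecialLinearGroup (Fin 2) F}
    (hg : g ∈ congruenceSet β γ) : ‖g.1 0 0‖ = 1 ∧ ‖g.1 1 1‖ = 1 := by
  have h := norm_mul_diag_sub_one_lt hβγ hg
  have h1 : ‖g.1 0 0 * g.1 1 1‖ = 1 := by
    have e : g.1 0 0 * g.1 1 1 = 1 + (g.1 0 0 * g.1 1 1 - 1) := by ring
    rw [e, norm_add_eq_of_lt (by rwa [norm_one]), norm_one]
  rw [norm_mul] at h1
  obtain ⟨ha, hd, -, -⟩ := hg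
  have := norm_nonneg (g.1 0 0)
  have := norm_nonneg (g.1 1 1)
  constructor <;> nlinarith

end congruence

section splitting

variable {F : Type*} [NontriviallyNormedField F] [IsUltrametricDist F] {q : ℕ} {ϖ δ β γ : F}

/-- The explicit form of the genuine character `ε`. -/
def splitSign (q : ℕ) (ϖ δ : F) (x : Mp2 F) : ℤˣ :=
  x.sgn * unitChar q ϖ (x.mat.1 1 1) ^ ord q (δ * lowerEntry x.mat)

namespace OddUniformizer

theorem unitChar_diag (hϖ : OddUniformizer q ϖ) (hβγ : ‖β * γ‖ < 1)
    {g : SpecialLinearGroup (Fin 2) F} (hg : g ∈ congruenceSet β γ) :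
    unitChar q ϖ (g.1 0 0) = unitChar q ϖ (g.1 1 1) := by
  obtain ⟨ha, hd⟩ := norm_diag_eq_one hβγ hg
  have ha0 : g.1 0 0 ≠ 0 := norm_pos_iff.1 (ha ▸ one_pos)
  have hd0 : g.1 1 1 ≠ 0 := norm_pos_iff.1 (hd ▸ one_pos)
  have h := hϖ.unitChar_eq_of_close (x := g.1 0 0 * g.1 1 1) (y := 1)
    (by rw [norm_mul, ha, hd, one_mul]) norm_one.le (norm_mul_diag_sub_one_lt hβγ hg)
  rw [hϖ.unitChar_mul ha0 hd0, hϖ.unitChar_one] at h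
  exact (eq_inv_of_mul_eq_one_left h).trans (Int.units_inv_eq_self _)

variable [ProperSpace F]

theorem splitSign_eq (hϖ : OddUniformizer q ϖ) (hδ : δ ≠ 0) {x : Mp2 F} (hd : ‖x.mat.1 1 1‖ = 1) :
    splitSign q ϖ δ x = x.sgn * hilbertSymbol (x.mat.1 1 1) (δ * lowerEntry x.mat) := by
  rw [hϖ.hilbertSymbol_unit_left hd (mul_ne_zero hδ (lowerEntry_ne_zero _))]
  rfl

theorem hilbertSymbol_congr_unit (hϖ : OddUniformizer q ϖ) {u v b : F} (hu : ‖u‖ = 1)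
    (hv : ‖v‖ = 1) (h : unitChar q ϖ u = unitChar q ϖ v) (hb : b ≠ 0) :
    hilbertSymbol u b = hilbertSymbol v b := by
  rw [hϖ.hilbertSymbol_unit_left hu hb, hϖ.hilbertSymbol_unit_left hv hb, h]

theorem hilbertSymbol_congr_norm (hϖ : OddUniformizer q ϖ) {u b c : F} (hu : ‖u‖ = 1)
    (hb : b ≠ 0) (hc : c ≠ 0) (h : ‖b‖ = ‖c‖) : hilbertSymbol u b = hilbertSymbol u c := by
  rw [hϖ.hilbertSymbol_unit_left hu hb, hϖ.hilbertSymbol_unit_left hu hc,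
    (hϖ.ord_eq_iff hb hc).2 h]

theorem symbolBilinear (hϖ : OddUniformizer q ϖ) : SymbolBilinear F :=
  fun _ _ _ ha hb hc => hϖ.hilbertSymbol_mul_left ha hb hc

/-- The 2-cocycle splits over `Γ[β, γ]`. -/
theorem cocycle_mul_hilbertSymbol (hϖ : OddUniformizer q ϖ) (hβγ : ‖β * γ‖ < 1)
    {g h : SpecialLinearGroup (Fin 2) F} (hg : g ∈ congruenceSet β γ)
    (hh : h ∈ congruenceSet β γ) :
    cocycle g h * (hilbertSymbol (g.1 1 1) (lowerEntry (g * h)) *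
      hilbertSymbol (h.1 1 1) (lowerEntry (g * h))) =
      hilbertSymbol (g.1 1 1) (lowerEntry g) * hilbertSymbol (h.1 1 1) (lowerEntry h) := by
  have hF := hϖ.symbolBilinear
  obtain ⟨ha₁, hd₁⟩ := norm_diag_eq_one hβγ hg
  obtain ⟨ha₂, hd₂⟩ := norm_diag_eq_one hβγ hh
  have hca : unitChar q ϖ (h.1 0 0) = unitChar q ϖ (h.1 1 1) := hϖ.unitChar_diag hβγ hh
  have hc12 : (g * h).1 1 0 = g.1 1 0 * h.1 0 0 + g.1 1 1 * h.1 1 0 := sl_mul_apply _ _ _ _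
  have hd12 : (g * h).1 1 1 = g.1 1 0 * h.1 0 1 + g.1 1 1 * h.1 1 1 := sl_mul_apply _ _ _ _
  have hsmall : ‖g.1 1 0 * h.1 0 1‖ < 1 := by
    rw [mul_comm]
    exact norm_mul_lt_of_congruence hβγ hh.2.2.1 hg.2.2.2
  have hb12 := lowerEntry_ne_zero (g * h)
  have hb1 := lowerEntry_ne_zero g
  have hb2 := lowerEntry_ne_zero h
  rw [cocycle_eq]
  have ha₂0 : h.1 0 0 ≠ 0 := norm_pos_iff.1 (ha₂ ▸ one_pos)
  have hd₁0 : g.1 1 1 ≠ 0 := norm_pos_iff.1 (hd₁ ▸ one_pos)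
  have hd₂0 : h.1 1 1 ≠ 0 := norm_pos_iff.1 (hd₂ ▸ one_pos)
  by_cases hc1 : g.1 1 0 = 0
  · rw [hc1, zero_mul, zero_add] at hc12 hd12
    rw [lowerEntry_of_eq hc1]
    have hu := hϖ.hilbertSymbol_unit_unit hd₁ hd₂
    have hu' := hϖ.hilbertSymbol_unit_unit hd₂ hd₁
    have e : lowerEntry (g * h) = g.1 1 1 * lowerEntry h := by
      by_cases hc2 : h.1 1 0 = 0
      · rw [lowerEntry_of_eq hc2, lowerEntry_of_eq (by rw [hc12, hc2, mul_zero]), hd12]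
      · rw [lowerEntry_of_ne hc2, lowerEntry_of_ne (by rw [hc12]; exact mul_ne_zero hd₁0 hc2), hc12]
    rw [e]
    simp only [hF.mul_left, hF.mul_right, ne_eq, mul_eq_zero, hd₁0, hb2, hd₂0, or_self,
      not_false_eq_true]
    have h1 := hϖ.hilbertSymbol_unit_unit hd₁ hd₁
    have hb2b : hilbertSymbol (lowerEntry h) (g.1 1 1) = hilbertSymbol (g.1 1 1) (lowerEntry h) :=
      hilbertSymbol_comm _ _
    rw [hu', h1, hb2b]
    simp only [mul_assoc, mul_comm, mul_left_comm, units_mul_cancel, Int.units_mul_self, mul_one,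
      one_mul]
  · rw [lowerEntry_of_ne hc1] at hb1 ⊢
    by_cases hc2 : h.1 1 0 = 0
    · rw [hc2, mul_zero, add_zero] at hc12
      rw [lowerEntry_of_eq hc2]
      have e : lowerEntry (g * h) = g.1 1 0 * h.1 0 0 := by
        rw [lowerEntry_of_ne (by rw [hc12]; exact mul_ne_zero hc1 ha₂0), hc12]
      have hda : hilbertSymbol (h.1 0 0) (g.1 1 0) = hilbertSymbol (h.1 1 1) (g.1 1 0) :=
        hϖ.hilbertSymbol_congr_unit ha₂ hd₂ hca hc1
      have hcd : hilbertSymbol (g.1 1 0) (h.1 1 1) = hilbertSymbol (h.1 1 1) (g.1 1 0) :=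
        hilbertSymbol_comm _ _
      have hcd' : hilbertSymbol (g.1 1 0) (h.1 0 0) = hilbertSymbol (h.1 1 1) (g.1 1 0) :=
        (hilbertSymbol_comm _ _).trans hda
      have hs : hilbertSymbol (g.1 1 0 * (g.1 1 0 * h.1 0 0)) = hilbertSymbol (h.1 0 0) := by
        funext z
        rw [← hilbertSymbol_mul_sq_left (h.1 0 0) z hc1]
        congr 1
        ring
      rw [e, hs]
      simp only [hF.mul_left, hF.mul_right, ne_eq, mul_eq_zero, hc1, ha₂0, hd₁0, hd₂0, or_self,
        not_false_eq_true, hϖ.hilbertSymbol_unit_unit ha₂ hd₂, hϖ.hilbertSymbol_unit_unit ha₂ ha₂,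
        hϖ.hilbertSymbol_unit_unit hd₁ ha₂, hϖ.hilbertSymbol_unit_unit hd₂ ha₂,
        hϖ.hilbertSymbol_unit_unit hd₂ hd₂, hda, mul_one, one_mul]
      simp only [mul_comm, mul_left_comm, Int.units_mul_self, one_mul]
    · rw [lowerEntry_of_ne hc2]
      have hac : hilbertSymbol (h.1 0 0) (h.1 1 0) = hilbertSymbol (h.1 1 1) (h.1 1 0) :=
        hϖ.hilbertSymbol_congr_unit ha₂ hd₂ hca hc2
      have hac₁ : hilbertSymbol (h.1 0 0) (g.1 1 0) = hilbertSymbol (h.1 1 1) (g.1 1 0) :=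
        hϖ.hilbertSymbol_congr_unit ha₂ hd₂ hca hc1
      by_cases hc : (g * h).1 1 0 = 0
      · have hrel : g.1 1 0 * h.1 0 0 = -(h.1 1 0 * g.1 1 1) := by
          rw [hc] at hc12
          linear_combination -hc12
        have hnorm : ‖g.1 1 0‖ = ‖h.1 1 0‖ := by
          have := congrArg (‖·‖) hrel
          simp only [norm_neg, norm_mul, ha₂, hd₁, mul_one] at this
          exact this
        have hdd : ‖g.1 1 1 * h.1 1 1‖ = 1 := by rw [norm_mul, hd₁, hd₂, one_mul]
        have hd : ‖(g * h).1 1 1‖ = 1 := by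
          rw [hd12, add_comm, norm_add_eq_of_lt (by rwa [hdd]), hdd]
        have hd0 : (g * h).1 1 1 ≠ 0 := norm_pos_iff.1 (hd ▸ one_pos)
        have hcd : unitChar q ϖ ((g * h).1 1 1) = unitChar q ϖ (g.1 1 1 * h.1 1 1) := by
          refine hϖ.unitChar_eq_of_close hd hdd.le ?_
          rw [hd12, add_sub_cancel_right]
          exact hsmall
        have h1 : ∀ c : F, c ≠ 0 → hilbertSymbol ((g * h).1 1 1) c =
            hilbertSymbol (g.1 1 1) c * hilbertSymbol (h.1 1 1) c := by
          intro c hc0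
          rw [hϖ.hilbertSymbol_congr_unit hd hdd hcd hc0, hF.mul_left hd₁0 hd₂0 hc0]
        -- The vanishing lower left entry says c₁a₂ = -c₂d₁, so this is (x, -x) = 1 for x = c₂d₁,
        -- expanded by bilinearity.
        have h2 : hilbertSymbol (g.1 1 0) (h.1 1 0) * hilbertSymbol (g.1 1 0) (g.1 1 1) *
            hilbertSymbol (h.1 0 0) (h.1 1 0) = 1 := by
          have := hilbertSymbol_neg_self (h.1 1 0 * g.1 1 1)
          rw [← hrel, hilbertSymbol_comm] at this
          rw [hF.mul_left hc1 ha₂0 (mul_ne_zero hc2 hd₁0), hF.mul_right hc2 hd₁0 hc1,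
            hF.mul_right hc2 hd₁0 ha₂0, hϖ.hilbertSymbol_unit_unit ha₂ hd₁, mul_one] at this
          exact this
        have h3 : hilbertSymbol (g.1 1 1) (g.1 1 0) = hilbertSymbol (g.1 1 1) (h.1 1 0) :=
          hϖ.hilbertSymbol_congr_norm hd₁ hc1 hc2 hnorm
        have h4 : hilbertSymbol (h.1 1 1) (g.1 1 0) = hilbertSymbol (h.1 1 1) (h.1 1 0) :=
          hϖ.hilbertSymbol_congr_norm hd₂ hc1 hc2 hnorm
        rw [hilbertSymbol_comm (g.1 1 0) (g.1 1 1), h3, hac] at h2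
        rw [lowerEntry_of_eq hc, hϖ.hilbertSymbol_unit_unit hd₁ hd,
          hϖ.hilbertSymbol_unit_unit hd₂ hd, mul_one, mul_one,
          hF.mul_left hc1 hd0 (mul_ne_zero hc2 hd0), hF.mul_right hc2 hd0 hc1,
          hF.mul_right hc2 hd0 hd0, hϖ.hilbertSymbol_unit_unit hd hd, mul_one,
          hilbertSymbol_comm (g.1 1 0) ((g * h).1 1 1), h1 _ hc1, h1 _ hc2, h3, h4]
        rw [mul_assoc] at h2
        rw [mul_assoc, Int.units_mul_self (_ * _), mul_one]
        exact (eq_inv_of_mul_eq_one_left h2).trans (Int.units_inv_eq_self _)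
      · rw [lowerEntry_of_ne hc] at hb12 ⊢
        -- The lower left entry of gh is c₁a₂ + d₁c₂. Divided by it the two summands add up to 1,
        -- and (x, 1 - x) = 1.
        have h2 : hilbertSymbol (g.1 1 0 * h.1 0 0 * (g * h).1 1 0)
            (g.1 1 1 * h.1 1 0 * (g * h).1 1 0) = 1 := by
          rw [← hilbertSymbol_div_left _ _ hc, ← hilbertSymbol_div_right _ _ hc]
          refine hilbertSymbol_of_add_eq_one ?_
          rw [← add_div, ← hc12, div_self hc]
        rw [← mul_one (_ * _), ← h2]
        have ha₂c : hilbertSymbol (h.1 0 0) ((g * h).1 1 0) =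
            hilbertSymbol (h.1 1 1) ((g * h).1 1 0) :=
          hϖ.hilbertSymbol_congr_unit ha₂ hd₂ hca hc
        set c₃ := (g * h).1 1 0
        simp only [hF.mul_left, hF.mul_right, ne_eq, mul_eq_zero, hc1, hc2, hc, ha₂0, hd₁0,
          or_self, not_false_eq_true, hac, ha₂c, hϖ.hilbertSymbol_unit_unit ha₂ hd₁,
          hilbertSymbol_comm (g.1 1 0) (g.1 1 1), hilbertSymbol_comm c₃ (g.1 1 1),
          hilbertSymbol_comm c₃ (h.1 1 0)]
        simp only [mul_assoc, mul_comm, mul_left_comm, units_mul_cancel, Int.units_mul_self,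
          one_mul]

/-- Modulo the maximal ideal the lower right entry of a product is the product of the lower right
entries, so the symbols with δ multiply; the remaining factors are the splitting identity for the
cocycle. -/
theorem splitSign_mul (hϖ : OddUniformizer q ϖ) (hδ : δ ≠ 0) (hβγ : ‖β * γ‖ < 1) {x y : Mp2 F}
    (hx : x.mat ∈ congruenceSet β γ) (hy : y.mat ∈ congruenceSet β γ) :
    splitSign q ϖ δ (x * y) = splitSign q ϖ δ x * splitSign q ϖ δ y := by
  have hF := hϖ.symbolBilinear
  obtain ⟨-, hd₁⟩ := norm_diag_eq_one hβγ hx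
  obtain ⟨-, hd₂⟩ := norm_diag_eq_one hβγ hy
  have hd₁0 : x.mat.1 1 1 ≠ 0 := norm_pos_iff.1 (hd₁ ▸ one_pos)
  have hd₂0 : y.mat.1 1 1 ≠ 0 := norm_pos_iff.1 (hd₂ ▸ one_pos)
  have hdd : ‖x.mat.1 1 1 * y.mat.1 1 1‖ = 1 := by rw [norm_mul, hd₁, hd₂, one_mul]
  have hsmall : ‖x.mat.1 1 0 * y.mat.1 0 1‖ < 1 := by
    rw [mul_comm]
    exact norm_mul_lt_of_congruence hβγ hy.2.2.1 hx.2.2.2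
  have hd12 : (x * y).mat.1 1 1 = x.mat.1 1 0 * y.mat.1 0 1 + x.mat.1 1 1 * y.mat.1 1 1 :=
    sl_mul_apply _ _ _ _
  have hd : ‖(x * y).mat.1 1 1‖ = 1 := by
    rw [hd12, add_comm, norm_add_eq_of_lt (by rwa [hdd]), hdd]
  have hcd : unitChar q ϖ ((x * y).mat.1 1 1) = unitChar q ϖ (x.mat.1 1 1 * y.mat.1 1 1) := by
    refine hϖ.unitChar_eq_of_close hd hdd.le ?_
    rw [hd12, add_sub_cancel_right]
    exact hsmall
  have hb := lowerEntry_ne_zero (x * y).mat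
  rw [hϖ.splitSign_eq hδ hd, hϖ.splitSign_eq hδ hd₁, hϖ.splitSign_eq hδ hd₂,
    hϖ.hilbertSymbol_congr_unit hd hdd hcd (mul_ne_zero hδ hb),
    hF.mul_left hd₁0 hd₂0 (mul_ne_zero hδ hb), hF.mul_right hδ hb hd₁0, hF.mul_right hδ hb hd₂0,
    hF.mul_right hδ (lowerEntry_ne_zero _) hd₁0, hF.mul_right hδ (lowerEntry_ne_zero _) hd₂0]
  have h := hϖ.cocycle_mul_hilbertSymbol hβγ hx hy
  change x.sgn * y.sgn * cocycle x.mat y.mat * (hilbertSymbol _ δ *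
    hilbertSymbol _ (lowerEntry (x.mat * y.mat)) * (hilbertSymbol _ δ *
    hilbertSymbol _ (lowerEntry (x.mat * y.mat)))) = _
  calc _ = x.sgn * y.sgn * (hilbertSymbol (x.mat.1 1 1) δ * hilbertSymbol (y.mat.1 1 1) δ) *
      (cocycle x.mat y.mat * (hilbertSymbol (x.mat.1 1 1) (lowerEntry (x.mat * y.mat)) *
        hilbertSymbol (y.mat.1 1 1) (lowerEntry (x.mat * y.mat)))) := by
        simp only [mul_left_comm, mul_assoc]
    _ = _ := by
        rw [h]
        simp only [mul_left_comm, mul_assoc]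

/-- `ε` is invariant under conjugation by `𝐰_a`. -/
theorem splitSign_eq_of_mul_wAnti (hϖ : OddUniformizer q ϖ) (hδ : δ ≠ 0) (hβγ : ‖β * γ‖ < 1)
    {x y : Mp2 F} (hx : x.mat ∈ congruenceSet β γ) (hy : y.mat ∈ congruenceSet β γ) (a : Fˣ)
    (h : x * wAnti a = wAnti a * y) : splitSign q ϖ δ x = splitSign q ϖ δ y := by
  have hF := hϖ.symbolBilinear
  obtain ⟨-, hd₁⟩ := norm_diag_eq_one hβγ hx
  obtain ⟨ha₂, hd₂⟩ := norm_diag_eq_one hβγ hy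
  have hd₁0 : x.mat.1 1 1 ≠ 0 := norm_pos_iff.1 (hd₁ ▸ one_pos)
  have ha := a.ne_zero
  have hm : x.mat * (wAnti a).mat = (wAnti a).mat * y.mat := congrArg Mp2.mat h
  have h10 : (x.mat * (wAnti a).mat).1 1 0 = x.mat.1 1 1 * a := by
    rw [sl_mul_apply]
    simp [wAnti]
  have h10' : ((wAnti a).mat * y.mat).1 1 0 = a * y.mat.1 0 0 := by
    rw [sl_mul_apply]
    simp [wAnti]
  have hda : x.mat.1 1 1 = y.mat.1 0 0 := by
    rw [hm, h10'] at h10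
    exact mul_right_cancel₀ ha (h10.symm.trans (mul_comm _ _))
  have hb : lowerEntry (x.mat * (wAnti a).mat) = x.mat.1 1 1 * a := by
    rw [lowerEntry_of_ne (by rw [h10]; exact mul_ne_zero hd₁0 ha), h10]
  have hwa : lowerEntry (wAnti a).mat = a := by simp [lowerEntry, wAnti]
  have hs : x.sgn * 1 * cocycle x.mat (wAnti a).mat = 1 * y.sgn * cocycle (wAnti a).mat y.mat :=
    congrArg Mp2.sgn h
  rw [cocycle_eq, cocycle_eq, ← hm, hb, hwa, mul_one, one_mul] at hs
  have hcong : ∀ c : F, c ≠ 0 → hilbertSymbol (y.mat.1 1 1) c = hilbertSymbol (x.mat.1 1 1) c :=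
    fun c hc => hϖ.hilbertSymbol_congr_unit hd₂ hd₁
      (by rw [hda, hϖ.unitChar_diag hβγ hy]) hc
  have hb1 := lowerEntry_ne_zero x.mat
  have hb2 := lowerEntry_ne_zero y.mat
  rw [hϖ.splitSign_eq hδ hd₁, hϖ.splitSign_eq hδ hd₂, hcong _ (mul_ne_zero hδ hb2),
    hF.mul_right hδ hb1 hd₁0, hF.mul_right hδ hb2 hd₁0]
  have e1 : (a : F) * (x.mat.1 1 1 * a) = x.mat.1 1 1 * (a * a) := by ring
  rw [e1, hilbertSymbol_mul_sq_right _ _ ha, hilbertSymbol_mul_sq_left _ _ ha] at hs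
  have hd := x.mat.1 1 1
  have hax := mul_ne_zero hd₁0 ha
  rw [hilbertSymbol_comm, hF.mul_right hb1 hax hd₁0, hF.mul_right hb2 hax hd₁0] at hs
  rw [← mul_assoc, ← mul_assoc] at hs
  have hs' := mul_right_cancel hs
  calc _ = x.sgn * hilbertSymbol (x.mat.1 1 1) (lowerEntry x.mat) * hilbertSymbol (x.mat.1 1 1) δ := by
        rw [mul_comm (hilbertSymbol _ δ), mul_assoc]
    _ = _ := by rw [hs', mul_assoc, mul_comm (hilbertSymbol _ δ)]

end OddUniformizer

end splitting

/-! ### Double cosets of alternating words -/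

section affine

variable {G : Type*} [Group G]

/-- Data from which the double coset decomposition with respect to an Iwahori subgroup can be
derived: `s`, `t` are the simple reflections, and `U`, `L` the two unipotent parts of `Γ`. -/
structure AffineSystem (Γ : Subgroup G) (s t : G) (U L : Set G) : Prop where
  U_subset : ∀ u ∈ U, u ∈ Γ
  L_subset : ∀ l ∈ L, l ∈ Γ
  decomp_left : ∀ γ ∈ Γ, ∃ l, ∃ u ∈ U, γ = l * u ∧ s * l * s⁻¹ ∈ Γ
  decomp_right : ∀ γ ∈ Γ, ∃ u, ∃ l ∈ L, γ = u * l ∧ t * u * t⁻¹ ∈ Γ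
  conj_left : ∀ l ∈ L, s⁻¹ * l * s ∈ U
  conj_right : ∀ u ∈ U, t⁻¹ * u * t ∈ L
  sq_left : s * s ∈ Γ
  sq_right : t * t ∈ Γ
  cell_left : ∀ u ∈ U, s * u * s ∈ Γ ∨ InDC Γ s (s * u * s)
  cell_right : ∀ l ∈ L, t * l * t ∈ Γ ∨ InDC Γ t (t * l * t)
  word_left : ∀ n, altProd s t (n + 1) ∉ Γ
  word_right : ∀ n, altProd t s (n + 1) ∉ Γ
  generate : Subgroup.closure ((Γ : Set G) ∪ {s, t}) = ⊤

namespace AffineSystem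

variable {Γ : Subgroup G} {s t : G} {U L : Set G}

theorem symm (h : AffineSystem Γ s t U L) : AffineSystem Γ t s L U where
  U_subset := h.L_subset
  L_subset := h.U_subset
  decomp_left := h.decomp_right
  decomp_right := h.decomp_left
  conj_left := h.conj_right
  conj_right := h.conj_left
  sq_left := h.sq_right
  sq_right := h.sq_left
  cell_left := h.cell_right
  cell_right := h.cell_left
  word_left := h.word_right
  word_right := h.word_left
  generate := by rw [Set.pair_comm]; exact h.generate

/-- Conjugation by t carries U into L and conjugation by s carries L back into U, so the letters of
an alternating word beginning with t can be passed one after the other. -/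
theorem conj_altProd_mem (h : AffineSystem Γ s t U L) (n : ℕ) :
    ∀ u ∈ U, (altProd t s n)⁻¹ * u * altProd t s n ∈ Γ := by
  induction n generalizing s t U L with
  | zero => intro u hu; simpa [altProd] using h.U_subset u hu
  | succ n ih =>
    intro u hu
    have := ih h.symm _ (h.conj_right u hu)
    rw [altProd, _root_.mul_inv_rev]
    simpa only [mul_assoc] using this

/-- Write γ = l u. The factor l passes to the left through s, and u passes to the right through the
whole word. This is the additivity of lengths. -/
theorem inDC_mul (h : AffineSystem Γ s t U L) (n : ℕ) (γ : Γ) :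
    InDC Γ (s * altProd t s n) (s * γ * altProd t s n) := by
  obtain ⟨l, u, hu, e, hl⟩ := h.decomp_left γ γ.2
  refine ⟨⟨_, hl⟩, ⟨_, h.conj_altProd_mem n u hu⟩, ?_⟩
  rw [e]
  group

theorem cell (h : AffineSystem Γ s t U L) (γ : Γ) :
    s * γ * s ∈ Γ ∨ InDC Γ s (s * γ * s) := by
  obtain ⟨l, u, hu, e, hl⟩ := h.decomp_left γ γ.2
  have e' : s * γ * s = (⟨_, hl⟩ : Γ) * (s * u * s) := by
    rw [e]
    group
  rw [e']
  rcases h.cell_left u hu with h1 | h1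
  · exact Or.inl (Γ.mul_mem hl h1)
  · exact Or.inr (h1.mul_left _)

/-- If the word already begins with s, the rank-one rule sΓs ⊂ Γ ∪ ΓsΓ leaves two possibilities: the
first letter cancels or the word stays as it is. -/
theorem inDC_mul_same (h : AffineSystem Γ s t U L) (n : ℕ) (γ : Γ) :
    InDC Γ (altProd t s n) (s * γ * altProd s t (n + 1)) ∨
      InDC Γ (altProd s t (n + 1)) (s * γ * altProd s t (n + 1)) := by
  have e : s * γ * altProd s t (n + 1) = s * γ * s * altProd t s n := by
    rw [altProd, ← mul_assoc]
  rw [e]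
  rcases h.cell γ with h1 | ⟨γ₁, γ₂, h1⟩
  · exact Or.inl ((InDC.refl _).mul_left ⟨_, h1⟩)
  · refine Or.inr ?_
    rw [h1, mul_assoc (γ₁ : G), mul_assoc (γ₁ : G)]
    exact (h.inDC_mul n γ₂).mul_left γ₁

theorem exists_inDC_mul (h : AffineSystem Γ s t U L) {g : G}
    (hg : ∃ n, InDC Γ (altProd s t n) g ∨ InDC Γ (altProd t s n) g) :
    ∃ n, InDC Γ (altProd s t n) (s * g) ∨ InDC Γ (altProd t s n) (s * g) := by
  have key : ∀ n (γ₁ γ₂ : Γ), ∃ m, InDC Γ (altProd s t m) (s * (γ₁ * altProd t s n * γ₂)) ∨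
      InDC Γ (altProd t s m) (s * (γ₁ * altProd t s n * γ₂)) := by
    intro n γ₁ γ₂
    refine ⟨n + 1, Or.inl ?_⟩
    rw [← mul_assoc, ← mul_assoc]
    exact (h.inDC_mul n γ₁).mul_right γ₂
  obtain ⟨n, ⟨γ₁, γ₂, rfl⟩ | ⟨γ₁, γ₂, rfl⟩⟩ := hg
  · cases n with
    | zero => exact key 0 γ₁ γ₂
    | succ n =>
      rw [← mul_assoc, ← mul_assoc]
      rcases h.inDC_mul_same n γ₁ with h1 | h1
      · exact ⟨n, Or.inr (h1.mul_right γ₂)⟩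
      · exact ⟨n + 1, Or.inl (h1.mul_right γ₂)⟩
  · exact key n γ₁ γ₂

/-- The union of the double cosets of alternating words is stable under left multiplication by Γ, s
and t. Inverses of s and t cost nothing, since the squares lie in Γ. -/
theorem exists_inDC (h : AffineSystem Γ s t U L) (g : G) :
    ∃ n, InDC Γ (altProd s t n) g ∨ InDC Γ (altProd t s n) g := by
  have hg : g ∈ Subgroup.closure ((Γ : Set G) ∪ {s, t}) := by rw [h.generate]; trivial
  have hswap : ∀ x : G, (∃ n, InDC Γ (altProd s t n) x ∨ InDC Γ (altProd t s n) x) ↔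
      ∃ n, InDC Γ (altProd t s n) x ∨ InDC Γ (altProd s t n) x :=
    fun x => exists_congr fun n => or_comm
  have hΓ : ∀ (γ : Γ) (x : G), (∃ n, InDC Γ (altProd s t n) x ∨ InDC Γ (altProd t s n) x) →
      ∃ n, InDC Γ (altProd s t n) (γ * x) ∨ InDC Γ (altProd t s n) (γ * x) :=
    fun γ x ⟨n, hn⟩ => ⟨n, hn.imp (fun h => h.mul_left γ) fun h => h.mul_left γ⟩
  have ht : ∀ x : G, (∃ n, InDC Γ (altProd s t n) x ∨ InDC Γ (altProd t s n) x) →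
      ∃ n, InDC Γ (altProd s t n) (t * x) ∨ InDC Γ (altProd t s n) (t * x) :=
    fun x hx => (hswap _).2 (h.symm.exists_inDC_mul ((hswap _).1 hx))
  refine Subgroup.closure_induction_left
    (p := fun g _ => ∃ n, InDC Γ (altProd s t n) g ∨ InDC Γ (altProd t s n) g)
    ⟨0, Or.inl (InDC.refl _)⟩ ?_ ?_ hg
  · rintro x (hx | hx | hx) y - hy
    · exact hΓ ⟨x, hx⟩ y hy
    · rw [hx]
      exact h.exists_inDC_mul hy
    · rw [Set.mem_singleton_iff.1 hx]
      exact ht y hy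
  · rintro x (hx | hx | hx) y - hy
    · exact hΓ ⟨x, hx⟩⁻¹ y hy
    · have e : x⁻¹ * y = ((⟨_, h.sq_left⟩⁻¹ : Γ) : G) * (s * y) := by
        rw [hx, Subgroup.coe_inv]
        group
      rw [e]
      exact hΓ _ _ (h.exists_inDC_mul hy)
    · have e : x⁻¹ * y = ((⟨_, h.sq_right⟩⁻¹ : Γ) : G) * (t * y) := by
        rw [Set.mem_singleton_iff.1 hx, Subgroup.coe_inv]
        group
      rw [e]
      exact hΓ _ _ (ht y hy)

theorem mul_left_inDC (h : AffineSystem Γ s t U L) {x y : G} (hxy : InDC Γ (s * x) y) :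
    ∃ γ : Γ, InDC Γ x (s * γ * y) := by
  obtain ⟨γ₁, γ₂, rfl⟩ := hxy
  refine ⟨γ₁⁻¹, ⟨⟨_, h.sq_left⟩, γ₂, ?_⟩⟩
  rw [Subgroup.coe_inv]
  group

/-- Tits's argument, by induction on the shorter length. Multiplication by sγ strips the first
letter of the shorter word; on the longer word it removes a letter, keeps the word or adds a letter,
and the induction hypothesis for the exchanged letters excludes all but the removal. Words of
positive length lie outside of Γ, which starts the induction. -/
theorem disjoint_aux (h : AffineSystem Γ s t U L) (n : ℕ) : ∀ m, n ≤ m →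
    (InDC Γ (altProd s t n) (altProd s t m) → n = m) ∧
    (InDC Γ (altProd s t n) (altProd t s m) → n = 0 ∧ m = 0) := by
  induction n generalizing s t U L with
  | zero =>
    have key : ∀ {x : G}, InDC Γ (altProd s t 0) x → x ∈ Γ := by
      rintro x ⟨γ₁, γ₂, rfl⟩
      rw [altProd, mul_one]
      exact Γ.mul_mem γ₁.2 γ₂.2
    intro m _
    cases m with
    | zero => exact ⟨fun _ => rfl, fun _ => ⟨rfl, rfl⟩⟩
    | succ m =>
      exact ⟨fun hm => absurd (key hm) (h.word_left m), fun hm => absurd (key hm) (h.word_right m)⟩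
  | succ n ih =>
    intro m hnm
    constructor
    · intro hm
      obtain ⟨m, rfl⟩ : ∃ k, m = k + 1 := ⟨m - 1, by omega⟩
      obtain ⟨γ, hγ⟩ := h.mul_left_inDC hm
      rcases h.inDC_mul_same m γ with h1 | h1
      · rw [((ih h.symm m (by omega)).1 (hγ.trans h1.symm))]
      · have := (ih h.symm (m + 1) (by omega)).2 (hγ.trans h1.symm)
        omega
    · intro hm
      obtain ⟨γ, hγ⟩ := h.mul_left_inDC hm
      have := (ih h.symm (m + 1) (by omega)).2 (hγ.trans (h.inDC_mul m γ).symm)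
      omega

theorem iwahoriSystem (h : AffineSystem Γ s t U L) : IwahoriSystem Γ s t where
  mul_left := h.inDC_mul
  mul_right := h.symm.inDC_mul
  cover g := by
    obtain ⟨n, hn | hn⟩ := h.exists_inDC g
    · exact ⟨Sum.inl n, hn⟩
    · obtain ⟨i, hi⟩ := exists_altWord_eq_right s t n
      exact ⟨i, hi ▸ hn⟩
  disjoint := by
    have hl : ∀ n m, InDC Γ (altProd s t n) (altProd s t m) → n = m := fun n m hnm =>
      (le_total n m).elim (fun hle => (h.disjoint_aux n m hle).1 hnm)
        fun hle => ((h.disjoint_aux m n hle).1 hnm.symm).symm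
    have hr : ∀ n m, InDC Γ (altProd t s n) (altProd t s m) → n = m := fun n m hnm =>
      (le_total n m).elim (fun hle => (h.symm.disjoint_aux n m hle).1 hnm)
        fun hle => ((h.symm.disjoint_aux m n hle).1 hnm.symm).symm
    have hlr : ∀ n m, ¬ InDC Γ (altProd s t n) (altProd t s (m + 1)) := fun n m hnm =>
      (le_total n (m + 1)).elim
        (fun hle => absurd ((h.disjoint_aux n _ hle).2 hnm).2 (by omega))
        fun hle => absurd ((h.symm.disjoint_aux _ n hle).2 hnm.symm).1 (by omega)
    rintro (n | n) (m | m) hnm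
    · rw [hl n m hnm]
    · exact absurd hnm (hlr n m)
    · exact absurd hnm.symm (hlr m n)
    · rw [Nat.succ_injective (hr _ _ hnm)]

end AffineSystem

/-- The kernel of π lies in the preimage of Γ. So an arbitrary lift of the left factor works, and
the right factor is then forced. -/
theorem InDC.of_map {H : Type*} [Group H] {Γ : Subgroup G} {π : H →* G}
    (hπ : Function.Surjective π) {x y : H} (h : InDC Γ (π x) (π y)) : InDC (Γ.comap π) x y := by
  obtain ⟨γ₁, γ₂, e⟩ := h
  obtain ⟨k₁, h₁⟩ := hπ γ₁
  have hk₁ : k₁ ∈ Γ.comap π := by rw [Subgroup.mem_comap, h₁]; exact γ₁.2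
  have hk₂ : (k₁ * x)⁻¹ * y ∈ Γ.comap π := by
    have e' : (γ₁ * π x : G)⁻¹ * (γ₁ * π x * γ₂) = γ₂ := by group
    rw [Subgroup.mem_comap, map_mul, map_inv, map_mul, h₁, e, e']
    exact γ₂.2
  exact ⟨⟨k₁, hk₁⟩, ⟨_, hk₂⟩, (mul_inv_cancel_left _ _).symm⟩

/-- Pullback of the double coset decomposition along a surjective homomorphism. -/
theorem IwahoriSystem.comap {H : Type*} [Group H] {Γ : Subgroup G} (π : H →* G)
    (hπ : Function.Surjective π) {s t : H} (h : IwahoriSystem Γ (π s) (π t)) :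
    IwahoriSystem (Γ.comap π) s t := by
  have down : ∀ x y : H, InDC (Γ.comap π) x y → InDC Γ (π x) (π y) := by
    rintro x y ⟨γ₁, γ₂, rfl⟩
    exact ⟨⟨_, γ₁.2⟩, ⟨_, γ₂.2⟩, by simp⟩
  refine ⟨fun n γ => .of_map hπ ?_, fun n γ => .of_map hπ ?_, fun g => ?_, fun i j hij => ?_⟩
  · simpa only [map_mul, map_altProd] using h.mul_left n ⟨_, γ.2⟩
  · simpa only [map_mul, map_altProd] using h.mul_right n ⟨_, γ.2⟩
  · obtain ⟨i, hi⟩ := h.cover (π g)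
    exact ⟨i, .of_map hπ (by rwa [map_altWord])⟩
  · exact h.disjoint i j (by simpa only [map_altWord] using down _ _ hij)

end affine

/-! ### The double cosets of `SL₂(F)` -/

section matrices

variable {F : Type*} [Field F]

/-- The lower triangular unipotent matrix `(1, 0; z, 1)`. -/
def lowerUnip (z : F) : SpecialLinearGroup (Fin 2) F :=
  ⟨!![1, 0; z, 1], by simp [Matrix.det_fin_two]⟩

theorem sl_ext {g h : SpecialLinearGroup (Fin 2) F} (h₀₀ : g.1 0 0 = h.1 0 0)
    (h₀₁ : g.1 0 1 = h.1 0 1) (h₁₀ : g.1 1 0 = h.1 1 0) (h₁₁ : g.1 1 1 = h.1 1 1) : g = h := by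
  apply Subtype.ext
  ext i j
  fin_cases i <;> fin_cases j <;> assumption

theorem mDiag_mat_mul (x y : Fˣ) : (mDiag x).mat * (mDiag y).mat = (mDiag (x * y)).mat := by
  apply sl_ext <;> rw [sl_mul_apply] <;> simp [mDiag, mul_comm]

theorem wAnti_mat_mul_mDiag (a x : Fˣ) :
    (wAnti a).mat * (mDiag x).mat = (wAnti (a * x)).mat := by
  apply sl_ext <;> rw [sl_mul_apply] <;> simp [mDiag, wAnti, mul_comm]

theorem wAnti_mat_mul_wAnti (a b : Fˣ) :
    (wAnti a).mat * (wAnti b).mat = (mDiag (-(b / a))).mat := by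
  apply sl_ext <;> rw [sl_mul_apply] <;> simp [mDiag, wAnti, div_eq_mul_inv, mul_comm, inv_neg]

theorem mDiag_mat_mul_uSharp (x : Fˣ) (y : F) :
    (mDiag x).mat * (uSharp y).mat = (uSharp (x * x * y)).mat * (mDiag x).mat := by
  apply sl_ext <;> rw [sl_mul_apply, sl_mul_apply] <;> simp [mDiag, uSharp]
  field_simp

theorem wAnti_mat_inv (a : Fˣ) : (wAnti a).mat⁻¹ = (wAnti (-a)).mat := by
  rw [inv_eq_iff_mul_eq_one, wAnti_mat_mul_wAnti]
  apply sl_ext <;> simp [mDiag, neg_div]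

theorem uSharp_mat_mul (x y : F) : (uSharp x).mat * (uSharp y).mat = (uSharp (x + y)).mat := by
  apply sl_ext <;> rw [sl_mul_apply] <;> simp [uSharp, add_comm]

theorem uSharp_mat_inv (x : F) : (uSharp x).mat⁻¹ = (uSharp (-x)).mat := by
  rw [inv_eq_iff_mul_eq_one, uSharp_mat_mul]
  apply sl_ext <;> simp [uSharp]

theorem lowerUnip_mul (x y : F) : lowerUnip x * lowerUnip y = lowerUnip (x + y) := by
  apply sl_ext <;> rw [sl_mul_apply] <;> simp [lowerUnip]

theorem lowerUnip_inv (x : F) : (lowerUnip x)⁻¹ = lowerUnip (-x) := by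
  rw [inv_eq_iff_mul_eq_one, lowerUnip_mul]
  apply sl_ext <;> simp [lowerUnip]

theorem conj_wAnti_apply (a : Fˣ) (g : SpecialLinearGroup (Fin 2) F) :
    ((wAnti a).mat⁻¹ * g * (wAnti a).mat).1 0 0 = g.1 1 1 ∧
    ((wAnti a).mat⁻¹ * g * (wAnti a).mat).1 0 1 = -(g.1 1 0 / (a * a)) ∧
    ((wAnti a).mat⁻¹ * g * (wAnti a).mat).1 1 0 = -(g.1 0 1 * (a * a)) ∧
    ((wAnti a).mat⁻¹ * g * (wAnti a).mat).1 1 1 = g.1 0 0 := by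
  have ha := a.ne_zero
  rw [wAnti_mat_inv]
  refine ⟨?_, ?_, ?_, ?_⟩ <;> rw [sl_mul_apply, sl_mul_apply, sl_mul_apply] <;> simp [wAnti] <;>
    field_simp

/-- The square of the antidiagonal matrix is the central element -1. -/
theorem conj_wAnti_inv (a : Fˣ) (g : SpecialLinearGroup (Fin 2) F) :
    (wAnti a).mat * g * (wAnti a).mat⁻¹ = (wAnti a).mat⁻¹ * g * (wAnti a).mat := by
  have h := conj_wAnti_apply (-a) g
  rw [wAnti_mat_inv, neg_neg] at h
  have h' := conj_wAnti_apply a g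
  have e : ((-a : Fˣ) : F) * ((-a : Fˣ) : F) = a * a := by simp
  rw [e] at h
  rw [wAnti_mat_inv a] at h' ⊢
  exact sl_ext (h.1.trans h'.1.symm) (h.2.1.trans h'.2.1.symm) (h.2.2.1.trans h'.2.2.1.symm)
    (h.2.2.2.trans h'.2.2.2.symm)

theorem conj_wAnti_lowerUnip (a : Fˣ) (z : F) :
    (wAnti a).mat⁻¹ * lowerUnip z * (wAnti a).mat = (uSharp (-(z / (a * a)))).mat := by
  obtain ⟨h1, h2, h3, h4⟩ := conj_wAnti_apply a (lowerUnip z)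
  apply sl_ext
  · rw [h1]; simp [lowerUnip, uSharp]
  · rw [h2]; simp [lowerUnip, uSharp]
  · rw [h3]; simp [lowerUnip, uSharp]
  · rw [h4]; simp [lowerUnip, uSharp]

theorem conj_wAnti_uSharp (a : Fˣ) (y : F) :
    (wAnti a).mat⁻¹ * (uSharp y).mat * (wAnti a).mat = lowerUnip (-(y * (a * a))) := by
  obtain ⟨h1, h2, h3, h4⟩ := conj_wAnti_apply a (uSharp y).mat
  apply sl_ext
  · rw [h1]; simp [lowerUnip, uSharp]
  · rw [h2]; simp [lowerUnip, uSharp]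
  · rw [h3]; simp [lowerUnip, uSharp]
  · rw [h4]; simp [lowerUnip, uSharp]

/-- The rank-one identity behind the rule for the product of a cell with itself. -/
theorem lowerUnip_eq (z : Fˣ) : lowerUnip (z : F) =
    (uSharp (z : F)⁻¹).mat * (wAnti z).mat * (uSharp (z : F)⁻¹).mat := by
  have hz := z.ne_zero
  apply sl_ext <;> rw [sl_mul_apply, sl_mul_apply, sl_mul_apply] <;>
    simp [lowerUnip, uSharp, wAnti]

theorem uSharp_eq (y : Fˣ) : (uSharp (y : F)).mat =
    lowerUnip (y : F)⁻¹ * (wAnti (-y⁻¹)).mat * lowerUnip (y : F)⁻¹ := by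
  have hz := y.ne_zero
  apply sl_ext <;> rw [sl_mul_apply, sl_mul_apply, sl_mul_apply] <;>
    simp [lowerUnip, uSharp, wAnti]

theorem eq_lower_mul_uSharp (g : SpecialLinearGroup (Fin 2) F) (h : g.1 0 0 ≠ 0) :
    (g * (uSharp (-(g.1 0 1 / g.1 0 0))).mat).1 0 0 = g.1 0 0 ∧
    (g * (uSharp (-(g.1 0 1 / g.1 0 0))).mat).1 0 1 = 0 ∧
    (g * (uSharp (-(g.1 0 1 / g.1 0 0))).mat).1 1 0 = g.1 1 0 ∧
    (g * (uSharp (-(g.1 0 1 / g.1 0 0))).mat).1 1 1 = (g.1 0 0)⁻¹ := by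
  have hdet := sl_det g
  refine ⟨?_, ?_, ?_, ?_⟩ <;> rw [sl_mul_apply] <;> simp [uSharp] <;> field_simp
  · ring
  · linear_combination hdet

theorem eq_upper_mul_lowerUnip (g : SpecialLinearGroup (Fin 2) F) (h : g.1 1 1 ≠ 0) :
    (g * lowerUnip (-(g.1 1 0 / g.1 1 1))).1 0 0 = (g.1 1 1)⁻¹ ∧
    (g * lowerUnip (-(g.1 1 0 / g.1 1 1))).1 0 1 = g.1 0 1 ∧
    (g * lowerUnip (-(g.1 1 0 / g.1 1 1))).1 1 0 = 0 ∧
    (g * lowerUnip (-(g.1 1 0 / g.1 1 1))).1 1 1 = g.1 1 1 := by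
  have hdet := sl_det g
  refine ⟨?_, ?_, ?_, ?_⟩ <;> rw [sl_mul_apply] <;> simp [lowerUnip] <;> field_simp
  · linear_combination hdet
  · ring

end matrices

theorem altProd_two_mul {M : Type*} [Monoid M] (a b : M) (n : ℕ) :
    altProd a b (2 * n) = (a * b) ^ n := by
  induction n with
  | zero => rw [pow_zero]; rfl
  | succ n ih =>
    rw [pow_succ', ← ih, mul_assoc]
    rfl

/-! ### Γ[β, γ] and its affine system in SL₂(F) -/

section congruenceSubgroup

variable {F : Type*} [NontriviallyNormedField F] [IsUltrametricDist F] {q : ℕ} {ϖ β γ : F}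

/-- `Γ[β, γ]` as a subgroup of `SL₂(F)`. -/
def congruenceSubgroup (β γ : F) (h : ‖β * γ‖ < 1) : Subgroup (SpecialLinearGroup (Fin 2) F) where
  carrier := congruenceSet β γ
  one_mem' := by simp [congruenceSet]
  mul_mem' := by
    intro g k hg hk
    have hbc : ∀ {b c : F}, ‖b‖ ≤ ‖β‖ → ‖c‖ ≤ ‖γ‖ → ‖b * c‖ ≤ 1 :=
      fun hb hc => (norm_mul_lt_of_congruence h hb hc).le
    have hmul : ∀ {a b : F} {r : ℝ}, ‖a‖ ≤ 1 → ‖b‖ ≤ r → ‖a * b‖ ≤ r := fun ha hb => by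
      rw [norm_mul]
      exact (mul_le_of_le_one_left (norm_nonneg _) ha).trans hb
    obtain ⟨a₁, d₁, b₁, c₁⟩ := hg
    obtain ⟨a₂, d₂, b₂, c₂⟩ := hk
    refine ⟨?_, ?_, ?_, ?_⟩ <;> rw [sl_mul_apply]
    · exact norm_add_le_of_le (hmul a₁ a₂) (hbc b₁ c₂)
    · exact norm_add_le_of_le (by rw [mul_comm]; exact hbc b₂ c₁) (hmul d₁ d₂)
    · exact norm_add_le_of_le (hmul a₁ b₂) (by rw [mul_comm]; exact hmul d₂ b₁)
    · exact norm_add_le_of_le (by rw [mul_comm]; exact hmul a₂ c₁) (hmul d₁ c₂)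
  inv_mem' := by
    intro g hg
    obtain ⟨a, d, b, c⟩ := hg
    rw [SpecialLinearGroup.SL2_inv_expl g]
    exact ⟨by simpa using d, by simpa using a, by simpa using b, by simpa using c⟩

variable {h : ‖β * γ‖ < 1}

theorem mem_congruenceSubgroup {g : SpecialLinearGroup (Fin 2) F} :
    g ∈ congruenceSubgroup β γ h ↔ g ∈ congruenceSet β γ := Iff.rfl

theorem uSharp_mem {y : F} (hy : ‖y‖ ≤ ‖β‖) : (uSharp y).mat ∈ congruenceSubgroup β γ h :=
  ⟨by simp [uSharp], by simp [uSharp], by simpa [uSharp] using hy, by simp [uSharp]⟩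

theorem lowerUnip_mem {z : F} (hz : ‖z‖ ≤ ‖γ‖) : lowerUnip z ∈ congruenceSubgroup β γ h :=
  ⟨by simp [lowerUnip], by simp [lowerUnip], by simp [lowerUnip], by simpa [lowerUnip] using hz⟩

theorem mDiag_mem {x : Fˣ} (hx : ‖(x : F)‖ = 1) : (mDiag x).mat ∈ congruenceSubgroup β γ h :=
  ⟨by simp [mDiag, hx], by simp [mDiag, hx], by simp [mDiag], by simp [mDiag]⟩

theorem conj_wAnti_mem_iff {a : Fˣ} {g : SpecialLinearGroup (Fin 2) F}
    (hg : g ∈ congruenceSubgroup β γ h) :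
    (wAnti a).mat⁻¹ * g * (wAnti a).mat ∈ congruenceSubgroup β γ h ↔
      ‖g.1 1 0 / (a * a)‖ ≤ ‖β‖ ∧ ‖g.1 0 1 * (a * a)‖ ≤ ‖γ‖ := by
  obtain ⟨h1, h2, h3, h4⟩ := conj_wAnti_apply a g
  rw [mem_congruenceSubgroup, congruenceSet, Set.mem_ofPred_eq, h1, h2, h3, h4, norm_neg, norm_neg]
  exact ⟨fun H => H.2.2, fun H => ⟨hg.2.1, hg.1, H⟩⟩

/-- Elements of the congruence group have units on the diagonal. A word of even length is diagonal
with a non-trivial power of a non-unit as its entry; a word of odd length is antidiagonal. -/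
theorem altProd_wAnti_notMem {a b : Fˣ} (hab : ‖(a : F)‖ ≠ ‖(b : F)‖) (n : ℕ) :
    altProd (wAnti a).mat (wAnti b).mat (n + 1) ∉ congruenceSubgroup β γ h := by
  set x : Fˣ := -(b / a) with hx
  have hx1 : ‖(x : F)‖ ≠ 1 := by
    rw [hx, Units.val_neg, norm_neg, Units.val_div_eq_div_val, norm_div, ne_eq,
      div_eq_one_iff_eq (norm_ne_zero_iff.2 a.ne_zero)]
    exact fun h => hab h.symm
  have hpow : ∀ k : ℕ, ((wAnti a).mat * (wAnti b).mat) ^ k = (mDiag (x ^ k)).mat := by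
    intro k
    rw [wAnti_mat_mul_wAnti]
    induction k with
    | zero =>
      rw [pow_zero, pow_zero]
      apply sl_ext <;> simp [mDiag]
    | succ k ih => rw [pow_succ, ih, mDiag_mat_mul, pow_succ]
  intro hmem
  have h1 := (norm_diag_eq_one h hmem).1
  rcases Nat.even_or_odd' (n + 1) with ⟨k, hk | hk⟩
  · rw [hk, altProd_two_mul, hpow] at h1
    have h2 : ‖(x : F)‖ ^ k = 1 := by simpa [mDiag] using h1
    exact hx1 ((pow_eq_one_iff_of_nonneg (norm_nonneg _) (by omega)).1 h2)
  · have e : altProd (wAnti a).mat (wAnti b).mat (n + 1) =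
        (mDiag (x ^ k)).mat * (wAnti a).mat := by
      rw [hk, ← hpow]
      have : ∀ k, altProd (wAnti a).mat (wAnti b).mat (2 * k + 1) =
          ((wAnti a).mat * (wAnti b).mat) ^ k * (wAnti a).mat := by
        intro k
        induction k with
        | zero => simp [altProd]
        | succ k ih =>
          rw [pow_succ', mul_assoc, ← ih, mul_assoc]
          rfl
      exact this k
    rw [e, sl_mul_apply] at h1
    simp [mDiag, wAnti] at h1

variable [ProperSpace F]

theorem OddUniformizer.norm_eq_of_lt (hϖ : OddUniformizer q ϖ) {x y : F} (hxy : ‖x‖ ≤ ‖y‖)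
    (hlt : ‖ϖ‖ * ‖y‖ < ‖x‖) : ‖x‖ = ‖y‖ := by
  refine le_antisymm hxy (not_lt.1 fun hxy' => ?_)
  have hy : 0 < ‖y‖ := (norm_nonneg _).trans_lt hxy'
  have h1 : ‖x / y‖ ≤ ‖ϖ‖ := hϖ.norm_le_of_lt_one (by rwa [norm_div, div_lt_one hy])
  rw [norm_div, div_le_iff₀ hy] at h1
  exact h1.not_gt hlt

/-- The product of the two reflections is diagonal with an entry of norm |ϖ|, which together with
the unit diagonal matrices gives the whole torus. A contracting torus element conjugates any upper
unipotent matrix into the congruence group, and the Bruhat decomposition does the rest. -/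
theorem generate_sl2 (hϖ : OddUniformizer q ϖ) {h : ‖β * γ‖ < 1} (hβ0 : β ≠ 0) {a a' : Fˣ}
    (haa' : ‖(a' : F)‖ = ‖(a : F)‖ * ‖ϖ‖) :
    Subgroup.closure ((congruenceSubgroup β γ h : Set (SpecialLinearGroup (Fin 2) F)) ∪
      {(wAnti a).mat, (wAnti a').mat}) = ⊤ := by
  set H := Subgroup.closure ((congruenceSubgroup β γ h : Set (SpecialLinearGroup (Fin 2) F)) ∪
      {(wAnti a).mat, (wAnti a').mat}) with hH
  have hΓ : ∀ g ∈ congruenceSubgroup β γ h, g ∈ H :=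
    fun g hg => Subgroup.subset_closure (Or.inl hg)
  have hw : (wAnti a).mat ∈ H := Subgroup.subset_closure (Or.inr (Or.inl rfl))
  have hw' : (wAnti a').mat ∈ H := Subgroup.subset_closure (Or.inr (Or.inr rfl))
  set x : Fˣ := -(a' / a) with hx
  have hxn : ‖(x : F)‖ = ‖ϖ‖ := by
    rw [hx, Units.val_neg, norm_neg, Units.val_div_eq_div_val, norm_div, haa',
      mul_div_cancel_left₀ _ (norm_ne_zero_iff.2 a.ne_zero)]
  have hmx : (mDiag x).mat ∈ H := by
    rw [hx, ← wAnti_mat_mul_wAnti]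
    exact H.mul_mem hw hw'
  let D : Fˣ →* SpecialLinearGroup (Fin 2) F :=
    { toFun := fun y => (mDiag y).mat
      map_one' := by apply sl_ext <;> simp [mDiag]
      map_mul' := fun y z => (mDiag_mat_mul y z).symm }
  have hD : ∀ y : Fˣ, (mDiag y).mat ∈ H := by
    intro y
    obtain ⟨n, hn⟩ := hϖ.exists_norm_eq y.ne_zero
    have h1 : ‖((y * x ^ (-n) : Fˣ) : F)‖ = 1 := by
      rw [Units.val_mul, Units.val_zpow_eq_zpow_val, norm_mul, _root_.norm_zpow, hxn, hn,
        ← _root_.zpow_add₀ hϖ.norm_pos.ne', add_neg_cancel, zpow_zero]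
    have h2 : (mDiag y).mat = D (y * x ^ (-n)) * D x ^ n := by
      rw [← map_zpow, ← map_mul, mul_assoc, ← _root_.zpow_add, neg_add_cancel, zpow_zero, mul_one]
      rfl
    rw [h2]
    exact H.mul_mem (hΓ _ (mDiag_mem h1)) (H.zpow_mem hmx n)
  have hU : ∀ y : F, (uSharp y).mat ∈ H := by
    intro y
    by_cases hy : y = 0
    · exact hΓ _ (uSharp_mem (by rw [hy, norm_zero]; exact norm_nonneg _))
    obtain ⟨z, hz0, hz⟩ := NormedField.exists_norm_lt F
      (lt_min one_pos (div_pos (norm_pos_iff.2 hβ0) (norm_pos_iff.2 hy)))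
    have hz1 : ‖z‖ < 1 := hz.trans_le (min_le_left _ _)
    have hz2 : ‖z‖ * ‖y‖ < ‖β‖ := by
      rw [← lt_div_iff₀ (norm_pos_iff.2 hy)]
      exact hz.trans_le (min_le_right _ _)
    set z' : Fˣ := Units.mk0 z (norm_pos_iff.1 hz0)
    have h1 := mDiag_mat_mul_uSharp z' y
    have h2 : (uSharp ((z' : F) * z' * y)).mat ∈ H := by
      refine hΓ _ (uSharp_mem ?_)
      change ‖z * z * y‖ ≤ ‖β‖
      rw [mul_assoc, norm_mul, norm_mul]
      exact (mul_le_of_le_one_left (by positivity) hz1.le).trans hz2.le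
    rw [← inv_mul_eq_iff_eq_mul] at h1
    have h3 : (uSharp y).mat = (mDiag z').mat⁻¹ * ((uSharp ((z' : F) * z' * y)).mat *
        (mDiag z').mat) := by
      rw [← mDiag_mat_mul_uSharp, inv_mul_cancel_left]
    rw [h3]
    exact H.mul_mem (H.inv_mem (hD _)) (H.mul_mem h2 (hD _))
  rw [eq_top_iff]
  intro g _
  by_cases hc : g.1 1 0 = 0
  · have ha0 : g.1 0 0 ≠ 0 := by
      have := sl_det g
      rw [hc, mul_zero, sub_zero] at this
      exact left_ne_zero_of_mul (this ▸ one_ne_zero)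
    have e : g = (uSharp (g.1 0 0 * g.1 0 1)).mat * (mDiag (Units.mk0 _ ha0)).mat :=
      congrArg Mp2.mat (eq_uSharp_mul_mDiag g (Units.mk0 _ ha0) rfl hc)
    rw [e]
    exact H.mul_mem (hU _) (hD _)
  · have e : g = (uSharp (g.1 0 0 / g.1 1 0)).mat *
        ((wAnti (Units.mk0 _ hc)).mat * (uSharp (g.1 1 1 / g.1 1 0)).mat) :=
      congrArg Mp2.mat (eq_uSharp_mul_wAnti_mul_uSharp g (Units.mk0 _ hc) rfl)
    rw [e]
    refine H.mul_mem (hU _) (H.mul_mem ?_ (hU _))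
    rw [← mul_inv_cancel_left a (Units.mk0 _ hc), ← wAnti_mat_mul_mDiag]
    exact H.mul_mem hw (hD _)

/-- The affine root system of `SL₂(F)`. -/
theorem affineSystem_sl2 (hϖ : OddUniformizer q ϖ) (h : ‖β * γ‖ < 1) (hβγ : ‖β * γ‖ = ‖ϖ‖)
    {a a' : Fˣ} (ha : ‖(a : F)‖ * ‖β‖ = 1) (ha' : ‖(a' : F)‖ = ‖γ‖) :
    AffineSystem (congruenceSubgroup β γ h) (wAnti a).mat (wAnti a').mat
      {g | ∃ y, ‖y‖ ≤ ‖β‖ ∧ g = (uSharp y).mat} {g | ∃ z, ‖z‖ ≤ ‖γ‖ ∧ g = lowerUnip z} := by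
  have hβ : 0 < ‖β‖ := by
    refine (norm_nonneg β).lt_of_ne' fun h0 => ?_
    rw [h0, mul_zero] at ha
    exact zero_ne_one ha
  have hγ : 0 < ‖γ‖ := by rw [← ha']; exact norm_pos_iff.2 a'.ne_zero
  have hβ0 : β ≠ 0 := norm_pos_iff.1 hβ
  have ha1 : ‖(a : F)‖ = ‖β‖⁻¹ := eq_inv_of_mul_eq_one_left ha
  have hϖ' := hβγ
  rw [norm_mul] at hϖ'
  have hϖ1 := hϖ.norm_lt_one
  have hna : ∀ c : F, ‖c / (a * a)‖ = ‖c‖ * ‖β‖ * ‖β‖ := by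
    intro c
    rw [norm_div, norm_mul, ha1]
    field_simp
  have hna' : ∀ c : F, ‖c * (a' * a')‖ = ‖c‖ * ‖γ‖ * ‖γ‖ := by
    intro c
    rw [norm_mul, norm_mul, ha', mul_assoc]
  have hc1 : ∀ {c : F}, ‖c‖ ≤ ‖γ‖ → ‖c / (a * a)‖ ≤ ‖β‖ := by
    intro c hc
    rw [hna]
    have : ‖c‖ * ‖β‖ ≤ 1 := by
      calc _ ≤ ‖γ‖ * ‖β‖ := by gcongr
        _ ≤ 1 := by rw [mul_comm, hϖ']; exact hϖ1.le
    exact mul_le_of_le_one_left hβ.le this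
  have hc2 : ∀ {c : F}, ‖c‖ ≤ ‖β‖ → ‖c * (a' * a')‖ ≤ ‖γ‖ := by
    intro c hc
    rw [hna']
    have : ‖c‖ * ‖γ‖ ≤ 1 := by
      calc _ ≤ ‖β‖ * ‖γ‖ := by gcongr
        _ ≤ 1 := by rw [hϖ']; exact hϖ1.le
    exact mul_le_of_le_one_left hγ.le this
  have hsq : ∀ b : Fˣ, (wAnti b).mat * (wAnti b).mat ∈ congruenceSubgroup β γ h := by
    intro b
    rw [wAnti_mat_mul_wAnti]
    exact mDiag_mem (by simp)
  have hne : ‖(a' : F)‖ = ‖(a : F)‖ * ‖ϖ‖ := by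
    rw [ha', ha1, ← hϖ']
    field_simp
  have hlt : ‖(a' : F)‖ < ‖(a : F)‖ := by
    rw [hne]
    exact mul_lt_of_lt_one_right (norm_pos_iff.2 a.ne_zero) hϖ1
  exact
    { U_subset := by
        rintro _ ⟨y, hy, rfl⟩
        exact uSharp_mem hy
      L_subset := by
        rintro _ ⟨z, hz, rfl⟩
        exact lowerUnip_mem hz
      decomp_left := by
        intro g hg
        obtain ⟨hA, hD⟩ := norm_diag_eq_one h hg
        obtain ⟨e1, e2, e3, e4⟩ := eq_lower_mul_uSharp g (norm_pos_iff.1 (hA ▸ one_pos))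
        have hb : ‖g.1 0 1 / g.1 0 0‖ ≤ ‖β‖ := by rw [norm_div, hA, div_one]; exact hg.2.2.1
        have hl : g * (uSharp (-(g.1 0 1 / g.1 0 0))).mat ∈ congruenceSubgroup β γ h :=
          Subgroup.mul_mem _ hg (uSharp_mem (by rwa [norm_neg]))
        refine ⟨g * (uSharp (-(g.1 0 1 / g.1 0 0))).mat, _, ⟨_, hb, rfl⟩, ?_, ?_⟩
        · rw [mul_assoc, uSharp_mat_mul, neg_add_cancel, ← mul_one g]
          congr 1
          · rw [mul_one]
          · apply sl_ext <;> simp [uSharp]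
        · rw [conj_wAnti_inv, conj_wAnti_mem_iff hl, e2, e3, zero_mul, norm_zero]
          exact ⟨hc1 hg.2.2.2, hγ.le⟩
      decomp_right := by
        intro g hg
        obtain ⟨hA, hD⟩ := norm_diag_eq_one h hg
        obtain ⟨e1, e2, e3, e4⟩ := eq_upper_mul_lowerUnip g (norm_pos_iff.1 (hD ▸ one_pos))
        have hb : ‖g.1 1 0 / g.1 1 1‖ ≤ ‖γ‖ := by rw [norm_div, hD, div_one]; exact hg.2.2.2
        have hl : g * lowerUnip (-(g.1 1 0 / g.1 1 1)) ∈ congruenceSubgroup β γ h :=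
          Subgroup.mul_mem _ hg (lowerUnip_mem (by rwa [norm_neg]))
        refine ⟨g * lowerUnip (-(g.1 1 0 / g.1 1 1)), _, ⟨_, hb, rfl⟩, ?_, ?_⟩
        · rw [mul_assoc, lowerUnip_mul, neg_add_cancel, ← mul_one g]
          congr 1
          · rw [mul_one]
          · apply sl_ext <;> simp [lowerUnip]
        · rw [conj_wAnti_inv, conj_wAnti_mem_iff hl, e2, e3, zero_div, norm_zero]
          exact ⟨hβ.le, hc2 hg.2.2.1⟩
      conj_left := by
        rintro _ ⟨z, hz, rfl⟩
        exact ⟨_, by rw [norm_neg]; exact hc1 hz, conj_wAnti_lowerUnip a z⟩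
      conj_right := by
        rintro _ ⟨y, hy, rfl⟩
        exact ⟨_, by rw [norm_neg]; exact hc2 hy, conj_wAnti_uSharp a' y⟩
      sq_left := hsq a
      sq_right := hsq a'
      cell_left := by
        rintro _ ⟨y, hy, rfl⟩
        have e : (wAnti a).mat * (uSharp y).mat * (wAnti a).mat =
            (wAnti a).mat * (wAnti a).mat * lowerUnip (-(y * (a * a))) := by
          rw [← conj_wAnti_uSharp]
          group
        rw [e]
        -- If the lower unipotent element is not in Γ, then y has the largest norm allowed, since no
        -- norm lies strictly between |ϖβ| and |β|. Then z⁻¹ is in β𝔬 and z/a is a unit, so the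
        -- rank-one identity exhibits one cell.
        by_cases hz : ‖-(y * ((a : F) * a))‖ ≤ ‖γ‖
        · exact Or.inl (Subgroup.mul_mem _ (hsq a) (lowerUnip_mem hz))
        · refine Or.inr (InDC.mul_left ?_ ⟨_, hsq a⟩)
          have hny : ‖y‖ = ‖β‖ := by
            refine hϖ.norm_eq_of_lt hy ?_
            rw [norm_neg, norm_mul, norm_mul, ha1, not_le] at hz
            rw [← hϖ', mul_comm ‖β‖, mul_assoc]
            calc ‖γ‖ * (‖β‖ * ‖β‖) < ‖y‖ * (‖β‖⁻¹ * ‖β‖⁻¹) * (‖β‖ * ‖β‖) := by gcongr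
              _ = ‖y‖ := by field_simp
          have hy0 : y ≠ 0 := norm_pos_iff.1 (hny ▸ hβ)
          set z : Fˣ := -(Units.mk0 y hy0 * (a * a)) with hzdef
          have hzv : (z : F) = -(y * ((a : F) * a)) := by simp [hzdef]
          have hzn : ‖(z : F)‖ = ‖β‖⁻¹ := by
            rw [hzv, norm_neg, norm_mul, norm_mul, ha1, hny]
            field_simp
          have hu : ‖(z : F)⁻¹‖ ≤ ‖β‖ := by rw [norm_inv, hzn, inv_inv]
          have hm : ‖((a⁻¹ * z : Fˣ) : F)‖ = 1 := by
            rw [Units.val_mul, Units.val_inv_eq_inv_val, norm_mul, norm_inv, hzn, ha1, inv_inv,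
              mul_inv_cancel₀ hβ.ne']
          rw [← hzv, lowerUnip_eq, ← mul_inv_cancel_left a z, ← wAnti_mat_mul_mDiag,
            mul_inv_cancel_left, ← mul_assoc, mul_assoc (_ * _)]
          exact ⟨⟨_, uSharp_mem hu⟩, ⟨_, Subgroup.mul_mem _ (mDiag_mem hm) (uSharp_mem hu)⟩, rfl⟩
      cell_right := by
        rintro _ ⟨z, hz, rfl⟩
        have e : (wAnti a').mat * lowerUnip z * (wAnti a').mat =
            (wAnti a').mat * (wAnti a').mat * (uSharp (-(z / (a' * a')))).mat := by
          rw [← conj_wAnti_lowerUnip]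
          group
        rw [e]
        by_cases hy : ‖-(z / ((a' : F) * a'))‖ ≤ ‖β‖
        · exact Or.inl (Subgroup.mul_mem _ (hsq a') (uSharp_mem hy))
        · refine Or.inr (InDC.mul_left ?_ ⟨_, hsq a'⟩)
          have hnz : ‖z‖ = ‖γ‖ := by
            refine hϖ.norm_eq_of_lt hz ?_
            rw [norm_neg, norm_div, norm_mul, ha', not_le, lt_div_iff₀ (by positivity)] at hy
            rwa [← hϖ', mul_assoc]
          have hz0 : z ≠ 0 := norm_pos_iff.1 (hnz ▸ hγ)
          set y : Fˣ := -(Units.mk0 z hz0 / (a' * a')) with hydef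
          have hyv : (y : F) = -(z / ((a' : F) * a')) := by
            simp [hydef, Units.val_div_eq_div_val]
          have hyn : ‖(y : F)‖ = ‖γ‖⁻¹ := by
            rw [hyv, norm_neg, norm_div, norm_mul, ha', hnz]
            field_simp
          have hu : ‖(y : F)⁻¹‖ ≤ ‖γ‖ := by rw [norm_inv, hyn, inv_inv]
          have hm : ‖((a'⁻¹ * -y⁻¹ : Fˣ) : F)‖ = 1 := by
            rw [Units.val_mul, Units.val_inv_eq_inv_val, Units.val_neg, Units.val_inv_eq_inv_val,
              norm_mul, norm_inv, norm_neg, norm_inv, hyn, ha', inv_inv, inv_mul_cancel₀ hγ.ne']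
          rw [← hyv, uSharp_eq, ← mul_inv_cancel_left a' (-y⁻¹), ← wAnti_mat_mul_mDiag,
            ← mul_assoc, mul_assoc (_ * _)]
          exact ⟨⟨_, lowerUnip_mem hu⟩,
            ⟨_, Subgroup.mul_mem _ (mDiag_mem hm) (lowerUnip_mem hu)⟩, rfl⟩
      word_left := altProd_wAnti_notMem hlt.ne'
      word_right := altProd_wAnti_notMem hlt.ne
      generate := generate_sl2 hϖ hβ0 hne }

end congruenceSubgroup

/-! ### The functions supported on a single double coset -/

section cells

variable {G : Type*} [Group G]

/-- Representatives `u x` of the left cosets of `Γ` in `Γ s Γ = ⋃ u(x) s Γ` with `ε(u(x)) = 1`,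
where `ε` is compatible with conjugation by `s`. -/
structure CosetReps (Γ : Subgroup G) (ε : Γ →* ℂ) (s : G) {X : Type*} (u : X → Γ) : Prop where
  eps_eq_one : ∀ x, ε (u x) = 1
  injective : Function.Injective fun x => ((u x * s : G) : G ⧸ Γ)
  cover : ∀ γ : Γ, ∃ x, ((γ * s : G) : G ⧸ Γ) = (u x * s : G)
  compatible : ∀ γ₁ γ₂ : Γ, γ₁ * s = s * γ₂ → ε γ₁ = ε γ₂

variable {Γ : Subgroup G} {ε : Γ →* ℂ} {s : G}

open scoped Classical in
/-- The function on `Γ s Γ` with value `ε(γ₁) v ε(γ₂)` at `γ₁ s γ₂`. -/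
def cellFun (ε : Γ →* ℂ) (s : G) (v : ℂ) (g : G) : ℂ :=
  if h : InDC Γ s g then ε h.choose * v * ε h.choose_spec.choose else 0

namespace CosetReps

variable {X : Type*} {u : X → Γ}

/-- Two factorizations of the same element differ by a pair γ, γ' with γ s = s γ', and `compatible`
equates ε on such pairs. Thus a function on the double coset is well defined by its value at s. -/
theorem eps_mul_congr (hs : CosetReps Γ ε s u) {γ₁ γ₂ γ₃ γ₄ : Γ}
    (h : (γ₁ * s * γ₂ : G) = γ₃ * s * γ₄) : ε γ₁ * ε γ₂ = ε γ₃ * ε γ₄ := by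
  have h1 : ε (γ₃⁻¹ * γ₁) = ε (γ₄ * γ₂⁻¹) := by
    refine hs.compatible _ _ ?_
    push_cast
    rw [mul_assoc, inv_mul_eq_iff_eq_mul, ← mul_assoc, ← mul_assoc, eq_mul_inv_iff_mul_eq]
    exact h
  have h2 : ε γ₃ * ε (γ₃⁻¹ * γ₁) * ε γ₂ = ε γ₃ * ε (γ₄ * γ₂⁻¹) * ε γ₂ := by rw [h1]
  simpa only [← map_mul, mul_inv_cancel_left, mul_assoc, inv_mul_cancel, mul_one] using h2

theorem cellFun_apply (hs : CosetReps Γ ε s u) (v : ℂ) (γ₁ γ₂ : Γ) :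
    cellFun ε s v (γ₁ * s * γ₂) = ε γ₁ * v * ε γ₂ := by
  have h : InDC Γ s (γ₁ * s * γ₂) := ⟨γ₁, γ₂, rfl⟩
  rw [cellFun, dif_pos h]
  have := hs.eps_mul_congr h.choose_spec.choose_spec
  linear_combination -v * this

theorem cellFun_mem [Finite X] (hs : CosetReps Γ ε s u) (v : ℂ) :
    cellFun ε s v ∈ HeckeAlg Γ ε := by
  constructor
  · intro γ₁ γ₂ g
    by_cases h : InDC Γ s g
    · obtain ⟨γ₃, γ₄, rfl⟩ := h
      have : (γ₁ : G) * (γ₃ * s * γ₄) * γ₂ = (γ₁ * γ₃ : Γ) * s * (γ₄ * γ₂ : Γ) := by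
        push_cast
        simp only [mul_assoc]
      rw [this, hs.cellFun_apply, hs.cellFun_apply, map_mul, map_mul]
      ring
    · have h' : ¬ InDC Γ s (γ₁ * g * γ₂) := fun h' => h (h'.trans ⟨γ₁⁻¹, γ₂⁻¹, by simp [mul_assoc]⟩)
      rw [cellFun, cellFun, dif_neg h, dif_neg h', mul_zero]
  · refine (Set.finite_range fun x => ((u x * s : G) : G ⧸ Γ)).subset ?_
    rintro _ ⟨g, hg, rfl⟩
    have h : InDC Γ s g := by
      by_contra h
      exact hg (dif_neg h)
    obtain ⟨γ₁, γ₂, rfl⟩ := h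
    obtain ⟨x, hx⟩ := hs.cover γ₁
    refine ⟨x, ?_⟩
    beta_reduce
    rw [← hx, QuotientGroup.eq]
    simp [mul_assoc]

/-- The element of the Hecke algebra supported on `Γ s Γ` with value `v` at `s`. -/
def cell [Finite X] (hs : CosetReps Γ ε s u) (v : ℂ) : HeckeAlg Γ ε :=
  ⟨cellFun ε s v, hs.cellFun_mem v⟩

theorem cell_apply [Finite X] (hs : CosetReps Γ ε s u) (v : ℂ) (γ₁ γ₂ : Γ) :
    (hs.cell v).1 (γ₁ * s * γ₂) = ε γ₁ * v * ε γ₂ := hs.cellFun_apply v γ₁ γ₂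

theorem cell_apply_of_eq [Finite X] (hs : CosetReps Γ ε s u) (v : ℂ) {g : G} (γ₁ γ₂ : Γ)
    (h : g = γ₁ * s * γ₂) : (hs.cell v).1 g = ε γ₁ * v * ε γ₂ := h ▸ hs.cell_apply v γ₁ γ₂

theorem cell_apply_self [Finite X] (hs : CosetReps Γ ε s u) (v : ℂ) : (hs.cell v).1 s = v := by
  rw [hs.cell_apply_of_eq v 1 1 (by simp)]
  simp

theorem cell_support [Finite X] (hs : CosetReps Γ ε s u) (v : ℂ) {g : G}
    (h : (hs.cell v).1 g ≠ 0) : InDC Γ s g := by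
  by_contra h'
  exact h (dif_neg h')

theorem cell_apply_mem [Finite X] (hs : CosetReps Γ ε s u) (v : ℂ) (h : s ∉ Γ) {g : G}
    (hg : g ∈ Γ) : (hs.cell v).1 g = 0 := by
  by_contra h'
  obtain ⟨γ₁, γ₂, rfl⟩ := hs.cell_support v h'
  rw [Subgroup.mul_mem_cancel_right _ γ₂.2, Subgroup.mul_mem_cancel_left _ γ₁.2] at hg
  exact h hg

/-- The square is supported on Γ ∪ ΓsΓ, so it is determined by its values at 1 and at s. These are
the two sums over coset representatives in the hypotheses; the cell function itself vanishes at 1.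
-/
theorem cell_mul_self [Fintype X] (hs : CosetReps Γ ε s u) {v c₁ c₀ : ℂ} (h : s ∉ Γ)
    (hcell : ∀ γ : Γ, s * γ * s ∈ Γ ∨ InDC Γ s (s * γ * s))
    (h₀ : v * ∑ x, (hs.cell v).1 (s⁻¹ * (u x : G)⁻¹) = c₀)
    (h₁ : v * ∑ x, (hs.cell v).1 (s⁻¹ * (u x : G)⁻¹ * s) = c₁ * v) :
    hs.cell v * hs.cell v = c₁ • hs.cell v + c₀ • (1 : HeckeAlg Γ ε) := by
  have hmul := HeckeAlg.mul_apply_eq_sum (hs.cell v) (fun g => hs.cell_support v) u hs.eps_eq_one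
    hs.injective hs.cover
  refine HeckeAlg.ext_of_support (s := s) ?_ ?_ ?_ ?_
  · intro g hg
    obtain ⟨x, hx, hx'⟩ := HeckeAlg.exists_of_cosetConv_ne_zero hg
    obtain ⟨γ₁, γ₂, e⟩ := hs.cell_support v hx
    obtain ⟨γ₃, γ₄, e'⟩ := hs.cell_support v hx'
    have hg' : g = γ₁ * (s * (γ₂ * γ₃ : Γ) * s) * γ₄ := by
      rw [inv_mul_eq_iff_eq_mul] at e'
      rw [e', e]
      simp [mul_assoc]
    rw [hg']
    refine (hcell (γ₂ * γ₃)).imp (fun h => ?_) fun h => ?_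
    · exact Γ.mul_mem (Γ.mul_mem γ₁.2 h) γ₄.2
    · exact (h.mul_left γ₁).mul_right γ₄
  · intro g hg
    by_cases hΓ : g ∈ Γ
    · exact Or.inl hΓ
    · refine Or.inr (hs.cell_support v fun h0 => hg ?_)
      change c₁ * (hs.cell v).1 g + c₀ * (1 : HeckeAlg Γ ε).1 g = 0
      rw [h0, HeckeAlg.one_apply_notMem hΓ, mul_zero, mul_zero, add_zero]
  · change _ = c₁ * (hs.cell v).1 1 + c₀ * (1 : HeckeAlg Γ ε).1 1
    rw [hmul, hs.cell_apply_self, hs.cell_apply_mem v h Γ.one_mem,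
      HeckeAlg.one_apply_mem Γ.one_mem, show (⟨1, Γ.one_mem⟩ : Γ) = 1 from rfl, map_one, ← h₀]
    simp
  · change _ = c₁ * (hs.cell v).1 s + c₀ * (1 : HeckeAlg Γ ε).1 s
    rw [hmul, hs.cell_apply_self, HeckeAlg.one_apply_notMem h, h₁]
    ring

end CosetReps

end cells

/-! ### Cells in the metaplectic group -/

section cover

variable {F : Type*} [Field F]

theorem wAnti_inv (a : Fˣ) : (wAnti a)⁻¹ = wAnti (-a) := by
  ext1
  · exact wAnti_mat_inv a
  · change 1 * cocycle (wAnti a).mat (wAnti a).mat⁻¹ = 1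
    have h1 : lowerEntry (wAnti a).mat = a := by simp [lowerEntry, wAnti]
    have h2 : lowerEntry (wAnti (-a)).mat = -a := by simp [lowerEntry, wAnti]
    rw [cocycle_eq, mul_inv_cancel, lowerEntry_one, wAnti_mat_inv, h1, h2, mul_one, mul_one,
      one_mul, hilbertSymbol_neg_self]

/-- The lift of a lower triangular unipotent matrix. -/
def lSharp (z : F) : Mp2 F := ⟨lowerUnip z, 1⟩

theorem lowerEntry_lowerUnip {z : F} (hz : z ≠ 0) : lowerEntry (lowerUnip z) = z := by
  simp [lowerEntry, lowerUnip, hz]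

theorem uSharp_inv (y : F) : (uSharp y)⁻¹ = uSharp (-y) := by
  ext1
  · exact uSharp_mat_inv y
  · change 1 * cocycle (uSharp y).mat (uSharp y).mat⁻¹ = 1
    rw [cocycle_uSharp_left, one_mul]

theorem lSharp_inv (z : F) : (lSharp z)⁻¹ = lSharp (-z) := by
  ext1
  · exact lowerUnip_inv z
  · change 1 * cocycle (lowerUnip z) (lowerUnip z)⁻¹ = 1
    rw [cocycle_eq, mul_inv_cancel, lowerEntry_one, lowerUnip_inv, one_mul, mul_one, mul_one]
    by_cases hz : z = 0
    · simp [hz, lowerEntry, lowerUnip, hilbertSymbol_one_left]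
    · rw [lowerEntry_lowerUnip hz, lowerEntry_lowerUnip (neg_ne_zero.2 hz), hilbertSymbol_neg_self]

/-- The unipotent lifts are conjugated into one another without a sign, because the cocycle reduces
to a symbol (x, -x). -/
theorem wAnti_inv_mul_uSharp_mul (a : Fˣ) (y : F) :
    (wAnti a)⁻¹ * uSharp y * wAnti a = lSharp (-(y * (a * a))) := by
  ext1
  · exact conj_wAnti_uSharp a y
  · rw [wAnti_inv]
    change 1 * 1 * cocycle (wAnti (-a)).mat (uSharp y).mat * 1 *
      cocycle ((wAnti (-a)).mat * (uSharp y).mat) (wAnti a).mat = 1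
    have h1 : lowerEntry (wAnti a).mat = a := by simp [lowerEntry, wAnti]
    have h2 : lowerEntry ((wAnti (-a)).mat * (uSharp y).mat) = -a := by
      rw [lowerEntry_mul_uSharp]; simp [lowerEntry, wAnti]
    rw [cocycle_uSharp_right, ← wAnti_mat_inv, cocycle_eq, conj_wAnti_uSharp, wAnti_mat_inv, h1, h2,
      one_mul, one_mul, one_mul]
    by_cases hy : y = 0
    · rw [hy, zero_mul, neg_zero, lowerEntry_of_eq (by simp [lowerUnip])]
      simp only [lowerUnip]
      rw [hilbertSymbol_comm]
      simpa using hilbertSymbol_neg_self (a : F)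
    · have hz : -(y * ((a : F) * a)) ≠ 0 := by simp [hy]
      rw [lowerEntry_lowerUnip hz, neg_mul, hilbertSymbol_comm, hilbertSymbol_neg_self]
      rfl

theorem wAnti_inv_mul_lSharp_mul (a : Fˣ) (z : F) :
    (wAnti a)⁻¹ * lSharp z * wAnti a = uSharp (-(z / (a * a))) := by
  ext1
  · exact conj_wAnti_lowerUnip a z
  · rw [wAnti_inv]
    change 1 * 1 * cocycle (wAnti (-a)).mat (lowerUnip z) * 1 *
      cocycle ((wAnti (-a)).mat * lowerUnip z) (wAnti a).mat = 1
    have h0 : lowerEntry (wAnti (-a)).mat = -a := by simp [lowerEntry, wAnti]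
    have h1 : lowerEntry (wAnti a).mat = a := by simp [lowerEntry, wAnti]
    have h2 : lowerEntry ((wAnti (-a)).mat * lowerUnip z) = -a := by
      have : ((wAnti (-a)).mat * lowerUnip z).1 1 0 = -a := by
        rw [sl_mul_apply]; simp [wAnti, lowerUnip]
      rw [lowerEntry_of_ne (by rw [this]; simp), this]
    have h3 : lowerEntry (uSharp (-(z / ((a : F) * a)))).mat = 1 := by simp [lowerEntry, uSharp]
    rw [cocycle, h0, h2, div_self (by simp), hilbertSymbol_one_left, ← wAnti_mat_inv, cocycle_eq,
      conj_wAnti_lowerUnip, wAnti_mat_inv, h1, h2, h3, mul_one (a : F),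
      mul_one (-(a : F)), hilbertSymbol_comm,
      hilbertSymbol_neg_self]
    rfl

variable [Fact (SymbolBilinear F)]

instance : Group (Mp2 F) := mp2Group Fact.out

/-- The projection of `Mp₂(F)` onto `SL₂(F)`. -/
def matHom : Mp2 F →* SpecialLinearGroup (Fin 2) F where
  toFun := Mp2.mat
  map_one' := rfl
  map_mul' _ _ := rfl

theorem matHom_surjective : Function.Surjective (matHom (F := F)) := fun g => ⟨⟨g, 1⟩, rfl⟩

/-- The sign (t, a) attached to the diagonal matrix compensates the cocycle. -/
theorem wAnti_mul_mk_mDiag (a t : Fˣ) :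
    wAnti a * ⟨(mDiag t).mat, hilbertSymbol (t : F) a⟩ = wAnti (a * t) := by
  have hF : SymbolBilinear F := Fact.out
  have ha := a.ne_zero
  have ht := t.ne_zero
  ext1
  · exact wAnti_mat_mul_mDiag a t
  · change 1 * hilbertSymbol (t : F) a * cocycle (wAnti a).mat (mDiag t).mat = 1
    have h1 : lowerEntry (wAnti a).mat = a := by simp [lowerEntry, wAnti]
    have h2 : lowerEntry (mDiag t).mat = (t : F)⁻¹ := by simp [lowerEntry, mDiag]
    have h3 : lowerEntry (wAnti (a * t)).mat = a * t := by simp [lowerEntry, wAnti]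
    have e1 : (a : F) * (a * t) = t * (a * a) := by ring
    have e2 : (t : F)⁻¹ * (a * t) = a := by field_simp
    rw [cocycle_eq, wAnti_mat_mul_mDiag, h1, h2, h3, e1, e2, hilbertSymbol_mul_sq_left _ _ ha,
      one_mul, hilbertSymbol_mul_self]

theorem lSharp_eq (z : Fˣ) : lSharp (z : F) =
    uSharp (z : F)⁻¹ * wAnti z * uSharp (z : F)⁻¹ := by
  have h := eq_uSharp_mul_wAnti_mul_uSharp (lowerUnip (z : F)) z (by simp [lowerUnip])
  rw [mul_assoc, lSharp, h]
  simp [lowerUnip]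

theorem uSharp_eq_lSharp (y : Fˣ) : uSharp (y : F) =
    lSharp (y : F)⁻¹ * wAnti (-y⁻¹) * lSharp (y : F)⁻¹ := by
  have hy := y.ne_zero
  have h0 : lowerEntry (wAnti (-y⁻¹)).mat = -(y : F)⁻¹ := by simp [lowerEntry, wAnti]
  have h2 : lowerEntry ((wAnti (-y⁻¹)).mat * lowerUnip (y : F)⁻¹) = -(y : F)⁻¹ := by
    have : ((wAnti (-y⁻¹)).mat * lowerUnip (y : F)⁻¹).1 1 0 = -(y : F)⁻¹ := by
      rw [sl_mul_apply]; simp [wAnti, lowerUnip]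
    rw [lowerEntry_of_ne (by rw [this]; simp), this]
  have h3 : lowerEntry (uSharp (y : F)).mat = 1 := by simp [lowerEntry, uSharp]
  have hm : lowerUnip (y : F)⁻¹ * ((wAnti (-y⁻¹)).mat * lowerUnip (y : F)⁻¹) = (uSharp (y : F)).mat := by
    rw [uSharp_eq, mul_assoc]
  rw [mul_assoc]
  ext1
  · exact hm.symm
  · change 1 = 1 * (1 * 1 * cocycle (wAnti (-y⁻¹)).mat (lowerUnip (y : F)⁻¹)) *
      cocycle (lowerUnip (y : F)⁻¹) ((wAnti (-y⁻¹)).mat * lowerUnip (y : F)⁻¹)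
    rw [cocycle, h0, h2, div_self (by simp), hilbertSymbol_one_left, cocycle_eq, hm, h2, h3,
      lowerEntry_lowerUnip (inv_ne_zero hy), mul_one (y : F)⁻¹, mul_one (-(y : F)⁻¹),
      hilbertSymbol_neg_self]
    rfl

end cover

/-! ### The quadratic relations in the metaplectic group -/

theorem intCast_unit_mul_self (u : ℤˣ) : (((u : ℤˣ) : ℤ) : ℂ) * ((u : ℤ) : ℂ) = 1 := by
  rw [← Int.cast_mul, ← Units.val_mul, Int.units_mul_self, Units.val_one, Int.cast_one]

section residueLift

variable {F : Type*} [NontriviallyNormedField F] [IsUltrametricDist F] [ProperSpace F] {q : ℕ} {ϖ : F}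

theorem norm_mul_residueLift_le (c : F) (k : 𝓀[F]) : ‖c * residueLift k‖ ≤ ‖c‖ := by
  rw [norm_mul]
  exact mul_le_of_le_one_right (norm_nonneg _) (norm_residueLift_le k)

theorem OddUniformizer.eq_of_norm_mul_sub_le (hϖ : OddUniformizer q ϖ) {c : F} (hc : c ≠ 0)
    {k l : 𝓀[F]} (hkl : ‖c * residueLift l - c * residueLift k‖ ≤ ‖c‖ * ‖ϖ‖) : k = l := by
  rw [← mul_sub, norm_mul, mul_le_mul_iff_right₀ (norm_pos_iff.2 hc)] at hkl
  rw [← residueClass_residueLift k, ← residueClass_residueLift l, eq_comm,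
    residueClass_eq_iff (norm_residueLift_le l) (norm_residueLift_le k)]
  exact hkl.trans_lt hϖ.norm_lt_one

theorem OddUniformizer.exists_norm_sub_mul_le (hϖ : OddUniformizer q ϖ) {b c d : F} (hc : c ≠ 0)
    (hb : ‖b‖ ≤ ‖c‖) (hd : ‖d‖ = 1) : ∃ k : 𝓀[F], ‖b - c * residueLift k * d‖ ≤ ‖c‖ * ‖ϖ‖ := by
  have hd0 : d ≠ 0 := norm_pos_iff.1 (hd ▸ one_pos)
  have hx : ‖b / (c * d)‖ ≤ 1 := by
    rw [norm_div, norm_mul, hd, mul_one]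
    exact div_le_one_of_le₀ hb (norm_nonneg _)
  refine ⟨residueClass (b / (c * d)), ?_⟩
  set k := residueClass (b / (c * d)) with hk
  have h1 := (residueClass_eq_iff hx (norm_residueLift_le k)).1 (residueClass_residueLift k).symm
  have e : b - c * residueLift k * d = c * ((b / (c * d) - residueLift k) * d) := by field_simp
  rw [e, norm_mul, norm_mul, hd, mul_one]
  gcongr
  exact hϖ.norm_le_of_lt_one h1

end residueLift

/-! ### The character on the inverse image of Γ[β, γ] and coset representatives in the cells -/

section split

variable {F : Type*} [NontriviallyNormedField F] [IsUltrametricDist F] {q : ℕ} {ϖ δ β γ : F}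
  [Fact (SymbolBilinear F)]

/-- The inverse image of `Γ[β, γ]` in `Mp₂(F)`. -/
def coverSubgroup (β γ : F) (h : ‖β * γ‖ < 1) : Subgroup (Mp2 F) :=
  (congruenceSubgroup β γ h).comap matHom

theorem mem_coverSubgroup {h : ‖β * γ‖ < 1} {x : Mp2 F} :
    x ∈ coverSubgroup β γ h ↔ x.mat ∈ congruenceSubgroup β γ h := Iff.rfl

theorem uSharp_mem_cover {h : ‖β * γ‖ < 1} {y : F} (hy : ‖y‖ ≤ ‖β‖) :
    uSharp y ∈ coverSubgroup β γ h := uSharp_mem (h := h) hy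

theorem lSharp_mem_cover {h : ‖β * γ‖ < 1} {z : F} (hz : ‖z‖ ≤ ‖γ‖) :
    lSharp z ∈ coverSubgroup β γ h := lowerUnip_mem (h := h) hz

theorem inv_mul_mem_iff {h : ‖β * γ‖ < 1} (a : Fˣ) {x y : Mp2 F} (hx : x ∈ coverSubgroup β γ h)
    (hy : y ∈ coverSubgroup β γ h) :
    (x * wAnti a)⁻¹ * (y * wAnti a) ∈ coverSubgroup β γ h ↔
      ‖(x.mat⁻¹ * y.mat).1 1 0 / (a * a)‖ ≤ ‖β‖ ∧ ‖(x.mat⁻¹ * y.mat).1 0 1 * (a * a)‖ ≤ ‖γ‖ := by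
  have e : (x * wAnti a)⁻¹ * (y * wAnti a) = (wAnti a)⁻¹ * (x⁻¹ * y) * wAnti a := by group
  rw [e, mem_coverSubgroup]
  exact conj_wAnti_mem_iff (Subgroup.mul_mem _ (Subgroup.inv_mem _ hx) hy)

variable [ProperSpace F]

/-- The genuine character `ε` of the inverse image of `Γ[β, γ]`. -/
def splitHom (hϖ : OddUniformizer q ϖ) (hδ : δ ≠ 0) (h : ‖β * γ‖ < 1) :
    coverSubgroup β γ h →* ℂ where
  toFun x := (((splitSign q ϖ δ (x : Mp2 F) : ℤˣ) : ℤ) : ℂ)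
  map_one' := by
    have e := hϖ.splitSign_mul hδ h (x := 1) (y := 1)
      (coverSubgroup β γ h).one_mem (coverSubgroup β γ h).one_mem
    rw [mul_one] at e
    rw [OneMemClass.coe_one, left_eq_mul.1 e]
    simp
  map_mul' x y := by
    have e := hϖ.splitSign_mul hδ h x.2 y.2
    rw [Subgroup.coe_mul, e, Units.val_mul, Int.cast_mul]

variable {hϖ : OddUniformizer q ϖ} {hδ : δ ≠ 0} {h : ‖β * γ‖ < 1}

theorem splitHom_apply (x : coverSubgroup β γ h) :
    splitHom hϖ hδ h x = (((splitSign q ϖ δ (x : Mp2 F) : ℤˣ) : ℤ) : ℂ) := rfl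

theorem splitHom_of_diag_eq_one {x : coverSubgroup β γ h} (hd : (x : Mp2 F).mat.1 1 1 = 1)
    (hs : (x : Mp2 F).sgn = 1) : splitHom hϖ hδ h x = 1 := by
  rw [splitHom_apply, splitSign, hd, hs, hϖ.unitChar_one, _root_.one_zpow]
  simp

theorem splitHom_uSharp {y : F} (hy : uSharp y ∈ coverSubgroup β γ h) :
    splitHom hϖ hδ h ⟨uSharp y, hy⟩ = 1 := splitHom_of_diag_eq_one (by simp [uSharp]) rfl

theorem splitHom_lSharp {z : F} (hz : lSharp z ∈ coverSubgroup β γ h) :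
    splitHom hϖ hδ h ⟨lSharp z, hz⟩ = 1 := splitHom_of_diag_eq_one (by simp [lSharp, lowerUnip]) rfl

/-- The representatives `𝐮♯(βx)`, where `x` runs through the residue classes. -/
def upperRep (β γ : F) (h : ‖β * γ‖ < 1) (k : 𝓀[F]) : coverSubgroup β γ h :=
  ⟨uSharp (β * residueLift k), uSharp_mem_cover (norm_mul_residueLift_le β k)⟩

/-- The lower triangular representatives `(1, 0; γx, 1)`. -/
def lowerRep (β γ : F) (h : ‖β * γ‖ < 1) (k : 𝓀[F]) : coverSubgroup β γ h :=
  ⟨lSharp (γ * residueLift k), lSharp_mem_cover (norm_mul_residueLift_le γ k)⟩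

theorem lowerRep_mat (k : 𝓀[F]) :
    (lowerRep β γ h k : Mp2 F).mat = lowerUnip (γ * residueLift k) := rfl

theorem compatible_wAnti (a : Fˣ) (x y : coverSubgroup β γ h)
    (hxy : (x : Mp2 F) * wAnti a = wAnti a * y) : splitHom hϖ hδ h x = splitHom hϖ hδ h y := by
  rw [splitHom_apply, splitHom_apply, hϖ.splitSign_eq_of_mul_wAnti hδ h x.2 y.2 a hxy]

/-- Conjugated by 𝐰_a, the element 𝐮♯(y) with y in β𝔬 stays in the group exactly when |y| ≤ |βϖ|. So
the cosets in the cell correspond to β𝔬/βϖ𝔬; for a general matrix the class of b/d in this quotient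
is the one that counts. -/
theorem cosetReps_upper (hβγ : ‖β * γ‖ = ‖ϖ‖) {a : Fˣ} (ha : ‖(a : F)‖ * ‖β‖ = 1) :
    CosetReps (coverSubgroup β γ h) (splitHom hϖ hδ h) (wAnti a) (upperRep β γ h) := by
  have hβ : 0 < ‖β‖ := by
    refine (norm_nonneg β).lt_of_ne' fun h0 => ?_
    rw [h0, mul_zero] at ha
    exact zero_ne_one ha
  have ha1 : ‖(a : F)‖ = ‖β‖⁻¹ := eq_inv_of_mul_eq_one_left ha
  have key : ∀ y : F, ‖y * ((a : F) * a)‖ ≤ ‖γ‖ ↔ ‖y‖ ≤ ‖β‖ * ‖ϖ‖ := by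
    intro y
    rw [norm_mul, norm_mul, ha1, ← hβγ, norm_mul, ← mul_inv, ← div_eq_mul_inv,
      div_le_iff₀ (by positivity), mul_comm ‖γ‖, mul_assoc]
  have hent : ∀ (b : F) (g : SpecialLinearGroup (Fin 2) F),
      ((uSharp b).mat⁻¹ * g).1 1 0 = g.1 1 0 ∧
      ((uSharp b).mat⁻¹ * g).1 0 1 = g.1 0 1 - b * g.1 1 1 := by
    intro b g
    rw [uSharp_mat_inv, sl_mul_apply, sl_mul_apply]
    simp [uSharp, sub_eq_add_neg]
  refine ⟨fun k => splitHom_uSharp _, fun k l hkl => ?_,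
    fun x => ?_, compatible_wAnti a⟩
  · have h1 := ((inv_mul_mem_iff a (upperRep β γ h k).2 (upperRep β γ h l).2).1
      (QuotientGroup.eq.1 hkl)).2
    rw [key, upperRep, (hent _ _).2] at h1
    refine hϖ.eq_of_norm_mul_sub_le (norm_pos_iff.1 hβ) ?_
    simpa [upperRep, uSharp] using h1
  · obtain ⟨hA, hD⟩ := norm_diag_eq_one h x.2
    obtain ⟨k, hk⟩ := hϖ.exists_norm_sub_mul_le (norm_pos_iff.1 hβ) x.2.2.2.1 hD
    refine ⟨k, (QuotientGroup.eq.2 ((inv_mul_mem_iff a (upperRep β γ h k).2 x.2).2 ⟨?_, ?_⟩)).symm⟩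
    · rw [upperRep, (hent _ _).1, norm_div, norm_mul, ha1, ← mul_inv, div_inv_eq_mul, ← mul_assoc]
      have : ‖(x : Mp2 F).mat.1 1 0‖ * ‖β‖ ≤ 1 := by
        calc _ ≤ ‖γ‖ * ‖β‖ := by gcongr; exact x.2.2.2.2
          _ ≤ 1 := by rw [mul_comm, ← norm_mul, hβγ]; exact hϖ.norm_lt_one.le
      exact mul_le_of_le_one_left hβ.le this
    · rw [key, upperRep, (hent _ _).2]
      exact hk

theorem cosetReps_lower (hβγ : ‖β * γ‖ = ‖ϖ‖) {a : Fˣ} (ha : ‖(a : F)‖ = ‖γ‖) :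
    CosetReps (coverSubgroup β γ h) (splitHom hϖ hδ h) (wAnti a) (lowerRep β γ h) := by
  have hγ : 0 < ‖γ‖ := by rw [← ha]; exact norm_pos_iff.2 a.ne_zero
  have key : ∀ y : F, ‖y / ((a : F) * a)‖ ≤ ‖β‖ ↔ ‖y‖ ≤ ‖γ‖ * ‖ϖ‖ := by
    intro y
    rw [norm_div, norm_mul, ha, ← hβγ, norm_mul, div_le_iff₀ (by positivity)]
    have : ‖β‖ * (‖γ‖ * ‖γ‖) = ‖γ‖ * (‖β‖ * ‖γ‖) := by ring
    rw [this]
  have hent : ∀ (b : F) (g : SpecialLinearGroup (Fin 2) F),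
      ((lowerUnip b)⁻¹ * g).1 0 1 = g.1 0 1 ∧
      ((lowerUnip b)⁻¹ * g).1 1 0 = g.1 1 0 - b * g.1 0 0 := by
    intro b g
    rw [lowerUnip_inv, sl_mul_apply, sl_mul_apply]
    constructor
    · simp [lowerUnip]
    · simp [lowerUnip]
      ring
  refine ⟨fun k => splitHom_lSharp _, fun k l hkl => ?_,
    fun x => ?_, compatible_wAnti a⟩
  · have h1 := ((inv_mul_mem_iff a (lowerRep β γ h k).2 (lowerRep β γ h l).2).1
      (QuotientGroup.eq.1 hkl)).1
    rw [key, lowerRep_mat, (hent _ _).2] at h1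
    refine hϖ.eq_of_norm_mul_sub_le (norm_pos_iff.1 hγ) ?_
    simpa [lowerRep, lSharp, lowerUnip] using h1
  · obtain ⟨hA, hD⟩ := norm_diag_eq_one h x.2
    obtain ⟨k, hk⟩ := hϖ.exists_norm_sub_mul_le (norm_pos_iff.1 hγ) x.2.2.2.2 hA
    refine ⟨k, (QuotientGroup.eq.2 ((inv_mul_mem_iff a (lowerRep β γ h k).2 x.2).2 ⟨?_, ?_⟩)).symm⟩
    · rw [key, lowerRep_mat, (hent _ _).2]
      exact hk
    · rw [lowerRep_mat, (hent _ _).1, norm_mul, norm_mul, ha, ← mul_assoc]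
      have : ‖(x : Mp2 F).mat.1 0 1‖ * ‖γ‖ ≤ 1 := by
        calc _ ≤ ‖β‖ * ‖γ‖ := by gcongr; exact x.2.2.2.1
          _ ≤ 1 := by rw [← norm_mul, hβγ]; exact hϖ.norm_lt_one.le
      exact mul_le_of_le_one_left hγ.le this

end split

/-! ### The values of the cells -/

section relations

variable {F : Type*} [NontriviallyNormedField F] [IsUltrametricDist F] [ProperSpace F] {q : ℕ}
  {ϖ δ β γ : F}

theorem norm_residueLift {k : 𝓀[F]} (hk : k ≠ 0) : ‖residueLift k‖ = 1 := by
  refine le_antisymm (norm_residueLift_le k) (not_lt.1 fun hlt => hk ?_)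
  rw [← residueClass_residueLift k, residueClass_eq_zero_iff (norm_residueLift_le k)]
  exact hlt

/-- For even exponent all q - 1 terms are 1; for odd exponent this is the sum of a non-trivial
quadratic character. This parity separates the two generators: only one of them keeps a linear term
in its relation. -/
theorem OddUniformizer.sum_unitChar (hϖ : OddUniformizer q ϖ) [Fintype 𝓀[F]] [DecidableEq 𝓀[F]]
    {e : F} (he : ‖e‖ = 1) (n : ℤ) :
    (∑ k : 𝓀[F], if k = 0 then (0 : ℂ) else
      (((unitChar q ϖ (e * residueLift k) ^ n : ℤˣ) : ℤ) : ℂ)) =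
      if Even n then (q : ℂ) - 1 else 0 := by
  have he0 : e ≠ 0 := norm_pos_iff.1 (he ▸ one_pos)
  split_ifs with hn
  · simp only [OddUniformizer.units_zpow_even _ hn]
    rw [Finset.sum_ite, Finset.sum_const_zero, zero_add, Finset.sum_const, ← Finset.compl_filter,
      Finset.card_compl, Finset.filter_eq' Finset.univ (0 : 𝓀[F]), if_pos (Finset.mem_univ _),
      Finset.card_singleton, ← Nat.card_eq_fintype_card, ← hϖ.card, nsmul_eq_mul,
      Nat.cast_sub hϖ.one_lt.le]
    simp
  · rw [Int.not_even_iff_odd] at hn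
    have h : ∀ k : 𝓀[F], (if k = 0 then (0 : ℂ) else
        (((unitChar q ϖ (e * residueLift k) ^ n : ℤˣ) : ℤ) : ℂ)) =
        ((unitChar q ϖ e : ℤˣ) : ℤ) * (quadraticChar 𝓀[F] k : ℤ) := by
      intro k
      split_ifs with hk
      · rw [hk, quadraticChar_zero, Int.cast_zero, mul_zero]
      · have hl : ‖residueLift k‖ = 1 := norm_residueLift hk
        have hl0 : residueLift k ≠ 0 := norm_pos_iff.1 (hl ▸ one_pos)
        rw [OddUniformizer.units_zpow_odd _ hn, hϖ.unitChar_mul he0 hl0, Units.val_mul,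
          Int.cast_mul]
        conv_rhs => rw [← residueClass_residueLift k, HasDifferent.quadraticChar_residueClass hϖ hl]
    simp only [h]
    rw [← Finset.mul_sum, ← Int.cast_sum, quadraticChar_sum_zero hϖ.ringChar_ne_two, Int.cast_zero,
      mul_zero]

variable [Fact (SymbolBilinear F)] {hϖ : OddUniformizer q ϖ} {hδ : δ ≠ 0} {h : ‖β * γ‖ < 1}

/-- The element 𝐰_{at} is 𝐰_a times a signed lift of the diagonal matrix of t, and ε takes the value
(t, aδ) on that lift. -/
theorem cell_wAnti_mul {a : Fˣ} {X : Type*} [Finite X] {u : X → coverSubgroup β γ h}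
    (hs : CosetReps (coverSubgroup β γ h) (splitHom hϖ hδ h) (wAnti a) u) (v : ℂ) {t : Fˣ}
    (ht : ‖(t : F)‖ = 1) :
    (hs.cell v).1 (wAnti (a * t)) =
      v * (((unitChar q ϖ (t : F) ^ ord q ((a : F) * δ) : ℤˣ) : ℤ) : ℂ) := by
  have hm : (⟨(mDiag t).mat, hilbertSymbol (t : F) a⟩ : Mp2 F) ∈ coverSubgroup β γ h := mDiag_mem (h := h) ht
  have ht0 := t.ne_zero
  have hti : ‖(t : F)⁻¹‖ = 1 := by rw [norm_inv, ht, inv_one]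
  rw [hs.cell_apply_of_eq v 1 ⟨_, hm⟩ (by rw [OneMemClass.coe_one, one_mul, wAnti_mul_mk_mDiag]),
    map_one, one_mul, splitHom_apply]
  congr 3
  have h1 : (mDiag t).mat.1 1 1 = (t : F)⁻¹ := by simp [mDiag]
  have h2 : lowerEntry (mDiag t).mat = (t : F)⁻¹ := by simp [lowerEntry, mDiag]
  rw [hϖ.splitSign_eq hδ (by rw [h1, hti]), h1, h2,
    ← hϖ.hilbertSymbol_unit_left ht (mul_ne_zero a.ne_zero hδ), hilbertSymbol_inv_left,
    hϖ.hilbertSymbol_congr_norm ht (mul_ne_zero hδ (inv_ne_zero ht0)) hδ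
      (by rw [norm_mul, hti, mul_one]),
    hϖ.symbolBilinear.mul_right a.ne_zero hδ ht0]

theorem cell_wAnti_inv {a : Fˣ} {X : Type*} [Finite X] {u : X → coverSubgroup β γ h}
    (hs : CosetReps (coverSubgroup β γ h) (splitHom hϖ hδ h) (wAnti a) u) (v : ℂ) :
    (hs.cell v).1 (wAnti a)⁻¹ =
      v * (((unitChar q ϖ (-1 : F) ^ ord q ((a : F) * δ) : ℤˣ) : ℤ) : ℂ) := by
  have e : (wAnti a)⁻¹ = wAnti (a * (-1)) := by rw [wAnti_inv, mul_neg_one]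
  rw [e, cell_wAnti_mul hs v (by simp)]
  simp

/-- The quadratic relation for a cell with representatives `u k` of the form that occurs for both
unipotent subgroups. -/
theorem cell_mul_self_of_conj {a : Fˣ} [Fintype 𝓀[F]] [DecidableEq 𝓀[F]]
    {u : 𝓀[F] → coverSubgroup β γ h}
    (hs : CosetReps (coverSubgroup β γ h) (splitHom hϖ hδ h) (wAnti a) u) (v : ℂ) {e : F}
    (he : ‖e‖ = 1) (hnot : wAnti a ∉ coverSubgroup β γ h)
    (hcell : ∀ x : coverSubgroup β γ h, wAnti a * x * wAnti a ∈ coverSubgroup β γ h ∨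
      InDC (coverSubgroup β γ h) (wAnti a) (wAnti a * x * wAnti a))
    (hval : ∀ k, (hs.cell v).1 ((wAnti a)⁻¹ * (u k : Mp2 F)⁻¹ * wAnti a) = if k = 0 then 0 else
      v * (((unitChar q ϖ (e * residueLift k) ^ ord q ((a : F) * δ) : ℤˣ) : ℤ) : ℂ)) :
    hs.cell v * hs.cell v =
      (v * if Even (ord q ((a : F) * δ)) then (q : ℂ) - 1 else 0) • hs.cell v +
      (q * v ^ 2 * (((unitChar q ϖ (-1 : F) ^ ord q ((a : F) * δ) : ℤˣ) : ℤ) : ℂ)) •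
        (1 : HeckeAlg (coverSubgroup β γ h) (splitHom hϖ hδ h)) := by
  refine hs.cell_mul_self hnot hcell ?_ ?_
  -- Since ε is 1 on the representatives, all q terms of the value at the identity equal the value
  -- at the inverse of 𝐰_a, which is 𝐰_{-a}.
  · have h1 : ∀ k, (hs.cell v).1 ((wAnti a)⁻¹ * (u k : Mp2 F)⁻¹) =
        v * (((unitChar q ϖ (-1 : F) ^ ord q ((a : F) * δ) : ℤˣ) : ℤ) : ℂ) := by
      intro k
      have := HeckeAlg.apply_mul_right (hs.cell v) (wAnti a)⁻¹ (u k)⁻¹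
      have h2 : splitHom hϖ hδ h (u k)⁻¹ = 1 := by
        have := HeckeAlg.eps_mul_eps_inv (ε := splitHom hϖ hδ h) (u k)
        rwa [hs.eps_eq_one, one_mul] at this
      rw [h2, one_mul, cell_wAnti_inv] at this
      exact this
    simp only [h1]
    rw [Finset.sum_const, Finset.card_univ, ← Nat.card_eq_fintype_card, ← hϖ.card, nsmul_eq_mul]
    ring
  · rw [← hϖ.sum_unitChar he, mul_comm, Finset.mul_sum]
    congr 1
    refine Finset.sum_congr rfl fun k _ => ?_
    rw [hval, mul_ite, mul_zero]

/-- The conjugate is a lower unipotent element. For the zero class it lies in the group, where the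
cell function vanishes; otherwise it equals u 𝐰_{at} u with a unit t and with ε(u) = 1. -/
theorem cell_conj_upper {a : Fˣ} (hβγ : ‖β * γ‖ = ‖ϖ‖) (ha : ‖(a : F)‖ * ‖β‖ = 1)
    (hs : CosetReps (coverSubgroup β γ h) (splitHom hϖ hδ h) (wAnti a) (upperRep β γ h))
    [Finite 𝓀[F]] [DecidableEq 𝓀[F]] (v : ℂ) (hnot : wAnti a ∉ coverSubgroup β γ h) (k : 𝓀[F]) :
    (hs.cell v).1 ((wAnti a)⁻¹ * (upperRep β γ h k : Mp2 F)⁻¹ * wAnti a) = if k = 0 then 0 else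
      v * (((unitChar q ϖ (a * β * residueLift k) ^ ord q ((a : F) * δ) : ℤˣ) : ℤ) : ℂ) := by
  have hβ : 0 < ‖β‖ := by
    refine (norm_nonneg β).lt_of_ne' fun h0 => ?_
    rw [h0, mul_zero] at ha
    exact zero_ne_one ha
  have ha1 : ‖(a : F)‖ = ‖β‖⁻¹ := eq_inv_of_mul_eq_one_left ha
  have e : (wAnti a)⁻¹ * (upperRep β γ h k : Mp2 F)⁻¹ * wAnti a =
      lSharp (β * residueLift k * (a * a)) := by
    rw [upperRep, uSharp_inv, wAnti_inv_mul_uSharp_mul, neg_mul, neg_neg]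
  rw [e]
  split_ifs with hk
  · refine hs.cell_apply_mem v hnot (lSharp_mem_cover ?_)
    have hl : ‖residueLift k‖ ≤ ‖ϖ‖ := by
      refine hϖ.norm_le_of_lt_one ?_
      rw [← residueClass_eq_zero_iff (norm_residueLift_le k), residueClass_residueLift, hk]
    rw [← hβγ, norm_mul] at hl
    rw [norm_mul, norm_mul, norm_mul, ha1]
    calc ‖β‖ * ‖residueLift k‖ * (‖β‖⁻¹ * ‖β‖⁻¹) ≤ ‖β‖ * (‖β‖ * ‖γ‖) * (‖β‖⁻¹ * ‖β‖⁻¹) := by gcongr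
      _ = ‖γ‖ := by field_simp
  · have hl := norm_residueLift hk
    have hl0 : residueLift k ≠ 0 := norm_pos_iff.1 (hl ▸ one_pos)
    set t : Fˣ := a * Units.mk0 β (norm_pos_iff.1 hβ) * Units.mk0 _ hl0 with ht
    have htv : (t : F) = a * β * residueLift k := rfl
    have htn : ‖(t : F)‖ = 1 := by rw [htv, norm_mul, norm_mul, ha, hl, one_mul]
    have hz : β * residueLift k * ((a : F) * a) = ((a * t : Fˣ) : F) := by
      rw [Units.val_mul, htv]; ring
    have hu : ‖((a * t : Fˣ) : F)⁻¹‖ ≤ ‖β‖ := by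
      rw [Units.val_mul, norm_inv, norm_mul, htn, mul_one, ha1, inv_inv]
    rw [hz, lSharp_eq, ← htv, ← cell_wAnti_mul hs v htn,
      (hs.cell v).2.1 ⟨uSharp _, uSharp_mem_cover hu⟩ ⟨uSharp _, uSharp_mem_cover hu⟩,
      splitHom_uSharp, one_mul, one_mul]

theorem cell_conj_lower {a : Fˣ} (hβγ : ‖β * γ‖ = ‖ϖ‖) (ha : ‖(a : F)‖ = ‖γ‖)
    (hs : CosetReps (coverSubgroup β γ h) (splitHom hϖ hδ h) (wAnti a) (lowerRep β γ h))
    [Finite 𝓀[F]] [DecidableEq 𝓀[F]] (v : ℂ) (hnot : wAnti a ∉ coverSubgroup β γ h) (k : 𝓀[F]) :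
    (hs.cell v).1 ((wAnti a)⁻¹ * (lowerRep β γ h k : Mp2 F)⁻¹ * wAnti a) = if k = 0 then 0 else
      v * (((unitChar q ϖ (-(γ / a) * residueLift k) ^ ord q ((a : F) * δ) : ℤˣ) : ℤ) : ℂ) := by
  have hγ : 0 < ‖γ‖ := by rw [← ha]; exact norm_pos_iff.2 a.ne_zero
  have e : (wAnti a)⁻¹ * (lowerRep β γ h k : Mp2 F)⁻¹ * wAnti a =
      uSharp (γ * residueLift k / (a * a)) := by
    rw [lowerRep, lSharp_inv, wAnti_inv_mul_lSharp_mul, neg_div, neg_neg]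
  rw [e]
  split_ifs with hk
  · refine hs.cell_apply_mem v hnot (uSharp_mem_cover ?_)
    have hl : ‖residueLift k‖ ≤ ‖ϖ‖ := by
      refine hϖ.norm_le_of_lt_one ?_
      rw [← residueClass_eq_zero_iff (norm_residueLift_le k), residueClass_residueLift, hk]
    rw [← hβγ, norm_mul] at hl
    rw [norm_div, norm_mul, norm_mul, ha]
    calc ‖γ‖ * ‖residueLift k‖ / (‖γ‖ * ‖γ‖) ≤ ‖γ‖ * (‖β‖ * ‖γ‖) / (‖γ‖ * ‖γ‖) := by gcongr
      _ = ‖β‖ := by field_simp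
  · have hl := norm_residueLift hk
    have hl0 : residueLift k ≠ 0 := norm_pos_iff.1 (hl ▸ one_pos)
    set t : Fˣ := -(Units.mk0 γ (norm_pos_iff.1 hγ) * a⁻¹) * Units.mk0 _ hl0 with ht
    have htv : (t : F) = -(γ / a) * residueLift k := by
      simp [ht, div_eq_mul_inv]
    have htn : ‖(t : F)‖ = 1 := by
      rw [htv, norm_mul, norm_neg, norm_div, ha, hl, div_self hγ.ne', one_mul]
    have htn' : ‖((t⁻¹ : Fˣ) : F)‖ = 1 := by
      rw [Units.val_inv_eq_inv_val, norm_inv, htn, inv_one]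
    have hz : γ * residueLift k / ((a : F) * a) = ((-(t * a⁻¹) : Fˣ) : F) := by
      rw [Units.val_neg, Units.val_mul, htv, Units.val_inv_eq_inv_val]
      field_simp
    have hw : -(-(t * a⁻¹))⁻¹ = a * t⁻¹ := by
      rw [inv_neg, neg_neg, _root_.mul_inv_rev, inv_inv]
    have hu : ‖((-(t * a⁻¹) : Fˣ) : F)⁻¹‖ ≤ ‖γ‖ := by
      rw [Units.val_neg, Units.val_mul, norm_inv, norm_neg, norm_mul, htn, one_mul,
        Units.val_inv_eq_inv_val, norm_inv, inv_inv, ha]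
    rw [hz, uSharp_eq_lSharp, hw, ← htv,
      (hs.cell v).2.1 ⟨lSharp _, lSharp_mem_cover hu⟩ ⟨lSharp _, lSharp_mem_cover hu⟩,
      splitHom_lSharp, one_mul, one_mul,
      cell_wAnti_mul hs v htn', Units.val_inv_eq_inv_val, hϖ.unitChar_inv t.ne_zero]

end relations

/-! ### The genuine Hecke algebra -/

section genuine

variable {F : Type*} [NontriviallyNormedField F] [IsUltrametricDist F] [ProperSpace F] {q : ℕ}
  {ϖ δ β γ : F}

theorem isOpen_congruenceSet (hβ : β ≠ 0) (hγ : γ ≠ 0) : IsOpen (congruenceSet β γ) := by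
  have h1 : ∀ (i j : Fin 2) {r : ℝ}, r ≠ 0 →
      IsOpen {g : SpecialLinearGroup (Fin 2) F | ‖g.1 i j‖ ≤ r} := by
    intro i j r hr
    have hc : Continuous fun g : SpecialLinearGroup (Fin 2) F => g.1 i j :=
      (continuous_apply_apply i j).comp continuous_subtype_val
    have := (IsUltrametricDist.isOpen_closedBall (0 : F) hr).preimage hc
    convert this using 1
    ext g
    simp
  exact (h1 0 0 one_ne_zero).inter ((h1 1 1 one_ne_zero).inter
    ((h1 0 1 (norm_ne_zero_iff.2 hβ)).inter (h1 1 0 (norm_ne_zero_iff.2 hγ))))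

theorem isCompact_congruenceSet (β γ : F) : IsCompact (congruenceSet β γ) := by
  set R : Fin 2 → Fin 2 → ℝ := ![![1, ‖β‖], ![‖γ‖, 1]] with hR
  have hK : IsCompact (Set.univ.pi fun i => Set.univ.pi fun j => Metric.closedBall (0 : F) (R i j)) :=
    isCompact_univ_pi fun i => isCompact_univ_pi fun j => isCompact_closedBall _ _
  have he : Topology.IsClosedEmbedding
      (Subtype.val : SpecialLinearGroup (Fin 2) F → Matrix (Fin 2) (Fin 2) F) :=
    (isClosed_eq (Continuous.matrix_det continuous_id) continuous_const).isClosedEmbedding_subtypeVal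
  have e : {M : Fin 2 → Fin 2 → F | ‖M 0 0‖ ≤ 1 ∧ ‖M 1 1‖ ≤ 1 ∧ ‖M 0 1‖ ≤ ‖β‖ ∧
      ‖M 1 0‖ ≤ ‖γ‖} = Set.univ.pi fun i => Set.univ.pi fun j => Metric.closedBall (0 : F) (R i j) := by
    ext M
    simp only [Set.mem_ofPred_eq, Set.mem_univ_pi, mem_closedBall_zero_iff, Fin.forall_fin_two, hR,
      Matrix.cons_val_zero, Matrix.cons_val_one]
    tauto
  rw [← e] at hK
  exact he.isCompact_preimage hK

theorem haarMp2_lift (μ : Measure (SpecialLinearGroup (Fin 2) F))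
    {S : Set (SpecialLinearGroup (Fin 2) F)} (hS : MeasurableSet S) :
    haarMp2 μ (lift S) = μ S + μ S := by
  have hm : ∀ ζ : ℤˣ, Measurable fun g : SpecialLinearGroup (Fin 2) F => (⟨g, ζ⟩ : Mp2 F) := by
    intro ζ
    rw [measurable_iff_comap_le]
    change MeasurableSpace.comap _ (_ ⊔ _) ≤ _
    rw [MeasurableSpace.comap_sup, MeasurableSpace.comap_comp, MeasurableSpace.comap_comp]
    refine sup_le ?_ ?_
    · exact MeasurableSpace.comap_id.le
    · exact (MeasurableSpace.comap_const _).trans_le bot_le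
  have hl : MeasurableSet (lift S) :=
    (le_sup_left : MeasurableSpace.comap Mp2.mat _ ≤ _) _ ⟨S, hS, rfl⟩
  rw [haarMp2, Measure.add_apply, Measure.map_apply (hm 1) hl, Measure.map_apply (hm (-1)) hl]
  rfl

variable [Fact (SymbolBilinear F)]

theorem measurableSet_coset (hβ : β ≠ 0) (hγ : γ ≠ 0) (h : ‖β * γ‖ < 1) (x : Mp2 F) :
    MeasurableSet {y | x⁻¹ * y ∈ coverSubgroup β γ h} := by
  refine (le_sup_left : MeasurableSpace.comap Mp2.mat _ ≤ _) _
    ⟨(fun g => x.mat⁻¹ * g) ⁻¹' congruenceSet β γ, ?_, rfl⟩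
  exact ((isOpen_congruenceSet hβ hγ).preimage (continuous_const_mul _)).measurableSet

theorem haarMp2_coset (hβ : β ≠ 0) (hγ : γ ≠ 0) (h : ‖β * γ‖ < 1)
    (μ : Measure (SpecialLinearGroup (Fin 2) F)) [μ.IsMulLeftInvariant] (x : Mp2 F) :
    haarMp2 μ {y | x⁻¹ * y ∈ coverSubgroup β γ h} = haarMp2 μ (lift (congruenceSet β γ)) := by
  have ho := isOpen_congruenceSet hβ hγ
  rw [haarMp2_lift μ ho.measurableSet]
  have := haarMp2_lift μ (S := (fun g => x.mat⁻¹ * g) ⁻¹' congruenceSet β γ)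
    (ho.preimage (continuous_const_mul _)).measurableSet
  rw [measure_preimage_mul] at this
  exact this

/-- The kernel {±1} of the projection is contained in the inverse image of Γ[β, γ], so the left
cosets upstairs embed into those downstairs. -/
theorem finite_cosets_iff (hβ : β ≠ 0) (hγ : γ ≠ 0) (h : ‖β * γ‖ < 1) (A : Set (Mp2 F)) :
    (QuotientGroup.mk '' A : Set (Mp2 F ⧸ coverSubgroup β γ h)).Finite ↔
      IsCompact (closure (Mp2.mat '' A)) := by
  rw [isCompact_closure_iff_finite_cosets (Γ := congruenceSubgroup β γ h)
    (isOpen_congruenceSet hβ hγ) (isCompact_congruenceSet β γ)]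
  set f : Mp2 F ⧸ coverSubgroup β γ h → SpecialLinearGroup (Fin 2) F ⧸ congruenceSubgroup β γ h :=
    fun x => (x.out.mat : SpecialLinearGroup (Fin 2) F) with hf
  have hfm : ∀ x : Mp2 F, f x = (x.mat : SpecialLinearGroup (Fin 2) F) := by
    intro x
    obtain ⟨y, hy⟩ := QuotientGroup.mk_out_eq_mul (coverSubgroup β γ h) x
    rw [hf]
    beta_reduce
    rw [hy, eq_comm, QuotientGroup.eq]
    change x.mat⁻¹ * (x.mat * (y : Mp2 F).mat) ∈ _
    rw [inv_mul_cancel_left]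
    exact y.2
  have hinj : Function.Injective f := by
    intro x y
    obtain ⟨x, rfl⟩ := QuotientGroup.mk_surjective x
    obtain ⟨y, rfl⟩ := QuotientGroup.mk_surjective y
    rw [hfm, hfm, QuotientGroup.eq, QuotientGroup.eq]
    exact id
  rw [← Set.finite_image_iff hinj.injOn, Set.image_image, Set.image_image]
  simp only [hfm]

variable {hϖ : OddUniformizer q ϖ} {hδ : δ ≠ 0} {h : ‖β * γ‖ < 1} {ψ : AddChar F Circle}

/-- Genuineness is no extra condition on the equivariant functions: [1, ζ] belongs to the inverse
image of Γ[β, γ], and ε takes the value ζ there. -/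
theorem genuineHecke_eq (hβ : β ≠ 0) (hγ : γ ≠ 0)
    (heps : ∀ x : coverSubgroup β γ h, eps ψ δ (x : Mp2 F) = splitHom hϖ hδ h x) :
    genuineHecke ψ δ (congruenceSet β γ) = HeckeAlg (coverSubgroup β γ h) (splitHom hϖ hδ h) := by
  ext φ
  constructor
  · rintro ⟨h1, -, h3⟩
    refine ⟨fun γ₁ γ₂ g => ?_, (finite_cosets_iff hβ hγ h _).2 h1⟩
    rw [h3 _ γ₁.2 _ γ₂.2, ← map_mul, ← heps]
    rfl
  · rintro ⟨h1, h2⟩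
    refine ⟨(finite_cosets_iff hβ hγ h _).1 h2, fun g ζ => ?_, fun γ₁ h₁ γ₂ h₂ g => ?_⟩
    · have hm : (⟨1, ζ⟩ : Mp2 F) ∈ coverSubgroup β γ h := (congruenceSubgroup β γ h).one_mem
      have e : (⟨g, ζ⟩ : Mp2 F) = ⟨1, ζ⟩ * ⟨g, 1⟩ := by
        ext1
        · exact (one_mul g).symm
        · change ζ = ζ * 1 * cocycle 1 g
          rw [cocycle_one_left, mul_one, mul_one]
      have e2 := HeckeAlg.apply_mul_left ⟨φ, h1, h2⟩ ⟨_, hm⟩ ⟨g, 1⟩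
      rw [e]
      refine e2.trans ?_
      congr 1
      rw [splitHom_apply, splitSign]
      simp [hϖ.unitChar_one]
    · have e := h1 ⟨γ₁, h₁⟩ ⟨γ₂, h₂⟩ g
      rw [← map_mul, ← heps] at e
      exact e

theorem heckeOne_eq
    (heps : ∀ x : coverSubgroup β γ h, eps ψ δ (x : Mp2 F) = splitHom hϖ hδ h x) :
    heckeOne ψ δ (congruenceSet β γ) =
      (1 : HeckeAlg (coverSubgroup β γ h) (splitHom hϖ hδ h)).1 := by
  funext g
  by_cases hg : g ∈ coverSubgroup β γ h
  · rw [HeckeAlg.one_apply_mem hg, heckeOne, Set.indicator_of_mem (by exact hg)]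
    exact heps ⟨g, hg⟩
  · rw [HeckeAlg.one_apply_notMem hg, heckeOne, Set.indicator_of_notMem (by exact hg)]

/-- Both sides choose a factorization of each element, possibly a different one; the value does not
depend on it. -/
theorem doubleCosetFun_eq {X : Type*} [Finite X] {u : X → coverSubgroup β γ h} {s : Mp2 F}
    (hs : CosetReps (coverSubgroup β γ h) (splitHom hϖ hδ h) s u)
    (heps : ∀ x : coverSubgroup β γ h, eps ψ δ (x : Mp2 F) = splitHom hϖ hδ h x) (r v : ℂ) :
    r • doubleCosetFun ψ δ (congruenceSet β γ) s v = (hs.cell (r * v)).1 := by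
  funext g
  rw [Pi.smul_apply, smul_eq_mul, doubleCosetFun]
  split_ifs with hg
  · obtain ⟨h1, h2, h3⟩ := hg.choose_spec
    rw [hs.cell_apply_of_eq _ ⟨_, h1⟩ ⟨_, h2⟩ h3, ← heps, ← heps]
    ring
  · rw [mul_zero, eq_comm]
    by_contra h'
    obtain ⟨γ₁, γ₂, e⟩ := hs.cell_support _ h'
    exact hg ⟨(γ₁, γ₂), γ₁.2, γ₂.2, e⟩

end genuine

/-! ### The structure of the genuine Hecke algebra -/

section genuineStructure

variable {F : Type*} [NontriviallyNormedField F] [IsUltrametricDist F] [ProperSpace F] {q : ℕ}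
  {ϖ δ β γ : F} [Fact (SymbolBilinear F)] {hϖ : OddUniformizer q ϖ} {hδ : δ ≠ 0} {h : ‖β * γ‖ < 1}

theorem iwahoriSystem_cover (hϖ : OddUniformizer q ϖ) (hβγ : ‖β * γ‖ = ‖ϖ‖) {a a' : Fˣ}
    (ha : ‖(a : F)‖ * ‖β‖ = 1) (ha' : ‖(a' : F)‖ = ‖γ‖) :
    IwahoriSystem (coverSubgroup β γ h) (wAnti a) (wAnti a') :=
  IwahoriSystem.comap matHom matHom_surjective (affineSystem_sl2 hϖ h hβγ ha ha').iwahoriSystem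

theorem cover_cell_of_affineSystem {a : Fˣ} {t : SpecialLinearGroup (Fin 2) F}
    {U L : Set (SpecialLinearGroup (Fin 2) F)}
    (A : AffineSystem (congruenceSubgroup β γ h) (wAnti a).mat t U L) :
    wAnti a ∉ coverSubgroup β γ h ∧
    ∀ x : coverSubgroup β γ h, wAnti a * x * wAnti a ∈ coverSubgroup β γ h ∨
      InDC (coverSubgroup β γ h) (wAnti a) (wAnti a * x * wAnti a) := by
  constructor
  · have := A.word_left 0
    rw [altProd, altProd, mul_one] at this
    exact this
  · intro x
    exact (A.cell ⟨_, x.2⟩).imp id fun H => InDC.of_map (π := matHom) matHom_surjective H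

/-- The quadratic relations for the cell of a simple reflection. -/
def CellRelation (hϖ : OddUniformizer q ϖ) (hδ : δ ≠ 0) (h : ‖β * γ‖ < 1) (a : Fˣ) : Prop :=
  ∃ (u : 𝓀[F] → coverSubgroup β γ h) (_ : Finite 𝓀[F])
    (hs : CosetReps (coverSubgroup β γ h) (splitHom hϖ hδ h) (wAnti a) u), ∀ v : ℂ,
    hs.cell v * hs.cell v =
      (v * if Even (ord q ((a : F) * δ)) then (q : ℂ) - 1 else 0) • hs.cell v +
      (q * v ^ 2 * (((unitChar q ϖ (-1 : F) ^ ord q ((a : F) * δ) : ℤˣ) : ℤ) : ℂ)) •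
        (1 : HeckeAlg (coverSubgroup β γ h) (splitHom hϖ hδ h))

theorem cellRelation_upper (hβγ : ‖β * γ‖ = ‖ϖ‖) {a : Fˣ} (ha : ‖(a : F)‖ * ‖β‖ = 1) :
    CellRelation hϖ hδ h a := by
  classical
  have hfin := hϖ.finite_residueField
  have := Fintype.ofFinite 𝓀[F]
  have hγ0 : γ ≠ 0 := by
    rintro rfl
    rw [mul_zero, norm_zero] at hβγ
    exact hϖ.norm_pos.ne hβγ
  obtain ⟨h1, h2⟩ := cover_cell_of_affineSystem
    (affineSystem_sl2 hϖ h hβγ ha (a' := Units.mk0 γ hγ0) rfl)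
  have hs : CosetReps (coverSubgroup β γ h) (splitHom hϖ hδ h) (wAnti a) (upperRep β γ h) :=
    cosetReps_upper hβγ ha
  refine ⟨upperRep β γ h, hfin, hs, fun v => ?_⟩
  have he : ‖(a : F) * β‖ = 1 := by rw [norm_mul, ha]
  exact cell_mul_self_of_conj hs v he h1 h2 (cell_conj_upper hβγ ha hs v h1)

theorem cellRelation_lower (hβγ : ‖β * γ‖ = ‖ϖ‖) {a : Fˣ} (ha : ‖(a : F)‖ = ‖γ‖) :
    CellRelation hϖ hδ h a := by
  classical
  have hfin := hϖ.finite_residueField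
  have := Fintype.ofFinite 𝓀[F]
  have hβ0 : β ≠ 0 := by
    rintro rfl
    rw [zero_mul, norm_zero] at hβγ
    exact hϖ.norm_pos.ne hβγ
  have hγ : ‖γ‖ ≠ 0 := by rw [← ha]; exact norm_ne_zero_iff.2 a.ne_zero
  obtain ⟨h1, h2⟩ := cover_cell_of_affineSystem
    (affineSystem_sl2 hϖ h hβγ (a := (Units.mk0 β hβ0)⁻¹)
      (by rw [Units.val_inv_eq_inv_val, norm_inv]; exact inv_mul_cancel₀ (norm_ne_zero_iff.2 hβ0))
      ha).symm
  have hs : CosetReps (coverSubgroup β γ h) (splitHom hϖ hδ h) (wAnti a) (lowerRep β γ h) :=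
    cosetReps_lower hβγ ha
  refine ⟨lowerRep β γ h, hfin, hs, fun v => ?_⟩
  have he : ‖-(γ / (a : F))‖ = 1 := by rw [norm_neg, norm_div, ha, div_self hγ]
  exact cell_mul_self_of_conj hs v he h1 h2 (cell_conj_lower hβγ ha hs v h1)

/-- A presentation of the genuine Hecke algebra, given the two simple reflections. -/
theorem exists_presentation {ψ : AddChar F Circle} (hψ : HasDifferent ψ δ ϖ)
    (heps : ∀ x : coverSubgroup β γ h, eps ψ δ (x : Mp2 F) = splitHom hϖ hδ h x) {a b : Fˣ}
    (ha : (a : F) = δ) (hb : ‖(b : F) * δ‖ = ‖δ‖ ^ 2 * ‖ϖ‖ ∨ ‖(b : F) * δ‖ = ‖δ‖ ^ 2 * ‖ϖ‖⁻¹)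
    (hI : IwahoriSystem (coverSubgroup β γ h) (wAnti a) (wAnti b))
    (hra : CellRelation hϖ hδ h a) (hrb : CellRelation hϖ hδ h b) {r : ℂ} (hr : r ^ 2 = (q : ℂ)⁻¹) :
    ∃ e : PresentedAlgebra q ≃ₐ[ℂ] HeckeAlg (coverSubgroup β γ h) (splitHom hϖ hδ h),
      (e (gen q 0)).1 = doubleCosetFun ψ δ (congruenceSet β γ) (wAnti a) (weilConst ψ δ a) ∧
      (e (gen q 1)).1 = r • doubleCosetFun ψ δ (congruenceSet β γ) (wAnti b) (weilConst ψ δ b) := by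
  obtain ⟨u, hfin, hs, hrel⟩ := hra
  obtain ⟨u', _, hs', hrel'⟩ := hrb
  have hq0 : (q : ℂ) ≠ 0 := Nat.cast_ne_zero.2 hϖ.odd.pos.ne'
  have hoδ := hϖ.norm_eq_zpow_ord hδ
  have hϖ0 : ‖ϖ‖ ≠ 0 := hϖ.norm_pos.ne'
  -- The relations depend only on the parity of the order of aδ and bδ: the first has the order of
  -- δ², the second differs from it by one uniformizer in either direction.
  have hea : Even (ord q ((a : F) * δ)) := by
    rw [ha, hϖ.ord_mul hδ hδ]
    exact ⟨_, rfl⟩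
  have hob : Odd (ord q ((b : F) * δ)) := by
    rcases hb with hb | hb
    · refine ⟨ord q δ, hϖ.ord_eq_of_norm ?_⟩
      rw [hb, hoδ, zpow_add₀ hϖ0, zpow_one, mul_comm (2 : ℤ), _root_.zpow_mul]
      norm_cast
    · refine ⟨ord q δ - 1, hϖ.ord_eq_of_norm ?_⟩
      rw [hb, hoδ, show 2 * (ord q δ - 1) + 1 = ord q δ * 2 + -1 by ring, zpow_add₀ hϖ0,
        _root_.zpow_neg_one, _root_.zpow_mul]
      norm_cast
  have hwa : weilConst ψ δ (a : F) = 1 := hψ.weilConst_of_even hϖ a.ne_zero hea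
  have hwb := hψ.weilConst_sq_of_odd hϖ b.ne_zero hob
  have h₀ : hs.cell 1 * hs.cell 1 = ((q : ℂ) - 1) • hs.cell 1 +
      (q : ℂ) • (1 : HeckeAlg (coverSubgroup β γ h) (splitHom hϖ hδ h)) := by
    rw [hrel, if_pos hea, OddUniformizer.units_zpow_even _ hea]
    simp
  have h₁ : hs'.cell (r * weilConst ψ δ b) * hs'.cell (r * weilConst ψ δ b) = 1 := by
    -- The factor r² = q⁻¹ cancels the number of cosets, and the square χ(-1) of the Weil constant
    -- cancels the sign from the value at 𝐰_{-b}.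
    have hc : (q : ℂ) * (r * weilConst ψ δ b) ^ 2 *
        (((unitChar q ϖ (-1 : F) ^ ord q ((b : F) * δ) : ℤˣ) : ℤ) : ℂ) = 1 := by
      rw [OddUniformizer.units_zpow_odd _ hob, mul_pow, hr, hwb]
      have := intCast_unit_mul_self (unitChar q ϖ (-1 : F))
      field_simp
      linear_combination this
    rw [hrel', hc, if_neg (Int.not_even_iff_odd.2 hob), mul_zero, zero_smul, zero_add, one_smul]
  refine ⟨AlgEquiv.ofBijective _ (HeckeAlg.liftPresented_bijective hϖ.odd.pos.ne' hI
    (fun g => hs.cell_support 1) (fun g => hs'.cell_support _) h₀ h₁), ?_, ?_⟩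
  · rw [AlgEquiv.coe_ofBijective, liftPresented_gen_zero, hwa, ← one_smul ℂ (doubleCosetFun _ _ _ _ _),
      doubleCosetFun_eq hs heps, one_mul]
  · rw [AlgEquiv.coe_ofBijective, liftPresented_gen_one, doubleCosetFun_eq hs' heps]

end genuineStructure

/-! ### The double cosets of `PGL₂(F)` -/

section pglMatrices

variable {F : Type*} [Field F]

theorem gl_det (g : GL (Fin 2) F) : g.1.det = g.1 0 0 * g.1 1 1 - g.1 0 1 * g.1 1 0 :=
  Matrix.det_fin_two _

theorem gl_det_ne_zero (g : GL (Fin 2) F) : g.1.det ≠ 0 :=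
  (Matrix.GeneralLinearGroup.det g).ne_zero

theorem gl_mul_apply (g h : GL (Fin 2) F) (i j : Fin 2) :
    (g * h).1 i j = g.1 i 0 * h.1 0 j + g.1 i 1 * h.1 1 j := by
  rw [Units.val_mul, Matrix.mul_apply, Fin.sum_univ_two]

theorem gl_ext {g h : GL (Fin 2) F} (h₀₀ : g.1 0 0 = h.1 0 0) (h₀₁ : g.1 0 1 = h.1 0 1)
    (h₁₀ : g.1 1 0 = h.1 1 0) (h₁₁ : g.1 1 1 = h.1 1 1) : g = h := by
  apply Units.ext
  ext i j
  fin_cases i <;> fin_cases j <;> assumption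

theorem pgl_mk_eq {g h : GL (Fin 2) F} {c : F} (hc : c ≠ 0) (h₀₀ : g.1 0 0 * c = h.1 0 0)
    (h₀₁ : g.1 0 1 * c = h.1 0 1) (h₁₀ : g.1 1 0 * c = h.1 1 0) (h₁₁ : g.1 1 1 * c = h.1 1 1) :
    ProjGenLinGroup.mk g = ProjGenLinGroup.mk h := by
  rw [ProjGenLinGroup.mk_eq_mk_iff]
  refine ⟨Units.mk0 c hc, gl_ext ?_ ?_ ?_ ?_⟩ <;> rw [gl_mul_apply] <;> simp [h₀₀, h₀₁, h₁₀, h₁₁]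

theorem exists_of_pgl_mk_eq {g h : GL (Fin 2) F}
    (e : ProjGenLinGroup.mk g = ProjGenLinGroup.mk h) :
    ∃ c : F, c ≠ 0 ∧ ∀ i j, g.1 i j * c = h.1 i j := by
  obtain ⟨c, hc⟩ := ProjGenLinGroup.mk_eq_mk_iff.1 e
  refine ⟨c, c.ne_zero, fun i j => ?_⟩
  rw [← hc, gl_mul_apply]
  fin_cases j <;> simp

/-- The matrix `(a, b; c, d)` of non-zero determinant. -/
def mkGL (a b c d : F) (h : a * d - b * c ≠ 0) : GL (Fin 2) F :=
  Matrix.GeneralLinearGroup.mkOfDetNeZero !![a, b; c, d] (by rwa [Matrix.det_fin_two])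

section entries

variable (a b c d : F) (h : a * d - b * c ≠ 0)

@[simp] theorem mkGL_apply_zero_zero : (mkGL a b c d h).1 0 0 = a := rfl
@[simp] theorem mkGL_apply_zero_one : (mkGL a b c d h).1 0 1 = b := rfl
@[simp] theorem mkGL_apply_one_zero : (mkGL a b c d h).1 1 0 = c := rfl
@[simp] theorem mkGL_apply_one_one : (mkGL a b c d h).1 1 1 = d := rfl

end entries

/-- `(1, y; 0, 1)` -/
def upperGL (y : F) : GL (Fin 2) F := mkGL 1 y 0 1 (by simp)

/-- `(1, 0; z, 1)` -/
def lowerGL (z : F) : GL (Fin 2) F := mkGL 1 0 z 1 (by simp)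

/-- `(x, 0; 0, 1)` -/
def diagGL (x : Fˣ) : GL (Fin 2) F := mkGL x 0 0 1 (by simp)

/-- `(0, 1; a, 0)` -/
def antiGL (a : Fˣ) : GL (Fin 2) F := mkGL 0 1 a 0 (by simp)

/-- The conjugate `(d, c/a; ab, a)` of a matrix by `(0, 1; a, 0)`, up to a scalar. -/
def swapGL (a : Fˣ) (g : GL (Fin 2) F) : GL (Fin 2) F :=
  mkGL (g.1 1 1) (g.1 1 0 / a) (a * g.1 0 1) (g.1 0 0) (by
    have h := gl_det_ne_zero g
    rw [gl_det] at h
    convert h using 1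
    field_simp [a.ne_zero])

theorem swapGL_det (a : Fˣ) (g : GL (Fin 2) F) : (swapGL a g).1.det = g.1.det := by
  rw [gl_det, gl_det]
  simp only [swapGL, mkGL_apply_zero_zero, mkGL_apply_zero_one, mkGL_apply_one_zero,
    mkGL_apply_one_one]
  field_simp [a.ne_zero]

theorem antiGL_mul_mul (a : Fˣ) (g : GL (Fin 2) F) :
    ProjGenLinGroup.mk (antiGL a) * ProjGenLinGroup.mk g * ProjGenLinGroup.mk (antiGL a) =
      ProjGenLinGroup.mk (swapGL a g) := by
  rw [← map_mul, ← map_mul]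
  have ha := a.ne_zero
  refine pgl_mk_eq (inv_ne_zero ha) ?_ ?_ ?_ ?_ <;> rw [gl_mul_apply, gl_mul_apply, gl_mul_apply] <;>
    simp [antiGL, swapGL] <;> field_simp

theorem antiGL_mul_antiGL (a b : Fˣ) :
    ProjGenLinGroup.mk (antiGL a) * ProjGenLinGroup.mk (antiGL b) =
      ProjGenLinGroup.mk (diagGL (b / a)) := by
  rw [← map_mul]
  have ha := a.ne_zero
  refine pgl_mk_eq (inv_ne_zero ha) ?_ ?_ ?_ ?_ <;> rw [gl_mul_apply] <;>
    simp [antiGL, diagGL, div_eq_mul_inv]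

theorem diagGL_mul (x y : Fˣ) : diagGL x * diagGL y = diagGL (x * y) := by
  apply gl_ext <;> rw [gl_mul_apply] <;> simp [diagGL]

theorem diagGL_one : diagGL (1 : Fˣ) = 1 := by
  apply gl_ext <;> simp [diagGL]

theorem antiGL_mul_self (a : Fˣ) :
    ProjGenLinGroup.mk (antiGL a) * ProjGenLinGroup.mk (antiGL a) = 1 := by
  rw [antiGL_mul_antiGL, div_self', diagGL_one, map_one]

theorem antiGL_inv (a : Fˣ) :
    (ProjGenLinGroup.mk (antiGL a))⁻¹ = ProjGenLinGroup.mk (antiGL a) :=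
  inv_eq_of_mul_eq_one_left (antiGL_mul_self a)

theorem antiGL_mul_diagGL (a x : Fˣ) : antiGL a * diagGL x = antiGL (a * x) := by
  apply gl_ext <;> rw [gl_mul_apply] <;> simp [antiGL, diagGL]

theorem upperGL_mul (x y : F) : upperGL x * upperGL y = upperGL (x + y) := by
  apply gl_ext <;> rw [gl_mul_apply] <;> simp [upperGL, add_comm]

theorem upperGL_zero : upperGL (0 : F) = 1 := by
  apply gl_ext <;> simp [upperGL]

theorem lowerGL_zero : lowerGL (0 : F) = 1 := by
  apply gl_ext <;> simp [lowerGL]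

theorem upperGL_inv (y : F) : (upperGL y)⁻¹ = upperGL (-y) :=
  inv_eq_of_mul_eq_one_left (by rw [upperGL_mul, neg_add_cancel, upperGL_zero])

theorem diagGL_mul_upperGL (x : Fˣ) (y : F) :
    diagGL x * upperGL y = upperGL (x * y) * diagGL x := by
  apply gl_ext <;> rw [gl_mul_apply, gl_mul_apply] <;> simp [diagGL, upperGL]

theorem swapGL_upperGL (a : Fˣ) (y : F) : swapGL a (upperGL y) = lowerGL (a * y) := by
  apply gl_ext <;> simp [swapGL, upperGL, lowerGL]

theorem swapGL_lowerGL (a : Fˣ) (z : F) : swapGL a (lowerGL z) = upperGL (z / a) := by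
  apply gl_ext <;> simp [swapGL, upperGL, lowerGL]

theorem pgl_lowerGL_eq (z : Fˣ) : ProjGenLinGroup.mk (lowerGL (z : F)) =
    ProjGenLinGroup.mk (upperGL (z : F)⁻¹) * ProjGenLinGroup.mk (antiGL (-(z * z))) *
      ProjGenLinGroup.mk (upperGL (z : F)⁻¹) := by
  rw [← map_mul, ← map_mul]
  have hz := z.ne_zero
  refine pgl_mk_eq (c := -z) (neg_ne_zero.2 hz) ?_ ?_ ?_ ?_ <;> rw [gl_mul_apply, gl_mul_apply, gl_mul_apply] <;>
    simp [lowerGL, upperGL, antiGL, hz]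

theorem exists_pgl_eq (g : GL (Fin 2) F) :
    (∃ y x, ProjGenLinGroup.mk g = ProjGenLinGroup.mk (upperGL y) * ProjGenLinGroup.mk (diagGL x)) ∨
    ∃ y x y', ProjGenLinGroup.mk g = ProjGenLinGroup.mk (upperGL y) *
      ProjGenLinGroup.mk (antiGL x) * ProjGenLinGroup.mk (upperGL y') := by
  have hdet := gl_det_ne_zero g
  by_cases hc : g.1 1 0 = 0
  · left
    have hdet' := gl_det g
    rw [hc, mul_zero, sub_zero] at hdet'
    rw [hdet'] at hdet
    have ha := left_ne_zero_of_mul hdet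
    have hd := right_ne_zero_of_mul hdet
    refine ⟨g.1 0 1 / g.1 1 1, Units.mk0 _ (div_ne_zero ha hd), ?_⟩
    rw [← map_mul]
    refine pgl_mk_eq (inv_ne_zero hd) ?_ ?_ ?_ ?_ <;> rw [gl_mul_apply] <;>
      simp [upperGL, diagGL, hc, hd, div_eq_mul_inv]
  · right
    refine ⟨g.1 0 0 / g.1 1 0, Units.mk0 (-(g.1 1 0 ^ 2 / g.1.det)) (by simp [hc, hdet]),
      g.1 1 1 / g.1 1 0, ?_⟩
    rw [← map_mul, ← map_mul]
    have hdet' := gl_det g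
    refine pgl_mk_eq (c := -(g.1 1 0 / g.1.det)) (by simp [hc, hdet]) ?_ ?_ ?_ ?_ <;>
      rw [gl_mul_apply, gl_mul_apply, gl_mul_apply] <;>
      simp only [upperGL, antiGL, mkGL_apply_zero_zero, mkGL_apply_zero_one, mkGL_apply_one_zero,
        mkGL_apply_one_one, Units.val_mk0] <;> field_simp <;> rw [hdet'] <;> ring

end pglMatrices

/-! ### The Iwahori subgroup of `PGL₂(F)` -/

section iwahoriSubgroup

variable {F : Type*} [NontriviallyNormedField F] [IsUltrametricDist F] {q : ℕ} {ϖ β γ : F}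

theorem gl_norm_diag_eq_one (h : ‖β * γ‖ < 1) {g : GL (Fin 2) F} (h₀₀ : ‖g.1 0 0‖ ≤ 1)
    (h₁₁ : ‖g.1 1 1‖ ≤ 1) (h₀₁ : ‖g.1 0 1‖ ≤ ‖β‖) (h₁₀ : ‖g.1 1 0‖ ≤ ‖γ‖) (hdet : ‖g.1.det‖ = 1) :
    ‖g.1 0 0‖ = 1 ∧ ‖g.1 1 1‖ = 1 := by
  have h1 : ‖g.1 0 0 * g.1 1 1‖ = 1 := by
    have e : g.1 0 0 * g.1 1 1 = g.1.det + g.1 0 1 * g.1 1 0 := by rw [gl_det]; ring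
    rw [e, norm_add_eq_of_lt (by rw [hdet]; exact norm_mul_lt_of_congruence h h₀₁ h₁₀), hdet]
  rw [norm_mul] at h1
  have := norm_nonneg (g.1 0 0)
  have := norm_nonneg (g.1 1 1)
  constructor <;> nlinarith

/-- The matrices `(a, b; c, d)` in `GL₂(F)` with `a, d ∈ 𝔬`, `b ∈ β𝔬`, `c ∈ γ𝔬` and determinant
in `𝔬ˣ`. -/
def iwahoriGL (β γ : F) (h : ‖β * γ‖ < 1) : Subgroup (GL (Fin 2) F) where
  carrier := {g | ‖g.1 0 0‖ ≤ 1 ∧ ‖g.1 1 1‖ ≤ 1 ∧ ‖g.1 0 1‖ ≤ ‖β‖ ∧ ‖g.1 1 0‖ ≤ ‖γ‖ ∧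
    ‖g.1.det‖ = 1}
  one_mem' := by simp
  mul_mem' := by
    rintro g k ⟨ha, hd, hb, hc, hg⟩ ⟨ha', hd', hb', hc', hk⟩
    have h1 : ∀ {x y : F} {r s : ℝ}, ‖x‖ ≤ r → ‖y‖ ≤ s → ‖x * y‖ ≤ r * s := fun hx hy => by
      rw [norm_mul]
      exact mul_le_mul hx hy (norm_nonneg _) ((norm_nonneg _).trans hx)
    refine ⟨?_, ?_, ?_, ?_, ?_⟩
    · rw [gl_mul_apply]
      exact norm_add_le_of_le ((h1 ha ha').trans_eq (one_mul 1))
        (norm_mul_lt_of_congruence h hb hc').le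
    · rw [gl_mul_apply]
      refine norm_add_le_of_le ?_ ((h1 hd hd').trans_eq (one_mul 1))
      rw [mul_comm]
      exact (norm_mul_lt_of_congruence h hb' hc).le
    · rw [gl_mul_apply]
      exact norm_add_le_of_le ((h1 ha hb').trans_eq (one_mul _)) ((h1 hb hd').trans_eq (mul_one _))
    · rw [gl_mul_apply]
      exact norm_add_le_of_le ((h1 hc ha').trans_eq (mul_one _)) ((h1 hd hc').trans_eq (one_mul _))
    · rw [Units.val_mul, Matrix.det_mul, norm_mul, hg, hk, one_mul]
  inv_mem' := by
    rintro g ⟨ha, hd, hb, hc, hg⟩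
    have hdet := gl_det_ne_zero g
    have e : g⁻¹ = mkGL (g.1 1 1 / g.1.det) (-(g.1 0 1 / g.1.det)) (-(g.1 1 0 / g.1.det))
        (g.1 0 0 / g.1.det) (by
          have : g.1 1 1 / g.1.det * (g.1 0 0 / g.1.det) -
              -(g.1 0 1 / g.1.det) * -(g.1 1 0 / g.1.det) = (g.1.det)⁻¹ := by
            field_simp
            rw [gl_det]; ring
          rw [this]
          exact inv_ne_zero hdet) := by
      refine inv_eq_of_mul_eq_one_right ?_
      have hdet' := gl_det g
      apply gl_ext <;> rw [gl_mul_apply] <;> simp <;> field_simp <;> rw [hdet'] <;> ring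
    have hdi : ‖((g⁻¹ : GL (Fin 2) F)).1.det‖ = 1 := by
      have h1 : (g * g⁻¹).1.det = 1 := by simp
      rw [Units.val_mul, Matrix.det_mul] at h1
      have h2 := congrArg (‖·‖) h1
      simpa only [norm_mul, hg, one_mul, norm_one] using h2
    refine ⟨?_, ?_, ?_, ?_, hdi⟩ <;> rw [e] <;> simp [norm_div, hg, ha, hd, hb, hc]

variable {h : ‖β * γ‖ < 1}

theorem mem_iwahoriGL {g : GL (Fin 2) F} : g ∈ iwahoriGL β γ h ↔ ‖g.1 0 0‖ ≤ 1 ∧ ‖g.1 1 1‖ ≤ 1 ∧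
    ‖g.1 0 1‖ ≤ ‖β‖ ∧ ‖g.1 1 0‖ ≤ ‖γ‖ ∧ ‖g.1.det‖ = 1 := Iff.rfl

/-- The image of `iwahoriGL` in `PGL₂(F)`. -/
def iwahoriPGL (β γ : F) (h : ‖β * γ‖ < 1) : Subgroup PGL(Fin 2, F) :=
  (iwahoriGL β γ h).map ProjGenLinGroup.mk

theorem mk_mem_iwahoriPGL {g : GL (Fin 2) F} (hg : g ∈ iwahoriGL β γ h) :
    ProjGenLinGroup.mk g ∈ iwahoriPGL β γ h := ⟨g, hg, rfl⟩

/-- A scalar that relates two matrices with unit determinants is itself a unit, so membership can be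
tested on any representative with unit determinant. -/
theorem mk_mem_iwahoriPGL_iff {g : GL (Fin 2) F} (hg : ‖g.1.det‖ = 1) :
    ProjGenLinGroup.mk g ∈ iwahoriPGL β γ h ↔ g ∈ iwahoriGL β γ h := by
  refine ⟨?_, mk_mem_iwahoriPGL⟩
  rintro ⟨k, hk, e⟩
  obtain ⟨c, hc, hkc⟩ := exists_of_pgl_mk_eq e
  have hd : g.1.det = k.1.det * c ^ 2 := by
    rw [gl_det, gl_det, ← hkc, ← hkc, ← hkc, ← hkc]; ring
  have hc1 : ‖c‖ = 1 := by
    rw [hd, norm_mul, hk.2.2.2.2, one_mul, norm_pow] at hg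
    exact (pow_eq_one_iff_of_nonneg (norm_nonneg c) two_ne_zero).1 hg
  have hn : ∀ i j, ‖g.1 i j‖ = ‖k.1 i j‖ := fun i j => by rw [← hkc, norm_mul, hc1, mul_one]
  refine ⟨?_, ?_, ?_, ?_, hg⟩ <;> rw [hn]
  · exact hk.1
  · exact hk.2.1
  · exact hk.2.2.1
  · exact hk.2.2.2.1

theorem norm_ratio_of_mem {g : GL (Fin 2) F} (hg : ProjGenLinGroup.mk g ∈ iwahoriPGL β γ h) :
    g.1 0 0 ≠ 0 ∧ ‖g.1 0 0‖ = ‖g.1 1 1‖ := by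
  obtain ⟨k, ⟨ha, hd, hb, hc, hk⟩, e⟩ := hg
  obtain ⟨c, hc0, hkc⟩ := exists_of_pgl_mk_eq e
  obtain ⟨hA, hD⟩ := gl_norm_diag_eq_one h ha hd hb hc hk
  constructor
  · rw [← hkc]
    exact mul_ne_zero (norm_pos_iff.1 (hA ▸ one_pos)) hc0
  · rw [← hkc, ← hkc, norm_mul, norm_mul, hA, hD]

theorem upperGL_mem {y : F} (hy : ‖y‖ ≤ ‖β‖) : upperGL y ∈ iwahoriGL β γ h := by
  refine ⟨?_, ?_, ?_, ?_, ?_⟩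
  · simp [upperGL]
  · simp [upperGL]
  · simpa [upperGL] using hy
  · simp [upperGL]
  · rw [gl_det]; simp [upperGL]

theorem lowerGL_mem {z : F} (hz : ‖z‖ ≤ ‖γ‖) : lowerGL z ∈ iwahoriGL β γ h := by
  refine ⟨?_, ?_, ?_, ?_, ?_⟩
  · simp [lowerGL]
  · simp [lowerGL]
  · simp [lowerGL]
  · simpa [lowerGL] using hz
  · rw [gl_det]; simp [lowerGL]

theorem diagGL_mem {x : Fˣ} (hx : ‖(x : F)‖ = 1) : diagGL x ∈ iwahoriGL β γ h := by
  refine ⟨?_, ?_, ?_, ?_, ?_⟩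
  · simp [diagGL, hx]
  · simp [diagGL]
  · simp [diagGL]
  · simp [diagGL]
  · rw [gl_det]; simp [diagGL, hx]

theorem swapGL_mem_iff {a : Fˣ} {g : GL (Fin 2) F} (hg : g ∈ iwahoriGL β γ h) :
    swapGL a g ∈ iwahoriGL β γ h ↔ ‖g.1 1 0‖ / ‖(a : F)‖ ≤ ‖β‖ ∧ ‖(a : F)‖ * ‖g.1 0 1‖ ≤ ‖γ‖ := by
  rw [mem_iwahoriGL, swapGL_det]
  simp only [swapGL, mkGL_apply_zero_zero, mkGL_apply_zero_one, mkGL_apply_one_zero,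
    mkGL_apply_one_one, norm_div, norm_mul]
  exact ⟨fun H => ⟨H.2.2.1, H.2.2.2.1⟩, fun H => ⟨hg.2.1, hg.1, H.1, H.2, hg.2.2.2.2⟩⟩

theorem anti_conj_mem_iff {a : Fˣ} {g : GL (Fin 2) F} (hg : g ∈ iwahoriGL β γ h) :
    ProjGenLinGroup.mk (antiGL a) * ProjGenLinGroup.mk g * ProjGenLinGroup.mk (antiGL a) ∈
      iwahoriPGL β γ h ↔ ‖g.1 1 0‖ / ‖(a : F)‖ ≤ ‖β‖ ∧ ‖(a : F)‖ * ‖g.1 0 1‖ ≤ ‖γ‖ := by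
  rw [antiGL_mul_mul, mk_mem_iwahoriPGL_iff (by rw [swapGL_det]; exact hg.2.2.2.2),
    swapGL_mem_iff hg]

theorem altProd_anti_notMem {a b : Fˣ} (hab : ‖(a : F)‖ ≠ ‖(b : F)‖) (n : ℕ) :
    altProd (ProjGenLinGroup.mk (antiGL a)) (ProjGenLinGroup.mk (antiGL b)) (n + 1) ∉
      iwahoriPGL β γ h := by
  have ha := norm_pos_iff.2 a.ne_zero
  have hb := norm_pos_iff.2 b.ne_zero
  let D : Fˣ →* PGL(Fin 2, F) :=
    { toFun := fun y => ProjGenLinGroup.mk (diagGL y)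
      map_one' := by rw [diagGL_one, map_one]
      map_mul' := fun y z => by rw [← diagGL_mul, map_mul] }
  have heven : ∀ m, altProd (ProjGenLinGroup.mk (antiGL a)) (ProjGenLinGroup.mk (antiGL b)) (2 * m) =
      D ((b / a) ^ m) := by
    intro m
    rw [altProd_two_mul, antiGL_mul_antiGL, map_pow]
    rfl
  intro hmem
  rcases Nat.even_or_odd' (n + 1) with ⟨m, hm | hm⟩
  · rw [hm, heven] at hmem
    have h1 := (norm_ratio_of_mem hmem).2
    simp only [diagGL, mkGL_apply_zero_zero, mkGL_apply_one_one, norm_one] at h1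
    have hm0 : m ≠ 0 := by omega
    rw [Units.val_pow_eq_pow_val, norm_pow, pow_eq_one_iff_of_nonneg (norm_nonneg _) hm0,
      Units.val_div_eq_div_val, norm_div, div_eq_one_iff_eq ha.ne'] at h1
    exact hab h1.symm
  · have h2 : altProd (ProjGenLinGroup.mk (antiGL a)) (ProjGenLinGroup.mk (antiGL b)) (2 * m + 1) =
        ProjGenLinGroup.mk (diagGL ((b / a) ^ m) * antiGL a) := by
      rw [map_mul]
      clear hm hmem
      have := heven m
      induction m with
      | zero => simp [altProd, diagGL_one]
      | succ m ih =>
        have e1 : ∀ k, altProd (ProjGenLinGroup.mk (antiGL a)) (ProjGenLinGroup.mk (antiGL b)) (k + 2) =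
            ProjGenLinGroup.mk (antiGL a) * (ProjGenLinGroup.mk (antiGL b) *
              altProd (ProjGenLinGroup.mk (antiGL a)) (ProjGenLinGroup.mk (antiGL b)) k) :=
          fun k => rfl
        rw [show 2 * (m + 1) + 1 = 2 * m + 1 + 2 by ring, e1, ih (heven m), ← mul_assoc,
          antiGL_mul_antiGL, ← mul_assoc, ← map_mul ProjGenLinGroup.mk (diagGL (b / a)), diagGL_mul,
          ← pow_succ']
    rw [hm, h2] at hmem
    refine (norm_ratio_of_mem hmem).1 ?_
    rw [gl_mul_apply]
    simp [diagGL, antiGL]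

theorem generate_pgl [ProperSpace F] (hϖ : OddUniformizer q ϖ) (hβ0 : β ≠ 0) {a b : Fˣ}
    (hab : ‖(b : F)‖ = ‖(a : F)‖ * ‖ϖ‖) :
    Subgroup.closure ((iwahoriPGL β γ h : Set PGL(Fin 2, F)) ∪
      {ProjGenLinGroup.mk (antiGL a), ProjGenLinGroup.mk (antiGL b)}) = ⊤ := by
  set H := Subgroup.closure ((iwahoriPGL β γ h : Set PGL(Fin 2, F)) ∪
      {ProjGenLinGroup.mk (antiGL a), ProjGenLinGroup.mk (antiGL b)}) with hH
  have hΓ : ∀ g ∈ iwahoriGL β γ h, ProjGenLinGroup.mk g ∈ H :=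
    fun g hg => Subgroup.subset_closure (Or.inl (mk_mem_iwahoriPGL hg))
  have hw : ProjGenLinGroup.mk (antiGL a) ∈ H := Subgroup.subset_closure (Or.inr (Or.inl rfl))
  have hw' : ProjGenLinGroup.mk (antiGL b) ∈ H := Subgroup.subset_closure (Or.inr (Or.inr rfl))
  let D : Fˣ →* PGL(Fin 2, F) :=
    { toFun := fun y => ProjGenLinGroup.mk (diagGL y)
      map_one' := by rw [diagGL_one, map_one]
      map_mul' := fun y z => by rw [← diagGL_mul, map_mul] }
  set x : Fˣ := b / a with hx
  have hxn : ‖(x : F)‖ = ‖ϖ‖ := by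
    rw [hx, Units.val_div_eq_div_val, norm_div, hab,
      mul_div_cancel_left₀ _ (norm_ne_zero_iff.2 a.ne_zero)]
  have hmx : D x ∈ H := by
    have : D x = ProjGenLinGroup.mk (antiGL a) * ProjGenLinGroup.mk (antiGL b) :=
      (antiGL_mul_antiGL a b).symm
    rw [this]
    exact H.mul_mem hw hw'
  have hD : ∀ y : Fˣ, D y ∈ H := by
    intro y
    obtain ⟨n, hn⟩ := hϖ.exists_norm_eq y.ne_zero
    have h1 : ‖((y * x ^ (-n) : Fˣ) : F)‖ = 1 := by
      rw [Units.val_mul, Units.val_zpow_eq_zpow_val, norm_mul, _root_.norm_zpow, hxn, hn,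
        ← _root_.zpow_add₀ hϖ.norm_pos.ne', add_neg_cancel, zpow_zero]
    have h2 : D y = D (y * x ^ (-n)) * D x ^ n := by
      rw [← map_zpow, ← map_mul, mul_assoc, ← _root_.zpow_add, neg_add_cancel, zpow_zero, mul_one]
    rw [h2]
    exact H.mul_mem (hΓ _ (diagGL_mem h1)) (H.zpow_mem hmx n)
  have hU : ∀ y : F, ProjGenLinGroup.mk (upperGL y) ∈ H := by
    intro y
    by_cases hy : y = 0
    · exact hΓ _ (upperGL_mem (by rw [hy, norm_zero]; exact norm_nonneg _))
    obtain ⟨z, hz0, hz⟩ := NormedField.exists_norm_lt F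
      (div_pos (norm_pos_iff.2 hβ0) (norm_pos_iff.2 hy))
    rw [lt_div_iff₀ (norm_pos_iff.2 hy), ← norm_mul] at hz
    set z' : Fˣ := Units.mk0 z (norm_pos_iff.1 hz0)
    have h1 := congrArg ProjGenLinGroup.mk (diagGL_mul_upperGL z' y)
    rw [map_mul, map_mul, ← eq_inv_mul_iff_mul_eq] at h1
    rw [h1]
    exact H.mul_mem (H.inv_mem (hD _)) (H.mul_mem (hΓ _ (upperGL_mem hz.le)) (hD _))
  have hW : ∀ y : Fˣ, ProjGenLinGroup.mk (antiGL y) ∈ H := by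
    intro y
    rw [← mul_inv_cancel_left a y, ← antiGL_mul_diagGL, map_mul]
    exact H.mul_mem hw (hD _)
  rw [eq_top_iff]
  intro g _
  obtain ⟨g, rfl⟩ := ProjGenLinGroup.mk_surjective g
  rcases exists_pgl_eq g with ⟨y, x, e⟩ | ⟨y, x, y', e⟩
  · rw [e]
    exact H.mul_mem (hU _) (hD _)
  · rw [e]
    exact H.mul_mem (H.mul_mem (hU _) (hW _)) (hU _)

end iwahoriSubgroup

/-! ### The Iwahori–Hecke algebra of `PGL₂(F)` -/

section pglSystem

variable {F : Type*} [NontriviallyNormedField F] [IsUltrametricDist F] [ProperSpace F] {q : ℕ}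
  {ϖ β γ : F} {h : ‖β * γ‖ < 1}

local notation "𝔪" => ProjGenLinGroup.mk

theorem inDC_anti {a : Fˣ} (ha : ‖(a : F)‖ * (‖β‖ * ‖β‖) = 1) {y : F} (hy : ‖y‖ = ‖β‖) :
    InDC (iwahoriPGL β γ h) (𝔪 (antiGL a)) (𝔪 (antiGL a) * 𝔪 (upperGL y) * 𝔪 (antiGL a)) := by
  have hβ : 0 < ‖β‖ := by
    refine (norm_nonneg β).lt_of_ne' fun h0 => ?_
    rw [h0, mul_zero, mul_zero] at ha
    exact zero_ne_one ha
  have ha1 : ‖(a : F)‖ = (‖β‖ * ‖β‖)⁻¹ := eq_inv_of_mul_eq_one_left ha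
  have hy0 : y ≠ 0 := norm_pos_iff.1 (hy ▸ hβ)
  set z : Fˣ := a * Units.mk0 y hy0 with hz
  have hzv : (z : F) = a * y := rfl
  have hzn : ‖(z : F)‖ = ‖β‖⁻¹ := by
    rw [hzv, norm_mul, ha1, hy]
    field_simp
  have hu : ‖(z : F)⁻¹‖ ≤ ‖β‖ := by rw [norm_inv, hzn, inv_inv]
  have hm : ‖((a⁻¹ * -(z * z) : Fˣ) : F)‖ = 1 := by
    rw [Units.val_mul, Units.val_neg, Units.val_mul, Units.val_inv_eq_inv_val, norm_mul, norm_inv,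
      norm_neg, norm_mul, hzn, ha1]
    field_simp
  rw [antiGL_mul_mul, swapGL_upperGL, ← hzv, pgl_lowerGL_eq, ← mul_inv_cancel_left a (-(z * z)),
    ← antiGL_mul_diagGL, map_mul, ← mul_assoc, mul_assoc (_ * _)]
  exact ⟨⟨_, mk_mem_iwahoriPGL (upperGL_mem hu)⟩, ⟨_, Subgroup.mul_mem _
    (mk_mem_iwahoriPGL (diagGL_mem hm)) (mk_mem_iwahoriPGL (upperGL_mem hu))⟩, rfl⟩

/-- An element of length zero normalizes the Iwahori subgroup. -/
theorem anti_conj_mem {b : Fˣ} (hb : ‖(b : F)‖ * ‖β‖ = ‖γ‖) {x : PGL(Fin 2, F)}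
    (hx : x ∈ iwahoriPGL β γ h) : 𝔪 (antiGL b) * x * 𝔪 (antiGL b) ∈ iwahoriPGL β γ h := by
  obtain ⟨g, hg, rfl⟩ := hx
  have hb0 := norm_pos_iff.2 b.ne_zero
  refine (anti_conj_mem_iff hg).2 ⟨?_, ?_⟩
  · rw [div_le_iff₀ hb0, mul_comm, hb]
    exact hg.2.2.2.1
  · rw [← hb]
    gcongr
    exact hg.2.2.1

/-- The first reflection behaves as in SL₂. The second normalizes the Iwahori subgroup, so the
second decomposition may take 1 as its lower unipotent part, and the second rank-one rule always
lands in the subgroup. -/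
theorem affineSystem_pgl (hϖ : OddUniformizer q ϖ) (hβγ : ‖β * γ‖ = ‖ϖ‖) {a b : Fˣ}
    (ha : ‖(a : F)‖ * (‖β‖ * ‖β‖) = 1) (hb : ‖(b : F)‖ * ‖β‖ = ‖γ‖) :
    AffineSystem (iwahoriPGL β γ h) (𝔪 (antiGL a)) (𝔪 (antiGL b))
      {x | ∃ y, ‖y‖ ≤ ‖β‖ ∧ x = 𝔪 (upperGL y)} {x | ∃ z, ‖z‖ ≤ ‖γ‖ ∧ x = 𝔪 (lowerGL z)} := by
  have hβ : 0 < ‖β‖ := by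
    refine (norm_nonneg β).lt_of_ne' fun h0 => ?_
    rw [h0, mul_zero, mul_zero] at ha
    exact zero_ne_one ha
  have hϖ' := hβγ
  rw [norm_mul] at hϖ'
  have hγ : 0 < ‖γ‖ := by
    refine (norm_nonneg γ).lt_of_ne' fun h0 => ?_
    rw [h0, mul_zero] at hϖ'
    exact hϖ.norm_pos.ne hϖ'
  have hβ0 : β ≠ 0 := norm_pos_iff.1 hβ
  have ha1 : ‖(a : F)‖ = (‖β‖ * ‖β‖)⁻¹ := eq_inv_of_mul_eq_one_left ha
  have hb1 : ‖(b : F)‖ = ‖γ‖ / ‖β‖ := by rw [← hb]; field_simp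
  have hc1 : ∀ {c : F}, ‖c‖ ≤ ‖γ‖ → ‖c‖ / ‖(a : F)‖ ≤ ‖β‖ := by
    intro c hc
    rw [ha1, div_inv_eq_mul, ← mul_assoc]
    have : ‖c‖ * ‖β‖ ≤ 1 := by
      calc _ ≤ ‖γ‖ * ‖β‖ := by gcongr
        _ ≤ 1 := by rw [mul_comm, hϖ']; exact hϖ.norm_lt_one.le
    exact mul_le_of_le_one_left hβ.le this
  have hab : ‖(b : F)‖ = ‖(a : F)‖ * ‖ϖ‖ := by
    rw [ha1, hb1, ← hϖ']
    field_simp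
  have hlt : ‖(b : F)‖ < ‖(a : F)‖ := by
    rw [hab]
    exact mul_lt_of_lt_one_right (norm_pos_iff.2 a.ne_zero) hϖ.norm_lt_one
  exact
    { U_subset := by
        rintro _ ⟨y, hy, rfl⟩
        exact mk_mem_iwahoriPGL (upperGL_mem hy)
      L_subset := by
        rintro _ ⟨z, hz, rfl⟩
        exact mk_mem_iwahoriPGL (lowerGL_mem hz)
      decomp_left := by
        rintro _ ⟨g, hg, rfl⟩
        obtain ⟨hA, hD⟩ := gl_norm_diag_eq_one h hg.1 hg.2.1 hg.2.2.1 hg.2.2.2.1 hg.2.2.2.2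
        have hA0 : g.1 0 0 ≠ 0 := norm_pos_iff.1 (hA ▸ one_pos)
        have hn : ‖g.1 0 1 / g.1 0 0‖ ≤ ‖β‖ := by rw [norm_div, hA, div_one]; exact hg.2.2.1
        have hl : g * upperGL (-(g.1 0 1 / g.1 0 0)) ∈ iwahoriGL β γ h :=
          Subgroup.mul_mem _ hg (upperGL_mem (by rwa [norm_neg]))
        refine ⟨𝔪 (g * upperGL (-(g.1 0 1 / g.1 0 0))), _, ⟨_, hn, rfl⟩, ?_, ?_⟩
        · rw [← map_mul, mul_assoc, upperGL_mul, neg_add_cancel, upperGL_zero, mul_one]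
        · have e1 : (g * upperGL (-(g.1 0 1 / g.1 0 0))).1 0 1 = 0 := by
            rw [gl_mul_apply]
            simp only [upperGL, mkGL_apply_zero_one, mkGL_apply_one_one]
            field_simp
            ring
          rw [antiGL_inv, anti_conj_mem_iff hl, e1, norm_zero, mul_zero]
          exact ⟨hc1 hl.2.2.2.1, hγ.le⟩
      decomp_right := by
        intro x hx
        refine ⟨x, 1, ⟨0, by rw [norm_zero]; exact hγ.le, by rw [lowerGL_zero, map_one]⟩,
          (mul_one x).symm, ?_⟩
        rw [antiGL_inv]
        exact anti_conj_mem hb hx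
      conj_left := by
        rintro _ ⟨z, hz, rfl⟩
        refine ⟨z / a, ?_, ?_⟩
        · rw [norm_div]
          exact hc1 hz
        · rw [antiGL_inv, antiGL_mul_mul, swapGL_lowerGL]
      conj_right := by
        rintro _ ⟨y, hy, rfl⟩
        refine ⟨b * y, ?_, ?_⟩
        · rw [norm_mul, ← hb]
          gcongr
        · rw [antiGL_inv, antiGL_mul_mul, swapGL_upperGL]
      sq_left := by
        rw [antiGL_mul_self]
        exact Subgroup.one_mem _
      sq_right := by
        rw [antiGL_mul_self]
        exact Subgroup.one_mem _
      cell_left := by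
        rintro _ ⟨y, hy, rfl⟩
        by_cases hz : ‖(a : F) * y‖ ≤ ‖γ‖
        · left
          rw [antiGL_mul_mul, swapGL_upperGL]
          exact mk_mem_iwahoriPGL (lowerGL_mem hz)
        · refine Or.inr (inDC_anti ha (hϖ.norm_eq_of_lt hy ?_))
          rw [norm_mul, ha1, not_le] at hz
          rw [← hϖ']
          calc ‖β‖ * ‖γ‖ * ‖β‖ = ‖γ‖ * (‖β‖ * ‖β‖) := by ring
            _ < (‖β‖ * ‖β‖)⁻¹ * ‖y‖ * (‖β‖ * ‖β‖) := by gcongr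
            _ = ‖y‖ := by field_simp
      cell_right := by
        rintro _ ⟨z, hz, rfl⟩
        exact Or.inl (anti_conj_mem hb (mk_mem_iwahoriPGL (lowerGL_mem hz)))
      word_left := altProd_anti_notMem hlt.ne'
      word_right := altProd_anti_notMem hlt.ne
      generate := generate_pgl hϖ hβ0 hab }

/-- The representatives `(1, βx; 0, 1)`. -/
def pglRep (β γ : F) (h : ‖β * γ‖ < 1) (k : 𝓀[F]) : iwahoriPGL β γ h :=
  ⟨𝔪 (upperGL (β * residueLift k)), mk_mem_iwahoriPGL (upperGL_mem (norm_mul_residueLift_le β k))⟩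

theorem pglRep_inv (k : 𝓀[F]) : ((pglRep β γ h k : PGL(Fin 2, F)))⁻¹ =
    𝔪 (upperGL (-(β * residueLift k))) := by
  rw [← upperGL_inv, map_inv]
  rfl

theorem cosetReps_pgl (hϖ : OddUniformizer q ϖ) (hβγ : ‖β * γ‖ = ‖ϖ‖) {a : Fˣ}
    (ha : ‖(a : F)‖ * (‖β‖ * ‖β‖) = 1) :
    CosetReps (iwahoriPGL β γ h) 1 (𝔪 (antiGL a)) (pglRep β γ h) := by
  have hβ : 0 < ‖β‖ := by
    refine (norm_nonneg β).lt_of_ne' fun h0 => ?_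
    rw [h0, mul_zero, mul_zero] at ha
    exact zero_ne_one ha
  have hβ0 := norm_pos_iff.1 hβ
  have ha1 : ‖(a : F)‖ = (‖β‖ * ‖β‖)⁻¹ := eq_inv_of_mul_eq_one_left ha
  have key : ∀ y : F, ‖(a : F)‖ * ‖y‖ ≤ ‖γ‖ ↔ ‖y‖ ≤ ‖β‖ * ‖ϖ‖ := by
    intro y
    rw [ha1, ← hβγ, norm_mul, inv_mul_le_iff₀ (by positivity), mul_assoc]
  have hcoset : ∀ (k : 𝓀[F]) (x : PGL(Fin 2, F)),
      ((pglRep β γ h k : PGL(Fin 2, F)) * 𝔪 (antiGL a))⁻¹ * (x * 𝔪 (antiGL a)) =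
      𝔪 (antiGL a) * (𝔪 (upperGL (-(β * residueLift k))) * x) * 𝔪 (antiGL a) := by
    intro k x
    rw [_root_.mul_inv_rev, antiGL_inv, pglRep_inv]
    simp only [mul_assoc]
  have hent : ∀ (b : F) (g : GL (Fin 2) F), (upperGL b * g).1 0 1 = g.1 0 1 + b * g.1 1 1 ∧
      (upperGL b * g).1 1 0 = g.1 1 0 := by
    intro b g
    rw [gl_mul_apply, gl_mul_apply]
    simp [upperGL]
  refine ⟨fun k => rfl, fun k l hkl => ?_, fun x => ?_, fun _ _ _ => rfl⟩
  · have h1 := QuotientGroup.eq.1 hkl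
    rw [hcoset, pglRep, ← map_mul, anti_conj_mem_iff (Subgroup.mul_mem _
      (upperGL_mem (by rw [norm_neg]; exact norm_mul_residueLift_le β k))
      (upperGL_mem (norm_mul_residueLift_le β l))), key, (hent _ _).1] at h1
    refine hϖ.eq_of_norm_mul_sub_le hβ0 ?_
    simpa [upperGL, ← sub_eq_add_neg] using h1.2
  · obtain ⟨_, g, hg, rfl⟩ := x
    obtain ⟨hA, hD⟩ := gl_norm_diag_eq_one h hg.1 hg.2.1 hg.2.2.1 hg.2.2.2.1 hg.2.2.2.2
    obtain ⟨k, hk⟩ := hϖ.exists_norm_sub_mul_le hβ0 hg.2.2.1 hD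
    have hm : upperGL (-(β * residueLift k)) * g ∈ iwahoriGL β γ h := Subgroup.mul_mem _
      (upperGL_mem (by rw [norm_neg]; exact norm_mul_residueLift_le β k)) hg
    refine ⟨k, (QuotientGroup.eq.2 ?_).symm⟩
    rw [hcoset, ← map_mul, anti_conj_mem_iff hm, key, (hent _ _).1, (hent _ _).2]
    constructor
    · rw [ha1, div_inv_eq_mul, ← mul_assoc]
      have : ‖g.1 1 0‖ * ‖β‖ ≤ 1 := by
        calc _ ≤ ‖γ‖ * ‖β‖ := by gcongr; exact hg.2.2.2.1
          _ ≤ 1 := by rw [mul_comm, ← norm_mul, hβγ]; exact hϖ.norm_lt_one.le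
      exact mul_le_of_le_one_left hβ.le this
    · rwa [neg_mul, ← sub_eq_add_neg]

theorem cosetReps_pgl_unit {b : Fˣ} (hb : ‖(b : F)‖ * ‖β‖ = ‖γ‖) :
    CosetReps (iwahoriPGL β γ h) 1 (𝔪 (antiGL b)) (fun _ : Unit => 1) := by
  refine ⟨fun _ => rfl, fun _ _ _ => rfl, fun x => ⟨(), ?_⟩, fun _ _ _ => rfl⟩
  rw [eq_comm, QuotientGroup.eq, OneMemClass.coe_one, one_mul, antiGL_inv, ← mul_assoc]
  exact anti_conj_mem hb x.2

/-- The presentation of the Iwahori–Hecke algebra. -/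
theorem exists_presentation_pgl (hϖ : OddUniformizer q ϖ) (hβγ : ‖β * γ‖ = ‖ϖ‖) (hβ : β ≠ 0)
    (hγ : γ ≠ 0) : Nonempty (PresentedAlgebra q ≃ₐ[ℂ] HeckeAlg (iwahoriPGL β γ h) 1) := by
  classical
  have hfin := hϖ.finite_residueField
  have := Fintype.ofFinite 𝓀[F]
  have hβn := norm_pos_iff.2 hβ
  set β' : Fˣ := Units.mk0 β hβ
  -- Up to the scalar β these are (0, β; β⁻¹, 0), the finite reflection, and (0, β; γ, 0), whose
  -- determinant has the norm of a uniformizer.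
  set a : Fˣ := (β' * β')⁻¹ with ha_def
  set b : Fˣ := Units.mk0 γ hγ * β'⁻¹ with hb_def
  have hav : (a : F) = (β * β)⁻¹ := by simp [ha_def, β']
  have hbv : (b : F) = γ * β⁻¹ := by simp [hb_def, β']
  have ha : ‖(a : F)‖ * (‖β‖ * ‖β‖) = 1 := by
    rw [hav, norm_inv, norm_mul]
    exact inv_mul_cancel₀ (by positivity)
  have hb : ‖(b : F)‖ * ‖β‖ = ‖γ‖ := by
    rw [hbv, norm_mul, norm_inv, inv_mul_cancel_right₀ hβn.ne']
  have A := affineSystem_pgl (h := h) hϖ hβγ ha hb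
  have hs := cosetReps_pgl (h := h) hϖ hβγ ha
  have ht := cosetReps_pgl_unit (h := h) hb
  have hsΓ : 𝔪 (antiGL a) ∉ iwahoriPGL β γ h := by simpa [altProd] using A.word_left 0
  have htΓ : 𝔪 (antiGL b) ∉ iwahoriPGL β γ h := by simpa [altProd] using A.word_right 0
  have hval : ∀ g, InDC (iwahoriPGL β γ h) (𝔪 (antiGL a)) g → (hs.cell 1).1 g = 1 := by
    rintro _ ⟨γ₁, γ₂, rfl⟩
    rw [hs.cell_apply]
    simp
  have h₀ : hs.cell 1 * hs.cell 1 = ((q : ℂ) - 1) • hs.cell 1 +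
      (q : ℂ) • (1 : HeckeAlg (iwahoriPGL β γ h) 1) := by
    refine hs.cell_mul_self hsΓ A.cell ?_ ?_
    · have h1 : ∀ k, (hs.cell 1).1 ((𝔪 (antiGL a))⁻¹ * (pglRep β γ h k : PGL(Fin 2, F))⁻¹) = 1 :=
        fun k => hval _ ⟨1, (pglRep β γ h k)⁻¹, by simp [antiGL_inv]⟩
      simp only [h1]
      rw [Finset.sum_const, Finset.card_univ, ← Nat.card_eq_fintype_card, ← hϖ.card]
      simp
    -- The exponent 0 writes the constant 1 in the shape of `OddUniformizer.sum_unitChar`, whose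
    -- even case then counts the q - 1 non-zero classes.
    · have h1 : ∀ k, (hs.cell 1).1 ((𝔪 (antiGL a))⁻¹ * (pglRep β γ h k : PGL(Fin 2, F))⁻¹ *
          𝔪 (antiGL a)) = if k = 0 then 0 else
            (((unitChar q ϖ (1 * residueLift k) ^ (0 : ℤ) : ℤˣ) : ℤ) : ℂ) := by
        intro k
        rw [antiGL_inv, pglRep_inv]
        split_ifs with hk
        · refine hs.cell_apply_mem 1 hsΓ ?_
          have hl : ‖residueLift k‖ ≤ ‖ϖ‖ := by
            refine hϖ.norm_le_of_lt_one ?_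
            rw [← residueClass_eq_zero_iff (norm_residueLift_le k), residueClass_residueLift, hk]
          rw [← hβγ, norm_mul] at hl
          rw [antiGL_mul_mul, swapGL_upperGL]
          refine mk_mem_iwahoriPGL (lowerGL_mem ?_)
          rw [hav, norm_mul, norm_neg, norm_inv, norm_mul, norm_mul]
          calc (‖β‖ * ‖β‖)⁻¹ * (‖β‖ * ‖residueLift k‖) ≤ (‖β‖ * ‖β‖)⁻¹ * (‖β‖ * (‖β‖ * ‖γ‖)) := by
                gcongr
            _ = ‖γ‖ := by field_simp
        · rw [hval _ (inDC_anti ha (by rw [norm_neg, norm_mul, norm_residueLift hk, mul_one]))]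
          simp
      simp only [h1]
      rw [hϖ.sum_unitChar norm_one, if_pos (by simp), one_mul, mul_one]
  have h₁ : ht.cell 1 * ht.cell 1 = 1 := by
    have e : ht.cell 1 * ht.cell 1 = (0 : ℂ) • ht.cell 1 +
        (1 : ℂ) • (1 : HeckeAlg (iwahoriPGL β γ h) 1) := by
      refine ht.cell_mul_self htΓ A.symm.cell ?_ ?_
      · simp [antiGL_inv, ht.cell_apply_self]
      · simp [ht.cell_apply_mem 1 htΓ (Subgroup.one_mem _)]
    rw [e, zero_smul, zero_add, one_smul]
  exact ⟨AlgEquiv.ofBijective _ (HeckeAlg.liftPresented_bijective hϖ.odd.pos.ne' A.iwahoriSystem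
    (fun g => hs.cell_support 1) (fun g => ht.cell_support 1) h₀ h₁)⟩

end pglSystem

/-! ### The topology of `PGL₂(F)` -/

section pglTopology

variable {F : Type*} [NontriviallyNormedField F]

instance : IsTopologicalGroup PGL(Fin 2, F) :=
  inferInstanceAs (IsTopologicalGroup (GL (Fin 2) F ⧸ Subgroup.center (GL (Fin 2) F)))

theorem continuous_mk_pgl : Continuous (ProjGenLinGroup.mk : GL (Fin 2) F → PGL(Fin 2, F)) :=
  QuotientGroup.continuous_mk (N := Subgroup.center (GL (Fin 2) F))

theorem isOpenMap_mk_pgl : IsOpenMap (ProjGenLinGroup.mk : GL (Fin 2) F → PGL(Fin 2, F)) :=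
  QuotientGroup.isOpenMap_coe (N := Subgroup.center (GL (Fin 2) F))

variable [IsUltrametricDist F] {β γ : F}

theorem isOpen_iwahoriPGL (hβ : β ≠ 0) (hγ : γ ≠ 0) (h : ‖β * γ‖ < 1) :
    IsOpen (iwahoriPGL β γ h : Set PGL(Fin 2, F)) := by
  refine isOpenMap_mk_pgl _ ?_
  have hval : Continuous fun g : GL (Fin 2) F => (g.1 : Matrix (Fin 2) (Fin 2) F) :=
    Units.continuous_val
  have hcont : ∀ i j : Fin 2, Continuous fun g : GL (Fin 2) F => g.1 i j :=
    fun i j => hval.matrix_elem i j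
  have h1 : ∀ (i j : Fin 2) {r : ℝ}, r ≠ 0 → IsOpen {g : GL (Fin 2) F | ‖g.1 i j‖ ≤ r} := by
    intro i j r hr
    have := (IsUltrametricDist.isOpen_closedBall (0 : F) hr).preimage (hcont i j)
    convert this using 1
    ext g
    simp
  have h2 : IsOpen {g : GL (Fin 2) F | ‖g.1.det‖ = 1} := by
    have hc : Continuous fun g : GL (Fin 2) F => g.1 0 0 * g.1 1 1 - g.1 0 1 * g.1 1 0 :=
      ((hcont 0 0).mul (hcont 1 1)).sub ((hcont 0 1).mul (hcont 1 0))
    have := (IsUltrametricDist.isOpen_sphere (0 : F) one_ne_zero).preimage hc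
    convert this using 1
    ext g
    simp [gl_det]
  exact (h1 0 0 one_ne_zero).inter ((h1 1 1 one_ne_zero).inter
    ((h1 0 1 (norm_ne_zero_iff.2 hβ)).inter ((h1 1 0 (norm_ne_zero_iff.2 hγ)).inter h2)))

/-- The topology of GL₂ also requires inverses to vary continuously. On the compact set of matrices
with |det| = 1 the inverse is the adjugate over the determinant, so that set maps continuously onto
the Iwahori subgroup of GL₂. -/
theorem isCompact_iwahoriPGL [ProperSpace F] (h : ‖β * γ‖ < 1) :
    IsCompact (iwahoriPGL β γ h : Set PGL(Fin 2, F)) := by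
  refine IsCompact.image (s := (iwahoriGL β γ h : Set (GL (Fin 2) F))) ?_ continuous_mk_pgl
  set R : Fin 2 → Fin 2 → ℝ := ![![1, ‖β‖], ![‖γ‖, 1]] with hR
  set S : Set (Matrix (Fin 2) (Fin 2) F) := {M | ‖M 0 0‖ ≤ 1 ∧ ‖M 1 1‖ ≤ 1 ∧ ‖M 0 1‖ ≤ ‖β‖ ∧
    ‖M 1 0‖ ≤ ‖γ‖ ∧ ‖M.det‖ = 1} with hS
  have hK : IsCompact (Set.univ.pi fun i => Set.univ.pi fun j => Metric.closedBall (0 : F) (R i j)) :=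
    isCompact_univ_pi fun i => isCompact_univ_pi fun j => isCompact_closedBall _ _
  have e : {M : Fin 2 → Fin 2 → F | ‖M 0 0‖ ≤ 1 ∧ ‖M 1 1‖ ≤ 1 ∧ ‖M 0 1‖ ≤ ‖β‖ ∧
      ‖M 1 0‖ ≤ ‖γ‖} = Set.univ.pi fun i => Set.univ.pi fun j => Metric.closedBall (0 : F) (R i j) := by
    ext M
    simp only [Set.mem_ofPred_eq, Set.mem_univ_pi, mem_closedBall_zero_iff, Fin.forall_fin_two, hR,
      Matrix.cons_val_zero, Matrix.cons_val_one]
    tauto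
  rw [← e] at hK
  have hdet : IsClosed {M : Matrix (Fin 2) (Fin 2) F | ‖M.det‖ = 1} :=
    isClosed_eq (Continuous.matrix_det continuous_id).norm continuous_const
  have hSK : IsCompact S := by
    have hE : S = {M : Matrix (Fin 2) (Fin 2) F | ‖M 0 0‖ ≤ 1 ∧ ‖M 1 1‖ ≤ 1 ∧ ‖M 0 1‖ ≤ ‖β‖ ∧
        ‖M 1 0‖ ≤ ‖γ‖} ∩ {M | ‖M.det‖ = 1} :=
      Set.ext fun M => ⟨fun H => ⟨⟨H.1, H.2.1, H.2.2.1, H.2.2.2.1⟩, H.2.2.2.2⟩,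
        fun H => ⟨H.1.1, H.1.2.1, H.1.2.2.1, H.1.2.2.2, H.2⟩⟩
    rw [hE]
    exact IsCompact.inter_right hK hdet
  have hne : ∀ M : S, M.1.det ≠ 0 := fun M => norm_pos_iff.1 (M.2.2.2.2.2 ▸ one_pos)
  let f : S → GL (Fin 2) F := fun M => Matrix.GeneralLinearGroup.mkOfDetNeZero M.1 (hne M)
  have hf : Continuous f := by
    rw [Units.continuous_iff]
    refine ⟨continuous_subtype_val, ?_⟩
    have h1 : ∀ M : S, (((f M)⁻¹ : GL (Fin 2) F) : Matrix (Fin 2) (Fin 2) F) =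
        (M.1.det)⁻¹ • M.1.adjugate := by
      intro M
      rw [Matrix.coe_units_inv, Matrix.inv_def, Ring.inverse_eq_inv']
      rfl
    simp only [h1]
    have hd : Continuous fun M : S => M.1.det := continuous_subtype_val.matrix_det
    exact (hd.inv₀ hne).smul continuous_subtype_val.matrix_adjugate
  have : CompactSpace S := isCompact_iff_compactSpace.1 hSK
  have hr : Set.range f = (iwahoriGL β γ h : Set (GL (Fin 2) F)) := by
    ext g
    constructor
    · rintro ⟨M, rfl⟩
      exact M.2
    · intro hg
      exact ⟨⟨g.1, hg⟩, Units.ext rfl⟩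
  rw [← hr]
  exact isCompact_range hf

theorem pglHecke_eq [ProperSpace F] (hβ : β ≠ 0) (hγ : γ ≠ 0) (h : ‖β * γ‖ < 1) :
    pglHecke (iwahoriPGL β γ h : Set PGL(Fin 2, F)) = HeckeAlg (iwahoriPGL β γ h) 1 := by
  ext φ
  have hc := isCompact_closure_iff_finite_cosets (isOpen_iwahoriPGL hβ hγ h)
    (isCompact_iwahoriPGL h) (Function.support φ)
  constructor
  · rintro ⟨h1, h2⟩
    refine ⟨fun γ₁ γ₂ g => ?_, hc.1 h1⟩
    rw [h2 _ γ₁.2 _ γ₂.2]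
    simp
  · rintro ⟨h1, h2⟩
    refine ⟨hc.2 h2, fun k₁ hk₁ k₂ hk₂ g => ?_⟩
    have := h1 ⟨k₁, hk₁⟩ ⟨k₂, hk₂⟩ g
    simpa using this

theorem conv_pgl_eq (hβ : β ≠ 0) (hγ : γ ≠ 0) (h : ‖β * γ‖ < 1) (ν : Measure PGL(Fin 2, F))
    [ν.IsMulLeftInvariant] (hν : ν (iwahoriPGL β γ h : Set PGL(Fin 2, F)) = 1)
    (φ₁ φ₂ : HeckeAlg (iwahoriPGL β γ h) 1) : conv ν φ₁.1 φ₂.1 = (φ₁ * φ₂).1 := by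
  refine conv_eq_cosetConv (fun x => ?_) (fun x => ?_) φ₁ φ₂
  · exact ((isOpen_iwahoriPGL hβ hγ h).preimage (continuous_const_mul x⁻¹)).measurableSet
  · rw [← hν]
    exact measure_preimage_mul ν x⁻¹ _

end pglTopology

/-! ### The main theorem -/

section main

variable {F : Type*} [NontriviallyNormedField F] [IsUltrametricDist F] [ProperSpace F] {q : ℕ}

-- If ψ were trivial on the next larger fractional ideal, c + 1 would contradict the maximality of
-- c.
omit [ProperSpace F] in
theorem HasDifferent.of_isGreatest {ψ : AddChar F Circle} {δ ϖ : Fˣ}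
    (hϖ : OddUniformizer q (ϖ : F)) (hψ : Continuous ψ) {c : ℤ}
    (hc : IsGreatest {n : ℤ | ∀ x : F, ‖x‖ ≤ ‖(ϖ : F)‖ ^ (-n) → ψ x = 1} c)
    (hδ : ‖(δ : F)‖ = ‖(ϖ : F)‖ ^ c) : HasDifferent ψ (δ : F) (ϖ : F) where
  continuous := hψ
  ne_zero := δ.ne_zero
  trivial x hx := by
    refine hc.1 x ?_
    rwa [norm_mul, hδ, ← le_div_iff₀ (zpow_pos hϖ.norm_pos _), one_div, ← _root_.zpow_neg] at hx
  nontrivial := by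
    by_contra! H
    have hmem : c + 1 ∈ {n : ℤ | ∀ x : F, ‖x‖ ≤ ‖(ϖ : F)‖ ^ (-n) → ψ x = 1} := by
      intro x hx
      refine H x ?_
      rw [_root_.zpow_neg, _root_.zpow_add₀ hϖ.norm_pos.ne', zpow_one] at hx
      rw [norm_mul, norm_mul, hδ, mul_assoc]
      have h0 : 0 < ‖(ϖ : F)‖ ^ c * ‖(ϖ : F)‖ := mul_pos (zpow_pos hϖ.norm_pos _) hϖ.norm_pos
      rwa [← one_div, le_div_iff₀ h0] at hx
    have := hc.2 hmem
    omega

variable [Fact (SymbolBilinear F)]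

/-- The theorem for the pair `(β, γ)`, given the two simple reflections `𝐰_a` and `𝐰_b`. -/
theorem genuine_structure {ϖ δ : F} {β γ : F} (hϖ : OddUniformizer q ϖ) {ψ : AddChar F Circle}
    (hψ : HasDifferent ψ δ ϖ) (hβγ : ‖β * γ‖ = ‖ϖ‖) (hβ : ‖β‖ ≤ ‖δ⁻¹‖) (hγ : ‖γ‖ ≤ ‖δ‖)
    (μ : Measure (SpecialLinearGroup (Fin 2) F)) [μ.IsMulLeftInvariant]
    (hμ : haarMp2 μ (lift (congruenceSet β γ)) = 1)
    (ν : Measure PGL(Fin 2, F)) [ν.IsMulLeftInvariant] (hν : ν (iwahori δ ϖ) = 1) {a b : Fˣ}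
    (ha : (a : F) = δ) (hb : ‖(b : F) * δ‖ = ‖δ‖ ^ 2 * ‖ϖ‖ ∨ ‖(b : F) * δ‖ = ‖δ‖ ^ 2 * ‖ϖ‖⁻¹)
    (hab : ‖(a : F)‖ * ‖β‖ = 1 ∧ ‖(b : F)‖ = ‖γ‖ ∨ ‖(b : F)‖ * ‖β‖ = 1 ∧ ‖(a : F)‖ = ‖γ‖)
    {r : ℂ} (hr : r ^ 2 = (q : ℂ)⁻¹) :
    ∃ hmul : ∀ φ₁ φ₂ : genuineHecke ψ δ (congruenceSet β γ),
        conv (haarMp2 μ) φ₁.1 φ₂.1 ∈ genuineHecke ψ δ (congruenceSet β γ),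
      (∃ e : PresentedAlgebra q ≃ₗ[ℂ] genuineHecke ψ δ (congruenceSet β γ),
        (∀ x y, (e (x * y)).1 = conv (haarMp2 μ) (e x).1 (e y).1) ∧
        (e 1).1 = heckeOne ψ δ (congruenceSet β γ) ∧
        (e (gen q 0)).1 = doubleCosetFun ψ δ (congruenceSet β γ) (wAnti a) (weilConst ψ δ a) ∧
        (e (gen q 1)).1 =
          r • doubleCosetFun ψ δ (congruenceSet β γ) (wAnti b) (weilConst ψ δ b)) ∧
      (∃ f : genuineHecke ψ δ (congruenceSet β γ) ≃ₗ[ℂ] pglHecke (iwahori δ ϖ),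
        ∀ φ₁ φ₂ : genuineHecke ψ δ (congruenceSet β γ),
          (f ⟨conv (haarMp2 μ) φ₁.1 φ₂.1, hmul φ₁ φ₂⟩).1 = conv ν (f φ₁).1 (f φ₂).1) := by
  have hδ := hψ.ne_zero
  have h : ‖β * γ‖ < 1 := by rw [hβγ]; exact hϖ.norm_lt_one
  have hne : β * γ ≠ 0 := norm_pos_iff.1 (by rw [hβγ]; exact hϖ.norm_pos)
  have hβ0 := left_ne_zero_of_mul hne
  have hγ0 := right_ne_zero_of_mul hne
  -- The bounds on β and γ place the group inside Γ[𝔡⁻¹, 𝔡], and |βγ| < 1 makes the diagonal entries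
  -- units, as the explicit formula for ε requires.
  have heps : ∀ x : coverSubgroup β γ h, eps ψ δ (x : Mp2 F) = splitHom hϖ hδ h x := by
    intro x
    exact hψ.eps_eq hϖ (norm_diag_eq_one h x.2).2 (x.2.2.2.1.trans hβ) (x.2.2.2.2.trans hγ)
  have hG := genuineHecke_eq (hϖ := hϖ) (hδ := hδ) (h := h) (ψ := ψ) hβ0 hγ0 heps
  have hconv : ∀ φ₁ φ₂ : HeckeAlg (coverSubgroup β γ h) (splitHom hϖ hδ h),
      conv (haarMp2 μ) φ₁.1 φ₂.1 = (φ₁ * φ₂).1 :=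
    conv_eq_cosetConv (measurableSet_coset hβ0 hγ0 h)
      (fun x => (haarMp2_coset hβ0 hγ0 h μ x).trans hμ)
  have hI : IwahoriSystem (coverSubgroup β γ h) (wAnti a) (wAnti b) := by
    rcases hab with hab | hab
    · exact iwahoriSystem_cover hϖ hβγ hab.1 hab.2
    · exact (iwahoriSystem_cover hϖ hβγ hab.1 hab.2).symm
  have hra : CellRelation hϖ hδ h a := by
    rcases hab with hab | hab
    · exact cellRelation_upper hβγ hab.1
    · exact cellRelation_lower hβγ hab.2
  have hrb : CellRelation hϖ hδ h b := by
    rcases hab with hab | hab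
    · exact cellRelation_lower hβγ hab.2
    · exact cellRelation_upper hβγ hab.1
  obtain ⟨E, hE₀, hE₁⟩ := exists_presentation hψ heps ha hb hI hra hrb hr
  have hpn : ‖δ⁻¹ * (ϖ * δ)‖ = ‖ϖ‖ := by
    rw [mul_comm ϖ, inv_mul_cancel_left₀ hδ]
  have hp : ‖δ⁻¹ * (ϖ * δ)‖ < 1 := hpn.trans_lt hϖ.norm_lt_one
  have hϖδ : ϖ * δ ≠ 0 := mul_ne_zero hϖ.ne_zero hδ
  have hP : pglHecke (iwahori δ ϖ) = HeckeAlg (iwahoriPGL δ⁻¹ (ϖ * δ) hp) 1 :=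
    pglHecke_eq (inv_ne_zero hδ) hϖδ hp
  obtain ⟨P⟩ := exists_presentation_pgl (h := hp) hϖ hpn (inv_ne_zero hδ) hϖδ
  have hconvP := conv_pgl_eq (inv_ne_zero hδ) hϖδ hp ν hν
  -- The comparison with PGL₂ passes through the common presentation; both submodules of functions
  -- are equal to abstract Hecke algebras whose products are the convolutions.
  refine ⟨fun φ₁ φ₂ => ?_, ⟨E.toLinearEquiv.trans (LinearEquiv.ofEq _ _ hG.symm), ?_, ?_, hE₀, hE₁⟩,
    (LinearEquiv.ofEq _ _ hG).trans ((E.symm.trans P).toLinearEquiv.trans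
      (LinearEquiv.ofEq _ _ hP.symm)), ?_⟩
  · have hG' : ∀ φ, φ ∈ genuineHecke ψ δ (congruenceSet β γ) ↔
        φ ∈ HeckeAlg (coverSubgroup β γ h) (splitHom hϖ hδ h) := fun φ => by rw [hG]
    have := hconv ⟨φ₁.1, (hG' _).1 φ₁.2⟩ ⟨φ₂.1, (hG' _).1 φ₂.2⟩
    exact (hG' _).2 (this ▸ SetLike.coe_mem _)
  · intro x y
    change (E (x * y)).1 = conv (haarMp2 μ) (E x).1 (E y).1
    rw [map_mul, hconv]
  · change (E 1).1 = _
    rw [map_one, heckeOne_eq heps]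
  · intro φ₁ φ₂
    set θ₁ : HeckeAlg (coverSubgroup β γ h) (splitHom hϖ hδ h) := LinearEquiv.ofEq _ _ hG φ₁
    set θ₂ : HeckeAlg (coverSubgroup β γ h) (splitHom hϖ hδ h) := LinearEquiv.ofEq _ _ hG φ₂
    change ((E.symm.trans P) _).1 = conv ν ((E.symm.trans P) θ₁).1 ((E.symm.trans P) θ₂).1
    rw [hconvP, ← map_mul]
    congr 2
    exact Subtype.ext (hconv θ₁ θ₂)

end main

end Metaplectic

end

/-! ### The two choices of Γ₂ -/

theorem mainTheorem8 {F : Type*} [NontriviallyNormedField F] [IsUltrametricDist F]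
    [ProperSpace F] [CharZero F]
    (q : ℕ) (hq : q = Nat.card 𝓀[F]) (hodd : Odd q)
    (ϖ : Fˣ) (hϖ : ∃ ϖ₀ : 𝒪[F], (ϖ₀ : F) = ϖ ∧ Irreducible ϖ₀)
    (hnorm : ‖(ϖ : F)‖ = (q : ℝ)⁻¹)
    (ψ : AddChar F Circle) (hψ : Continuous ψ) (hψ_ne : ψ ≠ 1)
    (c : ℤ) (hc : IsGreatest {n : ℤ | ∀ x : F, ‖x‖ ≤ ‖(ϖ : F)‖ ^ (-n) → ψ x = 1} c)
    (δ : Fˣ) (hδ : ‖(δ : F)‖ = ‖(ϖ : F)‖ ^ c)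
    (t : Metaplectic.Level)
    (μ : MeasureTheory.Measure (Matrix.SpecialLinearGroup (Fin 2) F)) [μ.IsHaarMeasure]
    (hμ : Metaplectic.haarMp2 μ (Metaplectic.lift (Metaplectic.Gamma2 (δ : F) (ϖ : F) t)) = 1)
    (ν : MeasureTheory.Measure (Matrix.ProjGenLinGroup (Fin 2) F)) [ν.IsHaarMeasure]
    (hν : ν (Metaplectic.iwahori (δ : F) (ϖ : F)) = 1) :
    -- the genuine functions are closed under convolution
    ∃ hmul : ∀ φ₁ φ₂ : Metaplectic.genuineHecke ψ (δ : F) (Metaplectic.Gamma2 (δ : F) (ϖ : F) t),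
        Metaplectic.conv (Metaplectic.haarMp2 μ) φ₁.1 φ₂.1 ∈
          Metaplectic.genuineHecke ψ (δ : F) (Metaplectic.Gamma2 (δ : F) (ϖ : F) t),
      -- the genuine Hecke algebra is presented by `Ũ₀` and `Ũ₁` with the two relations
      (∃ e : Metaplectic.PresentedAlgebra q ≃ₗ[ℂ]
          Metaplectic.genuineHecke ψ (δ : F) (Metaplectic.Gamma2 (δ : F) (ϖ : F) t),
        (∀ x y, (e (x * y)).1 = Metaplectic.conv (Metaplectic.haarMp2 μ) (e x).1 (e y).1) ∧
        (e 1).1 = Metaplectic.heckeOne ψ (δ : F) (Metaplectic.Gamma2 (δ : F) (ϖ : F) t) ∧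
        (e (Metaplectic.gen q 0)).1 = Metaplectic.heckeU ψ δ ϖ q t 0 ∧
        (e (Metaplectic.gen q 1)).1 = Metaplectic.heckeU ψ δ ϖ q t 1) ∧
      -- and it is isomorphic to the Iwahori–Hecke algebra of `PGL₂(F)`
      (∃ f : Metaplectic.genuineHecke ψ (δ : F) (Metaplectic.Gamma2 (δ : F) (ϖ : F) t) ≃ₗ[ℂ]
          Metaplectic.pglHecke (Metaplectic.iwahori (δ : F) (ϖ : F)),
        ∀ φ₁ φ₂ : Metaplectic.genuineHecke ψ (δ : F) (Metaplectic.Gamma2 (δ : F) (ϖ : F) t),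
          (f ⟨Metaplectic.conv (Metaplectic.haarMp2 μ) φ₁.1 φ₂.1, hmul φ₁ φ₂⟩).1 =
            Metaplectic.conv ν (f φ₁).1 (f φ₂).1) := by
  subst hq
  have hϖ' : Metaplectic.OddUniformizer (Nat.card 𝓀[F]) (ϖ : F) := ⟨hodd, rfl, hϖ, hnorm⟩
  have : Fact (Metaplectic.SymbolBilinear F) := ⟨hϖ'.symbolBilinear⟩
  have hψ' := Metaplectic.HasDifferent.of_isGreatest hϖ' hψ hc hδ
  set q := Nat.card 𝓀[F] with hq
  have hq0 : (q : ℝ) ≠ 0 := Nat.cast_ne_zero.2 hodd.pos.ne'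
  have hδ0 : ‖(δ : F)‖ ≠ 0 := norm_ne_zero_iff.2 δ.ne_zero
  have hϖ1 : ‖(ϖ : F)‖ ≤ 1 := hϖ'.norm_lt_one.le
  have hU₀ : ∀ t, Metaplectic.heckeU ψ δ ϖ q t 0 = Metaplectic.doubleCosetFun ψ (δ : F)
      (Metaplectic.Gamma2 (δ : F) (ϖ : F) t) (Metaplectic.wAnti δ)
      (Metaplectic.weilConst ψ (δ : F) δ) := by
    intro t
    have : t.exponent 0 = 0 := by cases t <;> simp [Metaplectic.Level.exponent]
    rw [Metaplectic.heckeU, this]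
    simp
  set r : ℂ := (((q : ℝ) ^ (-(|(1 : ℤ)| : ℝ) / 2) : ℝ) : ℂ) with hr
  have hr2 : r ^ 2 = (q : ℂ)⁻¹ := by
    rw [hr, ← Complex.ofReal_pow, ← Real.rpow_natCast, ← Real.rpow_mul (Nat.cast_nonneg q)]
    have : -(|((1 : ℤ) : ℝ)|) / 2 * ((2 : ℕ) : ℝ) = -1 := by norm_num
    rw [this, Real.rpow_neg_one]
    push_cast
    rfl
  -- In the first case β = δ⁻¹ and γ = ϖδ: the reflection 𝐰_δ goes with the upper unipotent part and
  -- 𝐰_{δϖ} with the lower one. In the second case β = ϖδ⁻¹ and γ = δ, and the roles are exchanged,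
  -- with δϖ⁻¹ in place of δϖ.
  cases t with
  | lower =>
    rw [hU₀]
    refine Metaplectic.genuine_structure hϖ' hψ' ?_ le_rfl ?_ μ hμ ν hν rfl (Or.inl ?_)
      (Or.inl ⟨?_, ?_⟩) hr2
    · rw [mul_comm (ϖ : F), inv_mul_cancel_left₀ δ.ne_zero]
    · rw [norm_mul]
      exact mul_le_of_le_one_left (norm_nonneg _) hϖ1
    · simp [Metaplectic.Level.exponent]
      ring
    · rw [norm_inv, mul_inv_cancel₀ hδ0]
    · simp [Metaplectic.Level.exponent, mul_comm]
  | upper =>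
    rw [hU₀]
    refine Metaplectic.genuine_structure hϖ' hψ' ?_ ?_ le_rfl μ hμ ν hν rfl (Or.inr ?_)
      (Or.inr ⟨?_, rfl⟩) hr2
    · rw [inv_mul_cancel_right₀ δ.ne_zero]
    · rw [norm_mul]
      exact mul_le_of_le_one_left (norm_nonneg _) hϖ1
    · simp [Metaplectic.Level.exponent]
      ring
    · simp [Metaplectic.Level.exponent]
      have := norm_ne_zero_iff.2 ϖ.ne_zero
      field_simp
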